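/- Let $N$ be a smooth (Hausdorff, $\sigma$-compact) manifold of dimension $n\ge 2$ and let $[D]$ be a projective structure on $N$, i.e. the class of all torsion-free affine connections $D'$ with $D'_XY=D_XY+\Upsilon(X)Y+\Upsilon(Y)X$, $\Upsilon\in\Omega^1(N)$, for a given torsion-free connection $D$. Write $\mathcal E(w)=|\Lambda^nTN|^{-w/(n+1)}$, let $\mathcal C=\mathcal E_+(1)$ be the bundle of positive elements of $\mathcal E(1)$, with projection to $N$ and Euler field $Z$, and let $M=T^*N\otimes|\Lambda^nTN|^{2/(n+1)}=T^*N\otimes\mathcal E(-2)$ be the weighted cotangent bundle. A scale is a smooth section $s:N\to\mathcal C$. For a torsion-free connection $D$ on a manifold with coordinates $x^A$ and induced coordinates $(x^A,p_A)$ on its cotangent bundle, its Patterson–Walker metric is $2\,dx^A\odot dp_A-2\Gamma_A{}^C{}_B\,p_C\,dx^A\odot dx^B$. Then: 1. Scales exist, and every scale $s$ is preserved by exactly one connection $D^s\in[D]$. Let $g_s$ be the metric on $M$ that corresponds to the Patterson–Walker metric of $D^s$ under $M\cong T^*N$, $q\mapsto s^2q$. The metrics $g_s$ have signature $(n,n)$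 and all lie in one conformal class $[g]$ on $M$. 2. There is exactly one torsion-free connection $\nabla$ on $\mathcal C$ (the Thomas cone connection) with $\nabla Z=\mathrm{id}_{T\mathcal C}$ and, for every scale $s$ and all vector fields $X,Y$ on $N$, lifted horizontally in the trivialization $\mathcal C\cong\mathbb R_+\times N$ given by $s$, $\nabla_XY=D^s_XY-\frac1{n-1}\mathrm{Ric}^{D^s}(X,Y)Z$. It is Ricci-flat and preserves a volume density. 3. Let $\mathbf g$ be the Patterson–Walker metric of $\nabla$ on $\mathbf M=T^*\mathcal C$. Then $\mathbf g$ is a pseudo-Riemannian metric of signature $(n+1,n+1)$, it is Ricci-flat on all of $\mathbf M$, and it is a Fefferman–Graham ambient metric for $(M,[g])$. Explicitly, every scale $s$ gives a diffeomorphism $\Phi_s=(t,q,\rho):\mathbf M\to\mathbb R_+\times M\times\mathbb R$, where for $\xi\in T^*_c\mathcal C$ with $c=t\,s(x)$ one puts $q=c^{-2}\,(ts)^*\xi\in M_x$ and $\rho=\xi(Z)/t^2$, and $$\mathbf g=\Phi_s^*\Big(2\rho\,dt\odot dt+2t\,dt\odot d\rho+t^2\big(g_s+\tfrac{2\rho}{n-1}\,\mathrm{Ric}^{D^s}\big)\Big),$$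 with $\mathrm{Ric}^{D^s}$ pulled back to $M$. The identification of the hypersurface $\rho=0$ with the ray bundle of metrics of $[g]$, $\xi\mapsto t^2g_s$ at $q$, and the dilations $(t,q,\rho)\mapsto(\lambda t,q,\rho)$, $\lambda>0$, do not depend on $s$. In particular, the two constructions $(N,[D])\rightsquigarrow(\mathcal C,\nabla)\rightsquigarrow(\mathbf M,\mathbf g)$ and $(N,[D])\rightsquigarrow(M,[g])\rightsquigarrow(\mathbf M,\mathbf g)$ agree, and $[g]$ admits a globally Ricci-flat Fefferman–Graham ambient metric which is itself a Patterson–Walker metric. -/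

import Mathlib

open scoped Manifold ContDiff Bundle
open Bundle

noncomputable section

namespace ProjectiveAmbient

/-! ### Covariant 2-tensor fields and pseudo-Riemannian metrics -/

section Tensors

variable {E : Type*} [NormedAddCommGroup E] [NormedSpace ℝ E]
  {H : Type*} [TopologicalSpace H] (I : ModelWithCorners ℝ E H)
  (X : Type*) [TopologicalSpace X] [ChartedSpace H X]

/-- Real functions of two tangent vectors at a common point of `X`. Bilinearity, symmetry and
smoothness are part of `IsPseudoRiemannian`. -/
abbrev Tensor2 : Type _ := ∀ x : X, TangentSpace I x → TangentSpace I x → ℝ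

variable {I X}

/-- Pullback `f^* g`. -/
def Tensor2.pullback {E' : Type*} [NormedAddCommGroup E'] [NormedSpace ℝ E']
    {H' : Type*} [TopologicalSpace H'] {J : ModelWithCorners ℝ E' H'}
    {Y : Type*} [TopologicalSpace Y] [ChartedSpace H' Y]
    (f : X → Y) (g : Tensor2 J Y) : Tensor2 I X :=
  fun x v w => g (f x) (mfderiv I J f x v) (mfderiv I J f x w)

/-- Two metrics are conformally related if `g' = e^{2f} g` with `f` smooth. -/
def Tensor2.ConformallyRelated (g g' : Tensor2 I X) : Prop :=
  ∃ f : X → ℝ, ContMDiff I 𝓘(ℝ, ℝ) ∞ f ∧ ∀ x v w, g' x v w = Real.exp (2 * f x) * g x v w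

variable [IsManifold I ∞ X]

/-- The vector field whose components in the chart at `x₀` are the constant vector `w`
(only its values on the domain of that chart matter). -/
def constField (x₀ : X) (w : E) (y : X) : TangentSpace I y :=
  (trivializationAt E (TangentSpace I : X → Type _) x₀).symm y w

/-- The components `g_{ij}(z)` of `g` in the chart at `x₀`, as a function on the model space. -/
def Tensor2.coeff (g : Tensor2 I X) (x₀ : X) (z v w : E) : ℝ :=
  g ((extChartAt I x₀).symm z) (constField x₀ v _) (constField x₀ w _)

/-- The function `B` is a symmetric bilinear form of signature `(p, q)`. -/
def HasSignature {V : Type*} [AddCommGroup V] [Module ℝ V] (B : V → V → ℝ) (p q : ℕ) : Prop :=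
  (∃ b : LinearMap.BilinForm ℝ V, ∀ v w, b v w = B v w) ∧ (∀ v w, B v w = B w v) ∧
    ∃ P Q : Submodule ℝ V, Module.finrank ℝ P = p ∧ Module.finrank ℝ Q = q ∧
      Module.finrank ℝ V = p + q ∧
      (∀ v ∈ P, v ≠ 0 → 0 < B v v) ∧ (∀ v ∈ Q, v ≠ 0 → B v v < 0)

/-- `g` is a smooth pseudo-Riemannian metric of signature `(p, q)`. -/
structure Tensor2.IsPseudoRiemannian (g : Tensor2 I X) (p q : ℕ) : Prop where
  signature : ∀ x, HasSignature (g x) p q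
  smooth : ∀ (x₀ : X) (v w : E),
    ContDiffOn ℝ ∞ (fun z => g.coeff x₀ z v w) (extChartAt I x₀).target

/-- `c` is a conformal structure of signature `(p, q)`: a full conformal class of metrics. -/
structure IsConformalStructure (c : Set (Tensor2 I X)) (p q : ℕ) : Prop where
  nonempty : c.Nonempty
  metric : ∀ g ∈ c, g.IsPseudoRiemannian p q
  mem_iff : ∀ g ∈ c, ∀ g', g' ∈ c ↔ g.ConformallyRelated g'

end Tensors

/-! ### Curvature in coordinates -/

section Curvature

variable {E : Type*} [NormedAddCommGroup E] [NormedSpace ℝ E] [FiniteDimensional ℝ E]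

/-- The curvature `R(u, v) w = ∇_u ∇_v w - ∇_v ∇_u w`, at the point `z` of the model space and for
constant vectors `u, v, w`, of the connection with Christoffel symbols `Γ z v w = ∇_v w`. -/
def coordCurvature (Γ : E → E → E → E) (z u v w : E) : E :=
  fderiv ℝ (fun y => Γ y v w) z u - fderiv ℝ (fun y => Γ y u w) z v
    + Γ z u (Γ z v w) - Γ z v (Γ z u w)

/-- The Ricci curvature `Ric(v, w) = tr (u ↦ R(u, v) w)`. -/
def coordRicci (Γ : E → E → E → E) (z v w : E) : ℝ :=
  ∑ i, (Module.finBasis ℝ E).coord i (coordCurvature Γ z (Module.finBasis ℝ E i) v w)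

/-- The Christoffel symbols of the Levi-Civita connection of a metric with components `G`: the
vector `a = Γ z u v` with
`2 G(a, w) = ∂_u G(v, w) + ∂_v G(u, w) - ∂_w G(u, v)` for all `w` (unique for nondegenerate `G`). -/
def coordLeviCivita (G : E → E → E → ℝ) (z u v : E) : E :=
  Classical.epsilon fun a => ∀ w, 2 * G z a w =
    fderiv ℝ (fun y => G y v w) z u + fderiv ℝ (fun y => G y u w) z v
      - fderiv ℝ (fun y => G y u v) z w

variable {H : Type*} [TopologicalSpace H] {I : ModelWithCorners ℝ E H}
  {X : Type*} [TopologicalSpace X] [ChartedSpace H X] [IsManifold I ∞ X]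

/-- The pseudo-Riemannian metric `g` is Ricci-flat on all of `X`. The Ricci tensor at `x` is computed
in the chart at `x`. -/
def Tensor2.RicciFlat (g : Tensor2 I X) : Prop :=
  ∀ (x : X) (v w : E), coordRicci (coordLeviCivita (g.coeff x)) (extChartAt I x x) v w = 0

end Curvature

/-! ### Affine connections -/

section Connections

variable {E : Type*} [NormedAddCommGroup E] [NormedSpace ℝ E] [FiniteDimensional ℝ E]
  [CompleteSpace E] {H : Type*} [TopologicalSpace H] (I : ModelWithCorners ℝ E H)
  (X : Type*) [TopologicalSpace X] [ChartedSpace H X] [IsManifold I ∞ X]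

/-- A smooth torsion-free affine connection; `D.cov Y x v` is `(D_v Y)(x)`. -/
structure TorsionFreeConnection where
  cov : CovariantDerivative I E (TangentSpace I : X → Type _)
  smooth : cov.ContMDiffCovariantDerivative ∞
  torsion_eq_zero : cov.torsion = 0

variable {I X}

/-- `Y` is a smooth vector field. -/
def IsSmoothField (Y : ∀ x : X, TangentSpace I x) : Prop :=
  ContMDiff I I.tangent ∞ (fun x => (⟨x, Y x⟩ : TangentBundle I X))

namespace TorsionFreeConnection

/-- The two connections are the same on smooth vector fields. -/
def Same (D D' : TorsionFreeConnection I X) : Prop :=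
  ∀ Y : ∀ x : X, TangentSpace I x, IsSmoothField Y → ∀ x v, D'.cov Y x v = D.cov Y x v

/-- `D` and `D'` are projectively related:
`D'_V Y = D_V Y + Υ(V) Y + Υ(Y) V` for some smooth 1-form `Υ`. -/
def ProjectivelyRelated (D D' : TorsionFreeConnection I X) : Prop :=
  ∃ Υ : ∀ x : X, TangentSpace I x →L[ℝ] ℝ,
    (∀ Y : ∀ x : X, TangentSpace I x, IsSmoothField Y →
      ContMDiff I 𝓘(ℝ, ℝ) ∞ (fun x => Υ x (Y x))) ∧
    ∀ Y : ∀ x : X, TangentSpace I x, IsSmoothField Y → ∀ (x : X) (v : TangentSpace I x),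
      D'.cov Y x v = D.cov Y x v + Υ x v • Y x + Υ x (Y x) • v

/-- The Christoffel symbols of `D` in the chart at `x₀`, as a function on the model space:
`christoffel x₀ z v w` is `D_v w` at the point with coordinates `z`. -/
def christoffel (D : TorsionFreeConnection I X) (x₀ : X) (z v w : E) : E :=
  (trivializationAt E (TangentSpace I : X → Type _) x₀
    ⟨(extChartAt I x₀).symm z, D.cov (constField x₀ w) _ (constField x₀ v _)⟩).2

/-- The Ricci tensor of `D`; its value at `x` is computed in the chart at `x`. -/
def ricci (D : TorsionFreeConnection I X) : Tensor2 I X :=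
  fun x v w => coordRicci (D.christoffel x) (extChartAt I x x) v w

/-- `D` is Ricci-flat. -/
def RicciFlat (D : TorsionFreeConnection I X) : Prop := ∀ x v w, D.ricci x v w = 0

/-- The Christoffel symbols at `x` in the chart at `x`: `(v, w) ↦ D_v w`, where `w` is extended
to have constant components in the chart at `x`. -/
def christoffelAt (D : TorsionFreeConnection I X) (x : X) (v w : TangentSpace I x) :
    TangentSpace I x :=
  D.cov (constField x w) x v

end TorsionFreeConnection

end Connections

/-! ### Density bundles -/

section Densities

variable {E : Type*} [NormedAddCommGroup E] [NormedSpace ℝ E]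
  {H : Type*} [TopologicalSpace H] (I : ModelWithCorners ℝ E H)
  (X : Type*) [TopologicalSpace X] [ChartedSpace H X] [IsManifold I ∞ X]

lemma det_tangent_ne_zero (i j : atlas H X) (x : X) (hi : x ∈ i.1.source) (hj : x ∈ j.1.source) :
    ((tangentBundleCore I X).coordChange i j x).det ≠ 0 := by
  have h1 : ((tangentBundleCore I X).coordChange j i x).comp
      ((tangentBundleCore I X).coordChange i j x) = ContinuousLinearMap.id ℝ E := by
    rw [(tangentBundleCore I X).coordChange_linear_comp i j i x ⟨⟨hi, hj⟩, hi⟩]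
    ext v
    exact (tangentBundleCore I X).coordChange_self i x hi v
  have h2 := congrArg ContinuousLinearMap.det h1
  intro h0
  simp only [ContinuousLinearMap.det, ContinuousLinearMap.toLinearMap_comp,
    LinearMap.det_comp] at h2 h0
  rw [h0] at h2
  simp at h2

variable [FiniteDimensional ℝ E]

lemma contDiff_det_clm {E : Type*} [NormedAddCommGroup E] [NormedSpace ℝ E]
    [FiniteDimensional ℝ E] : ContDiff ℝ ∞ (fun f : E →L[ℝ] E => f.det) := by
  classical
  have h : (fun f : E →L[ℝ] E => f.det) = fun f : E →L[ℝ] E => Matrix.det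
      (LinearMap.toMatrix (Module.finBasis ℝ E) (Module.finBasis ℝ E) (f : E →ₗ[ℝ] E)) := by
    funext f
    rw [LinearMap.det_toMatrix]
  rw [h]
  simp only [Matrix.det_apply]
  refine ContDiff.sum fun σ _ => ContDiff.const_smul _ (contDiff_prod fun i _ => ?_)
  let L : (E →L[ℝ] E) →ₗ[ℝ] ℝ :=
    { toFun := fun f => LinearMap.toMatrix (Module.finBasis ℝ E) (Module.finBasis ℝ E)
        (f : E →ₗ[ℝ] E) (σ i) i
      map_add' := fun f g => by simp [LinearMap.toMatrix_apply]
      map_smul' := fun c f => by simp [LinearMap.toMatrix_apply] }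
  exact L.toContinuousLinearMap.contDiff

/-- The line bundle `𝓔(w) = |Λ^d TX|^{-w/(d+1)}`, `d = dim X`: under a change of charts with
Jacobian matrix `J` the coefficient of a density is multiplied by `|det J|^{-w/(d+1)}` (that of an
element of `Λ^d TX` is multiplied by `det J`). -/
def densityCore (w : ℝ) : VectorBundleCore ℝ X ℝ (atlas H X) where
  baseSet i := i.1.source
  isOpen_baseSet i := i.1.open_source
  indexAt := achart H
  mem_baseSet_at := mem_chart_source H
  coordChange i j x :=
    (|((tangentBundleCore I X).coordChange i j x).det| ^ (-w / (Module.finrank ℝ E + 1 : ℝ))) •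
      ContinuousLinearMap.id ℝ ℝ
  coordChange_self i x hx v := by
    have : (tangentBundleCore I X).coordChange i i x = ContinuousLinearMap.id ℝ E := by
      ext u
      exact (tangentBundleCore I X).coordChange_self i x hx u
    rw [this]
    simp [ContinuousLinearMap.det]
  continuousOn_coordChange i j := by
    refine ContinuousOn.smul (ContinuousOn.rpow_const ?_ ?_) continuousOn_const
    · refine ContinuousOn.abs ?_
      exact ContinuousLinearMap.continuous_det.comp_continuousOn
        ((tangentBundleCore I X).continuousOn_coordChange i j)
    · rintro x ⟨hi, hj⟩
      exact Or.inl (abs_ne_zero.2 (det_tangent_ne_zero I X i j x hi hj))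
  coordChange_comp i j k x hx v := by
    have := (tangentBundleCore I X).coordChange_linear_comp i j k x hx
    have h2 := congrArg ContinuousLinearMap.det this
    simp only [ContinuousLinearMap.det, ContinuousLinearMap.toLinearMap_comp,
      LinearMap.det_comp] at h2
    simp only [ContinuousLinearMap.det, smul_apply,
      ContinuousLinearMap.id_apply, smul_eq_mul, ← h2, abs_mul]
    rw [Real.mul_rpow (abs_nonneg _) (abs_nonneg _)]
    ring

instance densityCore_isContMDiff (w : ℝ) : (densityCore I X w).IsContMDiff I ∞ where
  contMDiffOn_coordChange i j := by
    have : IsManifold I (∞ + 1) X := inferInstanceAs (IsManifold I ∞ X)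
    have h := (tangentBundleCore.isContMDiff (I := I) (M := X) (n := ∞)).contMDiffOn_coordChange i j
    intro x hx
    have hg : ContDiffAt ℝ ∞ (fun f : E →L[ℝ] E =>
        (|f.det| ^ (-w / (Module.finrank ℝ E + 1 : ℝ))) • ContinuousLinearMap.id ℝ ℝ)
        ((tangentBundleCore I X).coordChange i j x) := by
      have hd := det_tangent_ne_zero I X i j x hx.1 hx.2
      have h1 := contDiff_det_clm.contDiffAt (x := (tangentBundleCore I X).coordChange i j x)
      exact ((h1.abs hd).rpow_const_of_ne (abs_ne_zero.2 hd)).smul contDiffAt_const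
    exact hg.contMDiffAt.comp_contMDiffWithinAt x (h x hx)

/-- The fibre `𝓔(w)_x`. -/
abbrev Density (w : ℝ) : X → Type _ := (densityCore I X w).Fiber

instance (w : ℝ) (x : X) : IsTopologicalAddGroup (Density I X w x) :=
  inferInstanceAs (IsTopologicalAddGroup ℝ)

instance (w : ℝ) (x : X) : ContinuousSMul ℝ (Density I X w x) :=
  inferInstanceAs (ContinuousSMul ℝ ℝ)

variable {I X}

/-- The coefficient of a density at `x` with respect to the frame of the chart at `x`. For varying
weights these coefficients are compatible with products of densities. -/
def densityCoord {w : ℝ} {x : X} : Density I X w x ≃L[ℝ] ℝ :=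
  ContinuousLinearEquiv.refl ℝ ℝ

variable (I X)

/-- A scale: a smooth positive section of `𝓔(1)`. -/
structure Scale where
  val : ∀ x : X, Density I X 1 x
  pos : ∀ x, 0 < densityCoord (val x)
  smooth : ContMDiff I (I.prod 𝓘(ℝ, ℝ)) ∞
    (fun x => (⟨x, val x⟩ : TotalSpace ℝ (Density I X 1)))

/-- The total space of `𝓔_+(1)`, the positive elements of `𝓔(1)`. -/
def thomasCone : TopologicalSpace.Opens (TotalSpace ℝ (Density I X 1)) where
  carrier := {p | 0 < densityCoord p.2}
  is_open' := by
    rw [isOpen_iff_mem_nhds]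
    intro p hp
    let e := (densityCore I X 1).localTrivAt p.1
    have he : p ∈ e.source := (densityCore I X 1).mem_source_at p.1 p.2
    have hc : ContinuousAt (fun q => (e q).2) p :=
      continuous_snd.continuousAt.comp (e.continuousAt he)
    have hp' : 0 < (e p).2 := by
      have : e p = ⟨p.1, p.2⟩ := (densityCore I X 1).localTrivAt_apply p
      rw [this]
      exact hp
    filter_upwards [hc.eventually (lt_mem_nhds hp')] with q hq
    have h2 : (e q).2 = (|((tangentBundleCore I X).coordChange (achart H q.1) (achart H p.1)
        q.1).det| ^ (-1 / (Module.finrank ℝ E + 1 : ℝ))) * densityCoord q.2 := rfl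
    rw [h2] at hq
    exact pos_of_mul_pos_right hq (Real.rpow_nonneg (abs_nonneg _) _)

variable {I X}

/-- The connection that `D` induces on `𝓔(1)` preserves the scale `s` (equivalently, `D` preserves
the volume density that corresponds to `s`). In the chart at `x` this says
`ds(v) = (1/(d+1)) tr (w ↦ Γ(v, w)) s` at `x`. -/
def TorsionFreeConnection.Preserves [CompleteSpace E] (D : TorsionFreeConnection I X)
    (s : Scale I X) : Prop :=
  ∀ (x : X) (v : TangentSpace I x),
    mfderiv I 𝓘(ℝ, ℝ) (fun y => (trivializationAt ℝ (Density I X 1) x ⟨y, s.val y⟩).2) x v =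
      (∑ i, (Module.finBasis ℝ E).coord i (D.christoffelAt x v (Module.finBasis ℝ E i)))
        / (Module.finrank ℝ E + 1 : ℝ) * densityCoord (s.val x)

end Densities

/-! ### Patterson-Walker metrics -/

section PattersonWalker

variable {E : Type*} [NormedAddCommGroup E] [NormedSpace ℝ E] [FiniteDimensional ℝ E]
  [CompleteSpace E] {H : Type*} [TopologicalSpace H] (I : ModelWithCorners ℝ E H)
  (X : Type*) [TopologicalSpace X] [ChartedSpace H X] [IsManifold I ∞ X]

/-- The total space of the cotangent bundle `T^*X`. -/
abbrev CotangentSpace : Type _ :=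
  TotalSpace (E →L[ℝ] ℝ) (fun x : X => TangentSpace I x →L[ℝ] Trivial X ℝ x)

/-- The total space of `T^*X ⊗ 𝓔(w)`. -/
abbrev WeightedCotangentSpace (w : ℝ) : Type _ :=
  TotalSpace (E →L[ℝ] ℝ) (fun x : X => TangentSpace I x →L[ℝ] Density I X w x)

variable {I X}

/-- The Patterson-Walker metric `2 dx^A ⊙ dp_A - 2 Γ_A^C_B p_C dx^A ⊙ dx^B` of `D` on `T^*X`
(where `⊙` is the symmetrized product, so that `2 a ⊙ b = a ⊗ b + b ⊗ a`). At `ξ` over `x` it is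
written in the canonical coordinates `(x^A, p_A)` induced by the chart at `x`; these are the
coordinates of the chart of the manifold `T^*X` at `ξ`, in which a tangent vector at `ξ` is a pair
`(dx, dp)`. -/
def pattersonWalker (D : TorsionFreeConnection I X) :
    Tensor2 (I.prod 𝓘(ℝ, E →L[ℝ] ℝ)) (CotangentSpace I X) :=
  fun ξ (u u' : E × (E →L[ℝ] ℝ)) =>
    u'.2 u.1 + u.2 u'.1 - 2 * ξ.2 (D.christoffelAt ξ.1 u.1 u'.1)

end PattersonWalker

/-! ### Ambient metrics -/

section Ambient

/-- The positive reals as a manifold. -/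
abbrev PosReal : TopologicalSpace.Opens ℝ := ⟨Set.Ioi 0, isOpen_Ioi⟩

variable {E : Type*} [NormedAddCommGroup E] [NormedSpace ℝ E]
  {H : Type*} [TopologicalSpace H] {J : ModelWithCorners ℝ E H}
  {M : Type*} [TopologicalSpace M] [ChartedSpace H M]

/-- The symmetric 2-tensor `t² h_ρ + 2ρ dt ⊙ dt + 2t dt ⊙ dρ` on `ℝ_+ × M × ℝ` (with coordinates
`(t, q, ρ)`), where `h_ρ` is a family of symmetric 2-tensors on `M`. -/
def normalForm (h : ℝ → Tensor2 J M) :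
    Tensor2 (𝓘(ℝ, ℝ).prod (J.prod 𝓘(ℝ, ℝ))) (PosReal × M × ℝ) :=
  fun a (u u' : ℝ × E × ℝ) =>
    (a.1 : ℝ) ^ 2 * h a.2.2 a.2.1 u.2.1 u'.2.1 + 2 * a.2.2 * (u.1 * u'.1)
      + (a.1 : ℝ) * (u.1 * u'.2.2 + u'.1 * u.2.2)

/-- The dilation `(t, q, ρ) ↦ (λt, q, ρ)` of `ℝ_+ × M × ℝ`. -/
def dilate (l : PosReal) (a : PosReal × M × ℝ) : PosReal × M × ℝ :=
  (⟨l.1 * a.1.1, Set.mem_Ioi.2 (mul_pos l.2 a.1.2)⟩, a.2)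

variable [IsManifold J ∞ M]
  {E' : Type*} [NormedAddCommGroup E'] [NormedSpace ℝ E'] [FiniteDimensional ℝ E']
  {H' : Type*} [TopologicalSpace H'] {J' : ModelWithCorners ℝ E' H'}
  {X : Type*} [TopologicalSpace X] [ChartedSpace H' X] [IsManifold J' ∞ X]

/-- `G` is a globally Ricci-flat Fefferman-Graham ambient metric, on the manifold `X`, of the
conformal structure `c` of signature `(p, q)` on `M`: `X` is identified with `ℝ_+ × M × ℝ` in such
a way that `G = t² h_ρ + 2ρ dt ⊙ dt + 2t dt ⊙ dρ`, where `h_0` is a metric of the class `c`. -/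
structure IsRicciFlatAmbientMetric (c : Set (Tensor2 J M)) (p q : ℕ) (G : Tensor2 J' X) :
    Prop where
  metric : G.IsPseudoRiemannian (p + 1) (q + 1)
  ricciFlat : G.RicciFlat
  normalForm : ∃ (h : ℝ → Tensor2 J M)
    (Φ : Diffeomorph J' (𝓘(ℝ, ℝ).prod (J.prod 𝓘(ℝ, ℝ))) X (PosReal × M × ℝ) ∞),
    h 0 ∈ c ∧ G = Tensor2.pullback Φ (normalForm h)

end Ambient

/-! ### The constructions for a projective structure -/

section Projective

variable {E : Type*} [NormedAddCommGroup E] [NormedSpace ℝ E] [FiniteDimensional ℝ E]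
  [CompleteSpace E] {H : Type*} [TopologicalSpace H] {I : ModelWithCorners ℝ E H}
  {N : Type*} [TopologicalSpace N] [ChartedSpace H N] [IsManifold I ∞ N]

namespace Scale

/-- The identification `T^*N ⊗ 𝓔(-2) ≅ T^*N`, `q ↦ s² q`, given by a scale `s`. -/
def toCotangent (s : Scale I N) (q : WeightedCotangentSpace I N (-2)) : CotangentSpace I N :=
  ⟨q.1, (densityCoord (s.val q.1) ^ 2) •
    ((densityCoord (w := -2) (x := q.1)).toContinuousLinearMap ∘L q.2)⟩

/-- The fibre coordinate `x⁰` on the Thomas cone given by the scale `s`: `c = x⁰ s(x)` for `c`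
over `x`. -/
def fibreCoord (s : Scale I N) (c : thomasCone I N) : PosReal :=
  ⟨densityCoord c.1.2 / densityCoord (s.val c.1.1), div_pos c.2 (s.pos _)⟩

/-- The section `y ↦ t s(y)` of the Thomas cone. -/
def coneSection (s : Scale I N) (t : PosReal) (y : N) : thomasCone I N :=
  ⟨⟨y, (t : ℝ) • s.val y⟩, by
    show 0 < densityCoord ((t : ℝ) • s.val y)
    rw [map_smul]
    exact mul_pos t.2 (s.pos y)⟩

/-- The horizontal lift `T_x N → T_c 𝒞` in the trivialization `𝒞 ≅ ℝ_+ × N` given by `s`, for `c`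
over `x`: the derivative of the section `y ↦ t s(y)` through `c`. -/
def lift (s : Scale I N) (c : thomasCone I N) :
    TangentSpace I c.1.1 →L[ℝ] TangentSpace (I.prod 𝓘(ℝ, ℝ)) c :=
  mfderiv I (I.prod 𝓘(ℝ, ℝ)) (s.coneSection (s.fibreCoord c)) c.1.1

end Scale

/-- The Euler field `x⁰ ∂_{x⁰}` of the Thomas cone: in the chart at `c` its component along `N` is
zero and its component along the fibre is the fibre coordinate of `c`. -/
def eulerField (c : thomasCone I N) : TangentSpace (I.prod 𝓘(ℝ, ℝ)) c :=
  ((0, densityCoord c.1.2) : E × ℝ)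

/-- `∇` is the Thomas cone connection of the projective class of `D₀`: a torsion-free connection on
`𝒞 = 𝓔_+(1)` such that, in the trivialization of `𝒞` given by any scale `s`, with corresponding
connection `D` in the projective class,
`∇_V Y = D_V Y - (1/(n-1)) Ric(V, Y) Z` for vector fields `V, Y` on `N`, and `∇ Z = id`. -/
structure IsThomasConnection (D₀ : TorsionFreeConnection I N)
    (nabla : TorsionFreeConnection (I.prod 𝓘(ℝ, ℝ)) (thomasCone I N)) : Prop where
  cov_lift : ∀ (s : Scale I N) (D : TorsionFreeConnection I N),
    D₀.ProjectivelyRelated D → D.Preserves s →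
    ∀ Y : ∀ x : N, TangentSpace I x, IsSmoothField Y →
    ∀ (c : thomasCone I N) (v : TangentSpace I c.1.1),
      nabla.cov (fun c' => s.lift c' (Y c'.1.1)) c (s.lift c v) =
        s.lift c (D.cov Y c.1.1 v)
          - (1 / (Module.finrank ℝ E - 1 : ℝ) * D.ricci c.1.1 v (Y c.1.1)) • eulerField c
  cov_euler : ∀ (c : thomasCone I N) (u : TangentSpace (I.prod 𝓘(ℝ, ℝ)) c),
    nabla.cov eulerField c u = u

/-- The metric on the weighted cotangent bundle `T^*N ⊗ 𝓔(-2) = T^*N ⊗ |Λ^n TN|^{2/(n+1)}` that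
corresponds to the Patterson-Walker metric of `D` on `T^*N` under the identification given by the
scale `s`. -/
def weightedPattersonWalker (s : Scale I N) (D : TorsionFreeConnection I N) :
    Tensor2 (I.prod 𝓘(ℝ, E →L[ℝ] ℝ)) (WeightedCotangentSpace I N (-2)) :=
  Tensor2.pullback s.toCotangent (pattersonWalker D)

/-- The conformal Patterson-Walker structure of the projective class of `D₀`: all metrics on the
weighted cotangent bundle that are conformally related to the Patterson-Walker metric of a
connection in the projective class that preserves a scale. -/
def conformalPattersonWalker (D₀ : TorsionFreeConnection I N) :
    Set (Tensor2 (I.prod 𝓘(ℝ, E →L[ℝ] ℝ)) (WeightedCotangentSpace I N (-2))) :=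
  {g | ∃ (s : Scale I N) (D : TorsionFreeConnection I N), D₀.ProjectivelyRelated D ∧
    D.Preserves s ∧ (weightedPattersonWalker s D).ConformallyRelated g}

/-- The map `T^*𝒞 → ℝ_+ × (T^*N ⊗ 𝓔(-2)) × ℝ` given by a scale `s`. For `ξ` in the fibre of `T^*𝒞`
over `c = t s(x)` its components are `t`, the pullback of `ξ` under the section `y ↦ t s(y)`
divided by `c²`, and `ρ = ξ(Z) / t²`. In coordinates `(x⁰, x^A, y_A, y_0)` this is
`t = x⁰`, `p_A = y_A / (x⁰)²`, `ρ = y_0 / x⁰`, where `p` corresponds to the second component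
under `Scale.toCotangent`. -/
def ambientCoord (s : Scale I N)
    (ξ : CotangentSpace (I.prod 𝓘(ℝ, ℝ)) (thomasCone I N)) :
    PosReal × WeightedCotangentSpace I N (-2) × ℝ :=
  (s.fibreCoord ξ.1,
    ⟨ξ.1.1.1, ((densityCoord ξ.1.1.2) ^ 2)⁻¹ •
      ((densityCoord (I := I) (w := -2) (x := ξ.1.1.1)).symm.toContinuousLinearMap ∘L
        (ξ.2 ∘L s.lift ξ.1))⟩,
    ξ.2 (eulerField ξ.1) / (s.fibreCoord ξ.1 : ℝ) ^ 2)

end Projective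

end ProjectiveAmbient

end

noncomputable section

set_option synthInstance.maxHeartbeats 200000
set_option maxSynthPendingDepth 3
set_option linter.unusedSectionVars false

namespace ProjectiveAmbient

open Filter Topology

/-! ### Traces, curvature and determinants in coordinates -/

section CoordinateCalculus

variable {E : Type*} [NormedAddCommGroup E] [NormedSpace ℝ E] [FiniteDimensional ℝ E]

/-! In a chart everything is governed by two symbols that depend on the projective class alone. Let
`Γ` be the Christoffel symbols of a connection in the class. A projective change adds `Υ(v) w + Υ(w)
v`, whose trace is `(n+1) Υ(v)`, so the trace-free part `Π` of `Γ` (`thomasSymbol`) does not see it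
(`traceFree_add_symProd`). If `σ` is the coefficient of a scale `s` and `β = d log σ`, then a
connection preserves `s` exactly when the trace of `Γ(v, ·)` is `(n+1) β(v)`. Hence `D^s` can only
have the symbols `Π(v, w) + β(v) w + β(w) v`. It exists because the defect `β - tr Γ / (n+1)` is a
global 1-form (`covLogDeriv_transition`), which serves as `Υ`.

On the weighted cotangent bundle, the substitution of `σ² p` for the momentum produces derivatives
of `σ²` that cancel the `β`-part of `Γ`. Thus `g_s` is `σ²` times a metric built from `Π` alone
(`weightedPattersonWalker_eq_chart`), and the metrics of two scales differ by the factor `(s'/s)²`.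

Let `P` be the Ricci curvature of `Π` divided by `n-1` (`schoutenSymbol`), and let `y` be the fibre
coordinate of the cone. The cone connection has the symbols `((v, a), (w, b)) ↦ (Π(v, w) + (a/y) w +
(b/y) v, -y P(v, w))`. Neither `Π` nor `P` is the symbol of a connection or a tensor, but their
defects are expressed by the logarithmic derivative of the transition function of `𝓔(1)`, and the
change of `y` absorbs exactly these (`isSymbolFamily_coneSymbol`). The trace of the curvature is
`Ric(Π) - (n-1) P = 0` (`coordRicci_coneChristoffel`), and the trace of the symbols is `n dy/y`, so
a power of `y` is a parallel density. The Levi-Civita connection of a Patterson-Walker metric is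
explicit, and its Ricci tensor is the pullback of `Ric(v, w) + Ric(w, v)`
(`coordRicci_pattersonWalker`), so Ricci-flatness passes from the cone to its cotangent bundle.

The ambient coordinates evaluate a covector `ξ` on the horizontal lifts and on the Euler field. If
`η` and `η₀` denote its components along base and fibre, they are `t = y/σ`, `p = y⁻² (η + η₀ y β)`,
`ρ = η₀ σ²/y`. The normal form then becomes an algebraic identity, once the Ricci tensor of `D^s` is
written in terms of `P`, `Π` and `β` (`ricci_eq_schoutenSymbol`). The lifts given by two scales
differ by a multiple of the Euler field, so a change of scale moves `q` by a multiple of `ρ` and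
rescales `t` by a function on the base; the hypersurface `ρ = 0` and the dilations are therefore
unaffected in the sense required. -/

lemma sum_coord_eq_trace (f : E →ₗ[ℝ] E) :
    ∑ i, (Module.finBasis ℝ E).coord i (f (Module.finBasis ℝ E i)) = LinearMap.trace ℝ E f := by
  rw [LinearMap.trace_eq_matrix_trace ℝ (Module.finBasis ℝ E)]
  simp [Matrix.trace, LinearMap.toMatrix_apply]

/-- The trace as a continuous linear functional. -/
def trL : (E →L[ℝ] E) →L[ℝ] ℝ :=
  LinearMap.toContinuousLinearMap
    ((LinearMap.trace ℝ E) ∘ₗ (ContinuousLinearMap.coeLM ℝ : (E →L[ℝ] E) →ₗ[ℝ] (E →ₗ[ℝ] E)))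

lemma trL_apply (f : E →L[ℝ] E) : trL f = LinearMap.trace ℝ E (f : E →ₗ[ℝ] E) := rfl

lemma sum_coord_eq_trL (f : E →L[ℝ] E) :
    ∑ i, (Module.finBasis ℝ E).coord i (f (Module.finBasis ℝ E i)) = trL f :=
  sum_coord_eq_trace (f : E →ₗ[ℝ] E)

lemma trL_id : trL (ContinuousLinearMap.id ℝ E) = Module.finrank ℝ E := by
  rw [trL_apply, ContinuousLinearMap.coe_id, LinearMap.trace_id]

lemma trL_comp_comm {F : Type*} [NormedAddCommGroup F] [NormedSpace ℝ F] [FiniteDimensional ℝ F]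
    (f : E →L[ℝ] F) (g : F →L[ℝ] E) : trL (f ∘L g) = trL (g ∘L f) := by
  simp only [trL_apply, ContinuousLinearMap.toLinearMap_comp]
  exact LinearMap.trace_comp_comm' _ _

lemma trL_smulRight (φ : E →L[ℝ] ℝ) (v : E) : trL (φ.smulRight v) = φ v := by
  rw [trL_apply]
  exact LinearMap.trace_smulRight (φ : E →ₗ[ℝ] ℝ) v

lemma coordCurvature_congr {Γ Γ' : E → E → E → E} {z : E} (h : ∀ᶠ y in 𝓝 z, Γ y = Γ' y)
    (u v w : E) : coordCurvature Γ z u v w = coordCurvature Γ' z u v w := by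
  have h1 : ∀ v w, fderiv ℝ (fun y => Γ y v w) z = fderiv ℝ (fun y => Γ' y v w) z := fun v w =>
    Filter.EventuallyEq.fderiv_eq (h.mono fun y hy => by simp only [hy])
  simp only [coordCurvature, h1, h.self_of_nhds]

lemma coordRicci_congr {Γ Γ' : E → E → E → E} {z : E} (h : ∀ᶠ y in 𝓝 z, Γ y = Γ' y)
    (v w : E) : coordRicci Γ z v w = coordRicci Γ' z v w := by
  simp only [coordRicci, coordCurvature_congr h]

lemma coordRicci_eq_trL {Γ : E → E → E → E} {z v w : E} (f : E →L[ℝ] E)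
    (h : ∀ u, coordCurvature Γ z u v w = f u) : coordRicci Γ z v w = trL f := by
  rw [coordRicci, ← sum_coord_eq_trL]
  simp only [h]

/-- The values of a field of bilinear maps, as a function of three vectors. -/
abbrev uncurried (G : E → E →L[ℝ] E →L[ℝ] E) : E → E → E → E := fun y v w => G y v w

lemma fderiv_apply₂ {G : E → E →L[ℝ] E →L[ℝ] E} {z : E} (hG : DifferentiableAt ℝ G z) (v w u : E) :
    fderiv ℝ (fun y => G y v w) z u = fderiv ℝ G z u v w := by
  have h1 : HasFDerivAt (fun y => G y v w)
      (((fderiv ℝ G z).flip v).flip w) z := by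
    have := ((hG.hasFDerivAt.clm_apply (hasFDerivAt_const v z)).clm_apply (hasFDerivAt_const w z))
    refine this.congr_fderiv ?_
    ext u
    simp
  rw [h1.fderiv]
  rfl

lemma coordCurvature_uncurried {G : E → E →L[ℝ] E →L[ℝ] E} {z : E} (hG : DifferentiableAt ℝ G z)
    (u v w : E) : coordCurvature (uncurried G) z u v w =
      fderiv ℝ G z u v w - fderiv ℝ G z v u w + G z u (G z v w) - G z v (G z u w) := by
  simp only [coordCurvature, uncurried, fderiv_apply₂ hG]

/-- The curvature endomorphism `u ↦ R(u, v) w`. -/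
def curvatureEnd (G : E → E →L[ℝ] E →L[ℝ] E) (z v w : E) : E →L[ℝ] E :=
  ((fderiv ℝ G z).flip v).flip w - (fderiv ℝ G z v).flip w + (G z).flip (G z v w)
    - (G z v) ∘L (G z).flip w

lemma coordRicci_uncurried {G : E → E →L[ℝ] E →L[ℝ] E} {z : E} (hG : DifferentiableAt ℝ G z)
    (v w : E) : coordRicci (uncurried G) z v w =
      trL (((fderiv ℝ G z).flip v).flip w) - trL ((fderiv ℝ G z v).flip w)
        + trL ((G z).flip (G z v w)) - trL ((G z v) ∘L (G z).flip w) := by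
  rw [coordRicci_eq_trL (curvatureEnd G z v w) fun u => by
    rw [coordCurvature_uncurried hG]; rfl]
  simp [curvatureEnd]

/-- The Ricci curvature of a torsion-free connection, in terms of divergence and trace of the
Christoffel symbols. -/
lemma coordRicci_of_symm {G : E → E →L[ℝ] E →L[ℝ] E} {z : E} (hG : DifferentiableAt ℝ G z)
    (hs : ∀ᶠ y in 𝓝 z, ∀ v w, G y v w = G y w v) (v w : E) :
    coordRicci (uncurried G) z v w =
      trL (((fderiv ℝ G z).flip v).flip w) - trL (fderiv ℝ G z v w)
        + trL (G z (G z v w)) - trL ((G z v) ∘L (G z w)) := by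
  have hs0 : (G z).flip = G z := by
    ext v w
    exact hs.self_of_nhds w v
  have hs1 : (fderiv ℝ G z v).flip w = fderiv ℝ G z v w := by
    ext u
    rw [ContinuousLinearMap.flip_apply, ← fderiv_apply₂ hG, ← fderiv_apply₂ hG]
    congr 1
    exact Filter.EventuallyEq.fderiv_eq (hs.mono fun y hy => hy _ _)
  rw [coordRicci_uncurried hG, hs0, hs1]

/-- The curvature transforms as a tensor when the Christoffel symbols transform as a connection. -/
lemma coordCurvature_transform {G G' : E → E →L[ℝ] E →L[ℝ] E} {φ : E → E} {J : E → E →L[ℝ] E}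
    {z : E} (hG : DifferentiableAt ℝ G z) (hG' : DifferentiableAt ℝ G' (φ z))
    (hφ : ∀ᶠ y in 𝓝 z, HasFDerivAt φ (J y) y) (hJ : ContDiffAt ℝ 2 J z)
    (h : ∀ᶠ y in 𝓝 z, ∀ v w, J y (G y v w) = G' (φ y) (J y v) (J y w) + fderiv ℝ J y v w)
    (u v w : E) :
    J z (coordCurvature (uncurried G) z u v w) =
      coordCurvature (uncurried G') (φ z) (J z u) (J z v) (J z w) := by
  have hJd : ∀ᶠ y in 𝓝 z, DifferentiableAt ℝ J y :=
    (hJ.eventually (by simp)).mono fun y hy => hy.differentiableAt (by simp)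
  -- `J` is the Jacobian of `φ`, so its first derivative is a second derivative and symmetric; one
  -- order higher, `hsym2` lets the third derivatives cancel in the curvature.
  have hsym : ∀ u v, fderiv ℝ J z u v = fderiv ℝ J z v u := fun u v =>
    second_derivative_symmetric_of_eventually hφ hJd.self_of_nhds.hasFDerivAt u v
  have hJ2 : DifferentiableAt ℝ (fderiv ℝ J) z :=
    (hJ.fderiv_right (m := 1) (by norm_num)).differentiableAt (by simp)
  have hsym2 : ∀ u v w, fderiv ℝ (fderiv ℝ J) z u v w = fderiv ℝ (fderiv ℝ J) z v u w := by
    intro u v w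
    have := second_derivative_symmetric_of_eventually
      (hJd.mono fun y hy => hy.hasFDerivAt) hJ2.hasFDerivAt u v
    rw [this]
  -- This is the derivative of the transformation law in the direction `u`, taken by the product
  -- rule on both sides.
  have key : ∀ u v w, fderiv ℝ J z u (G z v w) + J z (fderiv ℝ G z u v w) =
      fderiv ℝ G' (φ z) (J z u) (J z v) (J z w) + G' (φ z) (fderiv ℝ J z u v) (J z w)
        + G' (φ z) (J z v) (fderiv ℝ J z u w) + fderiv ℝ (fderiv ℝ J) z u v w := by
    intro u v w
    have hJz := hJd.self_of_nhds.hasFDerivAt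
    have hl : HasFDerivAt (fun y => J y (G y v w)) _ z := hJz.clm_apply
      ((hG.hasFDerivAt.clm_apply (hasFDerivAt_const v z)).clm_apply (hasFDerivAt_const w z))
    have hcomp : HasFDerivAt (fun y => G' (φ y)) (fderiv ℝ G' (φ z) ∘L J z) z :=
      HasFDerivAt.comp (g := G') z hG'.hasFDerivAt hφ.self_of_nhds
    have hr : HasFDerivAt (fun y => G' (φ y) (J y v) (J y w) + fderiv ℝ J y v w) _ z :=
      ((hcomp.clm_apply (hJz.clm_apply (hasFDerivAt_const v z))).clm_apply
        (hJz.clm_apply (hasFDerivAt_const w z))).add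
      ((hJ2.hasFDerivAt.clm_apply (hasFDerivAt_const v z)).clm_apply (hasFDerivAt_const w z))
    have he := (Filter.EventuallyEq.fderiv_eq (h.mono fun y hy => hy v w) :
      fderiv ℝ (fun y => J y (G y v w)) z = _)
    rw [hl.fderiv, hr.fderiv] at he
    have := congrArg (fun L : E →L[ℝ] E => L u) he
    simp only [add_apply, ContinuousLinearMap.comp_apply,
      ContinuousLinearMap.flip_apply, ContinuousLinearMap.comp_zero, zero_add] at this
    rw [add_comm, this]
    abel
  rw [coordCurvature_uncurried hG, coordCurvature_uncurried hG']
  have h0 := h.self_of_nhds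
  have k1 := key u v w
  have k2 := key v u w
  rw [hsym v u] at k2
  rw [← hsym2 u v] at k2
  -- The law is applied once more to the inner symbol in the quadratic terms; the derivatives of `J`
  -- that this creates cancel those in `key`.
  have e1 := h0 u (G z v w)
  have e2 := h0 v (G z u w)
  rw [h0 v w, map_add, hsym u] at e1
  rw [h0 u w, map_add, hsym v] at e2
  simp only [map_sub, map_add]
  rw [e1, e2]
  have k1' : J z (fderiv ℝ G z u v w) = fderiv ℝ G' (φ z) (J z u) (J z v) (J z w) +
      G' (φ z) (fderiv ℝ J z u v) (J z w) + G' (φ z) (J z v) (fderiv ℝ J z u w) +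
      fderiv ℝ (fderiv ℝ J) z u v w - fderiv ℝ J z u (G z v w) := by rw [← k1]; abel
  have k2' : J z (fderiv ℝ G z v u w) = fderiv ℝ G' (φ z) (J z v) (J z u) (J z w) +
      G' (φ z) (fderiv ℝ J z u v) (J z w) + G' (φ z) (J z u) (fderiv ℝ J z v w) +
      fderiv ℝ (fderiv ℝ J) z u v w - fderiv ℝ J z v (G z u w) := by rw [← k2]; abel
  rw [k1', k2', hsym u (G z v w), hsym v (G z u w)]
  abel

/-- Tensoriality makes the two curvature endomorphisms conjugate under the Jacobian, and the trace
is invariant under conjugation. -/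
lemma coordRicci_transform {G G' : E → E →L[ℝ] E →L[ℝ] E} {φ : E → E} {J : E → E →L[ℝ] E}
    {z : E} (hG : DifferentiableAt ℝ G z) (hG' : DifferentiableAt ℝ G' (φ z))
    (hφ : ∀ᶠ y in 𝓝 z, HasFDerivAt φ (J y) y) (hJ : ContDiffAt ℝ 2 J z)
    (h : ∀ᶠ y in 𝓝 z, ∀ v w, J y (G y v w) = G' (φ y) (J y v) (J y w) + fderiv ℝ J y v w)
    {K : E →L[ℝ] E} (hK : K ∘L J z = ContinuousLinearMap.id ℝ E)
    (hK' : J z ∘L K = ContinuousLinearMap.id ℝ E) (v w : E) :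
    coordRicci (uncurried G) z v w = coordRicci (uncurried G') (φ z) (J z v) (J z w) := by
  rw [coordRicci_eq_trL (curvatureEnd G z v w) fun u => by
    rw [coordCurvature_uncurried hG]; rfl,
    coordRicci_eq_trL (curvatureEnd G' (φ z) (J z v) (J z w)) fun u => by
    rw [coordCurvature_uncurried hG']; rfl]
  have : curvatureEnd G' (φ z) (J z v) (J z w) = (J z ∘L curvatureEnd G z v w) ∘L K := by
    ext u
    have h1 := coordCurvature_transform hG hG' hφ hJ h (K u) v w
    rw [coordCurvature_uncurried hG, coordCurvature_uncurried hG'] at h1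
    have h2 : J z (K u) = u := congrArg (fun L : E →L[ℝ] E => L u) hK'
    rw [h2] at h1
    exact h1.symm
  rw [this, trL_comp_comm, ← ContinuousLinearMap.comp_assoc, hK, ContinuousLinearMap.id_comp]

/-- The derivative of the determinant at the identity is the trace. -/
lemma hasFDerivAt_det_id :
    HasFDerivAt (fun f : E →L[ℝ] E => f.det) trL (ContinuousLinearMap.id ℝ E) := by
  have hd : DifferentiableAt ℝ (fun f : E →L[ℝ] E => f.det) (ContinuousLinearMap.id ℝ E) :=
    (contDiff_det_clm.differentiable (by simp)).differentiableAt
  refine hd.hasFDerivAt.congr_fderiv ?_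
  ext M
  -- Differentiability being known, the line `id + t M` suffices. Along it the determinant is the
  -- polynomial `det (1 + t m)`, whose linear coefficient is the trace.
  have h1 : HasDerivAt (fun t : ℝ => ContinuousLinearMap.id ℝ E + t • M) M 0 := by
    simpa using ((hasDerivAt_id (0 : ℝ)).smul_const M).const_add (ContinuousLinearMap.id ℝ E)
  have hd' : HasFDerivAt (fun f : E →L[ℝ] E => f.det)
      (fderiv ℝ (fun f : E →L[ℝ] E => f.det) (ContinuousLinearMap.id ℝ E))
      (ContinuousLinearMap.id ℝ E + (0 : ℝ) • M) := by simpa using hd.hasFDerivAt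
  have h2 := hd'.comp_hasDerivAt (0 : ℝ) h1
  let m := LinearMap.toMatrix (Module.finBasis ℝ E) (Module.finBasis ℝ E) (M : E →ₗ[ℝ] E)
  have h3 : ((fun f : E →L[ℝ] E => f.det) ∘ fun t : ℝ => ContinuousLinearMap.id ℝ E + t • M) =
      fun t => ((1 + (Polynomial.X : Polynomial ℝ) • m.map Polynomial.C).det).eval t := by
    funext t
    simp only [Function.comp_apply, ContinuousLinearMap.det]
    rw [← LinearMap.det_toMatrix (Module.finBasis ℝ E), ← Polynomial.coe_evalRingHom,
      RingHom.map_det]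
    congr 1
    ext i j
    simp [m, LinearMap.toMatrix_apply, Matrix.one_apply, apply_ite (Polynomial.eval t),
      Finsupp.single_apply, eq_comm]
    ring
  rw [h3] at h2
  have h4 := h2.unique (Polynomial.hasDerivAt _ _)
  rw [h4, Matrix.derivative_det_one_add_X_smul, trL_apply,
    LinearMap.trace_eq_matrix_trace ℝ (Module.finBasis ℝ E)]

/-- Jacobi's formula for the logarithmic derivative of the determinant. -/
lemma hasFDerivAt_det {X : Type*} [NormedAddCommGroup X] [NormedSpace ℝ X]
    {A : X → E →L[ℝ] E} {A' : X →L[ℝ] E →L[ℝ] E} {x : X} (hA : HasFDerivAt A A' x)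
    {K : E →L[ℝ] E} (hK : K ∘L A x = ContinuousLinearMap.id ℝ E)
    (hK' : A x ∘L K = ContinuousLinearMap.id ℝ E) :
    HasFDerivAt (fun y => (A y).det)
      ((A x).det • (trL ∘L (ContinuousLinearMap.compL ℝ E E E K) ∘L A')) x := by
  -- Splitting off the constant factor `A x` moves the base point to the identity.
  have h1 : (fun y => (A y).det) = fun y => (A x).det * (K ∘L A y).det := by
    funext y
    have : A y = A x ∘L (K ∘L A y) := by
      rw [← ContinuousLinearMap.comp_assoc, hK', ContinuousLinearMap.id_comp]
    conv_lhs => rw [this]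
    simp only [ContinuousLinearMap.det, ContinuousLinearMap.toLinearMap_comp, LinearMap.det_comp]
  rw [h1]
  have h2 : HasFDerivAt (fun y => K ∘L A y) ((ContinuousLinearMap.compL ℝ E E E K) ∘L A') x :=
    (ContinuousLinearMap.compL ℝ E E E K).hasFDerivAt.comp x hA
  have h3 : HasFDerivAt (fun f : E →L[ℝ] E => f.det) trL (K ∘L A x) := by
    rw [hK]; exact hasFDerivAt_det_id
  exact (h3.comp x h2).const_mul _

end CoordinateCalculus

end ProjectiveAmbient

namespace ProjectiveAmbient

open Filter Topology

/-! ### Bilinear fields and the Ricci curvature of the cone symbols -/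

section Composition

variable {E F Y : Type*} [NormedAddCommGroup E] [NormedSpace ℝ E] [NormedAddCommGroup F]
  [NormedSpace ℝ F] [NormedAddCommGroup Y] [NormedSpace ℝ Y]

lemma contDiff_smulRight_const {k : ℕ∞ω} (φ : E →L[ℝ] ℝ) :
    ContDiff ℝ k (fun y : Y => φ.smulRight y) :=
  (ContinuousLinearMap.smulRightL ℝ E Y φ).contDiff

lemma hasFDerivAt_comp_fst {P : E → Y} {p : E × F} (h : DifferentiableAt ℝ P p.1) :
    HasFDerivAt (fun q : E × F => P q.1) (fderiv ℝ P p.1 ∘L ContinuousLinearMap.fst ℝ E F) p :=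
  HasFDerivAt.comp p h.hasFDerivAt hasFDerivAt_fst

end Composition

section BilinearFields

variable {E : Type*} [NormedAddCommGroup E] [NormedSpace ℝ E] [FiniteDimensional ℝ E]
  {F : Type*} [NormedAddCommGroup F] [NormedSpace ℝ F] [FiniteDimensional ℝ F]
  {F' : Type*} [NormedAddCommGroup F'] [NormedSpace ℝ F']

/-- The bilinear map with the same values as `B` on a basis. -/
def bilinExt (B : E → F → F') : E →L[ℝ] F →L[ℝ] F' :=
  ∑ i, ∑ j, (LinearMap.toContinuousLinearMap ((Module.finBasis ℝ E).coord i)).smulRight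
    ((LinearMap.toContinuousLinearMap ((Module.finBasis ℝ F).coord j)).smulRight
      (B (Module.finBasis ℝ E i) (Module.finBasis ℝ F j)))

/-- Christoffel symbols come as plain functions that are bilinear only over the chart domain.
Extension from a basis turns them into continuous bilinear maps at every point, whose smoothness is
that of finitely many components, without loss where bilinearity holds. -/
lemma bilinExt_apply {B : E → F → F'} (hl : ∀ w, IsLinearMap ℝ (fun v => B v w))
    (hr : ∀ v, IsLinearMap ℝ (B v)) (v : E) (w : F) : bilinExt B v w = B v w := by
  have h1 : B v w = (hl w).mk' _ v := rfl
  rw [h1]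
  conv_rhs => rw [← (Module.finBasis ℝ E).sum_repr v]
  rw [map_sum]
  simp only [bilinExt, sum_apply, map_smul]
  refine Finset.sum_congr rfl fun i _ => ?_
  have h2 : (hl w).mk' _ (Module.finBasis ℝ E i) = (hr (Module.finBasis ℝ E i)).mk' _ w := rfl
  rw [h2]
  conv_rhs => rw [← (Module.finBasis ℝ F).sum_repr w]
  rw [map_sum, Finset.smul_sum]
  refine Finset.sum_congr rfl fun j _ => ?_
  simp

lemma ContDiffWithinAt.bilinExt {X : Type*} [NormedAddCommGroup X] [NormedSpace ℝ X]
    {B : X → E → F → F'} {k : ℕ∞ω} {s : Set X} {x : X}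
    (h : ∀ v w, ContDiffWithinAt ℝ k (fun y => B y v w) s x) :
    ContDiffWithinAt ℝ k (fun y => bilinExt (B y)) s x := by
  unfold ProjectiveAmbient.bilinExt
  refine ContDiffWithinAt.sum fun i _ => ContDiffWithinAt.sum fun j _ => ?_
  exact (contDiff_smulRight_const _).contDiffAt.comp_contDiffWithinAt x
    ((contDiff_smulRight_const _).contDiffAt.comp_contDiffWithinAt x (h _ _))

/-- Cut `f` into its restrictions to the two factors and use the cyclicity of the trace on each
piece. -/
lemma trL_prod (f : (E × F) →L[ℝ] (E × F)) :
    trL f = trL (ContinuousLinearMap.fst ℝ E F ∘L f ∘L ContinuousLinearMap.inl ℝ E F)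
      + trL (ContinuousLinearMap.snd ℝ E F ∘L f ∘L ContinuousLinearMap.inr ℝ E F) := by
  have h : f = (f ∘L ContinuousLinearMap.inl ℝ E F) ∘L ContinuousLinearMap.fst ℝ E F
      + (f ∘L ContinuousLinearMap.inr ℝ E F) ∘L ContinuousLinearMap.snd ℝ E F := by
    refine ContinuousLinearMap.ext fun u => ?_
    simp [← map_add]
  conv_lhs => rw [h]
  rw [map_add, trL_comp_comm, trL_comp_comm _ (ContinuousLinearMap.snd ℝ E F)]

/-- The map on the left is `μ ↦ μ ∘ T`, the transpose of `T`. It is the fibre block of the curvature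
on a cotangent bundle. -/
lemma trL_dual (T : E →L[ℝ] E) :
    trL ((ContinuousLinearMap.compL ℝ E E ℝ).flip T) = trL T := by
  let e : (E →ₗ[ℝ] ℝ) ≃ₗ[ℝ] (E →L[ℝ] ℝ) := LinearMap.toContinuousLinearMap
  rw [trL_apply, trL_apply, ← LinearMap.trace_transpose' (T : E →ₗ[ℝ] E),
    ← LinearMap.trace_conj' (Module.Dual.transpose (T : E →ₗ[ℝ] E)) e]
  rfl

/-- Near `z` the field `Γ` is bilinear and its components are of class `C^k` at `z`. -/
structure IsBilinField (Γ : E → E → E → E) (k : ℕ∞ω) (z : E) : Prop where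
  left : ∀ᶠ y in 𝓝 z, ∀ w, IsLinearMap ℝ (fun v => Γ y v w)
  right : ∀ᶠ y in 𝓝 z, ∀ v, IsLinearMap ℝ (Γ y v)
  contDiff : ∀ v w, ContDiffAt ℝ k (fun y => Γ y v w) z

lemma IsBilinField.eventuallyEq {Γ : E → E → E → E} {k : ℕ∞ω} {z : E} (h : IsBilinField Γ k z) :
    ∀ᶠ y in 𝓝 z, Γ y = uncurried (fun y => bilinExt (Γ y)) y := by
  filter_upwards [h.left, h.right] with y hl hr
  funext v w
  exact (bilinExt_apply hl hr v w).symm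

lemma IsBilinField.contDiffAt {Γ : E → E → E → E} {k : ℕ∞ω} {z : E} (h : IsBilinField Γ k z) :
    ContDiffAt ℝ k (fun y => bilinExt (Γ y)) z :=
  ContDiffWithinAt.bilinExt fun v w => h.contDiff v w

end BilinearFields

section Ricci

variable {E : Type*} [NormedAddCommGroup E] [NormedSpace ℝ E] [FiniteDimensional ℝ E]
  {F : Type*} [NormedAddCommGroup F] [NormedSpace ℝ F] [FiniteDimensional ℝ F]

/-- A trace only involves the diagonal blocks, so the mixed components of the curvature of the cone
or of a cotangent bundle never have to be computed. -/
lemma coordRicci_prod {Γ : E × F → E × F → E × F → E × F} {p : E × F} (h : IsBilinField Γ 1 p)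
    (V W : E × F) (f : E →L[ℝ] E) (g : F →L[ℝ] F)
    (hf : ∀ u, (coordCurvature Γ p (u, 0) V W).1 = f u)
    (hg : ∀ u, (coordCurvature Γ p (0, u) V W).2 = g u) :
    coordRicci Γ p V W = trL f + trL g := by
  have hd : DifferentiableAt ℝ (fun y => bilinExt (Γ y)) p :=
    h.contDiffAt.differentiableAt (by simp)
  have hc : ∀ U, coordCurvature Γ p U V W = curvatureEnd (fun y => bilinExt (Γ y)) p V W U := by
    intro U
    rw [coordCurvature_congr h.eventuallyEq, coordCurvature_uncurried hd]
    rfl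
  rw [coordRicci_eq_trL _ hc, trL_prod]
  congr 2
  · ext u
    rw [← hf, hc]
    rfl
  · ext u
    rw [← hg, hc]
    rfl

/-- Projective change of the Ricci curvature, for the projectively equivalent connection with
Christoffel symbols `Γ(v, w) - β(v) w - β(w) v`. -/
lemma coordRicci_projective {G : E → E →L[ℝ] E →L[ℝ] E} {β : E → E →L[ℝ] ℝ} {z : E}
    (hG : DifferentiableAt ℝ G z) (hs : ∀ v w, G z v w = G z w v) (hβ : DifferentiableAt ℝ β z)
    (hβs : ∀ v w, fderiv ℝ β z v w = fderiv ℝ β z w v) (v w : E) :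
    coordRicci (fun y v w => G y v w - β y v • w - β y w • v) z v w =
      coordRicci (uncurried G) z v w + (Module.finrank ℝ E - 1 : ℝ) *
        (fderiv ℝ β z v w - β z (G z v w) + β z v * β z w) := by
  have hfd : ∀ v w u, fderiv ℝ (fun y => G y v w - β y v • w - β y w • v) z u =
      fderiv ℝ G z u v w - fderiv ℝ β z u v • w - fderiv ℝ β z u w • v := by
    intro v w u
    have h1 : HasFDerivAt (fun y => G y v w - β y v • w - β y w • v) _ z :=
      (((hG.hasFDerivAt.clm_apply (hasFDerivAt_const v z)).clm_apply (hasFDerivAt_const w z)).sub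
        ((hβ.hasFDerivAt.clm_apply (hasFDerivAt_const v z)).smul_const w)).sub
        ((hβ.hasFDerivAt.clm_apply (hasFDerivAt_const w z)).smul_const v)
    rw [h1.fderiv]
    simp
  -- `B(u) = (∇_u β)(w) + β(u) β(w)`. The curvature changes by `u ↦ B(v) u - B(u) v`, of trace `(n -
  -- 1) B(v)`; the multiples of `w` drop out because `dβ` and `G` are symmetric.
  let B : E →L[ℝ] ℝ := (fderiv ℝ β z).flip w - (β z) ∘L (G z).flip w + (β z w) • β z
  have hB : ∀ u, B u = fderiv ℝ β z u w - β z (G z u w) + β z u * β z w := by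
    intro u
    simp [B, mul_comm]
  rw [coordRicci_eq_trL (curvatureEnd G z v w + (B v) • ContinuousLinearMap.id ℝ E
      - B.smulRight v), coordRicci_eq_trL (curvatureEnd G z v w) fun u => by
    rw [coordCurvature_uncurried hG]; rfl]
  · rw [map_sub, map_add, map_smul, trL_id, trL_smulRight, smul_eq_mul, hB]
    ring
  · intro u
    have hc : curvatureEnd G z v w u = fderiv ℝ G z u v w - fderiv ℝ G z v u w
        + G z u (G z v w) - G z v (G z u w) := rfl
    simp only [coordCurvature, hfd, add_apply, sub_apply, smul_apply,
      ContinuousLinearMap.smulRight_apply, ContinuousLinearMap.id_apply, hB, hc]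
    simp only [map_sub, map_smul, smul_eq_mul, hβs u v, hs u v]
    module

/-- The Christoffel symbols of the Thomas cone connection in a chart, with components along the
base and along the fibre. -/
def coneChristoffel (K : E → E → E → E) (Q : E → E → E → ℝ) (p V W : E × ℝ) : E × ℝ :=
  (K p.1 V.1 W.1 + (V.2 / p.2) • W.1 + (W.2 / p.2) • V.1, -p.2 * Q p.1 V.1 W.1)

lemma hasFDerivAt_coneChristoffel {P : E → E →L[ℝ] E →L[ℝ] E} {Q : E → E →L[ℝ] E →L[ℝ] ℝ}
    {p : E × ℝ} (hp : p.2 ≠ 0) (hP : DifferentiableAt ℝ P p.1) (hQ : DifferentiableAt ℝ Q p.1)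
    (V W : E × ℝ) :
    ∃ L : (E × ℝ) →L[ℝ] (E × ℝ),
      HasFDerivAt (fun q => coneChristoffel (uncurried P) (fun z v w => Q z v w) q V W) L p ∧
      ∀ U, L U = (fderiv ℝ P p.1 U.1 V.1 W.1
          - (U.2 / p.2 ^ 2) • (V.2 • W.1 + W.2 • V.1),
        -U.2 * Q p.1 V.1 W.1 - p.2 * fderiv ℝ Q p.1 U.1 V.1 W.1) := by
  have hP1 : HasFDerivAt (fun q : E × ℝ => P q.1) (fderiv ℝ P p.1 ∘L
    ContinuousLinearMap.fst ℝ E ℝ) p := hasFDerivAt_comp_fst (P := P) hP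
  have hQ1 : HasFDerivAt (fun q : E × ℝ => Q q.1) (fderiv ℝ Q p.1 ∘L
    ContinuousLinearMap.fst ℝ E ℝ) p := hasFDerivAt_comp_fst (P := Q) hQ
  have hi : HasFDerivAt (fun q : E × ℝ => (q.2)⁻¹)
      ((-(p.2 ^ 2)⁻¹) • ContinuousLinearMap.snd ℝ E ℝ) p :=
    (hasDerivAt_inv hp).comp_hasFDerivAt p hasFDerivAt_snd
  have h : HasFDerivAt (fun q : E × ℝ => coneChristoffel (uncurried P) (fun z v w => Q z v w) q V W)
      _ p := ((((hP1.clm_apply (hasFDerivAt_const V.1 p)).clm_apply (hasFDerivAt_const W.1 p)).add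
      ((hi.const_mul V.2).smul_const W.1)).add ((hi.const_mul W.2).smul_const V.1)).prodMk
      ((hasFDerivAt_snd (p := p)).neg.mul ((hQ1.clm_apply (hasFDerivAt_const V.1 p)).clm_apply
        (hasFDerivAt_const W.1 p)))
  refine ⟨_, h, fun U => ?_⟩
  ext
  · simp
    module
  · simp
    ring

lemma isLinearMap_coneChristoffel_left {P : E → E →L[ℝ] E →L[ℝ] E} {Q : E → E →L[ℝ] E →L[ℝ] ℝ}
    (p W : E × ℝ) :
    IsLinearMap ℝ fun V => coneChristoffel (uncurried P) (fun z v w => Q z v w) p V W := by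
  refine ⟨fun a b => ?_, fun c a => ?_⟩
  · ext
    · simp only [coneChristoffel, uncurried, Prod.fst_add, Prod.snd_add, map_add, add_apply, add_div]
      module
    · simp only [coneChristoffel, uncurried, Prod.fst_add, Prod.snd_add, map_add, add_apply]
      ring
  · ext
    · simp only [coneChristoffel, uncurried, Prod.smul_fst, Prod.smul_snd, map_smul, smul_apply,
        smul_eq_mul, mul_div_assoc]
      module
    · simp only [coneChristoffel, uncurried, Prod.smul_fst, Prod.smul_snd, map_smul, smul_apply,
        smul_eq_mul]
      ring

lemma isLinearMap_coneChristoffel_right {P : E → E →L[ℝ] E →L[ℝ] E} {Q : E → E →L[ℝ] E →L[ℝ] ℝ}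
    (p V : E × ℝ) :
    IsLinearMap ℝ (coneChristoffel (uncurried P) (fun z v w => Q z v w) p V) := by
  refine ⟨fun a b => ?_, fun c a => ?_⟩
  · ext
    · simp only [coneChristoffel, uncurried, Prod.fst_add, Prod.snd_add, map_add, add_div]
      module
    · simp only [coneChristoffel, uncurried, Prod.fst_add, Prod.snd_add, map_add]
      ring
  · ext
    · simp only [coneChristoffel, uncurried, Prod.smul_fst, Prod.smul_snd, map_smul, smul_eq_mul,
        mul_div_assoc]
      module
    · simp only [coneChristoffel, uncurried, Prod.smul_fst, Prod.smul_snd, map_smul, smul_eq_mul]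
      ring

lemma contDiffAt_coneChristoffel {P : E → E →L[ℝ] E →L[ℝ] E} {Q : E → E →L[ℝ] E →L[ℝ] ℝ}
    {p : E × ℝ} {k : ℕ∞ω} (hp : p.2 ≠ 0) (hP : ContDiffAt ℝ k P p.1) (hQ : ContDiffAt ℝ k Q p.1)
    (V W : E × ℝ) :
    ContDiffAt ℝ k (fun q => coneChristoffel (uncurried P) (fun z v w => Q z v w) q V W) p := by
  have hP1 : ContDiffAt ℝ k (fun q : E × ℝ => P q.1) p := hP.comp p contDiffAt_fst
  have hQ1 : ContDiffAt ℝ k (fun q : E × ℝ => Q q.1) p := hQ.comp p contDiffAt_fst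
  exact ((((hP1.clm_apply contDiffAt_const).clm_apply contDiffAt_const).add
    ((contDiffAt_const.div contDiffAt_snd hp).smul contDiffAt_const)).add
    ((contDiffAt_const.div contDiffAt_snd hp).smul contDiffAt_const)).prodMk
    (contDiffAt_snd.neg.mul ((hQ1.clm_apply contDiffAt_const).clm_apply contDiffAt_const))

/-- The Thomas cone connection is Ricci-flat. -/
lemma coordRicci_coneChristoffel {P : E → E →L[ℝ] E →L[ℝ] E} {Q : E → E →L[ℝ] E →L[ℝ] ℝ}
    {p : E × ℝ} (hp : p.2 ≠ 0) (hP : ContDiffAt ℝ 1 P p.1) (hQ : ContDiffAt ℝ 1 Q p.1)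
    (hs : ∀ v w, P p.1 v w = P p.1 w v) (ht : ∀ v, trL (P p.1 v) = 0)
    (hQP : ∀ v w, (Module.finrank ℝ E - 1 : ℝ) * Q p.1 v w = coordRicci (uncurried P) p.1 v w)
    (V W : E × ℝ) :
    coordRicci (coneChristoffel (uncurried P) (fun z v w => Q z v w)) p V W = 0 := by
  have hPd : DifferentiableAt ℝ P p.1 := hP.differentiableAt (by simp)
  have hQd : DifferentiableAt ℝ Q p.1 := hQ.differentiableAt (by simp)
  have hbil : IsBilinField (coneChristoffel (uncurried P) (fun z v w => Q z v w)) 1 p := by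
    refine ⟨Eventually.of_forall fun q => isLinearMap_coneChristoffel_left q,
      Eventually.of_forall fun q => isLinearMap_coneChristoffel_right q, fun V W => ?_⟩
    exact contDiffAt_coneChristoffel hp hP hQ V W
  have hfd : ∀ V W U : E × ℝ,
      fderiv ℝ (fun q => coneChristoffel (uncurried P) (fun z v w => Q z v w) q V W) p U =
      (fderiv ℝ P p.1 U.1 V.1 W.1 - (U.2 / p.2 ^ 2) • (V.2 • W.1 + W.2 • V.1),
        -U.2 * Q p.1 V.1 W.1 - p.2 * fderiv ℝ Q p.1 U.1 V.1 W.1) := by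
    intro V W U
    obtain ⟨L, hL, hL'⟩ := hasFDerivAt_coneChristoffel hp hPd hQd V W
    rw [hL.fderiv, hL']
  have hsf : (P p.1).flip = P p.1 := by
    ext v w
    exact hs w v
  obtain ⟨v, a⟩ := V
  obtain ⟨w, b⟩ := W
  -- In the base block, the terms with `a/y` and `b/y` cancel in pairs and the rest has trace
  -- `Ric(v, w) - n Q(v, w) + Q(v, w)`, which is zero by the normalization of `Q`. The fibre block
  -- vanishes.
  rw [coordRicci_prod hbil (v, a) (w, b)
    (curvatureEnd P p.1 v w + (a / p.2) • P p.1 w + (b / p.2) • P p.1 v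
      - (Q p.1 v w) • ContinuousLinearMap.id ℝ E - (b / p.2) • P p.1 v - (a / p.2) • P p.1 w
      + ((Q p.1).flip w).smulRight v) 0]
  · simp only [map_sub, map_add, map_smul, trL_id, trL_smulRight, smul_eq_mul, ht, map_zero,
      ContinuousLinearMap.flip_apply]
    rw [← coordRicci_eq_trL (Γ := uncurried P) (curvatureEnd P p.1 v w) fun u => by
      rw [coordCurvature_uncurried hPd]; rfl, ← hQP]
    ring
  · intro u
    have hc : curvatureEnd P p.1 v w u = fderiv ℝ P p.1 u v w - fderiv ℝ P p.1 v u w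
        + P p.1 u (P p.1 v w) - P p.1 v (P p.1 u w) := rfl
    simp only [coordCurvature, hfd, add_apply, sub_apply, smul_apply,
      ContinuousLinearMap.smulRight_apply, ContinuousLinearMap.id_apply, hc,
      ContinuousLinearMap.flip_apply]
    simp only [coneChristoffel, uncurried, Prod.fst_add, Prod.fst_sub, map_add, map_smul]
    simp only [smul_add, smul_smul, zero_div, zero_mul, zero_smul, add_zero]
    have e1 : -p.2 * Q p.1 v w / p.2 = - Q p.1 v w := by field_simp
    have e2 : -p.2 * Q p.1 u w / p.2 = - Q p.1 u w := by field_simp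
    rw [e1, e2, hs u w, hs u v]
    module
  · intro u
    -- The derivative of the factor `-y` contributes `-u Q(v, w)`. It is compensated by the base
    -- part `(u/y) w` of the symbol of `(0, u)` and `W`, to which the symbol of `V` is applied.
    have z1 : Q p.1 0 = 0 := map_zero _
    have z2 : fderiv ℝ Q p.1 0 = 0 := map_zero _
    have z3 : fderiv ℝ Q p.1 v 0 = 0 := map_zero _
    have z4 : P p.1 0 = 0 := map_zero _
    have z5 : Q p.1 v ((u / p.2) • w) = (u / p.2) * Q p.1 v w := map_smul _ _ _
    simp only [coordCurvature, hfd]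
    simp only [coneChristoffel, uncurried, Prod.snd_add, Prod.snd_sub, z1, z2, z3, z4, zero_apply,
      smul_zero, add_zero, zero_add, mul_zero, sub_zero, z5]
    field_simp
    ring

end Ricci

end ProjectiveAmbient

namespace ProjectiveAmbient

open Filter Topology

/-! ### The Levi-Civita connection and the Ricci curvature of a Patterson-Walker metric -/

section Composition

variable {X Y Z W V : Type*} [NormedAddCommGroup X] [NormedSpace ℝ X] [NormedAddCommGroup Y]
  [NormedSpace ℝ Y] [NormedAddCommGroup Z] [NormedSpace ℝ Z] [NormedAddCommGroup W]
  [NormedSpace ℝ W] [NormedAddCommGroup V] [NormedSpace ℝ V]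

lemma ContDiffAt.clm_apply₂ {F : W → X →L[ℝ] Y →L[ℝ] Z} {k : ℕ∞ω} {z : W}
    (h : ContDiffAt ℝ k F z) (x : X) (y : Y) : ContDiffAt ℝ k (fun q => F q x y) z :=
  (h.clm_apply contDiffAt_const).clm_apply contDiffAt_const

lemma ContDiffAt.flip_flip {F : W → X →L[ℝ] Y →L[ℝ] Z →L[ℝ] V} {k : ℕ∞ω} {z : W}
    (h : ContDiffAt ℝ k F z) (y : Y) (x : Z) :
    ContDiffAt ℝ k (fun q => ((F q).flip y).flip x) z := by
  let ev : (Y →L[ℝ] Z →L[ℝ] V) →L[ℝ] V :=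
    (ContinuousLinearMap.apply ℝ V x) ∘L (ContinuousLinearMap.apply ℝ (Z →L[ℝ] V) y)
  have h1 : ContDiffAt ℝ k (fun q => ev ∘L F q) z := contDiffAt_const.clm_comp h
  exact h1

lemma hasFDerivAt_snd_comp {T : W → X →L[ℝ] Y} {p : W × (Y →L[ℝ] Z)}
    (hT : DifferentiableAt ℝ T p.1) :
    ∃ L : (W × (Y →L[ℝ] Z)) →L[ℝ] (X →L[ℝ] Z),
      HasFDerivAt (fun q : W × (Y →L[ℝ] Z) => q.2 ∘L T q.1) L p ∧ ∀ μ, L (0, μ) = μ ∘L T p.1 := by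
  have h1 : HasFDerivAt (fun q : W × (Y →L[ℝ] Z) => T q.1) _ p := hasFDerivAt_comp_fst (P := T) hT
  refine ⟨_, hasFDerivAt_snd.clm_comp h1, fun μ => ?_⟩
  ext x
  simp

lemma hasFDerivAt_const_comp {T : W → X →L[ℝ] Y} {p : W × V} (ν : Y →L[ℝ] Z)
    (hT : DifferentiableAt ℝ T p.1) :
    HasFDerivAt (fun q : W × V => ν ∘L T q.1) ((ContinuousLinearMap.compL ℝ X Y Z ν) ∘L
      (fderiv ℝ T p.1) ∘L ContinuousLinearMap.fst ℝ W V) p :=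
  (ContinuousLinearMap.compL ℝ X Y Z ν).hasFDerivAt.comp p (hasFDerivAt_comp_fst (P := T) hT)

end Composition

section LeviCivita

variable {E : Type*} [NormedAddCommGroup E] [NormedSpace ℝ E] [FiniteDimensional ℝ E]

/-- The components of the Patterson-Walker metric in canonical coordinates. -/
def coordPattersonWalker (G : E → E →L[ℝ] E →L[ℝ] E) (p V W : E × (E →L[ℝ] ℝ)) : ℝ :=
  W.2 V.1 + V.2 W.1 - 2 * p.2 (G p.1 V.1 W.1)

/-- The endomorphism that the momentum is composed with in the fibre component of the Levi-Civita
connection of the Patterson-Walker metric. -/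
def fibreEnd (G : E → E →L[ℝ] E →L[ℝ] E) (v w z : E) : E →L[ℝ] E :=
  (2 : ℝ) • G z (G z v w) - (fderiv ℝ G z v w + fderiv ℝ G z w v
    - ((fderiv ℝ G z).flip v).flip w)

lemma fibreEnd_apply (G : E → E →L[ℝ] E →L[ℝ] E) (v w z u : E) : fibreEnd G v w z u =
    (2 : ℝ) • G z (G z v w) u - (fderiv ℝ G z v w u + fderiv ℝ G z w v u
      - fderiv ℝ G z u v w) := rfl

lemma ContDiffAt.fibreEnd {G : E → E →L[ℝ] E →L[ℝ] E} {z : E} (hG : ContDiffAt ℝ 2 G z) (v w : E) :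
    ContDiffAt ℝ 1 (fibreEnd G v w) z := by
  have h0 : ContDiffAt ℝ 1 G z := hG.of_le (by norm_num)
  have h1 : ContDiffAt ℝ 1 (fderiv ℝ G) z := hG.fderiv_right (m := 1) (by norm_num)
  have h2 : ContDiffAt ℝ 1 (fun y => G y (G y v w)) z :=
    ContDiffAt.clm_apply h0 (ContDiffAt.clm_apply₂ h0 v w)
  exact (h2.const_smul (2 : ℝ)).sub (((ContDiffAt.clm_apply₂ h1 v w).add
    (ContDiffAt.clm_apply₂ h1 w v)).sub (ContDiffAt.flip_flip h1 v w))

/-- The fibre component of the Levi-Civita connection of the Patterson-Walker metric. -/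
def pattersonWalkerFibre (G : E → E →L[ℝ] E →L[ℝ] E) (p V W : E × (E →L[ℝ] ℝ)) : E →L[ℝ] ℝ :=
  p.2 ∘L fibreEnd G V.1 W.1 p.1 - V.2 ∘L G p.1 W.1 - W.2 ∘L G p.1 V.1

lemma pattersonWalkerFibre_apply (G : E → E →L[ℝ] E →L[ℝ] E) (p V W : E × (E →L[ℝ] ℝ)) (u : E) :
    pattersonWalkerFibre G p V W u = 2 * p.2 (G p.1 (G p.1 V.1 W.1) u)
      - (p.2 (fderiv ℝ G p.1 V.1 W.1 u) + p.2 (fderiv ℝ G p.1 W.1 V.1 u)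
        - p.2 (fderiv ℝ G p.1 u V.1 W.1)) - V.2 (G p.1 W.1 u) - W.2 (G p.1 V.1 u) := by
  simp only [pattersonWalkerFibre, sub_apply, ContinuousLinearMap.comp_apply, fibreEnd_apply,
    map_sub, map_add, map_smul, smul_eq_mul]

/-- The Levi-Civita connection of the Patterson-Walker metric. -/
def pattersonWalkerLeviCivita (G : E → E →L[ℝ] E →L[ℝ] E) (p V W : E × (E →L[ℝ] ℝ)) :
    E × (E →L[ℝ] ℝ) :=
  (G p.1 V.1 W.1, pattersonWalkerFibre G p V W)

lemma fderiv_coordPattersonWalker {G : E → E →L[ℝ] E →L[ℝ] E} {p : E × (E →L[ℝ] ℝ)}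
    (hG : DifferentiableAt ℝ G p.1) (V W U : E × (E →L[ℝ] ℝ)) :
    fderiv ℝ (fun q => coordPattersonWalker G q V W) p U =
      -2 * (U.2 (G p.1 V.1 W.1) + p.2 (fderiv ℝ G p.1 U.1 V.1 W.1)) := by
  have h1 : HasFDerivAt (fun q : E × (E →L[ℝ] ℝ) => G q.1) _ p := hasFDerivAt_comp_fst (P := G) hG
  have h2 : HasFDerivAt (fun q => coordPattersonWalker G q V W) _ p :=
    ((hasFDerivAt_snd.clm_apply ((h1.clm_apply (hasFDerivAt_const V.1 p)).clm_apply
      (hasFDerivAt_const W.1 p))).const_mul 2).const_sub (W.2 V.1 + V.2 W.1)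
  rw [h2.fderiv]
  simp
  ring

/-- Nondegeneracy: vertical test vectors detect the base component, and once these agree horizontal
ones detect the fibre component. -/
lemma coordPattersonWalker_inj {G : E → E →L[ℝ] E →L[ℝ] E} {p a b : E × (E →L[ℝ] ℝ)}
    (h : ∀ W, coordPattersonWalker G p a W = coordPattersonWalker G p b W) : a = b := by
  have h1 : a.1 = b.1 := by
    refine Module.forall_dual_apply_eq_zero_iff ℝ (a.1 - b.1) |>.1 (fun f => ?_) |> sub_eq_zero.1
    have := h (0, LinearMap.toContinuousLinearMap f)
    simp only [coordPattersonWalker, map_zero, add_zero, mul_zero, sub_zero] at this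
    have h2 : f a.1 = f b.1 := this
    rw [map_sub, h2, sub_self]
  refine Prod.ext h1 (ContinuousLinearMap.ext fun w => ?_)
  have := h (w, 0)
  simp only [coordPattersonWalker, h1, zero_apply, zero_add] at this
  linarith

/-- The explicit field satisfies the Koszul identity, and nondegeneracy makes the solution unique,
so the arbitrary choice in `coordLeviCivita` has to return it. Its base component is `G` itself: the
Levi-Civita connection projects to the given one. -/
lemma coordLeviCivita_pattersonWalker {G : E → E →L[ℝ] E →L[ℝ] E} {p : E × (E →L[ℝ] ℝ)}
    (hG : DifferentiableAt ℝ G p.1) (hs : ∀ v w, G p.1 v w = G p.1 w v)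
    {M : E × (E →L[ℝ] ℝ) → E × (E →L[ℝ] ℝ) → E × (E →L[ℝ] ℝ) → ℝ}
    (hM : ∀ᶠ q in 𝓝 p, M q = coordPattersonWalker G q) (U V : E × (E →L[ℝ] ℝ)) :
    coordLeviCivita M p U V = pattersonWalkerLeviCivita G p U V := by
  have hfd : ∀ V W U, fderiv ℝ (fun q => M q V W) p U =
      -2 * (U.2 (G p.1 V.1 W.1) + p.2 (fderiv ℝ G p.1 U.1 V.1 W.1)) := by
    intro V W U
    rw [← fderiv_coordPattersonWalker hG]
    congr 1
    exact Filter.EventuallyEq.fderiv_eq (hM.mono fun q hq => by simp only [hq])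
  have hsol : ∀ W, 2 * M p (pattersonWalkerLeviCivita G p U V) W =
      fderiv ℝ (fun y => M y V W) p U + fderiv ℝ (fun y => M y U W) p V
        - fderiv ℝ (fun y => M y U V) p W := by
    intro W
    rw [hfd, hfd, hfd, hM.self_of_nhds]
    simp only [coordPattersonWalker, pattersonWalkerLeviCivita, pattersonWalkerFibre_apply,
      hs V.1 W.1, hs U.1 W.1]
    ring
  have huniq : ∀ a, (∀ W, 2 * M p a W =
      fderiv ℝ (fun y => M y V W) p U + fderiv ℝ (fun y => M y U W) p V
        - fderiv ℝ (fun y => M y U V) p W) → a = pattersonWalkerLeviCivita G p U V := by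
    intro a ha
    refine coordPattersonWalker_inj (G := G) (p := p) fun W => ?_
    have := (ha W).trans (hsol W).symm
    rw [hM.self_of_nhds] at this
    linarith
  exact huniq _ (Classical.epsilon_spec (p := fun a => ∀ W, 2 * M p a W =
      fderiv ℝ (fun y => M y V W) p U + fderiv ℝ (fun y => M y U W) p V
        - fderiv ℝ (fun y => M y U V) p W) ⟨_, hsol⟩)

lemma contDiffAt_pattersonWalkerLeviCivita {G : E → E →L[ℝ] E →L[ℝ] E} {p : E × (E →L[ℝ] ℝ)}
    (hG : ContDiffAt ℝ 2 G p.1) (V W : E × (E →L[ℝ] ℝ)) :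
    ContDiffAt ℝ 1 (fun q => pattersonWalkerLeviCivita G q V W) p := by
  have h0 : ContDiffAt ℝ 1 (fun q : E × (E →L[ℝ] ℝ) => G q.1) p :=
    ContDiffAt.comp (g := G) p (hG.of_le (by norm_num)) contDiffAt_fst
  have hT : ContDiffAt ℝ 1 (fun q : E × (E →L[ℝ] ℝ) => fibreEnd G V.1 W.1 q.1) p :=
    ContDiffAt.comp (g := fibreEnd G V.1 W.1) p (ContDiffAt.fibreEnd hG _ _) contDiffAt_fst
  have hGv : ∀ v, ContDiffAt ℝ 1 (fun q : E × (E →L[ℝ] ℝ) => G q.1 v) p := fun v =>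
    h0.clm_apply contDiffAt_const
  exact (ContDiffAt.clm_apply₂ h0 _ _).prodMk (((contDiffAt_snd.clm_comp hT).sub
    (contDiffAt_const.clm_comp (hGv _))).sub (contDiffAt_const.clm_comp (hGv _)))

lemma isBilinField_pattersonWalkerLeviCivita {G : E → E →L[ℝ] E →L[ℝ] E} {p : E × (E →L[ℝ] ℝ)}
    (hG : ContDiffAt ℝ 2 G p.1) : IsBilinField (pattersonWalkerLeviCivita G) 1 p := by
  refine ⟨Eventually.of_forall fun q w => ⟨fun a b => ?_, fun c a => ?_⟩,
    Eventually.of_forall fun q w => ⟨fun a b => ?_, fun c a => ?_⟩,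
    contDiffAt_pattersonWalkerLeviCivita hG⟩
  all_goals
    refine Prod.ext (by simp [pattersonWalkerLeviCivita]) (ContinuousLinearMap.ext fun u => ?_)
    simp only [pattersonWalkerLeviCivita, pattersonWalkerFibre_apply, Prod.fst_add, Prod.snd_add,
      Prod.smul_fst, Prod.smul_snd, map_add, map_smul, add_apply, smul_apply, smul_eq_mul]
    ring

/-- The fibre component is affine in the momentum, and `fibreEnd` is its linear part. -/
lemma fderiv_pattersonWalkerFibre_vertical {G : E → E →L[ℝ] E →L[ℝ] E} {p : E × (E →L[ℝ] ℝ)}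
    (hG : ContDiffAt ℝ 2 G p.1) (V W : E × (E →L[ℝ] ℝ)) (μ : E →L[ℝ] ℝ) :
    (fderiv ℝ (fun q => pattersonWalkerLeviCivita G q V W) p (0, μ)).2 =
      μ ∘L fibreEnd G V.1 W.1 p.1 := by
  have hd := ((contDiffAt_pattersonWalkerLeviCivita hG V W).differentiableAt (by simp)).hasFDerivAt
  have hG0 : DifferentiableAt ℝ G p.1 := hG.differentiableAt (by simp)
  have hGv : ∀ v, DifferentiableAt ℝ (fun z => G z v) p.1 := fun v =>
    hG0.clm_apply (differentiableAt_const v)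
  obtain ⟨L, hL, hL'⟩ := hasFDerivAt_snd_comp (p := p)
    ((ContDiffAt.fibreEnd hG V.1 W.1).differentiableAt (by simp))
  have h1 : HasFDerivAt (fun q => pattersonWalkerFibre G q V W) _ p :=
    (hL.sub (hasFDerivAt_const_comp V.2 (hGv W.1))).sub (hasFDerivAt_const_comp W.2 (hGv V.1))
  have h2 := congrArg (fun L : (E × (E →L[ℝ] ℝ)) →L[ℝ] (E →L[ℝ] ℝ) => L (0, μ)) (hd.snd.unique h1)
  refine h2.trans ?_
  have z : ∀ T : E →L[ℝ] E →L[ℝ] E, ∀ ν : E →L[ℝ] ℝ, ((ContinuousLinearMap.compL ℝ E E ℝ ν) ∘L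
      T ∘L ContinuousLinearMap.fst ℝ E (E →L[ℝ] ℝ)) (0, μ) = 0 := fun T ν => by
    change ν ∘L T 0 = 0
    rw [map_zero, ContinuousLinearMap.comp_zero]
  rw [sub_apply, sub_apply, hL', z, z, sub_zero, sub_zero]

/-- The Ricci curvature of the Patterson-Walker metric. -/
lemma coordRicci_pattersonWalker {G : E → E →L[ℝ] E →L[ℝ] E} {p : E × (E →L[ℝ] ℝ)}
    (hG : ContDiffAt ℝ 2 G p.1) (hs : ∀ᶠ y in 𝓝 p.1, ∀ v w, G y v w = G y w v)
    {M : E × (E →L[ℝ] ℝ) → E × (E →L[ℝ] ℝ) → E × (E →L[ℝ] ℝ) → ℝ}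
    (hM : ∀ᶠ q in 𝓝 p, M q = coordPattersonWalker G q) (V W : E × (E →L[ℝ] ℝ)) :
    coordRicci (coordLeviCivita M) p V W =
      coordRicci (uncurried G) p.1 V.1 W.1 + coordRicci (uncurried G) p.1 W.1 V.1 := by
  have hGd : ∀ᶠ y in 𝓝 p.1, DifferentiableAt ℝ G y :=
    (hG.eventually (by simp)).mono fun y hy => hy.differentiableAt (by simp)
  have hG0 := hGd.self_of_nhds
  have ev : ∀ᶠ q in 𝓝 p, coordLeviCivita M q = pattersonWalkerLeviCivita G q := by
    have hfst : Tendsto (Prod.fst : E × (E →L[ℝ] ℝ) → E) (𝓝 p) (𝓝 p.1) := continuousAt_fst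
    filter_upwards [hfst.eventually hGd, hfst.eventually hs, hM.eventually_nhds] with q h1 h2 h3
    funext U V
    exact coordLeviCivita_pattersonWalker h1 h2 h3 U V
  rw [coordRicci_congr ev]
  have hb := isBilinField_pattersonWalkerLeviCivita hG
  have hfd1 : ∀ V W U, (fderiv ℝ (fun q => pattersonWalkerLeviCivita G q V W) p U).1 =
      fderiv ℝ G p.1 U.1 V.1 W.1 := by
    intro V W U
    have hd := ((contDiffAt_pattersonWalkerLeviCivita hG V W).differentiableAt (by simp)).hasFDerivAt.fst
    have h1 : HasFDerivAt (fun q : E × (E →L[ℝ] ℝ) => G q.1) _ p :=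
      hasFDerivAt_comp_fst (P := G) hG0
    have h2 : HasFDerivAt (fun q : E × (E →L[ℝ] ℝ) => G q.1 V.1 W.1) _ p :=
      (h1.clm_apply (hasFDerivAt_const V.1 p)).clm_apply (hasFDerivAt_const W.1 p)
    have := congrArg (fun L : (E × (E →L[ℝ] ℝ)) →L[ℝ] E => L U) (hd.unique h2)
    simpa using this
  -- The base block is the curvature of `G`. The fibre block is composition of `μ` with an
  -- endomorphism, hence a transpose, and the trace of that endomorphism is the Ricci curvature with
  -- its arguments exchanged.
  rw [coordRicci_prod hb V W (curvatureEnd G p.1 V.1 W.1)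
    ((ContinuousLinearMap.compL ℝ E E ℝ).flip
      (((fderiv ℝ G p.1).flip W.1).flip V.1 - fderiv ℝ G p.1 W.1 V.1 + G p.1 (G p.1 W.1 V.1)
        - (G p.1 W.1) ∘L (G p.1 V.1)))]
  · rw [← coordRicci_eq_trL (Γ := uncurried G) (curvatureEnd G p.1 V.1 W.1) fun u => by
      rw [coordCurvature_uncurried hG0]; rfl, trL_dual, coordRicci_of_symm hG0 hs W.1 V.1]
    simp only [map_add, map_sub]
  · intro u
    simp only [coordCurvature, Prod.fst_add, Prod.fst_sub, hfd1]
    rfl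
  · intro μ
    -- When one argument is the vertical vector `(0, μ)`, the symbol is the vertical vector `-μ ∘
    -- G(W)`, in which the momentum no longer occurs.
    have hh : (fderiv ℝ (fun q => pattersonWalkerLeviCivita G q (0, μ) W) p V).2 =
        -(μ ∘L fderiv ℝ G p.1 V.1 W.1) := by
      have e : (fun q => pattersonWalkerLeviCivita G q (0, μ) W) =
          fun q => ((0 : E), -(μ ∘L G q.1 W.1)) := by
        funext q
        refine Prod.ext ?_ (ContinuousLinearMap.ext fun u => ?_)
        · exact congrArg (fun L : E →L[ℝ] E => L W.1) (map_zero (G q.1))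
        · have z1 : fderiv ℝ G q.1 0 = 0 := map_zero _
          have z2 : G q.1 0 = 0 := map_zero _
          simp only [pattersonWalkerLeviCivita, pattersonWalkerFibre_apply, z1, z2, zero_apply,
            map_zero, neg_apply, ContinuousLinearMap.comp_apply]
          ring
      have hGv : HasFDerivAt (fun z => G z W.1) ((fderiv ℝ G p.1).flip W.1) p.1 := by
        refine (hG0.hasFDerivAt.clm_apply (hasFDerivAt_const W.1 p.1)).congr_fderiv ?_
        ext u
        simp
      have h2 : HasFDerivAt (fun q : E × (E →L[ℝ] ℝ) => ((0 : E), -(μ ∘L G q.1 W.1))) _ p :=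
        (hasFDerivAt_const (0 : E) p).prodMk (hasFDerivAt_const_comp μ hGv.differentiableAt).neg
      rw [e, h2.fderiv, hGv.fderiv]
      rfl
    simp only [coordCurvature, Prod.snd_add, Prod.snd_sub, fderiv_pattersonWalkerFibre_vertical hG,
      hh]
    ext u
    have hs0 := hs.self_of_nhds
    have hfs : ∀ u v w, fderiv ℝ G p.1 u v w = fderiv ℝ G p.1 u w v := by
      intro u v w
      rw [← fderiv_apply₂ hG0, ← fderiv_apply₂ hG0]
      congr 1
      exact Filter.EventuallyEq.fderiv_eq (hs.mono fun y hy => hy _ _)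
    have z1 : fderiv ℝ G p.1 0 = 0 := map_zero _
    have z2 : G p.1 0 = 0 := map_zero _
    simp only [pattersonWalkerLeviCivita, pattersonWalkerFibre_apply, z1, z2, zero_apply,
      map_zero, ContinuousLinearMap.comp_apply, add_apply, sub_apply, neg_apply, fibreEnd_apply,
      ContinuousLinearMap.compL_apply, ContinuousLinearMap.flip_apply, map_sub, map_add, map_smul,
      smul_eq_mul, hs0 V.1 W.1, hfs u V.1 W.1]
    ring

end LeviCivita

end ProjectiveAmbient

namespace ProjectiveAmbient

open Filter Topology

/-! ### Charts, coordinate vector fields and transition maps -/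

section Charts

variable {E : Type*} [NormedAddCommGroup E] [NormedSpace ℝ E]
  {H : Type*} [TopologicalSpace H] {I : ModelWithCorners ℝ E H}
  {X : Type*} [TopologicalSpace X] [ChartedSpace H X] [IsManifold I ∞ X]
  {F : Type*} [NormedAddCommGroup F] [NormedSpace ℝ F]

variable (I) in
/-- The differential at `x` of the chart at `x₀`. -/
def dChart (x₀ x : X) : TangentSpace I x →L[ℝ] E :=
  (trivializationAt E (TangentSpace I : X → Type _) x₀).continuousLinearMapAt ℝ x

variable (I) in
/-- The inverse of the differential at `x` of the chart at `x₀`. -/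
def dChartInv (x₀ x : X) : E →L[ℝ] TangentSpace I x :=
  (trivializationAt E (TangentSpace I : X → Type _) x₀).symmL ℝ x

lemma dChart_dChartInv {x₀ x : X} (hx : x ∈ (chartAt H x₀).source) (w : E) :
    dChart I x₀ x (dChartInv I x₀ x w) = w :=
  (trivializationAt E (TangentSpace I : X → Type _) x₀).continuousLinearMapAt_symmL hx w

lemma dChartInv_dChart {x₀ x : X} (hx : x ∈ (chartAt H x₀).source) (u : TangentSpace I x) :
    dChartInv I x₀ x (dChart I x₀ x u) = u :=
  (trivializationAt E (TangentSpace I : X → Type _) x₀).symmL_continuousLinearMapAt hx u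

lemma constField_eq {x₀ x : X} (hx : x ∈ (chartAt H x₀).source) (w : E) :
    (constField x₀ w x : TangentSpace I x) = dChartInv I x₀ x w :=
  ((trivializationAt E (TangentSpace I : X → Type _) x₀).symmL_apply (R := ℝ) hx w).symm

lemma trivializationAt_tangent {x₀ x : X} (hx : x ∈ (chartAt H x₀).source) (u : TangentSpace I x) :
    (trivializationAt E (TangentSpace I : X → Type _) x₀ ⟨x, u⟩).2 = dChart I x₀ x u :=
  (congrFun ((trivializationAt E (TangentSpace I : X → Type _) x₀).coe_linearMapAt_of_mem
    (R := ℝ) hx) u).symm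

lemma dChart_constField {x₀ x : X} (hx : x ∈ (chartAt H x₀).source) (w : E) :
    dChart I x₀ x (constField x₀ w x) = w := by
  rw [constField_eq hx, dChart_dChartInv hx]

lemma dChart_eq_mfderiv {x₀ x : X} (hx : x ∈ (chartAt H x₀).source) :
    dChart I x₀ x = mfderiv I 𝓘(ℝ, E) (extChartAt I x₀) x :=
  TangentBundle.continuousLinearMapAt_trivializationAt hx

/-- The tangent space at `x` is `E` by way of the chart at `x`. Definitions that read components in
the chart at the point itself are compared with computations in a fixed chart through this identity.
-/
lemma dChart_self (x : X) (u : TangentSpace I x) : dChart I x x u = u := by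
  rw [dChart_eq_mfderiv (mem_chart_source H x), mfderiv_extChartAt_self]
  rfl

lemma dChartInv_self (x : X) (u : E) : dChartInv I x x u = u := by
  have h : dChart I x x u = u := dChart_self x u
  have h2 : dChartInv I x x (dChart I x x u) = u := dChartInv_dChart (mem_chart_source H x) u
  exact (congrArg (dChartInv I x x) h).symm.trans h2

lemma dChart_inj {x₀ x : X} (hx : x ∈ (chartAt H x₀).source) {u u' : TangentSpace I x}
    (h : dChart I x₀ x u = dChart I x₀ x u') : u = u' := by
  rw [← dChartInv_dChart hx u, h, dChartInv_dChart hx]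

lemma constField_dChart {x₀ x : X} (hx : x ∈ (chartAt H x₀).source) (u : TangentSpace I x) :
    constField x₀ (dChart I x₀ x u) x = u := by
  rw [constField_eq hx, dChartInv_dChart hx]

lemma constField_self (x : X) (u : E) : (constField x u x : TangentSpace I x) = u := by
  rw [constField_eq (mem_chart_source H x), dChartInv_self]

lemma chart_left_inv {x₀ x : X} (hx : x ∈ (chartAt H x₀).source) :
    (extChartAt I x₀).symm (extChartAt I x₀ x) = x :=
  (extChartAt I x₀).left_inv (by rwa [extChartAt_source])

lemma chart_symm_mem {x₀ : X} {z : E} (hz : z ∈ (extChartAt I x₀).target) :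
    (extChartAt I x₀).symm z ∈ (chartAt H x₀).source := by
  rw [← extChartAt_source I]
  exact (extChartAt I x₀).map_target hz

lemma chart_mem_target {x₀ x : X} (hx : x ∈ (chartAt H x₀).source) :
    extChartAt I x₀ x ∈ (extChartAt I x₀).target :=
  (extChartAt I x₀).map_source (by rwa [extChartAt_source])

lemma eventually_mem_source {x₀ x : X} (hx : x ∈ (chartAt H x₀).source) :
    ∀ᶠ y in 𝓝 x, y ∈ (chartAt H x₀).source :=
  (chartAt H x₀).open_source.mem_nhds hx

/-- The components of a vector field in the chart at `x₀`. -/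
def localRep (x₀ : X) (Y : ∀ x : X, TangentSpace I x) (z : E) : E :=
  dChart I x₀ ((extChartAt I x₀).symm z) (Y ((extChartAt I x₀).symm z))

lemma localRep_apply {x₀ x : X} (hx : x ∈ (chartAt H x₀).source)
    (Y : ∀ x : X, TangentSpace I x) :
    localRep x₀ Y (extChartAt I x₀ x) = dChart I x₀ x (Y x) := by
  unfold localRep
  rw [chart_left_inv hx]

variable [I.Boundaryless]

lemma eventually_target {x₀ : X} {z : E} (hz : z ∈ (extChartAt I x₀).target) :
    ∀ᶠ y in 𝓝 z, y ∈ (extChartAt I x₀).target :=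
  (isOpen_extChartAt_target x₀).mem_nhds hz

lemma continuousAt_chart_symm {x₀ : X} {z : E} (hz : z ∈ (extChartAt I x₀).target) :
    ContinuousAt (extChartAt I x₀).symm z :=
  (continuousOn_extChartAt_symm x₀).continuousAt ((isOpen_extChartAt_target x₀).mem_nhds hz)

lemma eventually_chart_symm {x₀ x : X} (hx : x ∈ (chartAt H x₀).source) {p : X → Prop}
    (h : ∀ᶠ y in 𝓝 x, p y) : ∀ᶠ z in 𝓝 (extChartAt I x₀ x), p ((extChartAt I x₀).symm z) := by
  have := continuousAt_chart_symm (I := I) (chart_mem_target hx)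
  rw [ContinuousAt, chart_left_inv hx] at this
  exact this.eventually h

/-- Without boundary the model has full range, so smoothness relative to the range becomes ordinary
smoothness at a point of `E`. -/
lemma contMDiffAt_iff_chart {x₀ x : X} (hx : x ∈ (chartAt H x₀).source) {f : X → F} :
    ContMDiffAt I 𝓘(ℝ, F) ∞ f x ↔
      ContDiffAt ℝ ∞ (f ∘ (extChartAt I x₀).symm) (extChartAt I x₀ x) := by
  rw [contMDiffAt_iff_source_of_mem_source hx, I.range_eq_univ, contMDiffWithinAt_univ,
    contMDiffAt_iff_contDiffAt]

lemma mdifferentiableAt_chart_symm {x₀ : X} {z : E} (hz : z ∈ (extChartAt I x₀).target) :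
    MDifferentiableAt 𝓘(ℝ, E) I (extChartAt I x₀).symm z := by
  have := mdifferentiableWithinAt_extChartAt_symm (I := I) hz
  rwa [I.range_eq_univ, mdifferentiableWithinAt_univ] at this

lemma mdifferentiableAt_iff_chart {x₀ x : X} (hx : x ∈ (chartAt H x₀).source) {f : X → F} :
    MDifferentiableAt I 𝓘(ℝ, F) f x ↔
      DifferentiableAt ℝ (f ∘ (extChartAt I x₀).symm) (extChartAt I x₀ x) := by
  constructor
  · intro h
    rw [← mdifferentiableAt_iff_differentiableAt]
    refine MDifferentiableAt.comp (I' := I) _ ?_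
      (mdifferentiableAt_chart_symm (chart_mem_target hx))
    rwa [chart_left_inv hx]
  · intro h
    have h1 : MDifferentiableAt I 𝓘(ℝ, F) ((f ∘ (extChartAt I x₀).symm) ∘ extChartAt I x₀) x :=
      (mdifferentiableAt_iff_differentiableAt.2 h).comp x (mdifferentiableAt_extChartAt hx)
    refine h1.congr_of_eventuallyEq ?_
    filter_upwards [eventually_mem_source hx] with y hy
    simp only [Function.comp_apply, chart_left_inv hy]

/-- The differential of a function in terms of its coordinate representation. -/
lemma mfderiv_eq_chart {x₀ x : X} (hx : x ∈ (chartAt H x₀).source) {f : X → F}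
    (hf : MDifferentiableAt I 𝓘(ℝ, F) f x) (v : TangentSpace I x) :
    mfderiv I 𝓘(ℝ, F) f x v =
      fderiv ℝ (f ∘ (extChartAt I x₀).symm) (extChartAt I x₀ x) (dChart I x₀ x v) := by
  have h1 : HasMFDerivAt I 𝓘(ℝ, F) ((f ∘ (extChartAt I x₀).symm) ∘ extChartAt I x₀) x
      ((fderiv ℝ (f ∘ (extChartAt I x₀).symm) (extChartAt I x₀ x)).comp
        (mfderiv I 𝓘(ℝ, E) (extChartAt I x₀) x)) :=
    HasMFDerivAt.comp x ((mdifferentiableAt_iff_chart hx).1 hf).hasFDerivAt.hasMFDerivAt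
      (mdifferentiableAt_extChartAt hx).hasMFDerivAt
  have h2 : f =ᶠ[𝓝 x] ((f ∘ (extChartAt I x₀).symm) ∘ extChartAt I x₀) := by
    filter_upwards [eventually_mem_source hx] with y hy
    simp only [Function.comp_apply, chart_left_inv hy]
  rw [(h1.congr_of_eventuallyEq h2).mfderiv, dChart_eq_mfderiv hx]
  rfl

lemma contMDiffAt_field_iff {x₀ x : X} (hx : x ∈ (chartAt H x₀).source)
    {Y : ∀ x : X, TangentSpace I x} :
    ContMDiffAt I I.tangent ∞ (fun x => (⟨x, Y x⟩ : TangentBundle I X)) x ↔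
      ContDiffAt ℝ ∞ (localRep x₀ Y) (extChartAt I x₀ x) := by
  rw [(trivializationAt E (TangentSpace I : X → Type _) x₀).contMDiffAt_section_iff hx,
    contMDiffAt_iff_chart hx]
  have h : ((fun y => (trivializationAt E (TangentSpace I : X → Type _) x₀ ⟨y, Y y⟩).2) ∘
      (extChartAt I x₀).symm) =ᶠ[𝓝 (extChartAt I x₀ x)] localRep x₀ Y := by
    filter_upwards [eventually_chart_symm (I := I) hx (eventually_mem_source hx)] with z hz
    exact trivializationAt_tangent hz _
  exact ⟨fun k => k.congr_of_eventuallyEq h.symm, fun k => k.congr_of_eventuallyEq h⟩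

lemma mdifferentiableAt_field_iff {x₀ x : X} (hx : x ∈ (chartAt H x₀).source)
    {Y : ∀ x : X, TangentSpace I x} :
    MDifferentiableAt I I.tangent (fun x => (⟨x, Y x⟩ : TangentBundle I X)) x ↔
      DifferentiableAt ℝ (localRep x₀ Y) (extChartAt I x₀ x) := by
  rw [(trivializationAt E (TangentSpace I : X → Type _) x₀).mdifferentiableAt_section_iff I _ hx,
    mdifferentiableAt_iff_chart hx]
  refine Filter.EventuallyEq.differentiableAt_iff ?_
  filter_upwards [eventually_chart_symm (I := I) hx (eventually_mem_source hx)] with z hz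
  exact trivializationAt_tangent hz _

lemma localRep_constField (x₀ : X) (w : E) {z : E} (hz : z ∈ (extChartAt I x₀).target) :
    localRep x₀ (constField (I := I) x₀ w) z = w :=
  dChart_constField (chart_symm_mem hz) w

lemma localRep_constField_eventuallyEq {x₀ : X} (w : E) {z : E}
    (hz : z ∈ (extChartAt I x₀).target) :
    localRep x₀ (constField (I := I) x₀ w) =ᶠ[𝓝 z] fun _ => w := by
  filter_upwards [eventually_target hz] with y hy
  exact localRep_constField x₀ w hy

lemma contMDiffAt_constField {x₀ x : X} (hx : x ∈ (chartAt H x₀).source) (w : E) :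
    ContMDiffAt I I.tangent ∞ (fun x => (⟨x, constField x₀ w x⟩ : TangentBundle I X)) x := by
  rw [contMDiffAt_field_iff hx]
  exact contDiffAt_const.congr_of_eventuallyEq
    (localRep_constField_eventuallyEq w (chart_mem_target hx))

lemma mdifferentiableAt_constField {x₀ x : X} (hx : x ∈ (chartAt H x₀).source) (w : E) :
    MDifferentiableAt I I.tangent (fun x => (⟨x, constField x₀ w x⟩ : TangentBundle I X)) x :=
  (contMDiffAt_constField hx w).mdifferentiableAt (by simp)

/-- Every coordinate vector field agrees near a given point with a global smooth field. -/
lemma exists_isSmoothField_eventuallyEq [FiniteDimensional ℝ E] [T2Space X] {x₀ x : X}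
    (hx : x ∈ (chartAt H x₀).source) (w : E) :
    ∃ Y : ∀ x : X, TangentSpace I x, IsSmoothField Y ∧ ∀ᶠ y in 𝓝 x, Y y = constField x₀ w y := by
  -- A bump function supported in the chart domain and equal to one near `x`. Projective equivalence
  -- and smoothness of connections speak of global smooth fields only, so coordinate fields have to
  -- be cut off.
  obtain ⟨f, -, hf⟩ := ((SmoothBumpFunction.nhds_basis_tsupport (I := I) x).mem_iff).1
    ((chartAt H x₀).open_source.mem_nhds hx)
  refine ⟨(f : X → ℝ) • constField x₀ w, ?_, ?_⟩
  · exact ContMDiffOn.smul_section_of_tsupport (f.contMDiff.contMDiffOn) (chartAt H x₀).open_source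
      hf (fun y hy => (contMDiffAt_constField hy w).contMDiffWithinAt)
  · filter_upwards [f.eventuallyEq_one] with y hy
    simp [hy]

/-- The transition map between two charts. -/
abbrev transition (I : ModelWithCorners ℝ E H) (x₁ x₀ : X) : E → E :=
  extChartAt I x₀ ∘ (extChartAt I x₁).symm

/-- The Jacobian of the transition map between the charts at `x₁` and at `x₀`. -/
def transitionJ (I : ModelWithCorners ℝ E H) [IsManifold I ∞ X] (x₁ x₀ : X) (z : E) : E →L[ℝ] E :=
  fderiv ℝ (transition I x₁ x₀) z

lemma contDiffAt_transition {x₁ x₀ x : X} (h1 : x ∈ (chartAt H x₁).source)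
    (h0 : x ∈ (chartAt H x₀).source) :
    ContDiffAt ℝ ∞ (transition I x₁ x₀) (extChartAt I x₁ x) :=
  (contMDiffAt_iff_chart h1).1 (contMDiffAt_extChartAt' h0)

lemma contDiffAt_transitionJ {x₁ x₀ x : X} (h1 : x ∈ (chartAt H x₁).source)
    (h0 : x ∈ (chartAt H x₀).source) :
    ContDiffAt ℝ ∞ (transitionJ I x₁ x₀) (extChartAt I x₁ x) :=
  (contDiffAt_transition h1 h0).fderiv_right (by simp)

lemma transitionJ_dChart {x₁ x₀ x : X} (h1 : x ∈ (chartAt H x₁).source)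
    (h0 : x ∈ (chartAt H x₀).source) (u : TangentSpace I x) :
    transitionJ I x₁ x₀ (extChartAt I x₁ x) (dChart I x₁ x u) = dChart I x₀ x u := by
  rw [dChart_eq_mfderiv h0]
  exact (mfderiv_eq_chart h1 (mdifferentiableAt_extChartAt h0) u).symm

lemma transition_apply {x₁ x₀ x : X} (h1 : x ∈ (chartAt H x₁).source) :
    transition I x₁ x₀ (extChartAt I x₁ x) = extChartAt I x₀ x := by
  simp only [transition, Function.comp_apply, chart_left_inv h1]

lemma transitionJ_comp {x₁ x₀ x : X} (h1 : x ∈ (chartAt H x₁).source)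
    (h0 : x ∈ (chartAt H x₀).source) :
    transitionJ I x₀ x₁ (extChartAt I x₀ x) ∘L transitionJ I x₁ x₀ (extChartAt I x₁ x) =
      ContinuousLinearMap.id ℝ E := by
  ext w
  have h := transitionJ_dChart h1 h0 (dChartInv I x₁ x w)
  have h' := transitionJ_dChart h0 h1 (dChartInv I x₁ x w)
  rw [dChart_dChartInv h1] at h h'
  simp only [ContinuousLinearMap.comp_apply, ContinuousLinearMap.id_apply]
  rw [h, h']

/-- The components of the coordinate fields of the chart at `x₁` in the chart at `x₀`. -/
lemma localRep_constField_transition {x₁ x₀ x : X} (h1 : x ∈ (chartAt H x₁).source)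
    (h0 : x ∈ (chartAt H x₀).source) (w : E) :
    localRep x₀ (constField (I := I) x₁ w) (extChartAt I x₀ x) =
      transitionJ I x₁ x₀ (extChartAt I x₁ x) w := by
  rw [localRep_apply h0, ← transitionJ_dChart h1 h0, dChart_constField h1]

end Charts

end ProjectiveAmbient

namespace ProjectiveAmbient

open Filter Topology

/-! ### Covariant derivatives and Christoffel symbols -/

section Connections

variable {E : Type*} [NormedAddCommGroup E] [NormedSpace ℝ E] [FiniteDimensional ℝ E]
  {H : Type*} [TopologicalSpace H] {I : ModelWithCorners ℝ E H} [I.Boundaryless]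
  {X : Type*} [TopologicalSpace X] [ChartedSpace H X] [IsManifold I ∞ X]

/-- Covariant derivatives of vector fields. -/
abbrev AffineDerivative (I : ModelWithCorners ℝ E H) (X : Type*) [TopologicalSpace X]
    [ChartedSpace H X] [IsManifold I ∞ X] : Type _ :=
  CovariantDerivative I E (TangentSpace I : X → Type _)

/-- The Christoffel symbols of a covariant derivative in the chart at `x₀`. -/
def chris (cov : AffineDerivative I X) (x₀ : X) (z v w : E) : E :=
  dChart I x₀ ((extChartAt I x₀).symm z)
    (cov (constField x₀ w) ((extChartAt I x₀).symm z) (constField x₀ v _))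

/-- The Christoffel symbols as a field of bilinear maps. -/
def chrisL (cov : AffineDerivative I X) (x₀ : X) (z : E) : E →L[ℝ] E →L[ℝ] E :=
  bilinExt (chris cov x₀ z)

lemma add_congr_cov (cov : AffineDerivative I X) {Y Y' : ∀ x : X, TangentSpace I x} {x : X}
    (hY : MDifferentiableAt I I.tangent (fun x => (⟨x, Y x⟩ : TangentBundle I X)) x)
    (hY' : MDifferentiableAt I I.tangent (fun x => (⟨x, Y' x⟩ : TangentBundle I X)) x) :
    cov (Y + Y') x = cov Y x + cov Y' x :=
  cov.isCovariantDerivativeOnUniv.add hY hY'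

lemma cov_congr (cov : AffineDerivative I X) {Y Y' : ∀ x : X, TangentSpace I x} {x : X}
    (hY : MDifferentiableAt I I.tangent (fun x => (⟨x, Y x⟩ : TangentBundle I X)) x)
    (h : ∀ᶠ y in 𝓝 x, Y' y = Y y) : cov Y' x = cov Y x := by
  have hY' : MDifferentiableAt I I.tangent (fun x => (⟨x, Y' x⟩ : TangentBundle I X)) x :=
    hY.congr_of_eventuallyEq (h.mono fun y hy => by simp only [hy])
  exact cov.isCovariantDerivativeOnUniv.congr_of_eventuallyEq hY' hY univ_mem h

lemma chris_apply (cov : AffineDerivative I X) {x₀ x : X} (hx : x ∈ (chartAt H x₀).source)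
    (v w : E) : chris cov x₀ (extChartAt I x₀ x) v w =
      dChart I x₀ x (cov (constField x₀ w) x (constField x₀ v x)) := by
  unfold chris
  rw [chart_left_inv hx]

lemma isLinearMap_chris_left (cov : AffineDerivative I X) {x₀ : X} {z : E}
    (hz : z ∈ (extChartAt I x₀).target) (w : E) : IsLinearMap ℝ (fun v => chris cov x₀ z v w) := by
  unfold chris
  simp only [constField_eq (chart_symm_mem hz)]
  exact ⟨fun a b => by simp only [map_add], fun c a => by simp only [map_smul]⟩

lemma constField_add {x₀ : X} (w w' : E) {x : X} (hx : x ∈ (chartAt H x₀).source) :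
    (constField x₀ (w + w') x : TangentSpace I x) = constField x₀ w x + constField x₀ w' x := by
  simp only [constField_eq hx, map_add]

lemma constField_smul {x₀ : X} (c : ℝ) (w : E) {x : X} (hx : x ∈ (chartAt H x₀).source) :
    (constField x₀ (c • w) x : TangentSpace I x) = c • constField x₀ w x := by
  simp only [constField_eq hx, map_smul]

/-- Coordinate fields depend linearly on their components only over the chart domain, so linearity
in the differentiated field rests on the locality of `cov`. -/
lemma isLinearMap_chris_right (cov : AffineDerivative I X) {x₀ : X} {z : E}
    (hz : z ∈ (extChartAt I x₀).target) (v : E) : IsLinearMap ℝ (chris cov x₀ z v) := by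
  have hx := chart_symm_mem hz
  refine ⟨fun a b => ?_, fun c a => ?_⟩
  · have h1 : cov (constField x₀ (a + b)) ((extChartAt I x₀).symm z) =
        cov (constField x₀ a) ((extChartAt I x₀).symm z) +
          cov (constField x₀ b) ((extChartAt I x₀).symm z) := by
      rw [← add_congr_cov cov (mdifferentiableAt_constField hx a) (mdifferentiableAt_constField hx b)]
      refine cov_congr cov (mdifferentiableAt_add_section (mdifferentiableAt_constField hx a)
        (mdifferentiableAt_constField hx b)) ?_
      filter_upwards [eventually_mem_source hx] with y hy
      exact constField_add a b hy
    unfold chris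
    rw [h1, add_apply, map_add]
  · have h1 : cov (constField x₀ (c • a)) ((extChartAt I x₀).symm z) =
        c • cov (constField x₀ a) ((extChartAt I x₀).symm z) := by
      rw [← cov.isCovariantDerivativeOnUniv.smul_const c (mdifferentiableAt_constField hx a)]
      refine cov_congr cov ?_ ?_
      · exact (mdifferentiableAt_const (c := c)).smul_section (mdifferentiableAt_constField hx a)
      · filter_upwards [eventually_mem_source hx] with y hy
        exact constField_smul c a hy
    unfold chris
    rw [h1, smul_apply, map_smul]

lemma chrisL_apply (cov : AffineDerivative I X) {x₀ : X} {z : E}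
    (hz : z ∈ (extChartAt I x₀).target) (v w : E) :
    chrisL cov x₀ z v w = chris cov x₀ z v w :=
  bilinExt_apply (isLinearMap_chris_left cov hz) (isLinearMap_chris_right cov hz) v w

lemma localRep_add {x₀ : X} (Y Y' : ∀ x : X, TangentSpace I x) (z : E) :
    localRep x₀ (Y + Y') z = localRep x₀ Y z + localRep x₀ Y' z :=
  map_add _ _ _

lemma localRep_smul {x₀ : X} (f : X → ℝ) (Y : ∀ x : X, TangentSpace I x) (z : E) :
    localRep x₀ (f • Y) z = f ((extChartAt I x₀).symm z) • localRep x₀ Y z :=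
  map_smul _ _ _

/-- A covariant derivative in coordinates. -/
lemma dChart_cov (cov : AffineDerivative I X) {x₀ x : X} (hx : x ∈ (chartAt H x₀).source)
    {Y : ∀ x : X, TangentSpace I x}
    (hY : MDifferentiableAt I I.tangent (fun x => (⟨x, Y x⟩ : TangentBundle I X)) x)
    (v : TangentSpace I x) :
    dChart I x₀ x (cov Y x v) =
      fderiv ℝ (localRep x₀ Y) (extChartAt I x₀ x) (dChart I x₀ x v) +
        chrisL cov x₀ (extChartAt I x₀ x) (dChart I x₀ x v)
          (localRep x₀ Y (extChartAt I x₀ x)) := by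
  -- The covariant derivative minus the derivative of the components is tensorial in `Y`. It may
  -- thus be evaluated on the coordinate field with the same value at `x`, whose components have
  -- derivative zero.
  let Φ : (∀ x : X, TangentSpace I x) → E := fun Y => dChart I x₀ x (cov Y x v) -
    fderiv ℝ (localRep x₀ Y) (extChartAt I x₀ x) (dChart I x₀ x v)
  have hΦ : TensorialAt I E Φ x := by
    refine ⟨fun {f σ} hf hσ => ?_, fun {σ σ'} hσ hσ' => ?_⟩
    · let d : ℝ := mfderiv I 𝓘(ℝ, ℝ) f x v
      have h1 : cov (f • σ) x v = f x • cov σ x v + d • σ x := by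
        rw [cov.isCovariantDerivativeOnUniv.leibniz hσ hf]
        rfl
      have hd : d = fderiv ℝ (f ∘ (extChartAt I x₀).symm) (extChartAt I x₀ x) (dChart I x₀ x v) :=
        mfderiv_eq_chart hx hf v
      have h2 := ((mdifferentiableAt_iff_chart hx).1 hf).hasFDerivAt.smul
        ((mdifferentiableAt_field_iff hx).1 hσ).hasFDerivAt
      have h3 : localRep x₀ (f • σ) = (f ∘ (extChartAt I x₀).symm) • localRep x₀ σ :=
        funext (localRep_smul f σ)
      simp only [Φ]
      rw [h1, h3, h2.fderiv, map_add, map_smul, map_smul, hd]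
      simp only [add_apply, smul_apply, ContinuousLinearMap.smulRight_apply, Function.comp_apply,
        chart_left_inv hx, localRep_apply hx]
      module
    · have h2 := ((mdifferentiableAt_field_iff hx).1 hσ).hasFDerivAt.add
        ((mdifferentiableAt_field_iff hx).1 hσ').hasFDerivAt
      have h3 : localRep x₀ (σ + σ') = localRep x₀ σ + localRep x₀ σ' :=
        funext (localRep_add σ σ')
      simp only [Φ]
      rw [h3, h2.fderiv, add_congr_cov cov hσ hσ', add_apply, map_add, add_apply]
      abel
  have h := hΦ.pointwise hY (mdifferentiableAt_constField hx (dChart I x₀ x (Y x)))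
    (constField_dChart hx (Y x)).symm
  have h0 : fderiv ℝ (localRep x₀ (constField (I := I) x₀ (dChart I x₀ x (Y x))))
      (extChartAt I x₀ x) = 0 := by
    rw [(localRep_constField_eventuallyEq _ (chart_mem_target hx)).fderiv_eq]
    simp
  simp only [Φ, h0, zero_apply, sub_zero] at h
  rw [chrisL_apply cov (chart_mem_target hx), chris_apply cov hx, constField_dChart hx,
    localRep_apply hx, ← h]
  abel

/-- The smoothness hypothesis concerns fields that are smooth on all of `X`. The coordinate field is
replaced by a global field with the same germ, which has the same covariant derivative nearby. -/
lemma contDiffAt_chris [T2Space X] (cov : AffineDerivative I X)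
    (hc : cov.ContMDiffCovariantDerivative ∞) {x₀ : X} {z : E}
    (hz : z ∈ (extChartAt I x₀).target) (v w : E) :
    ContDiffAt ℝ ∞ (fun z => chris cov x₀ z v w) z := by
  have hx := chart_symm_mem hz
  obtain ⟨Y, hY, hYe⟩ := exists_isSmoothField_eventuallyEq (I := I) hx w
  have h1 : ContMDiffAt I (I.prod 𝓘(ℝ, E →L[ℝ] E)) ∞ (fun x : X =>
      (⟨x, cov Y x⟩ : TotalSpace (E →L[ℝ] E) fun x : X => TangentSpace I x →L[ℝ] TangentSpace I x))
      ((extChartAt I x₀).symm z) :=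
    (hc.contMDiff.contMDiff (σ := Y) (by simpa using hY.contMDiffOn)).contMDiffAt univ_mem
  have h2 := ContMDiffAt.clm_bundle_apply h1 (contMDiffAt_constField (I := I) hx v)
  rw [contMDiffAt_field_iff hx, (extChartAt I x₀).right_inv hz] at h2
  refine h2.congr_of_eventuallyEq ?_
  have h3 := eventually_chart_symm (I := I) hx hYe.eventually_nhds
  rw [(extChartAt I x₀).right_inv hz] at h3
  filter_upwards [h3, eventually_target hz] with y hy hyt
  change dChart I x₀ _ (cov (constField x₀ w) _ _) = dChart I x₀ _ (cov Y _ _)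
  rw [cov_congr cov (mdifferentiableAt_constField (chart_symm_mem hyt) w) hy]

lemma contDiffAt_chrisL [T2Space X] (cov : AffineDerivative I X)
    (hc : cov.ContMDiffCovariantDerivative ∞) {x₀ : X} {z : E}
    (hz : z ∈ (extChartAt I x₀).target) : ContDiffAt ℝ ∞ (chrisL cov x₀) z :=
  ContDiffWithinAt.bilinExt fun v w => contDiffAt_chris cov hc hz v w

/-- A covariant derivative with smooth Christoffel symbols is smooth. -/
lemma contMDiffCovariantDerivative_of_chris (cov : AffineDerivative I X)
    (h : ∀ x₀ : X, ContDiffAt ℝ ∞ (chrisL cov x₀) (extChartAt I x₀ x₀)) :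
    cov.ContMDiffCovariantDerivative ∞ := by
  refine ⟨⟨fun {σ} hσ => ?_⟩⟩
  rw [contMDiffOn_univ] at hσ ⊢
  intro x₀
  rw [contMDiffAt_hom_bundle]
  refine ⟨contMDiffAt_id, ?_⟩
  have hx₀ := mem_chart_source H x₀
  have hσ' : ContDiffAt ℝ ∞ (localRep x₀ σ) (extChartAt I x₀ x₀) :=
    (contMDiffAt_field_iff hx₀).1 (hσ x₀)
  rw [contMDiffAt_iff_chart hx₀]
  have h1 : ContDiffAt ℝ ∞ (fun z => fderiv ℝ (localRep x₀ σ) z +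
      (chrisL cov x₀ z).flip (localRep x₀ σ z)) (extChartAt I x₀ x₀) := by
    refine (hσ'.fderiv_right (by simp)).add ?_
    -- The flipped field is rebuilt from its components, so that its smoothness is again a statement
    -- about finitely many functions.
    have hfl : ContDiffAt ℝ ∞ (fun z => (chrisL cov x₀ z).flip) (extChartAt I x₀ x₀) :=
      ContDiffWithinAt.bilinExt (B := fun z v w => chrisL cov x₀ z w v) (fun v w =>
        ((h x₀).clm_apply contDiffAt_const).clm_apply contDiffAt_const) |>.congr_of_eventuallyEq
        (Eventually.of_forall fun z => by
          ext v w
          rw [bilinExt_apply (fun w => ⟨fun a b => by simp, fun c a => by simp⟩)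
            (fun w => ⟨fun a b => by simp, fun c a => by simp⟩)]
          rfl) (by
          ext v w
          rw [bilinExt_apply (fun w => ⟨fun a b => by simp, fun c a => by simp⟩)
            (fun w => ⟨fun a b => by simp, fun c a => by simp⟩)]
          rfl)
    exact hfl.clm_apply hσ'
  refine h1.congr_of_eventuallyEq ?_
  filter_upwards [eventually_target (chart_mem_target (I := I) hx₀)] with z hz
  have hx := chart_symm_mem hz
  ext v
  have h2 := dChart_cov cov hx
    ((hσ ((extChartAt I x₀).symm z)).mdifferentiableAt (by simp)) (dChartInv I x₀ _ v)
  rw [dChart_dChartInv hx, (extChartAt I x₀).right_inv hz] at h2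
  exact h2

end Connections

end ProjectiveAmbient

namespace ProjectiveAmbient

open Filter Topology

lemma two_le_infty : (2 : ℕ∞ω) ≤ ∞ := by
  change ((2 : ℕ∞) : WithTop ℕ∞) ≤ ((⊤ : ℕ∞) : WithTop ℕ∞)
  exact WithTop.coe_le_coe.2 le_top

/-! ### Transformation law, torsion and the Ricci tensor in charts -/

section Torsion

variable {E : Type*} [NormedAddCommGroup E] [NormedSpace ℝ E] [FiniteDimensional ℝ E]
  {H : Type*} [TopologicalSpace H] {I : ModelWithCorners ℝ E H} [I.Boundaryless]
  {X : Type*} [TopologicalSpace X] [ChartedSpace H X] [IsManifold I ∞ X]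

/-- The transformation law of Christoffel symbols. -/
lemma chrisL_transition (cov : AffineDerivative I X) {x₁ x₀ x : X}
    (h1 : x ∈ (chartAt H x₁).source) (h0 : x ∈ (chartAt H x₀).source) (v w : E) :
    transitionJ I x₁ x₀ (extChartAt I x₁ x) (chrisL cov x₁ (extChartAt I x₁ x) v w) =
      chrisL cov x₀ (extChartAt I x₀ x) (transitionJ I x₁ x₀ (extChartAt I x₁ x) v)
          (transitionJ I x₁ x₀ (extChartAt I x₁ x) w) +
        fderiv ℝ (transitionJ I x₁ x₀) (extChartAt I x₁ x) v w := by
  -- In the chart at `x₀`, the coordinate field `w` of the chart at `x₁` has the components `J w`,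
  -- with `J` evaluated at the `x₁`-coordinates of the point. Its covariant derivative there yields
  -- the symbols at `x₀` plus the derivative of `J w`.
  have h := dChart_cov cov h0 (mdifferentiableAt_constField h1 w) (dChartInv I x₁ x v)
  have hv : dChart I x₀ x (dChartInv I x₁ x v) = transitionJ I x₁ x₀ (extChartAt I x₁ x) v := by
    rw [← transitionJ_dChart h1 h0, dChart_dChartInv h1]
  rw [← transitionJ_dChart h1 h0, hv, localRep_constField_transition h1 h0, ← constField_eq h1,
    ← chris_apply cov h1, ← chrisL_apply cov (chart_mem_target h1)] at h
  rw [h, add_comm]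
  congr 1
  have he : localRep x₀ (constField (I := I) x₁ w) =ᶠ[𝓝 (extChartAt I x₀ x)]
      fun z => transitionJ I x₁ x₀ (transition I x₀ x₁ z) w := by
    filter_upwards [eventually_target (chart_mem_target (I := I) h0),
      eventually_chart_symm h0 (eventually_mem_source h1)] with z hz hz1
    have := localRep_constField_transition (I := I) hz1 (chart_symm_mem hz) w
    rwa [(extChartAt I x₀).right_inv hz] at this
  have hJ : DifferentiableAt ℝ (transitionJ I x₁ x₀) (transition I x₀ x₁ (extChartAt I x₀ x)) := by
    rw [transition_apply h0]
    exact (contDiffAt_transitionJ h1 h0).differentiableAt (by simp)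
  have hT : HasFDerivAt (transition I x₀ x₁) (transitionJ I x₀ x₁ (extChartAt I x₀ x))
      (extChartAt I x₀ x) :=
    ((contDiffAt_transition h0 h1).differentiableAt (by simp)).hasFDerivAt
  have h2 : HasFDerivAt (fun z => transitionJ I x₁ x₀ (transition I x₀ x₁ z)) _
      (extChartAt I x₀ x) := hJ.hasFDerivAt.comp _ hT
  have h3 := (h2.clm_apply (hasFDerivAt_const w _)).fderiv
  have h4 : transitionJ I x₀ x₁ (extChartAt I x₀ x) (transitionJ I x₁ x₀ (extChartAt I x₁ x) v) = v :=
    congrArg (fun L : E →L[ℝ] E => L v) (transitionJ_comp h1 h0)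
  rw [he.fderiv_eq, h3]
  simp only [add_apply, ContinuousLinearMap.comp_apply, ContinuousLinearMap.flip_apply,
    zero_apply, map_zero, zero_add, h4, transition_apply h0]

lemma hasFDerivAt_transition {x₁ x₀ x : X} (h1 : x ∈ (chartAt H x₁).source)
    (h0 : x ∈ (chartAt H x₀).source) :
    HasFDerivAt (transition I x₁ x₀) (transitionJ I x₁ x₀ (extChartAt I x₁ x)) (extChartAt I x₁ x) :=
  ((contDiffAt_transition h1 h0).differentiableAt (by simp)).hasFDerivAt

lemma fderiv_transitionJ_symm {x₁ x₀ x : X} (h1 : x ∈ (chartAt H x₁).source)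
    (h0 : x ∈ (chartAt H x₀).source) (v w : E) :
    fderiv ℝ (transitionJ I x₁ x₀) (extChartAt I x₁ x) v w =
      fderiv ℝ (transitionJ I x₁ x₀) (extChartAt I x₁ x) w v :=
  (contDiffAt_transition (I := I) h1 h0).isSymmSndFDerivAt (by simpa using two_le_infty) v w

/-- The bracket at `x` is defined by pulling back along the inverse of the chart at `x`, whose
differential at `x` is the identity. -/
lemma mlieBracket_eq_chart [CompleteSpace E] (V W : ∀ x : X, TangentSpace I x) (x : X) :
    VectorField.mlieBracket I V W x =
      (VectorField.lieBracket ℝ (localRep x V) (localRep x W) (extChartAt I x x) : E) := by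
  have hloc : ∀ V : (∀ x : X, TangentSpace I x), ∀ᶠ z in 𝓝 (extChartAt I x x),
      VectorField.mpullbackWithin 𝓘(ℝ, E) I (extChartAt I x).symm V (Set.range I) z =
        localRep x V z := by
    intro V
    filter_upwards [eventually_target (chart_mem_target (I := I) (mem_chart_source H x))] with z hz
    rw [VectorField.mpullbackWithin_apply]
    have h1 := mfderivWithin_extChartAt_symm_comp_mfderiv_extChartAt (I := I) hz
    have h2 := mfderiv_extChartAt_comp_mfderivWithin_extChartAt_symm (I := I) hz
    rw [ContinuousLinearMap.inverse_eq h1 h2]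
    unfold localRep
    rw [dChart_eq_mfderiv (chart_symm_mem hz)]
    rfl
  have h0 := mfderiv_extChartAt_self (I := I) (x := x)
  unfold VectorField.mlieBracket
  rw [VectorField.mlieBracketWithin_apply]
  have h3 : (mfderiv I 𝓘(ℝ, E) (extChartAt I x) x).inverse = ContinuousLinearMap.id ℝ E := by
    rw [h0]
    exact ContinuousLinearMap.inverse_id
  refine (congrArg (fun L : E →L[ℝ] E => L _) h3).trans ?_
  have h4 : (extChartAt I x).symm ⁻¹' Set.univ ∩ Set.range I = Set.univ := by
    rw [I.range_eq_univ]; simp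
  have h5 := Filter.EventuallyEq.lieBracket_vectorField_eq (𝕜 := ℝ) (hloc V) (hloc W)
  refine Eq.trans ?_ h5
  rw [h4]
  exact congrFun VectorField.lieBracketWithin_univ _

/-- The derivative terms of `∇_V W - ∇_W V` are the bracket, which leaves the antisymmetric part of
the symbols. Torsion is pointwise, so the centre of each chart is enough. -/
lemma torsion_eq_zero_of_symm [CompleteSpace E] (cov : AffineDerivative I X)
    (h : ∀ (x : X) (v w : E), chrisL cov x (extChartAt I x x) v w =
      chrisL cov x (extChartAt I x x) w v) : cov.torsion = 0 := by
  rw [CovariantDerivative.torsion_eq_zero_iff]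
  intro V W x hV hW
  have hx := mem_chart_source H x
  have h1 := (dChart_self x _).symm.trans (dChart_cov cov hx hW (V x))
  have h2 := (dChart_self x _).symm.trans (dChart_cov cov hx hV (W x))
  rw [mlieBracket_eq_chart]
  refine (congrArg₂ (fun a b : E => a - b) h1 h2).trans ?_
  rw [localRep_apply hx, localRep_apply hx, h x (dChart I x x (W x)), add_sub_add_right_eq_sub,
    VectorField.lieBracket, localRep_apply hx, localRep_apply hx]

/-- At the centre of a chart this is vanishing torsion on coordinate fields, whose brackets vanish.
Symmetry then spreads to any chart, because the inhomogeneous term of the transformation law is a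
second derivative. -/
lemma chrisL_symm [CompleteSpace E] {cov : AffineDerivative I X} (ht : cov.torsion = 0) {x₀ : X}
    {z : E} (hz : z ∈ (extChartAt I x₀).target) (v w : E) :
    chrisL cov x₀ z v w = chrisL cov x₀ z w v := by
  rw [CovariantDerivative.torsion_eq_zero_iff] at ht
  have hself : ∀ (x : X) (v w : E), chrisL cov x (extChartAt I x x) v w =
      chrisL cov x (extChartAt I x x) w v := by
    intro x v w
    have hx := mem_chart_source H x
    have hV := fun v => mdifferentiableAt_constField (I := I) hx v
    have hb := ht (hV v) (hV w)
    have hd : ∀ v, fderiv ℝ (localRep x (constField (I := I) x v)) (extChartAt I x x) = 0 := by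
      intro v
      rw [(localRep_constField_eventuallyEq v (chart_mem_target hx)).fderiv_eq]
      simp
    rw [mlieBracket_eq_chart, VectorField.lieBracket, hd, hd, zero_apply, zero_apply,
      sub_self] at hb
    have := congrArg (dChart I x x) (sub_eq_zero.1 hb)
    rwa [← chris_apply cov hx, ← chris_apply cov hx, ← chrisL_apply cov (chart_mem_target hx),
      ← chrisL_apply cov (chart_mem_target hx)] at this
  obtain ⟨x, hx, rfl⟩ : ∃ x, x ∈ (chartAt H x₀).source ∧ extChartAt I x₀ x = z :=
    ⟨_, chart_symm_mem hz, (extChartAt I x₀).right_inv hz⟩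
  have hxx := mem_chart_source H x
  have h := chrisL_transition cov hx hxx
  have h' : transitionJ I x₀ x (extChartAt I x₀ x) (chrisL cov x₀ (extChartAt I x₀ x) v w) =
      transitionJ I x₀ x (extChartAt I x₀ x) (chrisL cov x₀ (extChartAt I x₀ x) w v) := by
    rw [h, h, hself, fderiv_transitionJ_symm hx hxx]
  have h4 := fun v => congrArg (fun L : E →L[ℝ] E => L v) (transitionJ_comp (I := I) hx hxx)
  simp only [ContinuousLinearMap.comp_apply, ContinuousLinearMap.id_apply] at h4
  rw [← h4 (chrisL cov x₀ (extChartAt I x₀ x) v w), h', h4]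

lemma coordRicci_chrisL_transition [T2Space X] (cov : AffineDerivative I X)
    (hc : cov.ContMDiffCovariantDerivative ∞) {x₁ x₀ x : X}
    (h1 : x ∈ (chartAt H x₁).source) (h0 : x ∈ (chartAt H x₀).source) (v w : TangentSpace I x) :
    coordRicci (uncurried (chrisL cov x₁)) (extChartAt I x₁ x) (dChart I x₁ x v) (dChart I x₁ x w) =
      coordRicci (uncurried (chrisL cov x₀)) (extChartAt I x₀ x)
        (dChart I x₀ x v) (dChart I x₀ x w) := by
  rw [← transitionJ_dChart h1 h0, ← transitionJ_dChart h1 h0, ← transition_apply h1 (x₀ := x₀)]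
  have hn : ∀ᶠ y in 𝓝 (extChartAt I x₁ x), ∃ x', x' ∈ (chartAt H x₁).source ∧
      x' ∈ (chartAt H x₀).source ∧ extChartAt I x₁ x' = y := by
    filter_upwards [eventually_target (chart_mem_target (I := I) h1),
      eventually_chart_symm h1 (eventually_mem_source h0)] with z hz hz1
    exact ⟨_, chart_symm_mem hz, hz1, (extChartAt I x₁).right_inv hz⟩
  refine coordRicci_transform
    ((contDiffAt_chrisL cov hc (chart_mem_target h1)).differentiableAt (by simp)) ?_ ?_
    ((contDiffAt_transitionJ h1 h0).of_le two_le_infty) ?_ (transitionJ_comp h1 h0) ?_ _ _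
  · rw [transition_apply h1]
    exact (contDiffAt_chrisL cov hc (chart_mem_target h0)).differentiableAt (by simp)
  · filter_upwards [hn] with y ⟨x', hx1, hx0, hy⟩
    rw [← hy]
    exact hasFDerivAt_transition hx1 hx0
  · filter_upwards [hn] with y ⟨x', hx1, hx0, hy⟩ v w
    rw [← hy, chrisL_transition cov hx1 hx0, transition_apply hx1]
  · exact transitionJ_comp h0 h1

namespace TorsionFreeConnection

variable [CompleteSpace E] (D : TorsionFreeConnection I X)

lemma christoffel_eq {x₀ : X} {z : E} (hz : z ∈ (extChartAt I x₀).target) :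
    D.christoffel x₀ z = uncurried (chrisL D.cov x₀) z := by
  funext v w
  rw [uncurried, chrisL_apply _ hz]
  exact trivializationAt_tangent (chart_symm_mem hz) _

lemma christoffelAt_eq (x : X) (v w : E) :
    D.christoffelAt x v w = chrisL D.cov x (extChartAt I x x) v w := by
  have hx := mem_chart_source H x
  rw [chrisL_apply _ (chart_mem_target hx), chris_apply _ hx]
  have h1 : (constField x v x : TangentSpace I x) = v := constField_self x v
  have h2 : D.cov (constField x w) x (constField x v x) = D.christoffelAt x v w :=
    congrArg (fun u => D.cov (constField x w) x u) h1
  have h3 : dChart I x x (D.christoffelAt x v w) = D.christoffelAt x v w := dChart_self x _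
  exact h3.symm.trans (congrArg (dChart I x x) h2.symm)

lemma ricci_eq_coordRicci (x : X) (v w : E) :
    D.ricci x v w = coordRicci (uncurried (chrisL D.cov x)) (extChartAt I x x) v w := by
  refine coordRicci_congr ?_ v w
  filter_upwards [eventually_target (chart_mem_target (I := I) (mem_chart_source H x))] with z hz
  exact D.christoffel_eq hz

/-- The Ricci tensor in an arbitrary chart. -/
lemma ricci_eq_chart [T2Space X] {x₀ x : X} (hx : x ∈ (chartAt H x₀).source)
    (v w : TangentSpace I x) :
    D.ricci x v w = coordRicci (uncurried (chrisL D.cov x₀)) (extChartAt I x₀ x)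
      (dChart I x₀ x v) (dChart I x₀ x w) := by
  rw [← coordRicci_chrisL_transition D.cov D.smooth (mem_chart_source H x) hx]
  have h := D.ricci_eq_coordRicci x (dChart I x x v) (dChart I x x w)
  have hv : dChart I x x v = v := dChart_self x v
  have hw : dChart I x x w = w := dChart_self x w
  exact (congrArg₂ (fun v w : E => D.ricci x v w) hv hw).symm.trans h

lemma contDiffAt_chrisL [T2Space X] {x₀ : X} {z : E} (hz : z ∈ (extChartAt I x₀).target) :
    ContDiffAt ℝ ∞ (chrisL D.cov x₀) z :=
  ProjectiveAmbient.contDiffAt_chrisL D.cov D.smooth hz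

lemma chrisL_symm {x₀ : X} {z : E} (hz : z ∈ (extChartAt I x₀).target) (v w : E) :
    chrisL D.cov x₀ z v w = chrisL D.cov x₀ z w v :=
  ProjectiveAmbient.chrisL_symm D.torsion_eq_zero hz v w

end TorsionFreeConnection

end Torsion

end ProjectiveAmbient

namespace ProjectiveAmbient

open Filter Topology

/-! ### Densities and scales in charts -/

section Densities

variable {E : Type*} [NormedAddCommGroup E] [NormedSpace ℝ E] [FiniteDimensional ℝ E]
  {H : Type*} [TopologicalSpace H] {I : ModelWithCorners ℝ E H} [I.Boundaryless]
  {X : Type*} [TopologicalSpace X] [ChartedSpace H X] [IsManifold I ∞ X]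

variable (I) in
/-- The absolute value of the determinant of the Jacobian at `x` between the chart at `x` and the
chart at `x₀`. -/
def absJac (x₀ x : X) : ℝ := |(transitionJ I x x₀ (extChartAt I x x)).det|

lemma det_transitionJ_ne_zero {x₁ x₀ x : X} (h1 : x ∈ (chartAt H x₁).source)
    (h0 : x ∈ (chartAt H x₀).source) : (transitionJ I x₁ x₀ (extChartAt I x₁ x)).det ≠ 0 := by
  have h := congrArg ContinuousLinearMap.det (transitionJ_comp (I := I) h1 h0)
  simp only [ContinuousLinearMap.det, ContinuousLinearMap.toLinearMap_comp, LinearMap.det_comp,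
    ContinuousLinearMap.coe_id, LinearMap.det_id] at h
  exact right_ne_zero_of_mul_eq_one h

lemma absJac_pos {x₀ x : X} (hx : x ∈ (chartAt H x₀).source) : 0 < absJac I x₀ x :=
  abs_pos.2 (det_transitionJ_ne_zero (mem_chart_source H x) hx)

lemma absJac_transition {x₁ x₀ x : X} (h1 : x ∈ (chartAt H x₁).source)
    (h0 : x ∈ (chartAt H x₀).source) :
    absJac I x₀ x = |(transitionJ I x₁ x₀ (extChartAt I x₁ x)).det| * absJac I x₁ x := by
  have h : transitionJ I x x₀ (extChartAt I x x) =
      transitionJ I x₁ x₀ (extChartAt I x₁ x) ∘L transitionJ I x x₁ (extChartAt I x x) := by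
    ext w
    have hx := mem_chart_source H x
    have e0 := transitionJ_dChart (I := I) hx h0 (dChartInv I x x w)
    have e1 := transitionJ_dChart (I := I) hx h1 (dChartInv I x x w)
    have e2 := transitionJ_dChart (I := I) h1 h0 (dChartInv I x x w)
    rw [dChart_dChartInv hx] at e0 e1
    rw [ContinuousLinearMap.comp_apply, e0, e1, e2]
  rw [absJac, h, absJac, ← abs_mul]
  simp only [ContinuousLinearMap.det, ContinuousLinearMap.toLinearMap_comp, LinearMap.det_comp]

lemma absJac_self (x : X) : absJac I x x = 1 := by
  have h := absJac_transition (I := I) (mem_chart_source H x) (mem_chart_source H x)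
  have h0 := absJac_pos (I := I) (mem_chart_source H x)
  change absJac I x x = absJac I x x * absJac I x x at h
  exact (mul_eq_left₀ h0.ne').1 h.symm

/-- The coefficient of a density in the frame of the chart at `x₀`. -/
def densityRep {w : ℝ} (x₀ : X) {x : X} (c : Density I X w x) : ℝ :=
  (trivializationAt ℝ (Density I X w) x₀ ⟨x, c⟩).2

lemma densityRep_eq {w : ℝ} (x₀ : X) {x : X} (c : Density I X w x) :
    densityRep x₀ c =
      absJac I x₀ x ^ (-w / (Module.finrank ℝ E + 1 : ℝ)) * densityCoord c := by
  have h : absJac I x₀ x = |((tangentBundleCore I X).coordChange (achart H x) (achart H x₀) x).det| := by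
    rw [tangentBundleCore_coordChange_achart, I.range_eq_univ, fderivWithin_univ]
    rfl
  rw [h]
  rfl

lemma densityRep_self {w : ℝ} {x : X} (c : Density I X w x) : densityRep x c = densityCoord c := by
  rw [densityRep_eq, absJac_self, Real.one_rpow, one_mul]

lemma densityRep_transition {w : ℝ} {x₁ x₀ x : X} (h1 : x ∈ (chartAt H x₁).source)
    (h0 : x ∈ (chartAt H x₀).source) (c : Density I X w x) :
    densityRep x₀ c = |(transitionJ I x₁ x₀ (extChartAt I x₁ x)).det| ^
      (-w / (Module.finrank ℝ E + 1 : ℝ)) * densityRep x₁ c := by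
  rw [densityRep_eq, densityRep_eq, absJac_transition h1 h0,
    Real.mul_rpow (abs_nonneg _) (absJac_pos h1).le, mul_assoc]

lemma densityRep_pos {w : ℝ} {x₀ x : X} (hx : x ∈ (chartAt H x₀).source) {c : Density I X w x}
    (hc : 0 < densityCoord c) : 0 < densityRep x₀ c := by
  rw [densityRep_eq]
  exact mul_pos (Real.rpow_pos_of_pos (absJac_pos hx) _) hc

namespace Scale

variable (s : Scale I X)

/-- The coefficient of a scale in coordinates. -/
def rep (x₀ : X) (z : E) : ℝ := densityRep x₀ (s.val ((extChartAt I x₀).symm z))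

lemma rep_apply {x₀ x : X} (hx : x ∈ (chartAt H x₀).source) :
    s.rep x₀ (extChartAt I x₀ x) = densityRep x₀ (s.val x) := by
  unfold rep
  rw [chart_left_inv hx]

lemma rep_pos {x₀ : X} {z : E} (hz : z ∈ (extChartAt I x₀).target) : 0 < s.rep x₀ z :=
  densityRep_pos (chart_symm_mem hz) (s.pos _)

lemma contMDiffAt_densityRep {x₀ x : X} (hx : x ∈ (chartAt H x₀).source) :
    ContMDiffAt I 𝓘(ℝ, ℝ) ∞ (fun y => densityRep x₀ (s.val y)) x :=
  ((trivializationAt ℝ (Density I X 1) x₀).contMDiffAt_section_iff hx).1 (s.smooth x)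

lemma contDiffAt_rep {x₀ : X} {z : E} (hz : z ∈ (extChartAt I x₀).target) :
    ContDiffAt ℝ ∞ (s.rep x₀) z := by
  have h := (contMDiffAt_iff_chart (chart_symm_mem hz)).1
    (s.contMDiffAt_densityRep (chart_symm_mem hz))
  rwa [(extChartAt I x₀).right_inv hz] at h

/-- The logarithmic derivative of the coefficient of a scale. -/
def logDeriv (x₀ : X) (z : E) : E →L[ℝ] ℝ := fderiv ℝ (fun y => Real.log (s.rep x₀ y)) z

lemma contDiffAt_log_rep {x₀ : X} {z : E} (hz : z ∈ (extChartAt I x₀).target) :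
    ContDiffAt ℝ ∞ (fun y => Real.log (s.rep x₀ y)) z :=
  (s.contDiffAt_rep hz).log (s.rep_pos hz).ne'

lemma contDiffAt_logDeriv {x₀ : X} {z : E} (hz : z ∈ (extChartAt I x₀).target) :
    ContDiffAt ℝ ∞ (s.logDeriv x₀) z :=
  (s.contDiffAt_log_rep hz).fderiv_right (by simp)

lemma hasFDerivAt_log_rep {x₀ : X} {z : E} (hz : z ∈ (extChartAt I x₀).target) :
    HasFDerivAt (fun y => Real.log (s.rep x₀ y)) (s.logDeriv x₀ z) z :=
  ((s.contDiffAt_log_rep hz).differentiableAt (by simp)).hasFDerivAt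

lemma hasFDerivAt_rep {x₀ : X} {z : E} (hz : z ∈ (extChartAt I x₀).target) :
    HasFDerivAt (s.rep x₀) (s.rep x₀ z • s.logDeriv x₀ z) z := by
  have h := ((s.contDiffAt_rep hz).differentiableAt (by simp)).hasFDerivAt
  have h2 := (h.log (s.rep_pos hz).ne').fderiv
  refine h.congr_fderiv ?_
  rw [logDeriv, h2, smul_smul, mul_inv_cancel₀ (s.rep_pos hz).ne', one_smul]

lemma fderiv_logDeriv_symm {x₀ : X} {z : E} (hz : z ∈ (extChartAt I x₀).target) (v w : E) :
    fderiv ℝ (s.logDeriv x₀) z v w = fderiv ℝ (s.logDeriv x₀) z w v :=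
  (s.contDiffAt_log_rep hz).isSymmSndFDerivAt (by simpa using two_le_infty) v w

/-- The transformation law of the logarithmic derivative. -/
lemma logDeriv_transition {x₁ x₀ x : X} (h1 : x ∈ (chartAt H x₁).source)
    (h0 : x ∈ (chartAt H x₀).source) (v : E) :
    s.logDeriv x₀ (extChartAt I x₀ x) (transitionJ I x₁ x₀ (extChartAt I x₁ x) v) =
      s.logDeriv x₁ (extChartAt I x₁ x) v - (Module.finrank ℝ E + 1 : ℝ)⁻¹ *
        trL (transitionJ I x₀ x₁ (extChartAt I x₀ x) ∘L
          fderiv ℝ (transitionJ I x₁ x₀) (extChartAt I x₁ x) v) := by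
  let J := transitionJ I x₁ x₀
  have hJd : HasFDerivAt J (fderiv ℝ J (extChartAt I x₁ x)) (extChartAt I x₁ x) :=
    ((contDiffAt_transitionJ h1 h0).differentiableAt (by simp)).hasFDerivAt
  have hdet := hasFDerivAt_det hJd (transitionJ_comp h1 h0) (transitionJ_comp h0 h1)
  have hne := det_transitionJ_ne_zero (I := I) h1 h0
  have hlog := hdet.log hne
  -- The logarithm turns the power of `|det J|` into the multiple `-1/(n+1)` of `log det J`;
  -- `Real.log` ignores the sign, so no absolute value remains. Jacobi's formula gives the
  -- derivative.
  have he : (fun y => Real.log (s.rep x₀ (transition I x₁ x₀ y))) =ᶠ[𝓝 (extChartAt I x₁ x)]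
      fun y => -(Module.finrank ℝ E + 1 : ℝ)⁻¹ * Real.log (J y).det + Real.log (s.rep x₁ y) := by
    filter_upwards [eventually_target (chart_mem_target (I := I) h1),
      eventually_chart_symm h1 (eventually_mem_source h0)] with z hz hz0
    have hz1 := chart_symm_mem hz
    have e := densityRep_transition hz1 hz0 (s.val ((extChartAt I x₁).symm z))
    have hd := det_transitionJ_ne_zero (I := I) hz1 hz0
    rw [← s.rep_apply hz1, ← s.rep_apply hz0, ← transition_apply hz1] at e
    rw [(extChartAt I x₁).right_inv hz] at e hd
    rw [e, Real.log_mul (Real.rpow_pos_of_pos (abs_pos.2 hd) _).ne' (s.rep_pos hz).ne',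
      Real.log_rpow (abs_pos.2 hd), Real.log_abs]
    simp only [J]
    ring
  have hl : HasFDerivAt (fun y => Real.log (s.rep x₀ (transition I x₁ x₀ y)))
      (s.logDeriv x₀ (extChartAt I x₀ x) ∘L J (extChartAt I x₁ x)) (extChartAt I x₁ x) := by
    have h := s.hasFDerivAt_log_rep (chart_mem_target (I := I) h0)
    rw [← transition_apply h1] at h
    have h' := h.comp _ (hasFDerivAt_transition h1 h0)
    rwa [transition_apply h1] at h'
  have hr := (hlog.const_mul (-(Module.finrank ℝ E + 1 : ℝ)⁻¹)).add
    (s.hasFDerivAt_log_rep (chart_mem_target (I := I) h1))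
  have := congrArg (fun L : E →L[ℝ] ℝ => L v) (hl.unique (hr.congr_of_eventuallyEq he))
  simp only [ContinuousLinearMap.comp_apply, add_apply, smul_apply, smul_eq_mul, J] at this
  rw [this, ← mul_assoc _ (ContinuousLinearMap.det _), inv_mul_cancel₀ hne, one_mul]
  simp only [ContinuousLinearMap.compL_apply]
  ring

end Scale

end Densities

/-! ### The covariant logarithmic derivative of a scale -/

section Defect

variable {E : Type*} [NormedAddCommGroup E] [NormedSpace ℝ E] [FiniteDimensional ℝ E]
  [CompleteSpace E]
  {H : Type*} [TopologicalSpace H] {I : ModelWithCorners ℝ E H} [I.Boundaryless]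
  {X : Type*} [TopologicalSpace X] [ChartedSpace H X] [IsManifold I ∞ X]

/-- The covariant logarithmic derivative of a scale, in coordinates. -/
def covLogDeriv (D : TorsionFreeConnection I X) (s : Scale I X) (x₀ : X) (z : E) : E →L[ℝ] ℝ :=
  s.logDeriv x₀ z - (Module.finrank ℝ E + 1 : ℝ)⁻¹ • (trL ∘L chrisL D.cov x₀ z)

lemma contDiffAt_covLogDeriv [T2Space X] (D : TorsionFreeConnection I X) (s : Scale I X) {x₀ : X}
    {z : E} (hz : z ∈ (extChartAt I x₀).target) : ContDiffAt ℝ ∞ (covLogDeriv D s x₀) z :=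
  (s.contDiffAt_logDeriv hz).sub
    ((contDiffAt_const.clm_comp (D.contDiffAt_chrisL hz)).const_smul _)

/-- Both `d log σ` and `tr Γ / (n+1)` acquire the same inhomogeneous term, the trace of `K ∘ dJ`
divided by `-(n+1)` on passing to the new chart, so their difference is a 1-form on `X`. -/
lemma covLogDeriv_transition (D : TorsionFreeConnection I X) (s : Scale I X) {x₁ x₀ x : X}
    (h1 : x ∈ (chartAt H x₁).source) (h0 : x ∈ (chartAt H x₀).source) (u : TangentSpace I x) :
    covLogDeriv D s x₀ (extChartAt I x₀ x) (dChart I x₀ x u) =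
      covLogDeriv D s x₁ (extChartAt I x₁ x) (dChart I x₁ x u) := by
  rw [← transitionJ_dChart h1 h0]
  generalize dChart I x₁ x u = v
  let J := transitionJ I x₁ x₀ (extChartAt I x₁ x)
  let K := transitionJ I x₀ x₁ (extChartAt I x₀ x)
  have hKJ : K ∘L J = ContinuousLinearMap.id ℝ E := transitionJ_comp h1 h0
  have hJK : J ∘L K = ContinuousLinearMap.id ℝ E := transitionJ_comp h0 h1
  have h : K ∘L fderiv ℝ (transitionJ I x₁ x₀) (extChartAt I x₁ x) v =
      chrisL D.cov x₁ (extChartAt I x₁ x) v -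
        K ∘L (chrisL D.cov x₀ (extChartAt I x₀ x) (J v) ∘L J) := by
    ext w
    have h2 := congrArg K (chrisL_transition D.cov h1 h0 v w)
    have h3 := congrArg (fun L : E →L[ℝ] E => L (chrisL D.cov x₁ (extChartAt I x₁ x) v w)) hKJ
    simp only [ContinuousLinearMap.comp_apply, ContinuousLinearMap.id_apply] at h3
    simp only [ContinuousLinearMap.comp_apply, sub_apply]
    have h4 : K (J (chrisL D.cov x₁ (extChartAt I x₁ x) v w)) = _ := h2
    rw [h3, map_add] at h4
    rw [h4]
    simp only [J]
    abel
  have ht : trL (K ∘L (chrisL D.cov x₀ (extChartAt I x₀ x) (J v) ∘L J)) =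
      trL (chrisL D.cov x₀ (extChartAt I x₀ x) (J v)) := by
    rw [trL_comp_comm, ContinuousLinearMap.comp_assoc, hJK, ContinuousLinearMap.comp_id]
  have hs := s.logDeriv_transition h1 h0 v
  simp only [covLogDeriv, sub_apply, smul_apply, ContinuousLinearMap.comp_apply, smul_eq_mul]
  rw [hs]
  have h5 : trL (K ∘L fderiv ℝ (transitionJ I x₁ x₀) (extChartAt I x₁ x) v) = _ := congrArg trL h
  rw [map_sub, ht] at h5
  simp only [K, J] at h5
  rw [h5]
  ring

/-- At the centre of its chart a density has its canonical coefficient, and division of the defining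
equation by the positive coefficient of `s` makes it logarithmic. -/
lemma TorsionFreeConnection.preserves_iff (D : TorsionFreeConnection I X) (s : Scale I X) :
    D.Preserves s ↔ ∀ x, covLogDeriv D s x (extChartAt I x x) = 0 := by
  unfold TorsionFreeConnection.Preserves
  refine forall_congr' fun x => ?_
  have hx := mem_chart_source H x
  have hz := chart_mem_target (I := I) hx
  have hpos := s.rep_pos hz
  have h0 : densityCoord (s.val x) = s.rep x (extChartAt I x x) := by
    rw [s.rep_apply hx, densityRep_self]
  have h1 : ∀ v : E, mfderiv I 𝓘(ℝ, ℝ) (fun y => densityRep x (s.val y)) x v =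
      s.rep x (extChartAt I x x) * s.logDeriv x (extChartAt I x x) v := by
    intro v
    refine (mfderiv_eq_chart hx
      ((s.contMDiffAt_densityRep hx).mdifferentiableAt (by simp)) v).trans ?_
    have h2 : ((fun y => densityRep x (s.val y)) ∘ (extChartAt I x).symm) = s.rep x := rfl
    have h3 : dChart I x x v = v := dChart_self x v
    rw [h2, (s.hasFDerivAt_rep hz).fderiv, h3]
    rfl
  have h2 : ∀ v : E, (∑ i, (Module.finBasis ℝ E).coord i
      (D.christoffelAt x v (Module.finBasis ℝ E i))) = trL (chrisL D.cov x (extChartAt I x x) v) := by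
    intro v
    rw [← sum_coord_eq_trL]
    exact Finset.sum_congr rfl fun i _ => congrArg _ (D.christoffelAt_eq x v _)
  rw [ContinuousLinearMap.ext_iff]
  refine forall_congr' fun v => ?_
  refine (Eq.congr (h1 v) (congrArg₂ (fun a b => a / (Module.finrank ℝ E + 1 : ℝ) * b) (h2 v) h0)).trans ?_
  rw [div_eq_inv_mul, mul_comm _ (s.rep x (extChartAt I x x))]
  exact (mul_right_inj' hpos.ne').trans sub_eq_zero.symm

/-- In an arbitrary chart. -/
lemma TorsionFreeConnection.Preserves.covLogDeriv_eq_zero {D : TorsionFreeConnection I X}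
    {s : Scale I X} (h : D.Preserves s) {x₀ : X} {z : E} (hz : z ∈ (extChartAt I x₀).target) :
    covLogDeriv D s x₀ z = 0 := by
  have hx := chart_symm_mem hz
  ext v
  have h1 := covLogDeriv_transition D s (mem_chart_source H _) hx (dChartInv I x₀ _ v)
  rw [(D.preserves_iff s).1 h, dChart_dChartInv hx, (extChartAt I x₀).right_inv hz] at h1
  exact h1

lemma TorsionFreeConnection.Preserves.trL_chrisL {D : TorsionFreeConnection I X}
    {s : Scale I X} (h : D.Preserves s) {x₀ : X} {z : E} (hz : z ∈ (extChartAt I x₀).target)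
    (v : E) : trL (chrisL D.cov x₀ z v) = (Module.finrank ℝ E + 1 : ℝ) * s.logDeriv x₀ z v := by
  have h1 := congrArg (fun L : E →L[ℝ] ℝ => L v) (h.covLogDeriv_eq_zero hz)
  simp only [covLogDeriv, sub_apply, smul_apply, ContinuousLinearMap.comp_apply, smul_eq_mul,
    zero_apply, sub_eq_zero] at h1
  have h2 : (Module.finrank ℝ E + 1 : ℝ) ≠ 0 := by positivity
  rw [h1, mul_inv_cancel_left₀ h2]

end Defect

section Existence

variable {E : Type*} [NormedAddCommGroup E] [NormedSpace ℝ E] [FiniteDimensional ℝ E]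
  {H : Type*} [TopologicalSpace H] {I : ModelWithCorners ℝ E H} [I.Boundaryless]
  {X : Type*} [TopologicalSpace X] [ChartedSpace H X] [IsManifold I ∞ X]

/-- Positivity is a convex condition on the fibres, so a partition of unity glues the sections that
are constantly one in local trivializations. -/
lemma nonempty_scale [T2Space X] [SigmaCompactSpace X] : Nonempty (Scale I X) := by
  have hconv : ∀ x : X, Convex ℝ {c : Density I X 1 x | 0 < densityCoord c} := by
    intro x a ha b hb p q hp hq hpq
    simp only [Set.mem_ofPred_eq, map_add, map_smul, smul_eq_mul] at ha hb ⊢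
    rcases hp.eq_or_lt with rfl | hp
    · have : q = 1 := by linarith
      simpa [this] using hb
    · have := mul_pos hp ha
      have := mul_nonneg hq hb.le
      linarith
  obtain ⟨s, hs⟩ := exists_contMDiffSection_forall_mem_convex_of_local (n := ⊤) (F_fiber := ℝ) I
    (Density I X 1) (fun x => {c | 0 < densityCoord c}) hconv fun x₀ => by
    let e := trivializationAt ℝ (Density I X 1) x₀
    refine ⟨(chartAt H x₀).source, (chartAt H x₀).open_source.mem_nhds (mem_chart_source H x₀),
      fun x => e.symm x 1, fun x hx => ?_, fun x hx => ?_⟩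
    · refine ContMDiffAt.contMDiffWithinAt ?_
      rw [e.contMDiffAt_section_iff hx]
      refine contMDiffAt_const (c := (1 : ℝ)) |>.congr_of_eventuallyEq ?_
      filter_upwards [eventually_mem_source hx] with y hy
      exact congrArg Prod.snd (e.apply_mk_symm hy 1)
    · have h1 : densityRep x₀ (e.symm x 1) = 1 := congrArg Prod.snd (e.apply_mk_symm hx 1)
      rw [densityRep_eq] at h1
      by_contra h2
      have h3 := Real.rpow_pos_of_pos (absJac_pos (I := I) hx) (-1 / (Module.finrank ℝ E + 1 : ℝ))
      have h4 := mul_nonpos_of_nonneg_of_nonpos h3.le (not_lt.1 h2)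
      linarith
  exact ⟨⟨s, hs, s.contMDiff⟩⟩

end Existence

end ProjectiveAmbient

namespace ProjectiveAmbient

open Filter Topology

/-! ### Trace-free symbols and the connection of a scale -/

section SymProd

variable {E : Type*} [NormedAddCommGroup E] [NormedSpace ℝ E] [FiniteDimensional ℝ E]

/-- The bilinear map `(v, w) ↦ φ(v) w + φ(w) v`. -/
def symProd : (E →L[ℝ] ℝ) →L[ℝ] (E →L[ℝ] E →L[ℝ] E) :=
  LinearMap.toContinuousLinearMap
    { toFun := fun φ => φ.smulRight (ContinuousLinearMap.id ℝ E) +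
        (φ.smulRight (ContinuousLinearMap.id ℝ E)).flip
      map_add' := fun φ φ' => by
        ext v w
        simp only [add_apply, ContinuousLinearMap.smulRight_apply, ContinuousLinearMap.flip_apply,
          smul_apply, ContinuousLinearMap.id_apply]
        module
      map_smul' := fun c φ => by
        ext v w
        simp only [add_apply, ContinuousLinearMap.smulRight_apply, ContinuousLinearMap.flip_apply,
          smul_apply, ContinuousLinearMap.id_apply, RingHom.id_apply, smul_eq_mul]
        module }

lemma symProd_apply (φ : E →L[ℝ] ℝ) (v w : E) : symProd φ v w = φ v • w + φ w • v := rfl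

lemma trL_symProd (φ : E →L[ℝ] ℝ) (v : E) :
    trL (symProd φ v) = (Module.finrank ℝ E + 1 : ℝ) * φ v := by
  have h : symProd φ v = φ v • ContinuousLinearMap.id ℝ E + φ.smulRight v := rfl
  rw [h, map_add, map_smul, trL_id, trL_smulRight, smul_eq_mul]
  ring

/-- The trace-free part of a symmetric bilinear map. -/
def traceFree : (E →L[ℝ] E →L[ℝ] E) →L[ℝ] (E →L[ℝ] E →L[ℝ] E) :=
  ContinuousLinearMap.id ℝ _ - (Module.finrank ℝ E + 1 : ℝ)⁻¹ •
    (symProd ∘L ContinuousLinearMap.compL ℝ E (E →L[ℝ] E) ℝ trL)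

lemma traceFree_eq (G : E →L[ℝ] E →L[ℝ] E) :
    traceFree G = G - (Module.finrank ℝ E + 1 : ℝ)⁻¹ • symProd (trL ∘L G) := rfl

lemma trL_traceFree (G : E →L[ℝ] E →L[ℝ] E) (v : E) : trL (traceFree G v) = 0 := by
  have h2 : (Module.finrank ℝ E + 1 : ℝ) ≠ 0 := by positivity
  rw [traceFree_eq, sub_apply, smul_apply, map_sub, map_smul, trL_symProd, smul_eq_mul,
    inv_mul_cancel_left₀ h2, ContinuousLinearMap.comp_apply, sub_self]

lemma traceFree_symm {G : E →L[ℝ] E →L[ℝ] E} (h : ∀ v w, G v w = G w v) (v w : E) :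
    traceFree G v w = traceFree G w v := by
  simp only [traceFree_eq, sub_apply, smul_apply, symProd_apply, h v w]
  abel_nf

lemma trL_comp_symProd (φ : E →L[ℝ] ℝ) :
    trL ∘L symProd φ = (Module.finrank ℝ E + 1 : ℝ) • φ :=
  ContinuousLinearMap.ext fun v => trL_symProd φ v

/-- The trace of `symProd φ` is `(n+1) φ`, so `traceFree` annihilates it. This is the projective
invariance of `Π`. -/
lemma traceFree_add_symProd (G : E →L[ℝ] E →L[ℝ] E) (φ : E →L[ℝ] ℝ) :
    traceFree (G + symProd φ) = traceFree G := by
  have h2 : (Module.finrank ℝ E + 1 : ℝ) ≠ 0 := by positivity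
  rw [traceFree_eq, ContinuousLinearMap.comp_add, trL_comp_symProd, map_add, map_smul, smul_add,
    smul_smul, inv_mul_cancel₀ h2, one_smul, traceFree_eq]
  abel

end SymProd

section ProjectiveChange

variable {E : Type*} [NormedAddCommGroup E] [NormedSpace ℝ E] [FiniteDimensional ℝ E]
  [CompleteSpace E]
  {H : Type*} [TopologicalSpace H] {I : ModelWithCorners ℝ E H} [I.Boundaryless]
  {X : Type*} [TopologicalSpace X] [ChartedSpace H X] [IsManifold I ∞ X]

lemma chrisL_add_of_cov_eq {cov cov' : AffineDerivative I X} {x₀ : X} {z : E}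
    (hz : z ∈ (extChartAt I x₀).target)
    (φ : TangentSpace I ((extChartAt I x₀).symm z) →L[ℝ] ℝ)
    (h : ∀ (w : E) (v : TangentSpace I ((extChartAt I x₀).symm z)),
      cov' (constField x₀ w) ((extChartAt I x₀).symm z) v =
        cov (constField x₀ w) ((extChartAt I x₀).symm z) v + φ v • constField x₀ w _ +
          φ (constField x₀ w _) • v) :
    chrisL cov' x₀ z = chrisL cov x₀ z + symProd (φ ∘L dChartInv I x₀ _) := by
  have hx := chart_symm_mem hz
  ext v w
  rw [add_apply, add_apply, chrisL_apply _ hz, chrisL_apply _ hz]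
  change dChart I x₀ _ (cov' (constField x₀ w) _ _) = dChart I x₀ _ (cov (constField x₀ w) _ _) + _
  rw [h, map_add, map_add, map_smul, map_smul, dChart_constField hx, dChart_constField hx,
    symProd_apply, ContinuousLinearMap.comp_apply, ContinuousLinearMap.comp_apply,
    constField_eq hx, constField_eq hx, add_assoc]

namespace TorsionFreeConnection

/-- The relation is only given on global smooth fields; it reaches coordinate fields through global
fields with the same germ. -/
lemma ProjectivelyRelated.exists_chrisL [T2Space X] {D D' : TorsionFreeConnection I X}
    (h : D.ProjectivelyRelated D') {x₀ : X} {z : E} (hz : z ∈ (extChartAt I x₀).target) :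
    ∃ φ : E →L[ℝ] ℝ, chrisL D'.cov x₀ z = chrisL D.cov x₀ z + symProd φ := by
  obtain ⟨Υ, -, hΥ⟩ := h
  have hx := chart_symm_mem hz
  refine ⟨_, chrisL_add_of_cov_eq hz (Υ _) fun w v => ?_⟩
  obtain ⟨Y, hY, hYe⟩ := exists_isSmoothField_eventuallyEq (I := I) hx w
  have h1 := hΥ Y hY _ v
  rwa [cov_congr _ (mdifferentiableAt_constField hx w) hYe,
    cov_congr _ (mdifferentiableAt_constField hx w) hYe, hYe.self_of_nhds] at h1

lemma ProjectivelyRelated.traceFree_chrisL [T2Space X] {D D' : TorsionFreeConnection I X}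
    (h : D.ProjectivelyRelated D') {x₀ : X} {z : E} (hz : z ∈ (extChartAt I x₀).target) :
    traceFree (chrisL D'.cov x₀ z) = traceFree (chrisL D.cov x₀ z) := by
  obtain ⟨φ, hφ⟩ := h.exists_chrisL hz
  rw [hφ, traceFree_add_symProd]

/-- The part removed by `traceFree` is determined by the trace, and preservation of `s` says that
the trace is `(n+1) d log σ`. -/
lemma Preserves.chrisL_eq {D : TorsionFreeConnection I X} {s : Scale I X} (h : D.Preserves s)
    {x₀ : X} {z : E} (hz : z ∈ (extChartAt I x₀).target) :
    chrisL D.cov x₀ z = traceFree (chrisL D.cov x₀ z) + symProd (s.logDeriv x₀ z) := by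
  have h1 : trL ∘L chrisL D.cov x₀ z = (Module.finrank ℝ E + 1 : ℝ) • s.logDeriv x₀ z :=
    ContinuousLinearMap.ext fun v => h.trL_chrisL hz v
  have h2 : (Module.finrank ℝ E + 1 : ℝ) ≠ 0 := by positivity
  rw [traceFree_eq, h1, map_smul, smul_smul, inv_mul_cancel₀ h2, one_smul]
  abel

/-- The Christoffel symbols of the connection in the projective class of `D₀` that preserves `s`. -/
lemma ProjectivelyRelated.chrisL_eq [T2Space X] {D₀ D : TorsionFreeConnection I X}
    (h : D₀.ProjectivelyRelated D) {s : Scale I X} (hs : D.Preserves s)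
    {x₀ : X} {z : E} (hz : z ∈ (extChartAt I x₀).target) :
    chrisL D.cov x₀ z = traceFree (chrisL D₀.cov x₀ z) + symProd (s.logDeriv x₀ z) := by
  rw [hs.chrisL_eq hz, h.traceFree_chrisL hz]

lemma same_of_chrisL {D D' : TorsionFreeConnection I X}
    (h : ∀ x : X, chrisL D'.cov x (extChartAt I x x) = chrisL D.cov x (extChartAt I x x)) :
    D.Same D' := by
  intro Y hY x v
  have hx := mem_chart_source H x
  have hYx : MDifferentiableAt I I.tangent (fun x => (⟨x, Y x⟩ : TangentBundle I X)) x :=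
    (hY x).mdifferentiableAt (by simp)
  refine dChart_inj hx ?_
  rw [dChart_cov _ hx hYx, dChart_cov _ hx hYx, h]

/-- The covariant logarithmic derivative of a scale as a 1-form. -/
def covLogForm (D : TorsionFreeConnection I X) (s : Scale I X) (x : X) : TangentSpace I x →L[ℝ] ℝ :=
  covLogDeriv D s x (extChartAt I x x) ∘L dChart I x x

lemma covLogForm_apply (D : TorsionFreeConnection I X) (s : Scale I X) {x₀ x : X}
    (hx : x ∈ (chartAt H x₀).source) (u : TangentSpace I x) :
    D.covLogForm s x u = covLogDeriv D s x₀ (extChartAt I x₀ x) (dChart I x₀ x u) :=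
  covLogDeriv_transition D s hx (mem_chart_source H x) u

/-- The covariant derivative of the projective class of `D` that preserves `s`. -/
def covOfScale (D : TorsionFreeConnection I X) (s : Scale I X) : AffineDerivative I X :=
  D.cov.addOneForm fun x => (symProd (E := E) (D.covLogForm s x))

lemma covOfScale_apply (D : TorsionFreeConnection I X) (s : Scale I X)
    (Y : ∀ x : X, TangentSpace I x) (x : X) (v : TangentSpace I x) :
    D.covOfScale s Y x v = D.cov Y x v + D.covLogForm s x v • Y x + D.covLogForm s x (Y x) • v := by
  have h : D.covOfScale s Y x v =
    D.cov Y x v + (D.covLogForm s x (Y x) • v + D.covLogForm s x v • Y x) := rfl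
  rw [h]
  abel

lemma chrisL_covOfScale (D : TorsionFreeConnection I X) (s : Scale I X)
    {x₀ : X} {z : E} (hz : z ∈ (extChartAt I x₀).target) :
    chrisL (D.covOfScale s) x₀ z = chrisL D.cov x₀ z + symProd (covLogDeriv D s x₀ z) := by
  have hx := chart_symm_mem hz
  rw [chrisL_add_of_cov_eq hz _ fun w v => D.covOfScale_apply s _ _ v]
  congr 2
  ext v
  rw [ContinuousLinearMap.comp_apply, D.covLogForm_apply s hx, dChart_dChartInv hx,
    (extChartAt I x₀).right_inv hz]

/-- The connection in the projective class of `D` that preserves the scale `s`. -/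
def ofScale [T2Space X] (D : TorsionFreeConnection I X) (s : Scale I X) :
    TorsionFreeConnection I X where
  cov := D.covOfScale s
  smooth := by
    refine contMDiffCovariantDerivative_of_chris _ fun x₀ => ?_
    have hz := chart_mem_target (I := I) (mem_chart_source H x₀)
    refine ((D.contDiffAt_chrisL hz).add (symProd.contDiff.contDiffAt.comp _
      (contDiffAt_covLogDeriv D s hz))).congr_of_eventuallyEq ?_
    filter_upwards [eventually_target hz] with z hz
    exact D.chrisL_covOfScale s hz
  torsion_eq_zero := by
    refine torsion_eq_zero_of_symm _ fun x v w => ?_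
    have hz := chart_mem_target (I := I) (mem_chart_source H x)
    rw [D.chrisL_covOfScale s hz, add_apply, add_apply, add_apply, add_apply, D.chrisL_symm hz,
      symProd_apply, symProd_apply, add_comm (_ • w)]

lemma projectivelyRelated_ofScale [T2Space X] (D : TorsionFreeConnection I X) (s : Scale I X) :
    D.ProjectivelyRelated (D.ofScale s) := by
  refine ⟨D.covLogForm s, fun Y hY x₀ => ?_, fun Y _ x v => D.covOfScale_apply s Y x v⟩
  have hx := mem_chart_source H x₀
  have hz := chart_mem_target (I := I) hx
  rw [contMDiffAt_iff_chart hx]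
  refine ((contDiffAt_covLogDeriv D s hz).clm_apply ((contMDiffAt_field_iff hx).1 (hY x₀))).congr_of_eventuallyEq ?_
  filter_upwards [eventually_target hz] with z hz
  have h := D.covLogForm_apply s (chart_symm_mem hz) (Y ((extChartAt I x₀).symm z))
  rw [(extChartAt I x₀).right_inv hz] at h
  exact h

/-- Adding `symProd Υ` to the symbols lowers the covariant logarithmic derivative of `s` by `Υ`. In
`ofScale` the form `Υ` is that derivative, so the new one is zero. -/
lemma ofScale_preserves [T2Space X] (D : TorsionFreeConnection I X) (s : Scale I X) :
    (D.ofScale s).Preserves s := by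
  rw [preserves_iff]
  intro x
  have h : chrisL (D.ofScale s).cov x (extChartAt I x x) = _ :=
    D.chrisL_covOfScale s (chart_mem_target (I := I) (mem_chart_source H x))
  have h2 : (Module.finrank ℝ E + 1 : ℝ) ≠ 0 := by positivity
  rw [covLogDeriv, h, ContinuousLinearMap.comp_add, trL_comp_symProd, smul_add, smul_smul,
    inv_mul_cancel₀ h2, one_smul, covLogDeriv]
  abel

/-- The symbols are forced: the trace-free part by the class, the remaining part by the scale. -/
lemma ProjectivelyRelated.same [T2Space X] {D₀ D D' : TorsionFreeConnection I X}
    (h : D₀.ProjectivelyRelated D) (h' : D₀.ProjectivelyRelated D') {s : Scale I X}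
    (hs : D.Preserves s) (hs' : D'.Preserves s) : D.Same D' :=
  same_of_chrisL fun x => by
    have hz := chart_mem_target (I := I) (mem_chart_source H x)
    rw [h.chrisL_eq hs hz, h'.chrisL_eq hs' hz]

end TorsionFreeConnection

end ProjectiveChange

end ProjectiveAmbient

namespace ProjectiveAmbient

open Filter Topology

/-! ### Charts of total spaces and Patterson-Walker metrics on cotangent bundles -/

section TotalSpaces

variable {E : Type*} [NormedAddCommGroup E] [NormedSpace ℝ E]
  {H : Type*} [TopologicalSpace H] {I : ModelWithCorners ℝ E H}
  {X : Type*} [TopologicalSpace X] [ChartedSpace H X]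
  {F : Type*} [NormedAddCommGroup F] [NormedSpace ℝ F] {V : X → Type*}
  [TopologicalSpace (TotalSpace F V)] [∀ x, TopologicalSpace (V x)] [FiberBundle F V]

lemma totalSpace_mem_chart_source {ξ₀ ξ : TotalSpace F V}
    (hb : (trivializationAt F V ξ₀.1).baseSet = (chartAt H ξ₀.1).source) :
    ξ ∈ (chartAt (ModelProd H F) ξ₀).source ↔ ξ.1 ∈ (chartAt H ξ₀.1).source := by
  rw [FiberBundle.chartedSpace_chartAt]
  constructor
  · intro h
    have h1 : ξ ∈ (trivializationAt F V ξ₀.1).source := h.1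
    rwa [Trivialization.mem_source, hb] at h1
  · intro h
    have h1 : ξ ∈ (trivializationAt F V ξ₀.1).source := by rwa [Trivialization.mem_source, hb]
    refine ⟨h1, ?_, trivial⟩
    have h2 : (trivializationAt F V ξ₀.1 ξ).1 = ξ.1 := (trivializationAt F V ξ₀.1).coe_fst h1
    change (trivializationAt F V ξ₀.1 ξ).1 ∈ _
    rwa [h2]

lemma totalSpace_extChartAt {ξ₀ ξ : TotalSpace F V}
    (hξ : ξ.1 ∈ (trivializationAt F V ξ₀.1).baseSet) :
    extChartAt (I.prod 𝓘(ℝ, F)) ξ₀ ξ =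
      (extChartAt I ξ₀.1 ξ.1, (trivializationAt F V ξ₀.1 ξ).2) := by
  rw [FiberBundle.extChartAt]
  have h2 : (trivializationAt F V ξ₀.1 ξ).1 = ξ.1 :=
    (trivializationAt F V ξ₀.1).coe_fst (Trivialization.mem_source _ |>.2 hξ)
  change (extChartAt I ξ₀.1 (trivializationAt F V ξ₀.1 ξ).1, (trivializationAt F V ξ₀.1 ξ).2) = _
  rw [h2]

end TotalSpaces

section Maps

variable {E : Type*} [NormedAddCommGroup E] [NormedSpace ℝ E]
  {H : Type*} [TopologicalSpace H] {I : ModelWithCorners ℝ E H} [I.Boundaryless]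
  {X : Type*} [TopologicalSpace X] [ChartedSpace H X] [IsManifold I ∞ X]
  {E' : Type*} [NormedAddCommGroup E'] [NormedSpace ℝ E']
  {H' : Type*} [TopologicalSpace H'] {J : ModelWithCorners ℝ E' H'}
  {Y : Type*} [TopologicalSpace Y] [ChartedSpace H' Y] [IsManifold J ∞ Y]

/-- The differential of a map in terms of its coordinate representation. -/
lemma dChart_mfderiv {f : X → Y} {x₁ x : X} {y₁ : Y} (hx : x ∈ (chartAt H x₁).source)
    (hy : f x ∈ (chartAt H' y₁).source) (hf : MDifferentiableAt I J f x) (v : TangentSpace I x) :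
    dChart J y₁ (f x) (mfderiv I J f x v) =
      fderiv ℝ (extChartAt J y₁ ∘ f ∘ (extChartAt I x₁).symm) (extChartAt I x₁ x)
        (dChart I x₁ x v) := by
  have h1 : MDifferentiableAt J 𝓘(ℝ, E') (extChartAt J y₁) (f x) := mdifferentiableAt_extChartAt hy
  have h2 := mfderiv_eq_chart hx (h1.comp x hf) v
  rw [mfderiv_comp x h1 hf] at h2
  rw [dChart_eq_mfderiv hy]
  exact h2

end Maps

section Cotangent

variable {E : Type*} [NormedAddCommGroup E] [NormedSpace ℝ E] [FiniteDimensional ℝ E]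
  {H : Type*} [TopologicalSpace H] {I : ModelWithCorners ℝ E H} [I.Boundaryless]
  {X : Type*} [TopologicalSpace X] [ChartedSpace H X] [IsManifold I ∞ X]

/-- The components of a covector in the chart at `x₀`. -/
def covectorRep (x₀ : X) (ξ : CotangentSpace I X) : E →L[ℝ] ℝ := ξ.2 ∘L dChartInv I x₀ ξ.1

lemma cotangent_mem_chart_source {ξ₀ ξ : CotangentSpace I X} :
    ξ ∈ (chartAt (ModelProd H (E →L[ℝ] ℝ)) ξ₀).source ↔ ξ.1 ∈ (chartAt H ξ₀.1).source :=
  totalSpace_mem_chart_source (by simp [hom_trivializationAt_baseSet])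

lemma cotangent_trivializationAt (x₀ : X) (ξ : CotangentSpace I X) :
    (trivializationAt (E →L[ℝ] ℝ) (fun x : X => TangentSpace I x →L[ℝ] Trivial X ℝ x) x₀ ξ).2 =
      covectorRep x₀ ξ := by
  rw [hom_trivializationAt_apply]
  change (Trivialization.continuousLinearMapAt ℝ (trivializationAt ℝ (Trivial X ℝ) x₀) ξ.1) ∘L _ = _
  ext v
  rw [ContinuousLinearMap.comp_apply]
  have h := Bundle.Trivial.continuousLinearMapAt_trivialization ℝ X ℝ ξ.1
  exact congrArg (fun L : ℝ →L[ℝ] ℝ => L (ξ.2 (dChartInv I x₀ ξ.1 v))) h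

lemma cotangent_extChartAt {ξ₀ ξ : CotangentSpace I X} (h : ξ.1 ∈ (chartAt H ξ₀.1).source) :
    extChartAt (I.prod 𝓘(ℝ, E →L[ℝ] ℝ)) ξ₀ ξ = (extChartAt I ξ₀.1 ξ.1, covectorRep ξ₀.1 ξ) := by
  rw [totalSpace_extChartAt (by simpa [hom_trivializationAt_baseSet] using h),
    cotangent_trivializationAt]

lemma covectorRep_transition {x₁ x₀ : X} {ξ : CotangentSpace I X}
    (h1 : ξ.1 ∈ (chartAt H x₁).source) (h0 : ξ.1 ∈ (chartAt H x₀).source) :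
    covectorRep x₀ ξ = covectorRep x₁ ξ ∘L transitionJ I x₀ x₁ (extChartAt I x₀ ξ.1) := by
  ext v
  have h := transitionJ_dChart h0 h1 (dChartInv I x₀ ξ.1 v)
  rw [dChart_dChartInv h0] at h
  rw [ContinuousLinearMap.comp_apply, h]
  exact congrArg (fun u => ξ.2 u) (dChartInv_dChart h1 (dChartInv I x₀ ξ.1 v)).symm

lemma covectorRep_self (ξ : CotangentSpace I X) (v : E) : covectorRep ξ.1 ξ v = ξ.2 v :=
  congrArg (fun u : TangentSpace I ξ.1 => ξ.2 u) (dChartInv_self ξ.1 v)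

lemma cotangent_transition {ξ₁ ξ₀ ξ : CotangentSpace I X}
    (h1 : ξ.1 ∈ (chartAt H ξ₁.1).source) (h0 : ξ.1 ∈ (chartAt H ξ₀.1).source) :
    transition (I.prod 𝓘(ℝ, E →L[ℝ] ℝ)) ξ₁ ξ₀ =ᶠ[𝓝 (extChartAt (I.prod 𝓘(ℝ, E →L[ℝ] ℝ)) ξ₁ ξ)]
      fun q : E × (E →L[ℝ] ℝ) => (transition I ξ₁.1 ξ₀.1 q.1,
        q.2 ∘L transitionJ I ξ₀.1 ξ₁.1 (transition I ξ₁.1 ξ₀.1 q.1)) := by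
  have h1' := cotangent_mem_chart_source.2 h1
  have h0' := cotangent_mem_chart_source.2 h0
  filter_upwards [eventually_target (chart_mem_target (I := I.prod 𝓘(ℝ, E →L[ℝ] ℝ)) h1'),
    eventually_chart_symm h1' (eventually_mem_source h0')] with q hq hq0
  have hq1 := chart_symm_mem hq
  have hr := (extChartAt (I.prod 𝓘(ℝ, E →L[ℝ] ℝ)) ξ₁).right_inv hq
  rw [cotangent_mem_chart_source] at hq0 hq1
  rw [transition, Function.comp_apply, cotangent_extChartAt hq0, covectorRep_transition hq1 hq0]
  rw [cotangent_extChartAt hq1] at hr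
  generalize (extChartAt (I.prod 𝓘(ℝ, E →L[ℝ] ℝ)) ξ₁).symm q = η at hq0 hq1 hr ⊢
  subst hr
  rw [transition_apply hq1]

/-- The transition map is `(z, p) ↦ (φ(z), p ∘ K(φ(z)))`, where `K` is the Jacobian of the inverse
transition; the last term comes from differentiating `K`. -/
lemma transitionJ_cotangent {ξ₁ ξ₀ ξ : CotangentSpace I X}
    (h1 : ξ.1 ∈ (chartAt H ξ₁.1).source) (h0 : ξ.1 ∈ (chartAt H ξ₀.1).source)
    (V : E × (E →L[ℝ] ℝ)) :
    transitionJ (I.prod 𝓘(ℝ, E →L[ℝ] ℝ)) ξ₁ ξ₀ (extChartAt (I.prod 𝓘(ℝ, E →L[ℝ] ℝ)) ξ₁ ξ) V =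
      (transitionJ I ξ₁.1 ξ₀.1 (extChartAt I ξ₁.1 ξ.1) V.1,
        V.2 ∘L transitionJ I ξ₀.1 ξ₁.1 (extChartAt I ξ₀.1 ξ.1) +
          covectorRep ξ₁.1 ξ ∘L fderiv ℝ (transitionJ I ξ₀.1 ξ₁.1) (extChartAt I ξ₀.1 ξ.1)
            (transitionJ I ξ₁.1 ξ₀.1 (extChartAt I ξ₁.1 ξ.1) V.1)) := by
  have hφ := hasFDerivAt_transition (I := I) h1 h0
  have hK : HasFDerivAt (transitionJ I ξ₀.1 ξ₁.1) _ (extChartAt I ξ₀.1 ξ.1) :=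
    ((contDiffAt_transitionJ (I := I) h0 h1).differentiableAt (by simp)).hasFDerivAt
  rw [← transition_apply h1] at hK
  have hKφ : HasFDerivAt (fun z => transitionJ I ξ₀.1 ξ₁.1 (transition I ξ₁.1 ξ₀.1 z)) _
    (extChartAt I ξ₁.1 ξ.1) := hK.comp _ hφ
  rw [transitionJ, (cotangent_transition h1 h0).fderiv_eq, cotangent_extChartAt h1]
  have e1 : HasFDerivAt (fun q : E × (E →L[ℝ] ℝ) => transition I ξ₁.1 ξ₀.1 q.1) _
      (extChartAt I ξ₁.1 ξ.1, covectorRep ξ₁.1 ξ) :=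
    hasFDerivAt_comp_fst (P := transition I ξ₁.1 ξ₀.1) hφ.differentiableAt
  have e2 : HasFDerivAt (fun q : E × (E →L[ℝ] ℝ) =>
      transitionJ I ξ₀.1 ξ₁.1 (transition I ξ₁.1 ξ₀.1 q.1)) _
      (extChartAt I ξ₁.1 ξ.1, covectorRep ξ₁.1 ξ) :=
    hasFDerivAt_comp_fst (P := fun z => transitionJ I ξ₀.1 ξ₁.1 (transition I ξ₁.1 ξ₀.1 z))
      hKφ.differentiableAt
  have e3 := e1.prodMk (hasFDerivAt_snd.clm_comp e2)
  rw [e3.fderiv, hφ.fderiv, hKφ.fderiv, transition_apply h1]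
  ext v
  · simp
  · simp [add_comm]

end Cotangent

section PattersonWalker

variable {E : Type*} [NormedAddCommGroup E] [NormedSpace ℝ E] [FiniteDimensional ℝ E]
  [CompleteSpace E]
  {H : Type*} [TopologicalSpace H] {I : ModelWithCorners ℝ E H} [I.Boundaryless]
  {X : Type*} [TopologicalSpace X] [ChartedSpace H X] [IsManifold I ∞ X]

/-- The Patterson-Walker metric in an arbitrary chart. -/
lemma pattersonWalker_eq_chart (D : TorsionFreeConnection I X) {ξ₀ ξ : CotangentSpace I X}
    (h : ξ.1 ∈ (chartAt H ξ₀.1).source) (u u' : TangentSpace (I.prod 𝓘(ℝ, E →L[ℝ] ℝ)) ξ) :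
    pattersonWalker D ξ u u' = coordPattersonWalker (chrisL D.cov ξ₀.1)
      (extChartAt (I.prod 𝓘(ℝ, E →L[ℝ] ℝ)) ξ₀ ξ)
      (dChart (I.prod 𝓘(ℝ, E →L[ℝ] ℝ)) ξ₀ ξ u) (dChart (I.prod 𝓘(ℝ, E →L[ℝ] ℝ)) ξ₀ ξ u') := by
  have hx := mem_chart_source H ξ.1
  have hc : ∀ u : TangentSpace (I.prod 𝓘(ℝ, E →L[ℝ] ℝ)) ξ,
      dChart (I.prod 𝓘(ℝ, E →L[ℝ] ℝ)) ξ₀ ξ u = _ := fun u =>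
    (transitionJ_dChart (cotangent_mem_chart_source.2 hx) (cotangent_mem_chart_source.2 h) u).symm.trans
      (transitionJ_cotangent hx h _)
  have hself : ∀ u : TangentSpace (I.prod 𝓘(ℝ, E →L[ℝ] ℝ)) ξ,
      dChart (I.prod 𝓘(ℝ, E →L[ℝ] ℝ)) ξ ξ u = (u : E × (E →L[ℝ] ℝ)) := dChart_self ξ
  rw [hc u, hc u', hself u, hself u', cotangent_extChartAt h]
  change E × (E →L[ℝ] ℝ) at u u'
  have hid := fun v => congrArg (fun L : E →L[ℝ] E => L v) (transitionJ_comp (I := I) hx h)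
  -- The transformation law is used from the chart at `ξ₀` back to the chart at `ξ`. Its
  -- inhomogeneous term, paired with twice the momentum, equals the sum of the two terms by which
  -- the momentum components of `u` and `u'` fail to be tensorial.
  have hJ := chrisL_transition D.cov h hx (transitionJ I ξ.1 ξ₀.1 (extChartAt I ξ.1 ξ.1) u.1)
    (transitionJ I ξ.1 ξ₀.1 (extChartAt I ξ.1 ξ.1) u'.1)
  simp only [ContinuousLinearMap.comp_apply, ContinuousLinearMap.id_apply] at hid
  rw [hid, hid] at hJ
  have hsym := fderiv_transitionJ_symm (I := I) h hx
  have hPW : pattersonWalker D ξ u u' = u'.2 u.1 + u.2 u'.1 -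
      2 * covectorRep ξ.1 ξ (chrisL D.cov ξ.1 (extChartAt I ξ.1 ξ.1) u.1 u'.1) := by
    rw [covectorRep_self]
    exact congrArg (fun y : E => u'.2 u.1 + u.2 u'.1 - 2 * ξ.2 y) (D.christoffelAt_eq ξ.1 u.1 u'.1)
  rw [hPW, coordPattersonWalker, covectorRep_transition hx h]
  simp only [add_apply, ContinuousLinearMap.comp_apply, hid]
  rw [hJ, hsym, map_add]
  ring

lemma coeff_pattersonWalker (D : TorsionFreeConnection I X) {ξ₀ : CotangentSpace I X}
    {q : E × (E →L[ℝ] ℝ)} (hq : q ∈ (extChartAt (I.prod 𝓘(ℝ, E →L[ℝ] ℝ)) ξ₀).target) :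
    (pattersonWalker D).coeff ξ₀ q = coordPattersonWalker (chrisL D.cov ξ₀.1) q := by
  have h := chart_symm_mem hq
  funext V W
  unfold Tensor2.coeff
  rw [pattersonWalker_eq_chart D (cotangent_mem_chart_source.1 h), dChart_constField h,
    dChart_constField h, (extChartAt (I.prod 𝓘(ℝ, E →L[ℝ] ℝ)) ξ₀).right_inv hq]

lemma cotangent_target {ξ₀ : CotangentSpace I X} {q : E × (E →L[ℝ] ℝ)}
    (hq : q ∈ (extChartAt (I.prod 𝓘(ℝ, E →L[ℝ] ℝ)) ξ₀).target) :
    q.1 ∈ (extChartAt I ξ₀.1).target := by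
  have h := cotangent_mem_chart_source.1 (chart_symm_mem hq)
  have hr := (extChartAt (I.prod 𝓘(ℝ, E →L[ℝ] ℝ)) ξ₀).right_inv hq
  rw [cotangent_extChartAt h] at hr
  rw [← hr]
  exact chart_mem_target h

/-- Split forms of Patterson-Walker type have neutral signature. -/
lemma hasSignature_of_split (B : E →L[ℝ] E →L[ℝ] ℝ) (hB : ∀ v w, B v w = B w v) :
    HasSignature (fun u u' : E × (E →L[ℝ] ℝ) => u'.2 u.1 + u.2 u'.1 - 2 * B u.1 u'.1)
      (Module.finrank ℝ E) (Module.finrank ℝ E) := by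
  let e := (Module.finBasis ℝ E).equivFun
  -- An auxiliary inner product `S`. On the graphs of `B + S` and `B - S`, viewed as maps from `E`
  -- to its dual, the form restricts to `2 S` and `-2 S`; these graphs are the two definite
  -- subspaces.
  let S : E →L[ℝ] E →L[ℝ] ℝ := bilinExt fun v w => ∑ i, e v i * e w i
  have hS : ∀ v w, S v w = ∑ i, e v i * e w i := bilinExt_apply
    (fun w => ⟨fun a b => by simp [add_mul, Finset.sum_add_distrib],
      fun c a => by simp [Finset.mul_sum, mul_assoc]⟩)
    (fun w => ⟨fun a b => by simp [mul_add, Finset.sum_add_distrib],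
      fun c a => by simp [Finset.mul_sum, mul_left_comm]⟩)
  have hpos : ∀ v, v ≠ 0 → 0 < S v v := by
    intro v hv
    rw [hS]
    have hne : e v ≠ 0 := fun h => hv (e.map_eq_zero_iff.1 h)
    obtain ⟨i, hi⟩ := Function.ne_iff.1 hne
    exact Finset.sum_pos' (fun i _ => mul_self_nonneg _) ⟨i, Finset.mem_univ _, mul_self_pos.2 hi⟩
  let g : (E →L[ℝ] E →L[ℝ] ℝ) → E →ₗ[ℝ] E × (E →L[ℝ] ℝ) := fun T => LinearMap.id.prod (T : E →ₗ[ℝ] _)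
  have hg : ∀ T, Module.finrank ℝ (LinearMap.range (g T)) = Module.finrank ℝ E := fun T =>
    LinearMap.finrank_range_of_inj fun a b hab => congrArg Prod.fst hab
  have hdual : Module.finrank ℝ (E →L[ℝ] ℝ) = Module.finrank ℝ E := by
    rw [← (LinearMap.toContinuousLinearMap (𝕜 := ℝ) (E := E) (F' := ℝ)).finrank_eq]
    exact Subspace.dual_finrank_eq
  refine ⟨⟨LinearMap.mk₂ ℝ (fun u u' : E × (E →L[ℝ] ℝ) => u'.2 u.1 + u.2 u'.1 - 2 * B u.1 u'.1)
    ?_ ?_ ?_ ?_, fun v w => rfl⟩, fun v w => ?_, LinearMap.range (g (B + S)),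
    LinearMap.range (g (B - S)), hg _, hg _, ?_, ?_, ?_⟩
  · intro a b c
    simp only [Prod.fst_add, Prod.snd_add, map_add, add_apply]
    ring
  · intro c a b
    simp only [Prod.smul_fst, Prod.smul_snd, map_smul, smul_apply, smul_eq_mul]
    ring
  · intro a b c
    simp only [Prod.fst_add, Prod.snd_add, map_add, add_apply]
    ring
  · intro c a b
    simp only [Prod.smul_fst, Prod.smul_snd, map_smul, smul_apply, smul_eq_mul]
    ring
  · simp only [hB v.1 w.1]
    ring
  · rw [Module.finrank_prod, hdual]
  · rintro _ ⟨v, rfl⟩ hv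
    have hv0 : v ≠ 0 := fun h => hv (by rw [h, map_zero])
    have h := hpos v hv0
    have hgv : g (B + S) v = (v, B v + S v) := rfl
    simp only [hgv, add_apply]
    linarith
  · rintro _ ⟨v, rfl⟩ hv
    have hv0 : v ≠ 0 := fun h => hv (by rw [h, map_zero])
    have h := hpos v hv0
    have hgv : g (B - S) v = (v, B v - S v) := rfl
    simp only [hgv, sub_apply]
    linarith

lemma hasSignature_pattersonWalker (D : TorsionFreeConnection I X) (ξ : CotangentSpace I X) :
    HasSignature (pattersonWalker D ξ) (Module.finrank ℝ E) (Module.finrank ℝ E) := by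
  have hz := chart_mem_target (I := I) (mem_chart_source H ξ.1)
  let B : E →L[ℝ] E →L[ℝ] ℝ :=
    (ContinuousLinearMap.compL ℝ E E ℝ (covectorRep ξ.1 ξ)) ∘L chrisL D.cov ξ.1 (extChartAt I ξ.1 ξ.1)
  have h := hasSignature_of_split B fun v w => congrArg (covectorRep ξ.1 ξ) (D.chrisL_symm hz v w)
  have he : (fun u u' : E × (E →L[ℝ] ℝ) => u'.2 u.1 + u.2 u'.1 - 2 * B u.1 u'.1) =
      pattersonWalker D ξ := by
    funext u u'
    have h1 : B u.1 u'.1 = ξ.2 (D.christoffelAt ξ.1 u.1 u'.1) :=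
      (covectorRep_self ξ _).trans
        (congrArg (fun y : E => ξ.2 y) (D.christoffelAt_eq ξ.1 u.1 u'.1).symm)
    rw [h1]
    rfl
  exact he ▸ h

lemma contDiffAt_coordPattersonWalker {G : E → E →L[ℝ] E →L[ℝ] E} {q : E × (E →L[ℝ] ℝ)} {k : ℕ∞ω}
    (hG : ContDiffAt ℝ k G q.1) (V W : E × (E →L[ℝ] ℝ)) :
    ContDiffAt ℝ k (fun q => coordPattersonWalker G q V W) q := by
  have h0 : ContDiffAt ℝ k (fun q : E × (E →L[ℝ] ℝ) => G q.1) q :=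
    ContDiffAt.comp (g := G) q hG contDiffAt_fst
  exact contDiffAt_const.sub (contDiffAt_const.mul
    (contDiffAt_snd.clm_apply (ContDiffAt.clm_apply₂ h0 V.1 W.1)))

lemma isPseudoRiemannian_pattersonWalker [T2Space X] (D : TorsionFreeConnection I X) :
    (pattersonWalker D).IsPseudoRiemannian (Module.finrank ℝ E) (Module.finrank ℝ E) := by
  refine ⟨hasSignature_pattersonWalker D, fun ξ₀ V W => ?_⟩
  have h : ContDiffOn ℝ ∞ (fun q => coordPattersonWalker (chrisL D.cov ξ₀.1) q V W)
      (extChartAt (I.prod 𝓘(ℝ, E →L[ℝ] ℝ)) ξ₀).target := fun q hq =>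
    (contDiffAt_coordPattersonWalker (D.contDiffAt_chrisL (cotangent_target hq)) V W).contDiffWithinAt
  exact h.congr fun q hq => by rw [coeff_pattersonWalker D hq]

/-- The Ricci tensor of the metric is the pullback of `Ric(v, w) + Ric(w, v)`. -/
lemma ricciFlat_pattersonWalker [T2Space X] {D : TorsionFreeConnection I X} (h : D.RicciFlat) :
    (pattersonWalker D).RicciFlat := by
  intro ξ V W
  have hξ := mem_chart_source H ξ.1
  have hz := chart_mem_target (I := I) hξ
  have hq := chart_mem_target (I := I.prod 𝓘(ℝ, E →L[ℝ] ℝ))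
    (mem_chart_source (ModelProd H (E →L[ℝ] ℝ)) ξ)
  have hq1 : (extChartAt (I.prod 𝓘(ℝ, E →L[ℝ] ℝ)) ξ ξ).1 = extChartAt I ξ.1 ξ.1 := by
    rw [cotangent_extChartAt hξ]
  have hM : ∀ᶠ q in 𝓝 (extChartAt (I.prod 𝓘(ℝ, E →L[ℝ] ℝ)) ξ ξ),
      (pattersonWalker D).coeff ξ q = coordPattersonWalker (chrisL D.cov ξ.1) q := by
    filter_upwards [eventually_target hq] with q hq
    exact coeff_pattersonWalker D hq
  rw [coordRicci_pattersonWalker (by rw [hq1]; exact (D.contDiffAt_chrisL hz).of_le two_le_infty)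
    (by
      rw [hq1]
      filter_upwards [eventually_target hz] with y hy
      exact D.chrisL_symm hy) hM, hq1, ← D.ricci_eq_coordRicci, ← D.ricci_eq_coordRicci]
  exact (congrArg₂ (fun a b : ℝ => a + b) (h ξ.1 V.1 W.1) (h ξ.1 W.1 V.1)).trans (add_zero 0)

end PattersonWalker

end ProjectiveAmbient

namespace ProjectiveAmbient

open Filter Topology

/-! ### The conformal class on the weighted cotangent bundle -/

section Weighted

variable {E : Type*} [NormedAddCommGroup E] [NormedSpace ℝ E] [FiniteDimensional ℝ E]
  {H : Type*} [TopologicalSpace H] {I : ModelWithCorners ℝ E H} [I.Boundaryless]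
  {X : Type*} [TopologicalSpace X] [ChartedSpace H X] [IsManifold I ∞ X]

/-- The components of a weighted covector in the chart at `x₀`. -/
def weightedRep {w : ℝ} (x₀ : X) (q : WeightedCotangentSpace I X w) : E →L[ℝ] ℝ :=
  (absJac I x₀ q.1 ^ (-w / (Module.finrank ℝ E + 1 : ℝ))) •
    (((densityCoord (w := w) (x := q.1)).toContinuousLinearMap ∘L q.2) ∘L dChartInv I x₀ q.1)

lemma weighted_mem_chart_source {w : ℝ} {q₀ q : WeightedCotangentSpace I X w} :
    q ∈ (chartAt (ModelProd H (E →L[ℝ] ℝ)) q₀).source ↔ q.1 ∈ (chartAt H q₀.1).source :=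
  totalSpace_mem_chart_source (by
    rw [hom_trivializationAt_baseSet]
    exact Set.inter_self _)

lemma weighted_trivializationAt {w : ℝ} {x₀ : X} {q : WeightedCotangentSpace I X w}
    (hq : q.1 ∈ (chartAt H x₀).source) :
    (trivializationAt (E →L[ℝ] ℝ) (fun x : X => TangentSpace I x →L[ℝ] Density I X w x) x₀ q).2 =
      weightedRep x₀ q := by
  rw [hom_trivializationAt_apply]
  change (Trivialization.continuousLinearMapAt ℝ (trivializationAt ℝ (Density I X w) x₀) q.1) ∘L _ = _
  ext v
  rw [ContinuousLinearMap.comp_apply]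
  have h := congrFun ((trivializationAt ℝ (Density I X w) x₀).coe_linearMapAt_of_mem
    (R := ℝ) (b := q.1) hq) (q.2 (dChartInv I x₀ q.1 v))
  exact h.trans (densityRep_eq x₀ _)

lemma weighted_extChartAt {w : ℝ} {q₀ q : WeightedCotangentSpace I X w}
    (h : q.1 ∈ (chartAt H q₀.1).source) :
    extChartAt (I.prod 𝓘(ℝ, E →L[ℝ] ℝ)) q₀ q = (extChartAt I q₀.1 q.1, weightedRep q₀.1 q) := by
  rw [totalSpace_extChartAt ?_, weighted_trivializationAt h]
  rw [hom_trivializationAt_baseSet]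
  exact ⟨h, h⟩

lemma weighted_target {w : ℝ} {q₀ : WeightedCotangentSpace I X w} {p : E × (E →L[ℝ] ℝ)}
    (hp : p ∈ (extChartAt (I.prod 𝓘(ℝ, E →L[ℝ] ℝ)) q₀).target) :
    p.1 ∈ (extChartAt I q₀.1).target := by
  have h := weighted_mem_chart_source.1 (chart_symm_mem hp)
  have hr := (extChartAt (I.prod 𝓘(ℝ, E →L[ℝ] ℝ)) q₀).right_inv hp
  rw [weighted_extChartAt h] at hr
  rw [← hr]
  exact chart_mem_target h

variable (s : Scale I X)

/-- The Jacobian factors `|det|^{-1/(n+1)}`, squared, and `|det|^{2/(n+1)}` cancel: this is why the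
weight `-2` pairs with `s²`. -/
lemma covectorRep_toCotangent {x₀ : X} {q : WeightedCotangentSpace I X (-2)}
    (h : q.1 ∈ (chartAt H x₀).source) :
    covectorRep x₀ (s.toCotangent q) = densityRep x₀ (s.val q.1) ^ 2 • weightedRep x₀ q := by
  have hpos := absJac_pos (I := I) h
  have e : (absJac I x₀ q.1 ^ (-1 / (Module.finrank ℝ E + 1 : ℝ))) ^ 2 *
      absJac I x₀ q.1 ^ (-(-2) / (Module.finrank ℝ E + 1 : ℝ)) = 1 := by
    rw [← Real.rpow_natCast, ← Real.rpow_mul hpos.le, ← Real.rpow_add hpos]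
    rw [show -1 / (Module.finrank ℝ E + 1 : ℝ) * ((2 : ℕ) : ℝ) + -(-2) / (Module.finrank ℝ E + 1 : ℝ)
      = 0 by push_cast; ring, Real.rpow_zero]
  rw [weightedRep, smul_smul, densityRep_eq, mul_pow, mul_right_comm, e, one_mul]
  rfl

/-- The coordinate representation of `q ↦ s² q`. -/
lemma Scale.toCotangent_chart {q₀ : WeightedCotangentSpace I X (-2)} {ξ₀ : CotangentSpace I X}
    (hξ : ξ₀.1 = q₀.1) {p : E × (E →L[ℝ] ℝ)}
    (hp : p ∈ (extChartAt (I.prod 𝓘(ℝ, E →L[ℝ] ℝ)) q₀).target) :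
    extChartAt (I.prod 𝓘(ℝ, E →L[ℝ] ℝ)) ξ₀
        (s.toCotangent ((extChartAt (I.prod 𝓘(ℝ, E →L[ℝ] ℝ)) q₀).symm p)) =
      (p.1, s.rep q₀.1 p.1 ^ 2 • p.2) := by
  have h := weighted_mem_chart_source.1 (chart_symm_mem hp)
  have hr := (extChartAt (I.prod 𝓘(ℝ, E →L[ℝ] ℝ)) q₀).right_inv hp
  rw [weighted_extChartAt h] at hr
  generalize (extChartAt (I.prod 𝓘(ℝ, E →L[ℝ] ℝ)) q₀).symm p = q at h hr
  subst hr
  rw [cotangent_extChartAt (by rw [hξ]; exact h), hξ, covectorRep_toCotangent s h, s.rep_apply h]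
  rfl

lemma Scale.contDiffAt_rep_sq_smul {x₀ : X} {p : E × (E →L[ℝ] ℝ)} (hp : p.1 ∈ (extChartAt I x₀).target) :
    ContDiffAt ℝ ∞ (fun p : E × (E →L[ℝ] ℝ) => s.rep x₀ p.1 ^ 2 • p.2) p := by
  have h0 : ContDiffAt ℝ ∞ (fun p : E × (E →L[ℝ] ℝ) => s.rep x₀ p.1) p :=
    ContDiffAt.comp (g := s.rep x₀) p (s.contDiffAt_rep hp) contDiffAt_fst
  exact (h0.pow 2).smul contDiffAt_snd

lemma Scale.contMDiff_toCotangent :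
    ContMDiff (I.prod 𝓘(ℝ, E →L[ℝ] ℝ)) (I.prod 𝓘(ℝ, E →L[ℝ] ℝ)) ∞ s.toCotangent := by
  intro q₀
  rw [contMDiffAt_totalSpace]
  refine ⟨contMDiffAt_proj _, ?_⟩
  have hq := mem_chart_source (ModelProd H (E →L[ℝ] ℝ)) q₀
  have hp := chart_mem_target (I := I.prod 𝓘(ℝ, E →L[ℝ] ℝ)) hq
  rw [contMDiffAt_iff_chart hq]
  refine (s.contDiffAt_rep_sq_smul (weighted_target hp)).congr_of_eventuallyEq ?_
  filter_upwards [eventually_target hp] with p hp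
  have h := congrArg Prod.snd (s.toCotangent_chart (q₀ := q₀) (ξ₀ := s.toCotangent q₀) rfl hp)
  have hm : (s.toCotangent ((extChartAt (I.prod 𝓘(ℝ, E →L[ℝ] ℝ)) q₀).symm p)).1 ∈
      (chartAt H (s.toCotangent q₀).1).source :=
    weighted_mem_chart_source.1 (chart_symm_mem hp)
  rw [cotangent_extChartAt hm] at h
  exact (cotangent_trivializationAt (s.toCotangent q₀).1
    (s.toCotangent ((extChartAt (I.prod 𝓘(ℝ, E →L[ℝ] ℝ)) q₀).symm p))).trans h

end Weighted

section ConformalRelation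

variable {E : Type*} [NormedAddCommGroup E] [NormedSpace ℝ E]
  {H : Type*} [TopologicalSpace H] {I : ModelWithCorners ℝ E H}
  {X : Type*} [TopologicalSpace X] [ChartedSpace H X]

lemma Tensor2.ConformallyRelated.symm {g g' : Tensor2 I X} (h : g.ConformallyRelated g') :
    g'.ConformallyRelated g := by
  obtain ⟨f, hf, h⟩ := h
  refine ⟨fun x => -f x, hf.neg, fun x v w => ?_⟩
  rw [h, ← mul_assoc, ← Real.exp_add, show 2 * -f x + 2 * f x = 0 by ring, Real.exp_zero, one_mul]

lemma Tensor2.ConformallyRelated.trans {g g' g'' : Tensor2 I X} (h : g.ConformallyRelated g')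
    (h' : g'.ConformallyRelated g'') : g.ConformallyRelated g'' := by
  obtain ⟨f, hf, h⟩ := h
  obtain ⟨f', hf', h'⟩ := h'
  refine ⟨fun x => f' x + f x, hf'.add hf, fun x v w => ?_⟩
  rw [h', h, ← mul_assoc, ← Real.exp_add, mul_add]

lemma Tensor2.ConformallyRelated.refl (g : Tensor2 I X) : g.ConformallyRelated g :=
  ⟨fun _ => 0, contMDiff_const, fun x v w => by rw [mul_zero, Real.exp_zero, one_mul]⟩

end ConformalRelation

section ConformalMetrics

variable {E : Type*} [NormedAddCommGroup E] [NormedSpace ℝ E] [FiniteDimensional ℝ E]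
  [CompleteSpace E]
  {H : Type*} [TopologicalSpace H] {I : ModelWithCorners ℝ E H} [I.Boundaryless]
  {X : Type*} [TopologicalSpace X] [ChartedSpace H X] [IsManifold I ∞ X] [T2Space X]

/-- The trace-free part of the Christoffel symbols. -/
def thomasSymbol (D : TorsionFreeConnection I X) (x₀ : X) (z : E) : E →L[ℝ] E →L[ℝ] E :=
  traceFree (chrisL D.cov x₀ z)

lemma contDiffAt_thomasSymbol (D : TorsionFreeConnection I X) {x₀ : X} {z : E}
    (hz : z ∈ (extChartAt I x₀).target) : ContDiffAt ℝ ∞ (thomasSymbol D x₀) z :=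
  (traceFree (E := E)).contDiff.contDiffAt.comp z (D.contDiffAt_chrisL hz)

/-- In coordinates, the metric on the weighted cotangent bundle is a multiple of the
Patterson-Walker metric of the trace-free part of the Christoffel symbols. -/
lemma weightedPattersonWalker_eq_chart {D₀ D : TorsionFreeConnection I X} {s : Scale I X}
    (hD : D₀.ProjectivelyRelated D) (hs : D.Preserves s)
    {q₀ q : WeightedCotangentSpace I X (-2)} (h : q.1 ∈ (chartAt H q₀.1).source)
    (u u' : TangentSpace (I.prod 𝓘(ℝ, E →L[ℝ] ℝ)) q) :
    weightedPattersonWalker s D q u u' = densityRep q₀.1 (s.val q.1) ^ 2 *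
      coordPattersonWalker (thomasSymbol D₀ q₀.1) (extChartAt (I.prod 𝓘(ℝ, E →L[ℝ] ℝ)) q₀ q)
        (dChart (I.prod 𝓘(ℝ, E →L[ℝ] ℝ)) q₀ q u) (dChart (I.prod 𝓘(ℝ, E →L[ℝ] ℝ)) q₀ q u') := by
  have hq := weighted_mem_chart_source.2 h
  have hp := chart_mem_target (I := I.prod 𝓘(ℝ, E →L[ℝ] ℝ)) hq
  have hz := chart_mem_target (I := I) h
  have hmd := (s.contMDiff_toCotangent q).mdifferentiableAt (by simp)
  have hξ : (s.toCotangent q).1 ∈ (chartAt H (s.toCotangent q₀).1).source := h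
  have hd := fun u => dChart_mfderiv hq (cotangent_mem_chart_source.2 hξ) hmd u
  have hev : (extChartAt (I.prod 𝓘(ℝ, E →L[ℝ] ℝ)) (s.toCotangent q₀) ∘ s.toCotangent ∘
      (extChartAt (I.prod 𝓘(ℝ, E →L[ℝ] ℝ)) q₀).symm)
      =ᶠ[𝓝 (extChartAt (I.prod 𝓘(ℝ, E →L[ℝ] ℝ)) q₀ q)]
      fun p : E × (E →L[ℝ] ℝ) => (p.1, s.rep q₀.1 p.1 ^ 2 • p.2) := by
    filter_upwards [eventually_target hp] with p hp
    exact s.toCotangent_chart (q₀ := q₀) rfl hp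
  have hrep := s.hasFDerivAt_rep hz
  have e1 : HasFDerivAt (fun p : E × (E →L[ℝ] ℝ) => s.rep q₀.1 p.1) _
      (extChartAt I q₀.1 q.1, weightedRep q₀.1 q) :=
    hasFDerivAt_comp_fst (P := s.rep q₀.1) hrep.differentiableAt
  have e2 : HasFDerivAt (fun p : E × (E →L[ℝ] ℝ) => (p.1, s.rep q₀.1 p.1 ^ 2 • p.2)) _
      (extChartAt I q₀.1 q.1, weightedRep q₀.1 q) := (hasFDerivAt_fst (𝕜 := ℝ) (p := (extChartAt I q₀.1 q.1, weightedRep q₀.1 q))).prodMk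
    ((e1.pow 2).smul hasFDerivAt_snd)
  unfold weightedPattersonWalker Tensor2.pullback
  rw [pattersonWalker_eq_chart D hξ, hd, hd, hev.fderiv_eq, weighted_extChartAt h, e2.fderiv,
    hrep.fderiv, cotangent_extChartAt hξ]
  generalize dChart (I.prod 𝓘(ℝ, E →L[ℝ] ℝ)) q₀ q u = V
  generalize dChart (I.prod 𝓘(ℝ, E →L[ℝ] ℝ)) q₀ q u' = W
  -- The derivative of `σ² p` contains `2 σ² β p`. Paired symmetrically with the base components, it
  -- cancels the contribution of `symProd β`, so that only `Π` survives.
  have hG : chrisL D.cov (s.toCotangent q₀).1 (extChartAt I (s.toCotangent q₀).1 (s.toCotangent q).1) =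
      thomasSymbol D₀ q₀.1 (extChartAt I q₀.1 q.1) + symProd (s.logDeriv q₀.1 (extChartAt I q₀.1 q.1)) :=
    hD.chrisL_eq hs hz
  have hc : covectorRep (s.toCotangent q₀).1 (s.toCotangent q) =
      densityRep q₀.1 (s.val q.1) ^ 2 • weightedRep q₀.1 q := covectorRep_toCotangent s h
  simp only [coordPattersonWalker, hG, hc, ← s.rep_apply h]
  simp only [ContinuousLinearMap.prod_apply, add_apply, smul_apply, symProd_apply, map_add, map_smul,
    ContinuousLinearMap.comp_apply, ContinuousLinearMap.coe_fst', ContinuousLinearMap.coe_snd',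
    ContinuousLinearMap.smulRight_apply, smul_eq_mul]
  rw [nsmul_eq_mul]
  push_cast
  ring

/-- Conformal factors between the metrics of two scales. -/
lemma weightedPattersonWalker_conformallyRelated {D₀ D D' : TorsionFreeConnection I X}
    {s s' : Scale I X} (hD : D₀.ProjectivelyRelated D) (hs : D.Preserves s)
    (hD' : D₀.ProjectivelyRelated D') (hs' : D'.Preserves s') :
    (weightedPattersonWalker s D).ConformallyRelated (weightedPattersonWalker s' D') := by
  refine ⟨fun q => Real.log (densityCoord (s'.val q.1)) - Real.log (densityCoord (s.val q.1)),
    fun q₀ => ?_, fun q u u' => ?_⟩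
  · have hq := mem_chart_source (ModelProd H (E →L[ℝ] ℝ)) q₀
    have hp := chart_mem_target (I := I.prod 𝓘(ℝ, E →L[ℝ] ℝ)) hq
    have hlog : ∀ s : Scale I X, ContDiffAt ℝ ∞
        (fun p : E × (E →L[ℝ] ℝ) => Real.log (s.rep q₀.1 p.1))
        (extChartAt (I.prod 𝓘(ℝ, E →L[ℝ] ℝ)) q₀ q₀) := fun s =>
      ContDiffAt.comp (g := fun z => Real.log (s.rep q₀.1 z)) _
        (s.contDiffAt_log_rep (weighted_target hp)) contDiffAt_fst
    rw [contMDiffAt_iff_chart hq]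
    refine ((hlog s').sub (hlog s)).congr_of_eventuallyEq ?_
    filter_upwards [eventually_target hp] with p hp
    have h := weighted_mem_chart_source.1 (chart_symm_mem hp)
    have hr := (extChartAt (I.prod 𝓘(ℝ, E →L[ℝ] ℝ)) q₀).right_inv hp
    rw [weighted_extChartAt h] at hr
    rw [Function.comp_apply]
    generalize (extChartAt (I.prod 𝓘(ℝ, E →L[ℝ] ℝ)) q₀).symm p = q at h hr
    subst hr
    -- `densityCoord` refers to the chart at the moving point and need not vary smoothly. In the
    -- difference of the logarithms the Jacobian factor drops out and only coefficients in the fixed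
    -- chart remain.
    have hj := Real.rpow_pos_of_pos (absJac_pos (I := I) h) (-1 / (Module.finrank ℝ E + 1 : ℝ))
    rw [s.rep_apply h, s'.rep_apply h, densityRep_eq, densityRep_eq,
      Real.log_mul hj.ne' (s.pos _).ne', Real.log_mul hj.ne' (s'.pos _).ne']
    ring
  · have h := mem_chart_source H q.1
    rw [weightedPattersonWalker_eq_chart hD hs h, weightedPattersonWalker_eq_chart hD' hs' h,
      densityRep_self, densityRep_self, ← mul_assoc]
    congr 1
    have e : ∀ s : Scale I X, densityCoord (s.val q.1) ^ 2 =
        Real.exp (2 * Real.log (densityCoord (s.val q.1))) := fun s => by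
      rw [two_mul, Real.exp_add, Real.exp_log (s.pos _), sq]
    rw [e, e, ← Real.exp_add]
    congr 1
    ring

lemma HasSignature.const_mul {V : Type*} [AddCommGroup V] [Module ℝ V] {B : V → V → ℝ} {p q : ℕ}
    (h : HasSignature B p q) {c : ℝ} (hc : 0 < c) : HasSignature (fun v w => c * B v w) p q := by
  obtain ⟨⟨b, hb⟩, hs, P, Q, hP, hQ, hpq, hpos, hneg⟩ := h
  exact ⟨⟨c • b, fun v w => by rw [LinearMap.smul_apply, LinearMap.smul_apply, hb, smul_eq_mul]⟩,
    fun v w => congrArg (c * ·) (hs v w), P, Q, hP, hQ, hpq, fun v hv h0 => mul_pos hc (hpos v hv h0),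
    fun v hv h0 => mul_neg_of_pos_of_neg hc (hneg v hv h0)⟩

lemma hasSignature_weightedPattersonWalker {D₀ D : TorsionFreeConnection I X}
    {s : Scale I X} (hD : D₀.ProjectivelyRelated D) (hs : D.Preserves s)
    (q : WeightedCotangentSpace I X (-2)) :
    HasSignature (weightedPattersonWalker s D q) (Module.finrank ℝ E) (Module.finrank ℝ E) := by
  have hx := mem_chart_source H q.1
  have hz := chart_mem_target (I := I) hx
  let B : E →L[ℝ] E →L[ℝ] ℝ := (ContinuousLinearMap.compL ℝ E E ℝ (weightedRep q.1 q)) ∘L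
    thomasSymbol D₀ q.1 (extChartAt I q.1 q.1)
  have h := (hasSignature_of_split B fun v w => congrArg (weightedRep q.1 q)
    (traceFree_symm (D₀.chrisL_symm hz) v w)).const_mul (pow_pos (s.pos q.1) 2)
  have he : (fun u u' : E × (E →L[ℝ] ℝ) => densityCoord (s.val q.1) ^ 2 *
      (u'.2 u.1 + u.2 u'.1 - 2 * B u.1 u'.1)) = weightedPattersonWalker s D q := by
    funext u u'
    have h1 := weightedPattersonWalker_eq_chart hD hs hx u u'
    have hself : ∀ u : TangentSpace (I.prod 𝓘(ℝ, E →L[ℝ] ℝ)) q,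
      dChart (I.prod 𝓘(ℝ, E →L[ℝ] ℝ)) q q u = (u : E × (E →L[ℝ] ℝ)) := dChart_self q
    rw [hself u, hself u', densityRep_self, weighted_extChartAt hx] at h1
    exact h1.symm
  exact he ▸ h

lemma isPseudoRiemannian_of_conformallyRelated {D₀ D : TorsionFreeConnection I X}
    {s : Scale I X} (hD : D₀.ProjectivelyRelated D) (hs : D.Preserves s)
    {g : Tensor2 (I.prod 𝓘(ℝ, E →L[ℝ] ℝ)) (WeightedCotangentSpace I X (-2))}
    (hg : (weightedPattersonWalker s D).ConformallyRelated g) :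
    g.IsPseudoRiemannian (Module.finrank ℝ E) (Module.finrank ℝ E) := by
  obtain ⟨f, hf, hg⟩ := hg
  refine ⟨fun q => ?_, fun q₀ V W p hp => ?_⟩
  · have he : (fun u u' => Real.exp (2 * f q) * weightedPattersonWalker s D q u u') = g q := by
      funext u u'
      rw [hg]
    exact he ▸ (hasSignature_weightedPattersonWalker hD hs q).const_mul (Real.exp_pos _)
  · refine ContDiffAt.contDiffWithinAt ?_
    have hq := chart_symm_mem hp
    have hfp := (contMDiffAt_iff_chart hq).1 (hf.contMDiffAt)
    rw [(extChartAt (I.prod 𝓘(ℝ, E →L[ℝ] ℝ)) q₀).right_inv hp] at hfp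
    have hrep : ContDiffAt ℝ ∞ (fun p : E × (E →L[ℝ] ℝ) => s.rep q₀.1 p.1) p :=
      ContDiffAt.comp (g := s.rep q₀.1) p (s.contDiffAt_rep (weighted_target hp)) contDiffAt_fst
    refine (((contDiffAt_const (c := (2 : ℝ))).mul hfp).exp.mul ((hrep.pow 2).mul
      (contDiffAt_coordPattersonWalker (contDiffAt_thomasSymbol D₀ (weighted_target hp)) V
        W))).congr_of_eventuallyEq ?_
    filter_upwards [eventually_target hp] with p hp
    have hq := chart_symm_mem hp
    have h := weighted_mem_chart_source.1 hq
    have hr := (extChartAt (I.prod 𝓘(ℝ, E →L[ℝ] ℝ)) q₀).right_inv hp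
    have hr1 : extChartAt I q₀.1 ((extChartAt (I.prod 𝓘(ℝ, E →L[ℝ] ℝ)) q₀).symm p).1 = p.1 := by
      rw [weighted_extChartAt h] at hr
      exact congrArg Prod.fst hr
    unfold Tensor2.coeff
    rw [hg, weightedPattersonWalker_eq_chart hD hs h, dChart_constField hq, dChart_constField hq, hr,
      ← s.rep_apply h, hr1]
    rfl

lemma weightedPattersonWalker_mem {D₀ D : TorsionFreeConnection I X}
    {s : Scale I X} (hD : D₀.ProjectivelyRelated D) (hs : D.Preserves s) :
    weightedPattersonWalker s D ∈ conformalPattersonWalker D₀ :=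
  ⟨s, D, hD, hs, Tensor2.ConformallyRelated.refl _⟩

lemma isConformalStructure_conformalPattersonWalker [SigmaCompactSpace X]
    (D₀ : TorsionFreeConnection I X) :
    IsConformalStructure (conformalPattersonWalker D₀) (Module.finrank ℝ E)
      (Module.finrank ℝ E) := by
  refine ⟨?_, ?_, ?_⟩
  · obtain ⟨s⟩ := nonempty_scale (I := I) (X := X)
    exact ⟨_, weightedPattersonWalker_mem (D₀.projectivelyRelated_ofScale s) (D₀.ofScale_preserves s)⟩
  · rintro g ⟨s, D, hD, hs, hg⟩
    exact isPseudoRiemannian_of_conformallyRelated hD hs hg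
  · rintro g ⟨s, D, hD, hs, hg⟩ g'
    constructor
    · rintro ⟨s', D', hD', hs', hg'⟩
      exact hg.symm.trans ((weightedPattersonWalker_conformallyRelated hD hs hD' hs').trans hg')
    · intro h
      exact ⟨s, D, hD, hs, hg.trans h⟩

end ConformalMetrics

end ProjectiveAmbient

namespace ProjectiveAmbient

open Filter Topology

/-! ### The Thomas cone in charts -/

section Cone

variable {E : Type*} [NormedAddCommGroup E] [NormedSpace ℝ E] [FiniteDimensional ℝ E]
  {H : Type*} [TopologicalSpace H] {I : ModelWithCorners ℝ E H} [I.Boundaryless]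
  {X : Type*} [TopologicalSpace X] [ChartedSpace H X] [IsManifold I ∞ X]

/-- Points of one fibre are separated in a trivialization, others over the base. The cone thus
qualifies as a base manifold for the results on connections and cotangent bundles. -/
instance totalSpace_t2Space {F : Type*} [TopologicalSpace F] [T2Space F] {V : X → Type*}
    [TopologicalSpace (TotalSpace F V)] [∀ x, TopologicalSpace (V x)] [FiberBundle F V]
    [T2Space X] : T2Space (TotalSpace F V) := by
  refine ⟨fun a b hab => ?_⟩
  by_cases h : a.1 = b.1
  · let e := trivializationAt F V a.1
    have ha : a ∈ e.source := FiberBundle.mem_trivializationAt_proj_source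
    have hb : b ∈ e.source := by
      rw [Trivialization.mem_source, ← h]
      exact FiberBundle.mem_baseSet_trivializationAt' a.1
    have hne : e a ≠ e b := fun h => hab (e.injOn ha hb h)
    obtain ⟨u, v, hu, hv, hau, hbv, huv⟩ := t2_separation hne
    exact ⟨e.source ∩ e ⁻¹' u, e.source ∩ e ⁻¹' v,
      e.continuousOn.isOpen_inter_preimage e.open_source hu,
      e.continuousOn.isOpen_inter_preimage e.open_source hv, ⟨ha, hau⟩, ⟨hb, hbv⟩,
      (huv.preimage e).mono Set.inter_subset_right Set.inter_subset_right⟩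
  · exact separated_by_continuous (FiberBundle.continuous_proj F V) h

lemma cone_mem_chart_source {c₀ c : thomasCone I X} :
    c ∈ (chartAt (ModelProd H ℝ) c₀).source ↔ c.1.1 ∈ (chartAt H c₀.1.1).source := by
  rw [TopologicalSpace.Opens.chartAt_eq, OpenPartialHomeomorph.subtypeRestr_source]
  exact totalSpace_mem_chart_source rfl

lemma cone_extChartAt {c₀ c : thomasCone I X} (h : c.1.1 ∈ (chartAt H c₀.1.1).source) :
    extChartAt (I.prod 𝓘(ℝ, ℝ)) c₀ c = (extChartAt I c₀.1.1 c.1.1, densityRep c₀.1.1 c.1.2) := by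
  have hb : c.1.1 ∈ (trivializationAt ℝ (Density I X 1) c₀.1.1).baseSet := h
  rw [densityRep, ← totalSpace_extChartAt hb]
  simp only [extChartAt, TopologicalSpace.Opens.chartAt_eq]
  rfl

lemma coneRep_pos {x₀ : X} {c : thomasCone I X} (h : c.1.1 ∈ (chartAt H x₀).source) :
    0 < densityRep x₀ c.1.2 :=
  densityRep_pos h c.2

lemma cone_target {c₀ : thomasCone I X} {p : E × ℝ}
    (hp : p ∈ (extChartAt (I.prod 𝓘(ℝ, ℝ)) c₀).target) :
    p.1 ∈ (extChartAt I c₀.1.1).target ∧ 0 < p.2 := by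
  have h := cone_mem_chart_source.1 (chart_symm_mem hp)
  have hr := (extChartAt (I.prod 𝓘(ℝ, ℝ)) c₀).right_inv hp
  rw [cone_extChartAt h] at hr
  rw [← hr]
  exact ⟨chart_mem_target h, coneRep_pos h⟩

variable (I) in
/-- The transition function of the density bundle of weight one. -/
def densityJac (x₁ x₀ : X) (z : E) : ℝ :=
  |(transitionJ I x₁ x₀ z).det| ^ (-1 / (Module.finrank ℝ E + 1 : ℝ))

lemma densityJac_pos {x₁ x₀ x : X} (h1 : x ∈ (chartAt H x₁).source)
    (h0 : x ∈ (chartAt H x₀).source) : 0 < densityJac I x₁ x₀ (extChartAt I x₁ x) :=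
  Real.rpow_pos_of_pos (abs_pos.2 (det_transitionJ_ne_zero h1 h0)) _

/-- The logarithmic derivative of the transition function of the density bundle. -/
def logJac (I : ModelWithCorners ℝ E H) [IsManifold I ∞ X] (x₁ x₀ : X) (z : E) : E →L[ℝ] ℝ :=
  fderiv ℝ (fun y => Real.log (densityJac I x₁ x₀ y)) z

lemma contDiffAt_log_densityJac {x₁ x₀ x : X} (h1 : x ∈ (chartAt H x₁).source)
    (h0 : x ∈ (chartAt H x₀).source) :
    ContDiffAt ℝ ∞ (fun y => Real.log (densityJac I x₁ x₀ y)) (extChartAt I x₁ x) := by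
  have hd := det_transitionJ_ne_zero (I := I) h1 h0
  have h : ContDiffAt ℝ ∞ (fun y => (transitionJ I x₁ x₀ y).det) (extChartAt I x₁ x) :=
    contDiff_det_clm.contDiffAt.comp _ (contDiffAt_transitionJ h1 h0)
  exact (((h.abs hd).rpow_const_of_ne (abs_ne_zero.2 hd))).log (densityJac_pos h1 h0).ne'

lemma hasFDerivAt_densityJac {x₁ x₀ x : X} (h1 : x ∈ (chartAt H x₁).source)
    (h0 : x ∈ (chartAt H x₀).source) :
    HasFDerivAt (densityJac I x₁ x₀) (densityJac I x₁ x₀ (extChartAt I x₁ x) •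
      logJac I x₁ x₀ (extChartAt I x₁ x)) (extChartAt I x₁ x) := by
  have hd := det_transitionJ_ne_zero (I := I) h1 h0
  have h : ContDiffAt ℝ ∞ (fun y => (transitionJ I x₁ x₀ y).det) (extChartAt I x₁ x) :=
    contDiff_det_clm.contDiffAt.comp _ (contDiffAt_transitionJ h1 h0)
  have h2 : ContDiffAt ℝ ∞ (densityJac I x₁ x₀) (extChartAt I x₁ x) :=
    (h.abs hd).rpow_const_of_ne (abs_ne_zero.2 hd)
  have h3 := (h2.differentiableAt (by simp)).hasFDerivAt
  have hne := (densityJac_pos (I := I) h1 h0).ne'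
  have h4 := (h3.log hne).fderiv
  refine h3.congr_fderiv ?_
  rw [logJac, h4, smul_smul, mul_inv_cancel₀ hne, one_smul]

lemma contDiffAt_logJac {x₁ x₀ x : X} (h1 : x ∈ (chartAt H x₁).source)
    (h0 : x ∈ (chartAt H x₀).source) :
    ContDiffAt ℝ ∞ (logJac I x₁ x₀) (extChartAt I x₁ x) :=
  (contDiffAt_log_densityJac h1 h0).fderiv_right (by simp)

lemma fderiv_logJac_symm {x₁ x₀ x : X} (h1 : x ∈ (chartAt H x₁).source)
    (h0 : x ∈ (chartAt H x₀).source) (v w : E) :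
    fderiv ℝ (logJac I x₁ x₀) (extChartAt I x₁ x) v w =
      fderiv ℝ (logJac I x₁ x₀) (extChartAt I x₁ x) w v :=
  (contDiffAt_log_densityJac (I := I) h1 h0).isSymmSndFDerivAt (by simpa using two_le_infty) v w

lemma logJac_apply {x₁ x₀ x : X} (h1 : x ∈ (chartAt H x₁).source)
    (h0 : x ∈ (chartAt H x₀).source) (v : E) :
    logJac I x₁ x₀ (extChartAt I x₁ x) v = -(Module.finrank ℝ E + 1 : ℝ)⁻¹ *
      trL (transitionJ I x₀ x₁ (extChartAt I x₀ x) ∘L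
        fderiv ℝ (transitionJ I x₁ x₀) (extChartAt I x₁ x) v) := by
  have hJd : HasFDerivAt (transitionJ I x₁ x₀) (fderiv ℝ (transitionJ I x₁ x₀) (extChartAt I x₁ x))
      (extChartAt I x₁ x) := ((contDiffAt_transitionJ h1 h0).differentiableAt (by simp)).hasFDerivAt
  have hdet := hasFDerivAt_det hJd (transitionJ_comp h1 h0) (transitionJ_comp h0 h1)
  have hne := det_transitionJ_ne_zero (I := I) h1 h0
  have hlog := (hdet.log hne).const_mul (-(Module.finrank ℝ E + 1 : ℝ)⁻¹)
  have he : (fun y => Real.log (densityJac I x₁ x₀ y)) =ᶠ[𝓝 (extChartAt I x₁ x)]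
      fun y => -(Module.finrank ℝ E + 1 : ℝ)⁻¹ * Real.log (transitionJ I x₁ x₀ y).det := by
    filter_upwards [hdet.continuousAt.eventually_ne hne] with y hy
    rw [densityJac, Real.log_rpow (abs_pos.2 hy), Real.log_abs]
    ring
  rw [logJac, (hlog.congr_of_eventuallyEq he).fderiv]
  simp only [smul_apply, smul_eq_mul, ContinuousLinearMap.comp_apply]
  rw [inv_mul_cancel_left₀ hne]
  rfl

lemma cone_transition {c₁ c₀ c : thomasCone I X}
    (h1 : c.1.1 ∈ (chartAt H c₁.1.1).source) (h0 : c.1.1 ∈ (chartAt H c₀.1.1).source) :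
    transition (I.prod 𝓘(ℝ, ℝ)) c₁ c₀ =ᶠ[𝓝 (extChartAt (I.prod 𝓘(ℝ, ℝ)) c₁ c)]
      fun p : E × ℝ => (transition I c₁.1.1 c₀.1.1 p.1, densityJac I c₁.1.1 c₀.1.1 p.1 * p.2) := by
  have h1' := cone_mem_chart_source.2 h1
  have h0' := cone_mem_chart_source.2 h0
  filter_upwards [eventually_target (chart_mem_target (I := I.prod 𝓘(ℝ, ℝ)) h1'),
    eventually_chart_symm h1' (eventually_mem_source h0')] with q hq hq0
  have hq1 := chart_symm_mem hq
  have hr := (extChartAt (I.prod 𝓘(ℝ, ℝ)) c₁).right_inv hq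
  rw [cone_mem_chart_source] at hq0 hq1
  rw [transition, Function.comp_apply, cone_extChartAt hq0, densityRep_transition hq1 hq0]
  rw [cone_extChartAt hq1] at hr
  generalize (extChartAt (I.prod 𝓘(ℝ, ℝ)) c₁).symm q = η at hq0 hq1 hr ⊢
  subst hr
  rw [transition_apply hq1]
  rfl

/-- The transition map is `(z, y) ↦ (φ(z), j(z) y)`, and `dj = j d log j`. -/
lemma transitionJ_cone {c₁ c₀ c : thomasCone I X}
    (h1 : c.1.1 ∈ (chartAt H c₁.1.1).source) (h0 : c.1.1 ∈ (chartAt H c₀.1.1).source)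
    (V : E × ℝ) :
    transitionJ (I.prod 𝓘(ℝ, ℝ)) c₁ c₀ (extChartAt (I.prod 𝓘(ℝ, ℝ)) c₁ c) V =
      (transitionJ I c₁.1.1 c₀.1.1 (extChartAt I c₁.1.1 c.1.1) V.1,
        densityJac I c₁.1.1 c₀.1.1 (extChartAt I c₁.1.1 c.1.1) *
          (V.2 + densityRep c₁.1.1 c.1.2 * logJac I c₁.1.1 c₀.1.1 (extChartAt I c₁.1.1 c.1.1) V.1)) := by
  have hφ := hasFDerivAt_transition (I := I) h1 h0
  have hj := hasFDerivAt_densityJac (I := I) h1 h0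
  rw [transitionJ, (cone_transition h1 h0).fderiv_eq, cone_extChartAt h1]
  have e1 : HasFDerivAt (fun q : E × ℝ => transition I c₁.1.1 c₀.1.1 q.1) _
      (extChartAt I c₁.1.1 c.1.1, densityRep c₁.1.1 c.1.2) :=
    hasFDerivAt_comp_fst (P := transition I c₁.1.1 c₀.1.1) hφ.differentiableAt
  have e2 : HasFDerivAt (fun q : E × ℝ => densityJac I c₁.1.1 c₀.1.1 q.1) _
      (extChartAt I c₁.1.1 c.1.1, densityRep c₁.1.1 c.1.2) :=
    hasFDerivAt_comp_fst (P := densityJac I c₁.1.1 c₀.1.1) hj.differentiableAt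
  have e3 : HasFDerivAt (fun p : E × ℝ => (transition I c₁.1.1 c₀.1.1 p.1,
      densityJac I c₁.1.1 c₀.1.1 p.1 * p.2)) _ (extChartAt I c₁.1.1 c.1.1, densityRep c₁.1.1 c.1.2) :=
    e1.prodMk (e2.mul hasFDerivAt_snd)
  rw [e3.fderiv, hφ.fderiv, hj.fderiv]
  refine Prod.ext rfl ?_
  simp only [ContinuousLinearMap.prod_apply, add_apply, smul_apply, ContinuousLinearMap.comp_apply,
    ContinuousLinearMap.coe_fst', ContinuousLinearMap.coe_snd', smul_eq_mul]
  ring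

/-- Transitions are linear on the fibres, and such maps preserve the radial field `y ∂_y`. -/
lemma dChart_eulerField {c₀ c : thomasCone I X} (h : c.1.1 ∈ (chartAt H c₀.1.1).source) :
    dChart (I.prod 𝓘(ℝ, ℝ)) c₀ c (eulerField c) = ((0, densityRep c₀.1.1 c.1.2) : E × ℝ) := by
  have hx := mem_chart_source H c.1.1
  rw [← transitionJ_dChart (cone_mem_chart_source.2 hx) (cone_mem_chart_source.2 h)]
  have hself : dChart (I.prod 𝓘(ℝ, ℝ)) c c (eulerField c) = ((0, densityCoord c.1.2) : E × ℝ) :=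
    dChart_self c _
  rw [hself, transitionJ_cone hx h, map_zero, map_zero, mul_zero, add_zero,
    densityRep_transition hx h c.1.2, densityRep_self]
  rfl

/-- All tangent spaces are the model space, so a vector can be carried along an equality of base
points; `coneSection_fibreCoord` is such an equality, not a definitional one. -/
lemma dChart_congr {x₀ x x' : X} (h : x' = x) (u : E) :
    dChart I x₀ x' u = dChart I x₀ x u := by
  subst h
  rfl

namespace Scale

variable (s : Scale I X)

lemma coneSection_fibreCoord (c : thomasCone I X) :
    s.coneSection (s.fibreCoord c) c.1.1 = c := by
  refine Subtype.ext ?_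
  have h : (densityCoord c.1.2 / densityCoord (s.val c.1.1)) • s.val c.1.1 = c.1.2 := by
    refine densityCoord.injective ?_
    rw [map_smul, smul_eq_mul, div_mul_cancel₀ _ (s.pos _).ne']
  exact congrArg (fun v => (⟨c.1.1, v⟩ : TotalSpace ℝ (Density I X 1))) h

lemma contMDiff_coneSection (t : PosReal) :
    ContMDiff I (I.prod 𝓘(ℝ, ℝ)) ∞ (s.coneSection t) := by
  rw [← ContMDiff.subtypeVal_comp_iff]
  exact fun x => (contMDiffAt_const (c := (t : ℝ))).smul_section (s.smooth x)

lemma densityRep_smul {w : ℝ} (x₀ : X) {x : X} (a : ℝ) (d : Density I X w x) :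
    densityRep x₀ (a • d) = a * densityRep x₀ d := by
  rw [densityRep_eq, densityRep_eq, map_smul, smul_eq_mul]
  ring

lemma fibreCoord_mul_densityRep {x₀ : X} {c : thomasCone I X} :
    (s.fibreCoord c : ℝ) * densityRep x₀ (s.val c.1.1) = densityRep x₀ c.1.2 := by
  rw [densityRep_eq, densityRep_eq]
  change densityCoord c.1.2 / densityCoord (s.val c.1.1) * _ = _
  rw [mul_left_comm, div_mul_cancel₀ _ (s.pos _).ne']

lemma coneSection_chart {c₀ : thomasCone I X} (t : PosReal) {x : X}
    (h : x ∈ (chartAt H c₀.1.1).source) :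
    extChartAt (I.prod 𝓘(ℝ, ℝ)) c₀ (s.coneSection t x) =
      (extChartAt I c₀.1.1 x, (t : ℝ) * densityRep c₀.1.1 (s.val x)) := by
  rw [← densityRep_smul]
  exact cone_extChartAt (c := s.coneSection t x) h

/-- In the chart the section is `z ↦ (z, t σ(z))`, with derivative `(v, t σ β(v))`, and `t σ` is the
fibre coordinate of `c`. -/
lemma dChart_lift {c₀ c : thomasCone I X} (h : c.1.1 ∈ (chartAt H c₀.1.1).source)
    (v : TangentSpace I c.1.1) :
    dChart (I.prod 𝓘(ℝ, ℝ)) c₀ c (s.lift c v) = ((dChart I c₀.1.1 c.1.1 v,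
      densityRep c₀.1.1 c.1.2 * s.logDeriv c₀.1.1 (extChartAt I c₀.1.1 c.1.1)
        (dChart I c₀.1.1 c.1.1 v)) : E × ℝ) := by
  let t := s.fibreCoord c
  have hmd := (s.contMDiff_coneSection t c.1.1).mdifferentiableAt (by simp)
  have hc : s.coneSection t c.1.1 = c := s.coneSection_fibreCoord c
  have hy : s.coneSection t c.1.1 ∈ (chartAt (ModelProd H ℝ) c₀).source := by
    rw [hc]
    exact cone_mem_chart_source.2 h
  have h1 := dChart_mfderiv h hy hmd v
  have h2 := (dChart_congr (I := I.prod 𝓘(ℝ, ℝ)) (x₀ := c₀) hc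
    (mfderiv I (I.prod 𝓘(ℝ, ℝ)) (s.coneSection t) c.1.1 v)).symm
  change dChart (I.prod 𝓘(ℝ, ℝ)) c₀ c (mfderiv I (I.prod 𝓘(ℝ, ℝ)) (s.coneSection t) c.1.1 v) = _
  have hz := chart_mem_target (I := I) h
  have he : (extChartAt (I.prod 𝓘(ℝ, ℝ)) c₀ ∘ s.coneSection t ∘ (extChartAt I c₀.1.1).symm)
      =ᶠ[𝓝 (extChartAt I c₀.1.1 c.1.1)] fun z => (z, (t : ℝ) * s.rep c₀.1.1 z) := by
    filter_upwards [eventually_target hz] with z hz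
    have hzm := chart_symm_mem hz
    have hr := (extChartAt I c₀.1.1).right_inv hz
    simp only [Function.comp_apply]
    rw [s.coneSection_chart t hzm, hr]
    rfl
  have hd := (hasFDerivAt_id (𝕜 := ℝ) (extChartAt I c₀.1.1 c.1.1)).prodMk
    ((s.hasFDerivAt_rep hz).const_mul (t : ℝ))
  rw [h2, h1, (hd.congr_of_eventuallyEq he).fderiv]
  refine Prod.ext rfl ?_
  simp only [ContinuousLinearMap.prod_apply, smul_apply, smul_eq_mul]
  rw [← mul_assoc, s.rep_apply h, s.fibreCoord_mul_densityRep]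

end Scale

end Cone

end ProjectiveAmbient

namespace ProjectiveAmbient

open Filter Topology

/-! ### Connections from compatible families of symbols -/

section Symbols

variable {E : Type*} [NormedAddCommGroup E] [NormedSpace ℝ E] [FiniteDimensional ℝ E]
  {H : Type*} [TopologicalSpace H] {I : ModelWithCorners ℝ E H} [I.Boundaryless]
  {X : Type*} [TopologicalSpace X] [ChartedSpace H X] [IsManifold I ∞ X]

/-- The covariant derivative whose Christoffel symbols at `x` in the chart at `x` are `G x`. -/
def covOfSymbols (G : X → E →L[ℝ] E →L[ℝ] E) : AffineDerivative I X where
  toFun Y x :=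
    (fderiv ℝ (localRep x Y) (extChartAt I x x) + (G x).flip (localRep x Y (extChartAt I x x)) :
      E →L[ℝ] E)
  -- At each `x` only the chart at `x` is used, so the Leibniz rule needs no compatibility between
  -- charts; compatibility matters only for smoothness.
  isCovariantDerivativeOnUniv := by
    refine ⟨fun {σ σ' x} hσ hσ' _ => ?_, fun {σ g x} hσ hg _ => ?_⟩
    · have hx := mem_chart_source H x
      have h2 := ((mdifferentiableAt_field_iff hx).1 hσ).hasFDerivAt.add
        ((mdifferentiableAt_field_iff hx).1 hσ').hasFDerivAt
      have h3 : localRep x (σ + σ') = localRep x σ + localRep x σ' :=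
        funext (localRep_add σ σ')
      refine ContinuousLinearMap.ext fun v : E => ?_
      change (fderiv ℝ (localRep x (σ + σ')) (extChartAt I x x) v
        + G x v (localRep x (σ + σ') (extChartAt I x x)) : E) =
        (fderiv ℝ (localRep x σ) (extChartAt I x x) v + G x v (localRep x σ (extChartAt I x x)))
        + (fderiv ℝ (localRep x σ') (extChartAt I x x) v
          + G x v (localRep x σ' (extChartAt I x x)))
      rw [h3, h2.fderiv, Pi.add_apply, map_add, add_apply]
      abel
    · have hx := mem_chart_source H x
      have h2 := ((mdifferentiableAt_iff_chart hx).1 hg).hasFDerivAt.smul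
        ((mdifferentiableAt_field_iff hx).1 hσ).hasFDerivAt
      have h3 : localRep x (g • σ) = (g ∘ (extChartAt I x).symm) • localRep x σ :=
        funext (localRep_smul g σ)
      refine ContinuousLinearMap.ext fun v : TangentSpace I x => ?_
      have hd : (mfderiv I 𝓘(ℝ, ℝ) g x v : ℝ) =
          fderiv ℝ (g ∘ (extChartAt I x).symm) (extChartAt I x x) v :=
        (mfderiv_eq_chart hx hg v).trans (congrArg
          (fun u : E => fderiv ℝ (g ∘ (extChartAt I x).symm) (extChartAt I x x) u) (dChart_self x v))
      have hs : localRep x σ (extChartAt I x x) = σ x :=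
        (localRep_apply hx σ).trans (dChart_self x (σ x))
      have key : ∀ (v : E), (fderiv ℝ (localRep x (g • σ)) (extChartAt I x x) v
        + G x v (localRep x (g • σ) (extChartAt I x x)) : E) =
        g x • (fderiv ℝ (localRep x σ) (extChartAt I x x) v
          + G x v (localRep x σ (extChartAt I x x)))
        + (fderiv ℝ (g ∘ (extChartAt I x).symm) (extChartAt I x x) v) •
          localRep x σ (extChartAt I x x) := by
        intro v
        rw [h3, h2.fderiv, Pi.smul_apply', map_smul]
        simp only [add_apply, smul_apply, ContinuousLinearMap.smulRight_apply, Function.comp_apply,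
          chart_left_inv hx]
        module
      refine (key v).trans ?_
      exact congrArg₂ (fun (d : ℝ) (y : E) => g x • (fderiv ℝ (localRep x σ) (extChartAt I x x) v
          + G x v (localRep x σ (extChartAt I x x))) + d • y) hd.symm hs

lemma chrisL_covOfSymbols_self (G : X → E →L[ℝ] E →L[ℝ] E) (x : X) :
    chrisL (covOfSymbols (I := I) G) x (extChartAt I x x) = G x := by
  have hx := mem_chart_source H x
  ext v w
  rw [chrisL_apply _ (chart_mem_target hx), chris_apply _ hx]
  have h0 : fderiv ℝ (localRep x (constField (I := I) x w)) (extChartAt I x x) = 0 := by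
    rw [(localRep_constField_eventuallyEq _ (chart_mem_target hx)).fderiv_eq]
    simp
  have h1 : localRep x (constField (I := I) x w) (extChartAt I x x) = w :=
    localRep_constField x w (chart_mem_target hx)
  have h2 : ∀ u : E, covOfSymbols (I := I) G (constField x w) x u = G x u w := by
    intro u
    change (fderiv ℝ (localRep x (constField (I := I) x w)) (extChartAt I x x) u
        + G x u (localRep x (constField (I := I) x w) (extChartAt I x x)) : E) = _
    rw [h0, h1, zero_apply, zero_add]
  refine (dChart_self x _).trans ((h2 _).trans ?_)
  exact congrArg (fun u : E => G x u w) (constField_self x v)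

/-- The transformation law of Christoffel symbols, for a family of fields of bilinear maps. -/
structure IsSymbolFamily (S : X → E → E →L[ℝ] E →L[ℝ] E) (I : ModelWithCorners ℝ E H)
    [IsManifold I ∞ X] : Prop where
  transition : ∀ {x₁ x₀ x : X}, x ∈ (chartAt H x₁).source → x ∈ (chartAt H x₀).source →
    ∀ v w, transitionJ I x₁ x₀ (extChartAt I x₁ x) (S x₁ (extChartAt I x₁ x) v w) =
      S x₀ (extChartAt I x₀ x) (transitionJ I x₁ x₀ (extChartAt I x₁ x) v)
          (transitionJ I x₁ x₀ (extChartAt I x₁ x) w) +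
        fderiv ℝ (transitionJ I x₁ x₀) (extChartAt I x₁ x) v w
  contDiffAt : ∀ {x₀ : X} {z : E}, z ∈ (extChartAt I x₀).target → ContDiffAt ℝ ∞ (S x₀) z
  symm : ∀ {x₀ : X} {z : E}, z ∈ (extChartAt I x₀).target → ∀ v w, S x₀ z v w = S x₀ z w v

/-- Both sides obey the same transformation law and agree at the centre of every chart. -/
lemma IsSymbolFamily.chrisL_eq {S : X → E → E →L[ℝ] E →L[ℝ] E} (hS : IsSymbolFamily S I)
    {x₀ : X} {z : E} (hz : z ∈ (extChartAt I x₀).target) :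
    chrisL (covOfSymbols (I := I) fun x => S x (extChartAt I x x)) x₀ z = S x₀ z := by
  obtain ⟨x, hx, rfl⟩ : ∃ x, x ∈ (chartAt H x₀).source ∧ extChartAt I x₀ x = z :=
    ⟨_, chart_symm_mem hz, (extChartAt I x₀).right_inv hz⟩
  have hxx := mem_chart_source H x
  have h4 := fun v => congrArg (fun L : E →L[ℝ] E => L v) (transitionJ_comp (I := I) hx hxx)
  simp only [ContinuousLinearMap.comp_apply, ContinuousLinearMap.id_apply] at h4
  ext v w
  rw [← h4 (chrisL _ _ _ v w), ← h4 (S x₀ _ v w), chrisL_transition _ hx hxx,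
    hS.transition hx hxx, chrisL_covOfSymbols_self]

/-- The torsion-free connection with given Christoffel symbols. -/
def IsSymbolFamily.connection [CompleteSpace E] {S : X → E → E →L[ℝ] E →L[ℝ] E}
    (hS : IsSymbolFamily S I) : TorsionFreeConnection I X where
  cov := covOfSymbols fun x => S x (extChartAt I x x)
  smooth := contMDiffCovariantDerivative_of_chris _ fun x₀ => by
    have hz := chart_mem_target (I := I) (mem_chart_source H x₀)
    refine (hS.contDiffAt hz).congr_of_eventuallyEq ?_
    filter_upwards [eventually_target hz] with z hz
    exact hS.chrisL_eq hz
  torsion_eq_zero := torsion_eq_zero_of_symm _ fun x v w => by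
    have hz := chart_mem_target (I := I) (mem_chart_source H x)
    rw [hS.chrisL_eq hz]
    exact hS.symm hz v w

end Symbols

end ProjectiveAmbient

namespace ProjectiveAmbient

open Filter Topology

/-! ### The projectively invariant symbols `Π` and `P` -/

section ThomasSymbol

variable {E : Type*} [NormedAddCommGroup E] [NormedSpace ℝ E] [FiniteDimensional ℝ E]
  [CompleteSpace E]
  {H : Type*} [TopologicalSpace H] {I : ModelWithCorners ℝ E H} [I.Boundaryless]
  {X : Type*} [TopologicalSpace X] [ChartedSpace H X] [IsManifold I ∞ X]

lemma thomasSymbol_symm (D : TorsionFreeConnection I X) {x₀ : X} {z : E}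
    (hz : z ∈ (extChartAt I x₀).target) (v w : E) :
    thomasSymbol D x₀ z v w = thomasSymbol D x₀ z w v :=
  traceFree_symm (D.chrisL_symm hz) v w

lemma trL_thomasSymbol (D : TorsionFreeConnection I X) (x₀ : X) (z v : E) :
    trL (thomasSymbol D x₀ z v) = 0 :=
  trL_traceFree _ v

/-- The transformation law of the trace-free part of the Christoffel symbols. -/
lemma thomasSymbol_transition (D : TorsionFreeConnection I X) {x₁ x₀ x : X}
    (h1 : x ∈ (chartAt H x₁).source) (h0 : x ∈ (chartAt H x₀).source) (v w : E) :
    transitionJ I x₁ x₀ (extChartAt I x₁ x) (thomasSymbol D x₁ (extChartAt I x₁ x) v w) =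
      thomasSymbol D x₀ (extChartAt I x₀ x) (transitionJ I x₁ x₀ (extChartAt I x₁ x) v)
          (transitionJ I x₁ x₀ (extChartAt I x₁ x) w) +
        fderiv ℝ (transitionJ I x₁ x₀) (extChartAt I x₁ x) v w +
        (logJac I x₁ x₀ (extChartAt I x₁ x) v • transitionJ I x₁ x₀ (extChartAt I x₁ x) w +
          logJac I x₁ x₀ (extChartAt I x₁ x) w • transitionJ I x₁ x₀ (extChartAt I x₁ x) v) := by
  have hn : (Module.finrank ℝ E + 1 : ℝ) ≠ 0 := by positivity
  have hc := transitionJ_comp (I := I) h1 h0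
  -- The trace of the law for the full symbols: conjugation by `J` leaves the trace unchanged, and
  -- the inhomogeneous term contributes the logarithmic derivative of the density transition
  -- function by Jacobi's formula.
  have ht : ∀ v, (Module.finrank ℝ E + 1 : ℝ)⁻¹ * trL (chrisL D.cov x₁ (extChartAt I x₁ x) v) =
      (Module.finrank ℝ E + 1 : ℝ)⁻¹ * trL (chrisL D.cov x₀ (extChartAt I x₀ x)
        (transitionJ I x₁ x₀ (extChartAt I x₁ x) v)) - logJac I x₁ x₀ (extChartAt I x₁ x) v := by
    intro v
    have h2 : chrisL D.cov x₁ (extChartAt I x₁ x) v =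
        (transitionJ I x₀ x₁ (extChartAt I x₀ x) ∘L chrisL D.cov x₀ (extChartAt I x₀ x)
          (transitionJ I x₁ x₀ (extChartAt I x₁ x) v)) ∘L transitionJ I x₁ x₀ (extChartAt I x₁ x) +
        transitionJ I x₀ x₁ (extChartAt I x₀ x) ∘L
          fderiv ℝ (transitionJ I x₁ x₀) (extChartAt I x₁ x) v := by
      ext w
      have h3 := congrArg (fun L : E →L[ℝ] E => L (chrisL D.cov x₁ (extChartAt I x₁ x) v w)) hc
      simp only [ContinuousLinearMap.comp_apply, ContinuousLinearMap.id_apply] at h3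
      rw [← h3, chrisL_transition _ h1 h0, map_add]
      rfl
    rw [h2, map_add, trL_comp_comm, ← ContinuousLinearMap.comp_assoc,
      transitionJ_comp (I := I) h0 h1, ContinuousLinearMap.id_comp, logJac_apply h1 h0]
    ring
  have e : ∀ (x₀ : X) z v w, thomasSymbol D x₀ z v w = chrisL D.cov x₀ z v w -
      (((Module.finrank ℝ E + 1 : ℝ)⁻¹ * trL (chrisL D.cov x₀ z v)) • w +
        ((Module.finrank ℝ E + 1 : ℝ)⁻¹ * trL (chrisL D.cov x₀ z w)) • v) := by
    intro x₀ z v w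
    rw [thomasSymbol, traceFree_eq, sub_apply, sub_apply, smul_apply, smul_apply, symProd_apply,
      smul_add, smul_smul, smul_smul]
    rfl
  rw [e, e, ht, ht, map_sub, map_add, map_smul, map_smul, chrisL_transition _ h1 h0]
  module

variable [T2Space X]

/-- A multiple of the Ricci curvature of the trace-free part of the Christoffel symbols. -/
def schoutenSymbol (D : TorsionFreeConnection I X) (x₀ : X) (z : E) : E →L[ℝ] E →L[ℝ] ℝ :=
  bilinExt fun v w => (Module.finrank ℝ E - 1 : ℝ)⁻¹ *
    coordRicci (uncurried (thomasSymbol D x₀)) z v w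

/-- Every term containing the trace of `Π` vanishes, together with its derivative. What is left is
visibly bilinear and smooth, as the definition of `schoutenSymbol` by basis extension requires. -/
lemma coordRicci_thomasSymbol (D : TorsionFreeConnection I X) {x₀ : X} {z : E}
    (hz : z ∈ (extChartAt I x₀).target) (v w : E) :
    coordRicci (uncurried (thomasSymbol D x₀)) z v w =
      trL (((fderiv ℝ (thomasSymbol D x₀) z).flip v).flip w)
        - trL (((thomasSymbol D x₀ z) v) ∘L (thomasSymbol D x₀ z w)) := by
  have hd := (contDiffAt_thomasSymbol D hz).differentiableAt (by simp)
  rw [coordRicci_of_symm hd ((eventually_target hz).mono fun y hy => thomasSymbol_symm D hy),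
    trL_thomasSymbol]
  have h : trL (fderiv ℝ (thomasSymbol D x₀) z v w) = 0 := by
    have h1 : HasFDerivAt (fun y => trL (thomasSymbol D x₀ y w)) _ z :=
      (trL (E := E)).hasFDerivAt.comp z (hd.hasFDerivAt.clm_apply (hasFDerivAt_const w z))
    have h2 := h1.unique ((hasFDerivAt_const (0 : ℝ) z).congr_of_eventuallyEq
      (Eventually.of_forall fun y => trL_thomasSymbol D x₀ y w))
    have h3 := congrArg (fun L : E →L[ℝ] ℝ => L v) h2
    simpa using h3
  rw [h]
  ring

lemma schoutenSymbol_apply (D : TorsionFreeConnection I X) {x₀ : X} {z : E}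
    (hz : z ∈ (extChartAt I x₀).target) (v w : E) :
    schoutenSymbol D x₀ z v w = (Module.finrank ℝ E - 1 : ℝ)⁻¹ *
      coordRicci (uncurried (thomasSymbol D x₀)) z v w := by
  refine bilinExt_apply (fun w => ?_) (fun v => ?_) v w
  · simp only [coordRicci_thomasSymbol D hz]
    refine ⟨fun a b => ?_, fun c a => ?_⟩
    · simp only [map_add, ContinuousLinearMap.flip_add, add_apply, ContinuousLinearMap.add_comp]
      ring
    · simp only [map_smul, ContinuousLinearMap.flip_smul, smul_apply, ContinuousLinearMap.smul_comp,
        smul_eq_mul]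
      ring
  · simp only [coordRicci_thomasSymbol D hz]
    refine ⟨fun a b => ?_, fun c a => ?_⟩
    · simp only [map_add, ContinuousLinearMap.comp_add]
      ring
    · simp only [map_smul, ContinuousLinearMap.comp_smul, smul_eq_mul]
      ring

lemma contDiffAt_schoutenSymbol (D : TorsionFreeConnection I X) {x₀ : X} {z : E}
    (hz : z ∈ (extChartAt I x₀).target) : ContDiffAt ℝ ∞ (schoutenSymbol D x₀) z := by
  refine ContDiffWithinAt.bilinExt fun v w => ?_
  have hs := contDiffAt_thomasSymbol D hz
  have hd : ContDiffAt ℝ ∞ (fderiv ℝ (thomasSymbol D x₀)) z := hs.fderiv_right (by simp)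
  refine contDiffAt_const.mul ?_
  have h : ContDiffAt ℝ ∞ (fun z => trL (((fderiv ℝ (thomasSymbol D x₀) z).flip v).flip w)
        - trL (((thomasSymbol D x₀ z) v) ∘L (thomasSymbol D x₀ z w))) z :=
    ((trL (E := E)).contDiff.contDiffAt.comp z (ContDiffAt.flip_flip hd v w)).sub
    ((trL (E := E)).contDiff.contDiffAt.comp z
      ((hs.clm_apply contDiffAt_const).clm_comp (hs.clm_apply contDiffAt_const)))
  refine h.congr_of_eventuallyEq ?_
  filter_upwards [eventually_target hz] with z hz
  exact coordRicci_thomasSymbol D hz v w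

/-- The divergence of `Π` inherits the symmetry of `Π`, and the quadratic term is symmetric by
cyclicity of the trace. -/
lemma schoutenSymbol_symm (D : TorsionFreeConnection I X) {x₀ : X} {z : E}
    (hz : z ∈ (extChartAt I x₀).target) (v w : E) :
    schoutenSymbol D x₀ z v w = schoutenSymbol D x₀ z w v := by
  have hd := (contDiffAt_thomasSymbol D hz).differentiableAt (by simp)
  have h1 : ((fderiv ℝ (thomasSymbol D x₀) z).flip v).flip w =
      ((fderiv ℝ (thomasSymbol D x₀) z).flip w).flip v := by
    ext u
    simp only [ContinuousLinearMap.flip_apply]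
    rw [← fderiv_apply₂ hd, ← fderiv_apply₂ hd]
    congr 1
    exact Filter.EventuallyEq.fderiv_eq ((eventually_target hz).mono
      fun y hy => thomasSymbol_symm D hy _ _)
  rw [schoutenSymbol_apply D hz, schoutenSymbol_apply D hz, coordRicci_thomasSymbol D hz,
    coordRicci_thomasSymbol D hz, h1, trL_comp_comm]

/-- A projective change of the Ricci curvature of the trace-free part of the Christoffel symbols. -/
lemma coordRicci_thomasSymbol_sub (D : TorsionFreeConnection I X)
    (hE : (Module.finrank ℝ E - 1 : ℝ) ≠ 0) {x₀ : X} {z : E}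
    (hz : z ∈ (extChartAt I x₀).target) {β : E → E →L[ℝ] ℝ} (hβ : DifferentiableAt ℝ β z)
    (hβs : ∀ v w, fderiv ℝ β z v w = fderiv ℝ β z w v) (v w : E) :
    coordRicci (uncurried fun y => thomasSymbol D x₀ y - symProd (β y)) z v w =
      (Module.finrank ℝ E - 1 : ℝ) * (schoutenSymbol D x₀ z v w + fderiv ℝ β z v w
        - β z (thomasSymbol D x₀ z v w) + β z v * β z w) := by
  have hd := (contDiffAt_thomasSymbol D hz).differentiableAt (by simp)
  have h : (uncurried fun y => thomasSymbol D x₀ y - symProd (β y)) =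
      fun y v w => thomasSymbol D x₀ y v w - β y v • w - β y w • v := by
    funext y v w
    simp only [uncurried, sub_apply, symProd_apply]
    abel
  rw [h, coordRicci_projective hd (thomasSymbol_symm D hz) hβ hβs, schoutenSymbol_apply D hz]
  field_simp
  ring

/-- After subtraction of `symProd` of the logarithmic Jacobian, `Π` at `x₁` transforms into `Π` at
`x₀` like the symbols of a genuine connection, so the Ricci curvatures correspond as tensors; the
subtraction itself is a projective change with a closed form. -/
lemma schoutenSymbol_transition (D : TorsionFreeConnection I X)
    (hE : (Module.finrank ℝ E - 1 : ℝ) ≠ 0) {x₁ x₀ x : X}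
    (h1 : x ∈ (chartAt H x₁).source) (h0 : x ∈ (chartAt H x₀).source) (v w : E) :
    schoutenSymbol D x₀ (extChartAt I x₀ x) (transitionJ I x₁ x₀ (extChartAt I x₁ x) v)
        (transitionJ I x₁ x₀ (extChartAt I x₁ x) w) =
      schoutenSymbol D x₁ (extChartAt I x₁ x) v w
        + fderiv ℝ (logJac I x₁ x₀) (extChartAt I x₁ x) v w
        - logJac I x₁ x₀ (extChartAt I x₁ x) (thomasSymbol D x₁ (extChartAt I x₁ x) v w)
        + logJac I x₁ x₀ (extChartAt I x₁ x) v * logJac I x₁ x₀ (extChartAt I x₁ x) w := by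
  have hl := (contDiffAt_logJac (I := I) h1 h0).differentiableAt (by simp)
  have hd1 := (contDiffAt_thomasSymbol D (chart_mem_target h1)).differentiableAt (by simp)
  have key := coordRicci_thomasSymbol_sub D hE (chart_mem_target h1) hl (fderiv_logJac_symm h1 h0) v w
  have hn : ∀ᶠ y in 𝓝 (extChartAt I x₁ x), ∃ x', x' ∈ (chartAt H x₁).source ∧
      x' ∈ (chartAt H x₀).source ∧ extChartAt I x₁ x' = y := by
    filter_upwards [eventually_target (chart_mem_target (I := I) h1),
      eventually_chart_symm h1 (eventually_mem_source h0)] with z hz hz1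
    exact ⟨_, chart_symm_mem hz, hz1, (extChartAt I x₁).right_inv hz⟩
  have ht : coordRicci (uncurried fun y => thomasSymbol D x₁ y - symProd (logJac I x₁ x₀ y))
      (extChartAt I x₁ x) v w = coordRicci (uncurried (thomasSymbol D x₀))
      (transition I x₁ x₀ (extChartAt I x₁ x)) (transitionJ I x₁ x₀ (extChartAt I x₁ x) v)
        (transitionJ I x₁ x₀ (extChartAt I x₁ x) w) := by
    refine coordRicci_transform ?_ ?_ ?_
      ((contDiffAt_transitionJ h1 h0).of_le two_le_infty) ?_ (transitionJ_comp h1 h0)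
      (transitionJ_comp h0 h1) _ _
    · exact hd1.sub ((symProd (E := E)).differentiableAt.comp _ hl)
    · rw [transition_apply h1]
      exact (contDiffAt_thomasSymbol D (chart_mem_target h0)).differentiableAt (by simp)
    · filter_upwards [hn] with y ⟨x', hx1, hx0, hy⟩
      rw [← hy]
      exact hasFDerivAt_transition hx1 hx0
    · filter_upwards [hn] with y ⟨x', hx1, hx0, hy⟩ v w
      rw [← hy, transition_apply hx1, sub_apply, sub_apply, map_sub,
        thomasSymbol_transition D hx1 hx0, symProd_apply, map_add, map_smul, map_smul,
        add_sub_cancel_right]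
  rw [transition_apply h1, key] at ht
  rw [schoutenSymbol_apply D (chart_mem_target h0), ← ht, inv_mul_cancel_left₀ hE]

end ThomasSymbol

end ProjectiveAmbient

namespace ProjectiveAmbient

open Filter Topology

/-! ### The Thomas cone connection and its Ricci-flatness -/

section ThomasConnection

variable {E : Type*} [NormedAddCommGroup E] [NormedSpace ℝ E] [FiniteDimensional ℝ E]
  [CompleteSpace E]
  {H : Type*} [TopologicalSpace H] {I : ModelWithCorners ℝ E H} [I.Boundaryless]
  {X : Type*} [TopologicalSpace X] [ChartedSpace H X] [IsManifold I ∞ X]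

lemma fderiv_transitionJ_cone {c₁ c₀ c : thomasCone I X}
    (h1 : c.1.1 ∈ (chartAt H c₁.1.1).source) (h0 : c.1.1 ∈ (chartAt H c₀.1.1).source)
    (V W : E × ℝ) :
    fderiv ℝ (transitionJ (I.prod 𝓘(ℝ, ℝ)) c₁ c₀) (extChartAt (I.prod 𝓘(ℝ, ℝ)) c₁ c) V W =
      (fderiv ℝ (transitionJ I c₁.1.1 c₀.1.1) (extChartAt I c₁.1.1 c.1.1) V.1 W.1,
        densityJac I c₁.1.1 c₀.1.1 (extChartAt I c₁.1.1 c.1.1) *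
          (logJac I c₁.1.1 c₀.1.1 (extChartAt I c₁.1.1 c.1.1) V.1 * W.2
            + V.2 * logJac I c₁.1.1 c₀.1.1 (extChartAt I c₁.1.1 c.1.1) W.1
            + densityRep c₁.1.1 c.1.2 *
              (fderiv ℝ (logJac I c₁.1.1 c₀.1.1) (extChartAt I c₁.1.1 c.1.1) V.1 W.1
                + logJac I c₁.1.1 c₀.1.1 (extChartAt I c₁.1.1 c.1.1) V.1 *
                  logJac I c₁.1.1 c₀.1.1 (extChartAt I c₁.1.1 c.1.1) W.1))) := by
  have h1' := cone_mem_chart_source.2 h1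
  have h0' := cone_mem_chart_source.2 h0
  have hT := ((contDiffAt_transitionJ (I := I.prod 𝓘(ℝ, ℝ)) h1' h0').differentiableAt
    (by simp)).hasFDerivAt
  have hTW := (hT.clm_apply (hasFDerivAt_const W _)).fderiv
  have e : fderiv ℝ (transitionJ (I.prod 𝓘(ℝ, ℝ)) c₁ c₀) (extChartAt (I.prod 𝓘(ℝ, ℝ)) c₁ c) V W =
      fderiv ℝ (fun p => transitionJ (I.prod 𝓘(ℝ, ℝ)) c₁ c₀ p W)
        (extChartAt (I.prod 𝓘(ℝ, ℝ)) c₁ c) V := by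
    rw [hTW]
    simp
  have he : (fun p => transitionJ (I.prod 𝓘(ℝ, ℝ)) c₁ c₀ p W)
      =ᶠ[𝓝 (extChartAt (I.prod 𝓘(ℝ, ℝ)) c₁ c)] fun p : E × ℝ =>
        (transitionJ I c₁.1.1 c₀.1.1 p.1 W.1, densityJac I c₁.1.1 c₀.1.1 p.1 *
          (W.2 + p.2 * logJac I c₁.1.1 c₀.1.1 p.1 W.1)) := by
    filter_upwards [eventually_target (chart_mem_target (I := I.prod 𝓘(ℝ, ℝ)) h1'),
      eventually_chart_symm h1' (eventually_mem_source h0')] with q hq hq0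
    have hq1 := chart_symm_mem hq
    have hr := (extChartAt (I.prod 𝓘(ℝ, ℝ)) c₁).right_inv hq
    rw [cone_mem_chart_source] at hq0 hq1
    have h := transitionJ_cone hq1 hq0 W
    rw [hr] at h
    rw [cone_extChartAt hq1] at hr
    have e1 := congrArg Prod.fst hr
    have e2 := congrArg Prod.snd hr
    simp only at e1 e2
    rw [h, e1, e2]
  rw [e, he.fderiv_eq, cone_extChartAt h1]
  have hJ := (contDiffAt_transitionJ (I := I) h1 h0).differentiableAt (by simp)
  have hj := hasFDerivAt_densityJac (I := I) h1 h0
  have hl := (contDiffAt_logJac (I := I) h1 h0).differentiableAt (by simp)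
  let p : E × ℝ := (extChartAt I c₁.1.1 c.1.1, densityRep c₁.1.1 c.1.2)
  have e1 : HasFDerivAt (fun q : E × ℝ => transitionJ I c₁.1.1 c₀.1.1 q.1) _ p :=
    hasFDerivAt_comp_fst (P := transitionJ I c₁.1.1 c₀.1.1) hJ
  have e2 : HasFDerivAt (fun q : E × ℝ => densityJac I c₁.1.1 c₀.1.1 q.1) _ p :=
    hasFDerivAt_comp_fst (P := densityJac I c₁.1.1 c₀.1.1) hj.differentiableAt
  have e3 : HasFDerivAt (fun q : E × ℝ => logJac I c₁.1.1 c₀.1.1 q.1) _ p :=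
    hasFDerivAt_comp_fst (P := logJac I c₁.1.1 c₀.1.1) hl
  have e4 : HasFDerivAt (fun p : E × ℝ =>
        (transitionJ I c₁.1.1 c₀.1.1 p.1 W.1, densityJac I c₁.1.1 c₀.1.1 p.1 *
          (W.2 + p.2 * logJac I c₁.1.1 c₀.1.1 p.1 W.1))) _ p :=
    (e1.clm_apply (hasFDerivAt_const W.1 p)).prodMk (e2.mul ((hasFDerivAt_snd.mul
      (e3.clm_apply (hasFDerivAt_const W.1 p))).const_add W.2))
  rw [e4.fderiv]
  change (ContinuousLinearMap.prod _ _) V = _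
  rw [hj.fderiv]
  simp only [p, ContinuousLinearMap.prod_apply, add_apply, smul_apply, ContinuousLinearMap.comp_apply,
    ContinuousLinearMap.coe_fst', ContinuousLinearMap.coe_snd', smul_eq_mul,
    ContinuousLinearMap.flip_apply, zero_apply, map_zero, zero_add]
  refine Prod.ext rfl ?_
  simp only
  ring

variable [T2Space X]

/-- The Christoffel symbols of the Thomas cone connection. -/
def coneSymbol (D : TorsionFreeConnection I X) (x₀ : X) (p : E × ℝ) :
    E × ℝ →L[ℝ] E × ℝ →L[ℝ] E × ℝ :=
  bilinExt (coneChristoffel (uncurried (thomasSymbol D x₀)) (fun z v w => schoutenSymbol D x₀ z v w) p)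

lemma coneSymbol_apply (D : TorsionFreeConnection I X) (x₀ : X) (p V W : E × ℝ) :
    coneSymbol D x₀ p V W = (thomasSymbol D x₀ p.1 V.1 W.1 + (V.2 / p.2) • W.1 + (W.2 / p.2) • V.1,
      -p.2 * schoutenSymbol D x₀ p.1 V.1 W.1) :=
  bilinExt_apply (fun w => isLinearMap_coneChristoffel_left p w)
    (isLinearMap_coneChristoffel_right p) V W

/-- Along the base, the projective defect of `Π` is absorbed by the shift of `a/y` and `b/y` under
the transition. Along the fibre, the defect of `P` accounts for the second derivative of `j(z) y`.
-/
lemma isSymbolFamily_coneSymbol (D : TorsionFreeConnection I X)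
    (hE : (Module.finrank ℝ E - 1 : ℝ) ≠ 0) :
    IsSymbolFamily (fun c₀ : thomasCone I X => coneSymbol D c₀.1.1) (I.prod 𝓘(ℝ, ℝ)) := by
  refine ⟨fun {c₁ c₀ c} h1 h0 V W => ?_, fun {c₀ p} hp => ?_, fun {c₀ p} hp V W => ?_⟩
  · rw [cone_mem_chart_source] at h1 h0
    have hy := (coneRep_pos h1).ne'
    have hj := (densityJac_pos (I := I) h1 h0).ne'
    have hy0 : densityRep c₀.1.1 c.1.2 = densityJac I c₁.1.1 c₀.1.1 (extChartAt I c₁.1.1 c.1.1) *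
        densityRep c₁.1.1 c.1.2 := densityRep_transition h1 h0 c.1.2
    rw [fderiv_transitionJ_cone h1 h0, coneSymbol_apply, coneSymbol_apply, transitionJ_cone h1 h0,
      transitionJ_cone h1 h0, transitionJ_cone h1 h0, cone_extChartAt h1, cone_extChartAt h0]
    simp only []
    rw [hy0, schoutenSymbol_transition D hE h1 h0]
    generalize hyg : densityRep c₁.1.1 c.1.2 = y at hy ⊢
    generalize densityJac I c₁.1.1 c₀.1.1 (extChartAt I c₁.1.1 c.1.1) = j at hj ⊢
    refine Prod.ext ?_ ?_
    · simp only [map_add, map_smul, Prod.fst_add]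
      rw [thomasSymbol_transition D h1 h0]
      -- The quotient of fibre component and fibre coordinate shifts by the logarithmic derivative
      -- of `j`.
      have e : ∀ a l : ℝ, j * (a + y * l) / (j * y) = a / y + l := fun a l => by field_simp
      rw [e, e]
      module
    · simp only [map_add, map_smul, Prod.snd_add, smul_eq_mul]
      field_simp
      ring
  · obtain ⟨hz, hp2⟩ := cone_target hp
    exact ContDiffWithinAt.bilinExt fun V W => contDiffAt_coneChristoffel hp2.ne'
      (contDiffAt_thomasSymbol D hz) (contDiffAt_schoutenSymbol D hz) V W
  · obtain ⟨hz, -⟩ := cone_target hp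
    rw [coneSymbol_apply, coneSymbol_apply, thomasSymbol_symm D hz, schoutenSymbol_symm D hz]
    refine Prod.ext ?_ rfl
    simp only
    abel

/-- The Thomas cone connection. -/
def thomasConnection (D : TorsionFreeConnection I X) (hE : (Module.finrank ℝ E - 1 : ℝ) ≠ 0) :
    TorsionFreeConnection (I.prod 𝓘(ℝ, ℝ)) (thomasCone I X) :=
  (isSymbolFamily_coneSymbol D hE).connection

lemma chrisL_thomasConnection (D : TorsionFreeConnection I X)
    (hE : (Module.finrank ℝ E - 1 : ℝ) ≠ 0) {c₀ : thomasCone I X} {p : E × ℝ}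
    (hp : p ∈ (extChartAt (I.prod 𝓘(ℝ, ℝ)) c₀).target) :
    chrisL (thomasConnection D hE).cov c₀ p = coneSymbol D c₀.1.1 p :=
  (isSymbolFamily_coneSymbol D hE).chrisL_eq hp

lemma ricciFlat_thomasConnection (D : TorsionFreeConnection I X)
    (hE : (Module.finrank ℝ E - 1 : ℝ) ≠ 0) : (thomasConnection D hE).RicciFlat := by
  intro c V W
  have hp := chart_mem_target (I := I.prod 𝓘(ℝ, ℝ)) (mem_chart_source (ModelProd H ℝ) c)
  obtain ⟨hz, hp2⟩ := cone_target hp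
  refine ((thomasConnection D hE).ricci_eq_coordRicci c V W).trans ?_
  have he : ∀ᶠ q in 𝓝 (extChartAt (I.prod 𝓘(ℝ, ℝ)) c c),
      uncurried (chrisL (thomasConnection D hE).cov c) q = coneChristoffel
        (uncurried (thomasSymbol D c.1.1)) (fun z v w => schoutenSymbol D c.1.1 z v w) q := by
    filter_upwards [eventually_target hp] with q hq
    funext V W
    rw [uncurried, chrisL_thomasConnection D hE hq, coneSymbol_apply]
    rfl
  refine (coordRicci_congr he V W).trans ?_
  refine coordRicci_coneChristoffel hp2.ne' ((contDiffAt_thomasSymbol D hz).of_le (by simp))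
    ((contDiffAt_schoutenSymbol D hz).of_le (by simp)) (thomasSymbol_symm D hz)
    (trL_thomasSymbol D _ _) (fun v w => ?_) _ _
  rw [schoutenSymbol_apply D hz, mul_inv_cancel_left₀ hE]

end ThomasConnection

end ProjectiveAmbient

namespace ProjectiveAmbient

open Filter Topology

/-! ### Characterization and uniqueness of the cone connection -/

section Characterization

variable {E : Type*} [NormedAddCommGroup E] [NormedSpace ℝ E] [FiniteDimensional ℝ E]
  [CompleteSpace E]
  {H : Type*} [TopologicalSpace H] {I : ModelWithCorners ℝ E H} [I.Boundaryless]
  {X : Type*} [TopologicalSpace X] [ChartedSpace H X] [IsManifold I ∞ X]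

lemma cone_chart_symm {c₀ : thomasCone I X} {p : E × ℝ}
    (hp : p ∈ (extChartAt (I.prod 𝓘(ℝ, ℝ)) c₀).target) :
    ((extChartAt (I.prod 𝓘(ℝ, ℝ)) c₀).symm p).1.1 = (extChartAt I c₀.1.1).symm p.1 ∧
      densityRep c₀.1.1 ((extChartAt (I.prod 𝓘(ℝ, ℝ)) c₀).symm p).1.2 = p.2 := by
  have h := cone_mem_chart_source.1 (chart_symm_mem hp)
  have hr := (extChartAt (I.prod 𝓘(ℝ, ℝ)) c₀).right_inv hp
  rw [cone_extChartAt h] at hr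
  refine ⟨?_, congrArg Prod.snd hr⟩
  rw [← congrArg Prod.fst hr, chart_left_inv h]

lemma localRep_eulerField {c₀ : thomasCone I X} {p : E × ℝ}
    (hp : p ∈ (extChartAt (I.prod 𝓘(ℝ, ℝ)) c₀).target) :
    localRep c₀ (eulerField (I := I)) p = ((0, p.2) : E × ℝ) := by
  rw [localRep, dChart_eulerField (cone_mem_chart_source.1 (chart_symm_mem hp)),
    (cone_chart_symm hp).2]

lemma localRep_lift (s : Scale I X) (Y : ∀ x : X, TangentSpace I x) {c₀ : thomasCone I X}
    {p : E × ℝ} (hp : p ∈ (extChartAt (I.prod 𝓘(ℝ, ℝ)) c₀).target) :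
    localRep c₀ (fun c => s.lift c (Y c.1.1)) p = ((localRep c₀.1.1 Y p.1,
      p.2 * s.logDeriv c₀.1.1 p.1 (localRep c₀.1.1 Y p.1)) : E × ℝ) := by
  have h := cone_mem_chart_source.1 (chart_symm_mem hp)
  have h1 := localRep_apply h Y
  have h2 : extChartAt I c₀.1.1 ((extChartAt (I.prod 𝓘(ℝ, ℝ)) c₀).symm p).1.1 = p.1 := by
    rw [(cone_chart_symm hp).1, (extChartAt I c₀.1.1).right_inv (cone_target hp).1]
  rw [localRep, s.dChart_lift h, (cone_chart_symm hp).2, ← h1, h2]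

lemma mdifferentiableAt_eulerField (c : thomasCone I X) :
    MDifferentiableAt (I.prod 𝓘(ℝ, ℝ)) (I.prod 𝓘(ℝ, ℝ)).tangent
      (fun c => (⟨c, eulerField c⟩ : TangentBundle (I.prod 𝓘(ℝ, ℝ)) (thomasCone I X))) c := by
  have hc := mem_chart_source (ModelProd H ℝ) c
  rw [mdifferentiableAt_field_iff hc]
  have h : DifferentiableAt ℝ (fun p : E × ℝ => ((0, p.2) : E × ℝ))
      (extChartAt (I.prod 𝓘(ℝ, ℝ)) c c) := by fun_prop
  refine h.congr_of_eventuallyEq ?_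
  filter_upwards [eventually_target (chart_mem_target (I := I.prod 𝓘(ℝ, ℝ)) hc)] with p hp
  exact localRep_eulerField hp

lemma hasFDerivAt_lift (s : Scale I X) {Y : ∀ x : X, TangentSpace I x} {c : thomasCone I X}
    (hY : ContMDiffAt I I.tangent ∞ (fun x => (⟨x, Y x⟩ : TangentBundle I X)) c.1.1) :
    ∃ L : E × ℝ →L[ℝ] E × ℝ, HasFDerivAt (localRep c (fun c => s.lift c (Y c.1.1))) L
        (extChartAt (I.prod 𝓘(ℝ, ℝ)) c c) ∧
      ∀ V : E × ℝ, L V = (fderiv ℝ (localRep c.1.1 Y) (extChartAt I c.1.1 c.1.1) V.1,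
        V.2 * s.logDeriv c.1.1 (extChartAt I c.1.1 c.1.1)
            (localRep c.1.1 Y (extChartAt I c.1.1 c.1.1)) +
          densityRep c.1.1 c.1.2 * (fderiv ℝ (s.logDeriv c.1.1) (extChartAt I c.1.1 c.1.1) V.1
              (localRep c.1.1 Y (extChartAt I c.1.1 c.1.1)) +
            s.logDeriv c.1.1 (extChartAt I c.1.1 c.1.1)
              (fderiv ℝ (localRep c.1.1 Y) (extChartAt I c.1.1 c.1.1) V.1))) := by
  have hc := mem_chart_source (ModelProd H ℝ) c
  have hx := mem_chart_source H c.1.1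
  have hz := chart_mem_target (I := I) hx
  have he : localRep c (fun c => s.lift c (Y c.1.1)) =ᶠ[𝓝 (extChartAt (I.prod 𝓘(ℝ, ℝ)) c c)]
      fun p : E × ℝ => ((localRep c.1.1 Y p.1,
        p.2 * s.logDeriv c.1.1 p.1 (localRep c.1.1 Y p.1)) : E × ℝ) := by
    filter_upwards [eventually_target (chart_mem_target (I := I.prod 𝓘(ℝ, ℝ)) hc)] with p hp
    exact localRep_lift s Y hp
  have hYd := ((contMDiffAt_field_iff hx).1 hY).differentiableAt (by simp)
  have hβ := (s.contDiffAt_logDeriv hz).differentiableAt (by simp)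
  let p : E × ℝ := (extChartAt I c.1.1 c.1.1, densityRep c.1.1 c.1.2)
  have e1 : HasFDerivAt (fun q : E × ℝ => localRep c.1.1 Y q.1) _ p :=
    hasFDerivAt_comp_fst (P := localRep c.1.1 Y) hYd
  have e2 : HasFDerivAt (fun q : E × ℝ => s.logDeriv c.1.1 q.1) _ p :=
    hasFDerivAt_comp_fst (P := s.logDeriv c.1.1) hβ
  have e3 : HasFDerivAt (fun p : E × ℝ => ((localRep c.1.1 Y p.1,
        p.2 * s.logDeriv c.1.1 p.1 (localRep c.1.1 Y p.1)) : E × ℝ)) _ p :=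
    e1.prodMk (hasFDerivAt_snd.mul (e2.clm_apply e1))
  have hp : extChartAt (I.prod 𝓘(ℝ, ℝ)) c c = p := cone_extChartAt hx
  rw [hp] at he ⊢
  refine ⟨_, e3.congr_of_eventuallyEq he, fun V => Prod.ext rfl ?_⟩
  simp only [p, ContinuousLinearMap.prod_apply, add_apply, smul_apply, ContinuousLinearMap.comp_apply,
    ContinuousLinearMap.coe_fst', ContinuousLinearMap.coe_snd', smul_eq_mul,
    ContinuousLinearMap.flip_apply]
  ring

lemma mdifferentiableAt_lift (s : Scale I X) {Y : ∀ x : X, TangentSpace I x} {c : thomasCone I X}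
    (hY : ContMDiffAt I I.tangent ∞ (fun x => (⟨x, Y x⟩ : TangentBundle I X)) c.1.1) :
    MDifferentiableAt (I.prod 𝓘(ℝ, ℝ)) (I.prod 𝓘(ℝ, ℝ)).tangent (fun c =>
      (⟨c, s.lift c (Y c.1.1)⟩ : TangentBundle (I.prod 𝓘(ℝ, ℝ)) (thomasCone I X))) c := by
  rw [mdifferentiableAt_field_iff (mem_chart_source (ModelProd H ℝ) c)]
  obtain ⟨L, hL, -⟩ := hasFDerivAt_lift s hY
  exact hL.differentiableAt

variable [T2Space X]

/-- The Ricci tensor of the connection that preserves a scale. -/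
lemma ricci_eq_schoutenSymbol {D₀ D : TorsionFreeConnection I X} {s : Scale I X}
    (hE : (Module.finrank ℝ E - 1 : ℝ) ≠ 0) (hD : D₀.ProjectivelyRelated D) (hs : D.Preserves s)
    {x₀ x : X} (hx : x ∈ (chartAt H x₀).source) (v w : TangentSpace I x) :
    D.ricci x v w = (Module.finrank ℝ E - 1 : ℝ) *
      (schoutenSymbol D₀ x₀ (extChartAt I x₀ x) (dChart I x₀ x v) (dChart I x₀ x w)
        - fderiv ℝ (s.logDeriv x₀) (extChartAt I x₀ x) (dChart I x₀ x v) (dChart I x₀ x w)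
        + s.logDeriv x₀ (extChartAt I x₀ x) (thomasSymbol D₀ x₀ (extChartAt I x₀ x)
            (dChart I x₀ x v) (dChart I x₀ x w))
        + s.logDeriv x₀ (extChartAt I x₀ x) (dChart I x₀ x v) *
            s.logDeriv x₀ (extChartAt I x₀ x) (dChart I x₀ x w)) := by
  have hz := chart_mem_target (I := I) hx
  have hβ := (s.contDiffAt_logDeriv hz).differentiableAt (by simp)
  have hneg : fderiv ℝ (fun y => -s.logDeriv x₀ y) (extChartAt I x₀ x) =
      -fderiv ℝ (s.logDeriv x₀) (extChartAt I x₀ x) := hβ.hasFDerivAt.neg.fderiv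
  -- The symbols of `D` are `Π - symProd (-β)`, so the formula for a projective change applies with
  -- `-β`; this explains the signs of the terms linear in `β`.
  have he : ∀ᶠ y in 𝓝 (extChartAt I x₀ x), uncurried (chrisL D.cov x₀) y =
      uncurried (fun y => thomasSymbol D₀ x₀ y - symProd (-s.logDeriv x₀ y)) y := by
    filter_upwards [eventually_target hz] with y hy
    funext v w
    change chrisL D.cov x₀ y v w = (thomasSymbol D₀ x₀ y - symProd (-s.logDeriv x₀ y)) v w
    rw [hD.chrisL_eq hs hy, map_neg, sub_neg_eq_add]
    rfl
  rw [D.ricci_eq_chart hx, coordRicci_congr he, coordRicci_thomasSymbol_sub D₀ hE hz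
    (β := fun y => -s.logDeriv x₀ y) hβ.neg, hneg]
  · simp only [neg_apply]
    ring
  · intro v w
    rw [hneg, neg_apply, neg_apply, neg_apply, neg_apply, s.fderiv_logDeriv_symm hz]

/-- For `V = (v, a)` the derivative of the components `(0, y)` is `(0, a)`, and the symbol of `V`
with `(0, y)` is `(v, 0)`. -/
lemma thomasConnection_cov_euler (D : TorsionFreeConnection I X)
    (hE : (Module.finrank ℝ E - 1 : ℝ) ≠ 0) (c : thomasCone I X)
    (u : TangentSpace (I.prod 𝓘(ℝ, ℝ)) c) :
    (thomasConnection D hE).cov eulerField c u = u := by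
  have hc := mem_chart_source (ModelProd H ℝ) c
  have hx := mem_chart_source H c.1.1
  have ht := chart_mem_target (I := I.prod 𝓘(ℝ, ℝ)) hc
  refine dChart_inj hc ?_
  rw [dChart_cov _ hc (mdifferentiableAt_eulerField c) u, chrisL_thomasConnection D hE ht,
    localRep_eulerField ht]
  generalize dChart (I.prod 𝓘(ℝ, ℝ)) c c u = V
  have he : localRep c (eulerField (I := I)) =ᶠ[𝓝 (extChartAt (I.prod 𝓘(ℝ, ℝ)) c c)]
      ContinuousLinearMap.inr ℝ E ℝ ∘L ContinuousLinearMap.snd ℝ E ℝ := by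
    filter_upwards [eventually_target ht] with p hp
    exact localRep_eulerField hp
  rw [he.fderiv_eq, ContinuousLinearMap.fderiv, coneSymbol_apply]
  have hy := (cone_target ht).2.ne'
  generalize extChartAt (I.prod 𝓘(ℝ, ℝ)) c c = p at hy ⊢
  refine Prod.ext ?_ ?_
  · simp [div_self hy]
  · simp

/-- The lift of `Y` has components `(Y, y β(Y))`. Hence the quotients of fibre components by `y` are
values of `β`, which complete `Π` to the symbols of `D`; along the fibre the derivatives of `β`
combine with `-y P` to the Ricci tensor of `D`. -/
lemma thomasConnection_cov_lift {D₀ D : TorsionFreeConnection I X} {s : Scale I X}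
    (hE : (Module.finrank ℝ E - 1 : ℝ) ≠ 0) (hD : D₀.ProjectivelyRelated D) (hs : D.Preserves s)
    {Y : ∀ x : X, TangentSpace I x} (hY : IsSmoothField Y) (c : thomasCone I X)
    (v : TangentSpace I c.1.1) :
    (thomasConnection D₀ hE).cov (fun c' => s.lift c' (Y c'.1.1)) c (s.lift c v) =
      s.lift c (D.cov Y c.1.1 v)
        - (1 / (Module.finrank ℝ E - 1 : ℝ) * D.ricci c.1.1 v (Y c.1.1)) • eulerField c := by
  have hc := mem_chart_source (ModelProd H ℝ) c
  have hx := mem_chart_source H c.1.1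
  have hz := chart_mem_target (I := I) hx
  have ht := chart_mem_target (I := I.prod 𝓘(ℝ, ℝ)) hc
  have hp : extChartAt (I.prod 𝓘(ℝ, ℝ)) c c = (extChartAt I c.1.1 c.1.1, densityRep c.1.1 c.1.2) :=
    cone_extChartAt hx
  have hYm := (hY c.1.1).mdifferentiableAt (by simp)
  refine dChart_inj hc ?_
  obtain ⟨L, hL, hL'⟩ := hasFDerivAt_lift s (hY c.1.1)
  rw [dChart_cov _ hc (mdifferentiableAt_lift s (hY c.1.1)) _, chrisL_thomasConnection D₀ hE ht,
    localRep_lift s Y ht, hL.fderiv, hL', map_sub, map_smul, s.dChart_lift hx, s.dChart_lift hx,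
    dChart_eulerField hx, dChart_cov D.cov hx hYm, coneSymbol_apply, hD.chrisL_eq hs hz,
    ricci_eq_schoutenSymbol hE hD hs hx, hp, ← localRep_apply hx Y]
  have hy := (coneRep_pos hx (c := c)).ne'
  generalize dChart I c.1.1 c.1.1 v = v'
  generalize localRep c.1.1 Y (extChartAt I c.1.1 c.1.1) = Y'
  generalize fderiv ℝ (localRep c.1.1 Y) (extChartAt I c.1.1 c.1.1) v' = dY
  generalize hyg : densityRep c.1.1 c.1.2 = y at hy ⊢
  refine Prod.ext ?_ ?_
  · simp only [Prod.fst_add, Prod.fst_sub, Prod.smul_fst, smul_zero, sub_zero, add_apply,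
      symProd_apply, mul_div_cancel_left₀ _ hy]
    simp only [thomasSymbol]
    module
  · simp only [Prod.snd_add, Prod.snd_sub, Prod.smul_snd, smul_eq_mul, add_apply,
      symProd_apply, map_add, map_smul, thomasSymbol]
    field_simp
    ring

lemma isThomasConnection_thomasConnection (D₀ : TorsionFreeConnection I X)
    (hE : (Module.finrank ℝ E - 1 : ℝ) ≠ 0) : IsThomasConnection D₀ (thomasConnection D₀ hE) :=
  ⟨fun _ _ hD hs _ hY c v => thomasConnection_cov_lift hE hD hs hY c v,
    thomasConnection_cov_euler D₀ hE⟩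

/-- The Thomas cone connection is unique. -/
lemma IsThomasConnection.same [SigmaCompactSpace X] {D₀ : TorsionFreeConnection I X}
    {nabla nabla' : TorsionFreeConnection (I.prod 𝓘(ℝ, ℝ)) (thomasCone I X)}
    (h : IsThomasConnection D₀ nabla) (h' : IsThomasConnection D₀ nabla') : nabla.Same nabla' := by
  obtain ⟨s⟩ := nonempty_scale (I := I) (X := X)
  refine TorsionFreeConnection.same_of_chrisL fun c => ?_
  have hc := mem_chart_source (ModelProd H ℝ) c
  have hx := mem_chart_source H c.1.1
  have hz := chart_mem_target (I := I) hx
  have ht := chart_mem_target (I := I.prod 𝓘(ℝ, ℝ)) hc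
  have hp : extChartAt (I.prod 𝓘(ℝ, ℝ)) c c = (extChartAt I c.1.1 c.1.1, densityRep c.1.1 c.1.2) :=
    cone_extChartAt hx
  let y := densityRep c.1.1 c.1.2
  have hy : y ≠ 0 := (coneRep_pos hx (c := c)).ne'
  let β := s.logDeriv c.1.1 (extChartAt I c.1.1 c.1.1)
  -- The difference of the symbols is symmetric. It vanishes when one argument is the Euler field
  -- and when both are horizontal lifts for one chosen scale.
  let Δ := chrisL nabla'.cov c (extChartAt (I.prod 𝓘(ℝ, ℝ)) c c) -
    chrisL nabla.cov c (extChartAt (I.prod 𝓘(ℝ, ℝ)) c c)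
  have hsym : ∀ V W, Δ V W = Δ W V := fun V W => by
    simp only [Δ, sub_apply, nabla'.chrisL_symm ht V, nabla.chrisL_symm ht V]
  have hZ : ∀ V : E × ℝ, Δ V (0, y) = 0 := by
    intro V
    have e := dChart_cov nabla.cov hc (mdifferentiableAt_eulerField c)
      (dChartInv (I.prod 𝓘(ℝ, ℝ)) c c V)
    have e' := dChart_cov nabla'.cov hc (mdifferentiableAt_eulerField c)
      (dChartInv (I.prod 𝓘(ℝ, ℝ)) c c V)
    rw [h.cov_euler, dChart_dChartInv hc, localRep_eulerField ht, hp] at e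
    rw [h'.cov_euler, dChart_dChartInv hc, localRep_eulerField ht, hp] at e'
    simp only [Δ, sub_apply, hp]
    exact sub_eq_zero.2 (add_left_cancel (e.symm.trans e')).symm
  have hL : ∀ v w : E, Δ (v, y * β v) (w, y * β w) = 0 := by
    intro v w
    obtain ⟨Y, hY, hYe⟩ := exists_isSmoothField_eventuallyEq (I := I) hx w
    have hYw : localRep c.1.1 Y (extChartAt I c.1.1 c.1.1) = w := by
      rw [localRep_apply hx, hYe.self_of_nhds]
      exact dChart_constField hx w
    have hlv : dChart (I.prod 𝓘(ℝ, ℝ)) c c (s.lift c (dChartInv I c.1.1 c.1.1 v)) =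
        (v, y * β v) := by
      rw [s.dChart_lift hx, dChart_dChartInv hx]
    have e := dChart_cov nabla.cov hc (mdifferentiableAt_lift s (hY c.1.1))
      (s.lift c (dChartInv I c.1.1 c.1.1 v))
    have e' := dChart_cov nabla'.cov hc (mdifferentiableAt_lift s (hY c.1.1))
      (s.lift c (dChartInv I c.1.1 c.1.1 v))
    have hr := TorsionFreeConnection.projectivelyRelated_ofScale D₀ s
    have hs := TorsionFreeConnection.ofScale_preserves D₀ s
    rw [h.cov_lift s _ hr hs Y hY, localRep_lift s Y ht, hlv, hp, hYw] at e
    rw [h'.cov_lift s _ hr hs Y hY, localRep_lift s Y ht, hlv, hp, hYw] at e'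
    simp only [Δ, sub_apply, hp]
    exact sub_eq_zero.2 (add_left_cancel (e.symm.trans e')).symm
  -- Lifts and the Euler field span the tangent space of the cone.
  have hdec : ∀ V : E × ℝ, V = (V.1, y * β V.1) + ((V.2 - y * β V.1) / y) • (0, y) := by
    intro V
    refine Prod.ext ?_ ?_
    · simp
    · simp only [Prod.snd_add, Prod.smul_snd, smul_eq_mul]
      field_simp
      ring
  refine sub_eq_zero.1 (ContinuousLinearMap.ext fun V => ContinuousLinearMap.ext fun W => ?_)
  change Δ V W = 0
  rw [hdec W, map_add, map_smul, hZ, smul_zero, add_zero, hsym, hdec V, map_add, map_smul, hZ,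
    smul_zero, add_zero, hL]

end Characterization

end ProjectiveAmbient

namespace ProjectiveAmbient

open Filter Topology

/-! ### The parallel volume density on the cone -/

section ParallelDensity

variable {E : Type*} [NormedAddCommGroup E] [NormedSpace ℝ E] [FiniteDimensional ℝ E]
  [CompleteSpace E]
  {H : Type*} [TopologicalSpace H] {I : ModelWithCorners ℝ E H} [I.Boundaryless]
  {X : Type*} [TopologicalSpace X] [ChartedSpace H X] [IsManifold I ∞ X]

/-- The map is a transvection along the fibre followed by a block-diagonal map. -/
lemma det_shear (f : E × ℝ →L[ℝ] E × ℝ) (J : E →L[ℝ] E) (j : ℝ) (φ : E →L[ℝ] ℝ)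
    (h : ∀ V, f V = (J V.1, j * (V.2 + φ V.1))) : f.det = J.det * j := by
  have hf : (f : E × ℝ →ₗ[ℝ] E × ℝ) =
      (LinearMap.prodMap (J : E →ₗ[ℝ] E) (j • LinearMap.id : ℝ →ₗ[ℝ] ℝ)) ∘ₗ
        LinearMap.transvection ((φ : E →ₗ[ℝ] ℝ) ∘ₗ LinearMap.fst ℝ E ℝ) ((0, 1) : E × ℝ) := by
    refine LinearMap.ext fun V => (h V).trans ?_
    simp [LinearMap.transvection.apply]
  rw [ContinuousLinearMap.det, hf, LinearMap.det_comp, LinearMap.det_prodMap,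
    LinearMap.transvection.det]
  simp [ContinuousLinearMap.det]

lemma det_transitionJ_cone {c₁ c₀ c : thomasCone I X}
    (h1 : c.1.1 ∈ (chartAt H c₁.1.1).source) (h0 : c.1.1 ∈ (chartAt H c₀.1.1).source) :
    (transitionJ (I.prod 𝓘(ℝ, ℝ)) c₁ c₀ (extChartAt (I.prod 𝓘(ℝ, ℝ)) c₁ c)).det =
      (transitionJ I c₁.1.1 c₀.1.1 (extChartAt I c₁.1.1 c.1.1)).det *
        densityJac I c₁.1.1 c₀.1.1 (extChartAt I c₁.1.1 c.1.1) :=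
  det_shear _ _ _ (densityRep c₁.1.1 c.1.2 • logJac I c₁.1.1 c₀.1.1 (extChartAt I c₁.1.1 c.1.1))
    fun V => transitionJ_cone h1 h0 V

variable [T2Space X]

/-- The cone has dimension `n+1`, so its densities of weight one transform by `|det J ·
j|^{-1/(n+2)}`. With `j = |det J|^{-1/(n+1)}` this factor is `j^{n/(n+2)}`, which is how that power
of the fibre coordinate transforms. -/
lemma densityRep_cone_rpow {c₀ c : thomasCone I X} (h : c.1.1 ∈ (chartAt H c₀.1.1).source) :
    densityRep c₀ ((densityCoord (I := I.prod 𝓘(ℝ, ℝ)) (w := 1) (x := c)).symm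
      (densityCoord c.1.2 ^ (Module.finrank ℝ E / (Module.finrank ℝ E + 2) : ℝ))) =
      densityRep c₀.1.1 c.1.2 ^ (Module.finrank ℝ E / (Module.finrank ℝ E + 2) : ℝ) := by
  have hx := mem_chart_source H c.1.1
  have hdet := abs_pos.2 (det_transitionJ_ne_zero (I := I) hx h)
  rw [densityRep_eq, absJac, det_transitionJ_cone hx h, ContinuousLinearEquiv.apply_symm_apply,
    densityRep_transition hx h c.1.2, densityRep_self, densityJac, abs_mul,
    abs_of_pos (Real.rpow_pos_of_pos hdet _), Real.mul_rpow hdet.le (Real.rpow_pos_of_pos hdet _).le,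
    Real.mul_rpow (Real.rpow_pos_of_pos hdet _).le (le_of_lt c.2), ← Real.rpow_mul hdet.le,
    ← Real.rpow_mul hdet.le, ← Real.rpow_add hdet]
  congr 2
  have hf : (Module.finrank ℝ (E × ℝ) : ℝ) = Module.finrank ℝ E + 1 := by simp
  have h1 : (Module.finrank ℝ E + 1 : ℝ) ≠ 0 := by positivity
  have h2 : (Module.finrank ℝ E + 2 : ℝ) ≠ 0 := by positivity
  have h3 : (Module.finrank ℝ E + 1 + 1 : ℝ) ≠ 0 := by positivity
  rw [hf]
  field_simp
  ring

/-- The power of the fibre coordinate that is a volume density on the cone. -/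
def coneScale (I : ModelWithCorners ℝ E H) [I.Boundaryless] (X : Type*) [TopologicalSpace X]
    [ChartedSpace H X] [IsManifold I ∞ X] [T2Space X] :
    Scale (I.prod 𝓘(ℝ, ℝ)) (thomasCone I X) where
  val c := densityCoord.symm
    (densityCoord c.1.2 ^ (Module.finrank ℝ E / (Module.finrank ℝ E + 2) : ℝ))
  pos c := by
    rw [ContinuousLinearEquiv.apply_symm_apply]
    exact Real.rpow_pos_of_pos c.2 _
  smooth c := by
    have hc := mem_chart_source (ModelProd H ℝ) c
    have ht := chart_mem_target (I := I.prod 𝓘(ℝ, ℝ)) hc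
    refine ((trivializationAt ℝ (Density (I.prod 𝓘(ℝ, ℝ)) (thomasCone I X) 1)
      c).contMDiffAt_section_iff hc).2 ?_
    rw [contMDiffAt_iff_chart hc]
    have h : ContDiffAt ℝ ∞ (fun p : E × ℝ =>
        p.2 ^ (Module.finrank ℝ E / (Module.finrank ℝ E + 2) : ℝ))
        (extChartAt (I.prod 𝓘(ℝ, ℝ)) c c) :=
      contDiffAt_snd.rpow_const_of_ne (cone_target ht).2.ne'
    refine h.congr_of_eventuallyEq ?_
    filter_upwards [eventually_target ht] with p hp
    rw [← (cone_chart_symm hp).2]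
    exact densityRep_cone_rpow (cone_mem_chart_source.1 (chart_symm_mem hp))

lemma logDeriv_coneScale {c₀ : thomasCone I X} {p : E × ℝ}
    (hp : p ∈ (extChartAt (I.prod 𝓘(ℝ, ℝ)) c₀).target) (V : E × ℝ) :
    (coneScale I X).logDeriv c₀ p V =
      (Module.finrank ℝ E / (Module.finrank ℝ E + 2) : ℝ) * (V.2 / p.2) := by
  have he : (fun p => Real.log ((coneScale I X).rep c₀ p)) =ᶠ[𝓝 p] fun p =>
      (Module.finrank ℝ E / (Module.finrank ℝ E + 2) : ℝ) * Real.log p.2 := by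
    filter_upwards [eventually_target hp] with p hp
    rw [← Real.log_rpow (cone_target hp).2, ← (cone_chart_symm hp).2]
    exact congrArg Real.log (densityRep_cone_rpow (cone_mem_chart_source.1 (chart_symm_mem hp)))
  have hd := (hasFDerivAt_snd (p := p) (𝕜 := ℝ) (E := E) (F := ℝ)).log (cone_target hp).2.ne'
  rw [Scale.logDeriv, he.fderiv_eq, (hd.const_mul _).fderiv]
  simp only [smul_apply, ContinuousLinearMap.coe_snd', smul_eq_mul]
  ring

lemma trL_coneSymbol (D : TorsionFreeConnection I X) (x₀ : X) (p V : E × ℝ) :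
    trL (coneSymbol D x₀ p V) = Module.finrank ℝ E * (V.2 / p.2) := by
  have h1 : ContinuousLinearMap.fst ℝ E ℝ ∘L coneSymbol D x₀ p V ∘L ContinuousLinearMap.inl ℝ E ℝ =
      thomasSymbol D x₀ p.1 V.1 + (V.2 / p.2) • ContinuousLinearMap.id ℝ E := by
    ext w
    simp [coneSymbol_apply]
  have h2 : ContinuousLinearMap.snd ℝ E ℝ ∘L coneSymbol D x₀ p V ∘L ContinuousLinearMap.inr ℝ E ℝ =
      0 := by
    ext
    simp [coneSymbol_apply]
  rw [trL_prod, h1, h2, map_zero, add_zero, map_add, map_smul, trL_thomasSymbol, trL_id, zero_add,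
    smul_eq_mul, mul_comm]

/-- The trace of the symbols is `n dy/y`; divided by `n+2`, the dimension of the cone plus one, it
is the logarithmic derivative of `y^{n/(n+2)}`. -/
lemma thomasConnection_preserves (D : TorsionFreeConnection I X)
    (hE : (Module.finrank ℝ E - 1 : ℝ) ≠ 0) : (thomasConnection D hE).Preserves (coneScale I X) := by
  rw [TorsionFreeConnection.preserves_iff]
  intro c
  have ht := chart_mem_target (I := I.prod 𝓘(ℝ, ℝ)) (mem_chart_source (ModelProd H ℝ) c)
  refine ContinuousLinearMap.ext fun V => ?_
  have hf : (Module.finrank ℝ (E × ℝ) : ℝ) = Module.finrank ℝ E + 1 := by simp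
  rw [covLogDeriv, sub_apply, smul_apply, ContinuousLinearMap.comp_apply,
    chrisL_thomasConnection D hE ht, trL_coneSymbol, logDeriv_coneScale ht, hf, smul_eq_mul,
    zero_apply]
  ring

end ParallelDensity

end ProjectiveAmbient

namespace ProjectiveAmbient

open Filter Topology

/-! ### The ambient coordinates of a scale and their dependence on it -/

section AmbientCoordinates

variable {E : Type*} [NormedAddCommGroup E] [NormedSpace ℝ E] [FiniteDimensional ℝ E]
  [CompleteSpace E]
  {H : Type*} [TopologicalSpace H] {I : ModelWithCorners ℝ E H} [I.Boundaryless]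
  {X : Type*} [TopologicalSpace X] [ChartedSpace H X] [IsManifold I ∞ X]

lemma densityRep_sq_mul_weightedRep {x₀ : X} {q : WeightedCotangentSpace I X (-2)}
    (h : q.1 ∈ (chartAt H x₀).source) (c : Density I X 1 q.1) (v : E) :
    densityRep x₀ c ^ 2 * weightedRep x₀ q v =
      densityCoord c ^ 2 * densityCoord (q.2 (dChartInv I x₀ q.1 v)) := by
  have hj := absJac_pos (I := I) h
  have e : (absJac I x₀ q.1 ^ (-1 / (Module.finrank ℝ E + 1 : ℝ))) ^ 2 *
      absJac I x₀ q.1 ^ (-(-2) / (Module.finrank ℝ E + 1 : ℝ)) = 1 := by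
    rw [← Real.rpow_natCast, ← Real.rpow_mul hj.le, ← Real.rpow_add hj]
    convert Real.rpow_zero _ using 2
    push_cast
    ring
  rw [densityRep_eq]
  change _ * (absJac I x₀ q.1 ^ (-(-2) / (Module.finrank ℝ E + 1 : ℝ)) *
    densityCoord (q.2 (dChartInv I x₀ q.1 v))) = _
  linear_combination densityCoord c ^ 2 * densityCoord (q.2 (dChartInv I x₀ q.1 v)) * e

namespace Scale

variable (s s' : Scale I X)

/-- Lifts and the Euler field form a frame, so a covector on the cone is known from its values on
them, that is, from the data kept by `ambientCoord`. -/
lemma eq_lift_add_eulerField {c₀ c : thomasCone I X} (h : c.1.1 ∈ (chartAt H c₀.1.1).source)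
    (V : E × ℝ) :
    dChartInv (I.prod 𝓘(ℝ, ℝ)) c₀ c V = s.lift c (dChartInv I c₀.1.1 c.1.1 V.1) +
      (V.2 / densityRep c₀.1.1 c.1.2 - s.logDeriv c₀.1.1 (extChartAt I c₀.1.1 c.1.1) V.1) •
        eulerField c := by
  have hc := cone_mem_chart_source.2 h
  have hy := (coneRep_pos h (c := c)).ne'
  refine dChart_inj hc ?_
  rw [dChart_dChartInv hc, map_add, map_smul, s.dChart_lift h, dChart_eulerField h,
    dChart_dChartInv h]
  refine Prod.ext ?_ ?_
  · simp
  · simp only [Prod.snd_add, Prod.smul_snd, smul_eq_mul]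
    field_simp
    ring

lemma covectorRep_cone {c₀ : thomasCone I X} {ξ : CotangentSpace (I.prod 𝓘(ℝ, ℝ)) (thomasCone I X)}
    (h : ξ.1.1.1 ∈ (chartAt H c₀.1.1).source) (V : E × ℝ) :
    covectorRep c₀ ξ V = (ξ.2 (s.lift ξ.1 (dChartInv I c₀.1.1 ξ.1.1.1 V.1)) : ℝ) +
      (V.2 / densityRep c₀.1.1 ξ.1.1.2 -
        s.logDeriv c₀.1.1 (extChartAt I c₀.1.1 ξ.1.1.1) V.1) * ξ.2 (eulerField ξ.1) := by
  have e := congrArg ξ.2 (s.eq_lift_add_eulerField h V)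
  rw [map_add, map_smul] at e
  exact e

lemma fibreCoord_sq_mul (ξ : CotangentSpace (I.prod 𝓘(ℝ, ℝ)) (thomasCone I X)) :
    ((ambientCoord s ξ).1 : ℝ) ^ 2 * (ambientCoord s ξ).2.2 = ξ.2 (eulerField ξ.1) :=
  mul_div_cancel₀ _ (pow_ne_zero 2 (s.fibreCoord ξ.1).2.ne')

lemma densityRep_sq_mul_ambientCoord {x₀ : X}
    {ξ : CotangentSpace (I.prod 𝓘(ℝ, ℝ)) (thomasCone I X)}
    (h : ξ.1.1.1 ∈ (chartAt H x₀).source) (v : E) :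
    densityRep x₀ ξ.1.1.2 ^ 2 * weightedRep x₀ (ambientCoord s ξ).2.1 v =
      ξ.2 (s.lift ξ.1 (dChartInv I x₀ ξ.1.1.1 v)) := by
  refine (densityRep_sq_mul_weightedRep (q := (ambientCoord s ξ).2.1) h ξ.1.1.2 v).trans ?_
  have hy : densityCoord ξ.1.1.2 ^ 2 ≠ 0 := pow_ne_zero 2 (ne_of_gt ξ.1.2)
  exact mul_inv_cancel_left₀ hy _

/-- A covector on the cone in terms of its ambient coordinates. -/
lemma covectorRep_eq_ambientCoord {c₀ : thomasCone I X}
    {ξ : CotangentSpace (I.prod 𝓘(ℝ, ℝ)) (thomasCone I X)}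
    (h : ξ.1.1.1 ∈ (chartAt H c₀.1.1).source) (V : E × ℝ) :
    covectorRep c₀ ξ V =
      densityRep c₀.1.1 ξ.1.1.2 ^ 2 * weightedRep c₀.1.1 (ambientCoord s ξ).2.1 V.1 +
      (V.2 / densityRep c₀.1.1 ξ.1.1.2 -
        s.logDeriv c₀.1.1 (extChartAt I c₀.1.1 ξ.1.1.1) V.1) *
          (((ambientCoord s ξ).1 : ℝ) ^ 2 * (ambientCoord s ξ).2.2) := by
  rw [s.covectorRep_cone h, s.densityRep_sq_mul_ambientCoord h, s.fibreCoord_sq_mul]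

lemma covectorRep_injective {x₀ : X} {x : X} (hx : x ∈ (chartAt H x₀).source)
    {φ φ' : TangentSpace I x →L[ℝ] Trivial X ℝ x}
    (h : ∀ v, covectorRep x₀ (⟨x, φ⟩ : CotangentSpace I X) v = covectorRep x₀ ⟨x, φ'⟩ v) :
    φ = φ' := by
  refine ContinuousLinearMap.ext fun u => ?_
  have e := h (dChart I x₀ x u)
  have hu := dChartInv_dChart hx u
  exact ((congrArg φ hu).symm.trans e).trans (congrArg φ' hu)

/-- The base point is `t s(x)`, and over it `covectorRep_eq_ambientCoord` recovers the covector. -/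
lemma ambientCoord_injective : Function.Injective (ambientCoord s) := by
  intro ξ η h
  have hbase : ξ.1 = η.1 := by
    have e1 : s.fibreCoord ξ.1 = s.fibreCoord η.1 := congrArg Prod.fst h
    have e2 : ξ.1.1.1 = η.1.1.1 := congrArg (fun a => a.2.1.1) h
    rw [← s.coneSection_fibreCoord ξ.1, ← s.coneSection_fibreCoord η.1, e1, e2]
  obtain ⟨c, φ⟩ := ξ
  obtain ⟨c', φ'⟩ := η
  change c = c' at hbase
  subst hbase
  have hx := mem_chart_source H c.1.1
  refine congrArg (TotalSpace.mk c) (covectorRep_injective (mem_chart_source (ModelProd H ℝ) c)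
    fun V => ?_)
  rw [s.covectorRep_eq_ambientCoord hx V, s.covectorRep_eq_ambientCoord hx V, h]

lemma lift_eq (c : thomasCone I X) (v : E) : s.lift c v =
    ((v, densityCoord c.1.2 * s.logDeriv c.1.1 (extChartAt I c.1.1 c.1.1) v) : E × ℝ) := by
  have e := s.dChart_lift (mem_chart_source H c.1.1) v
  have e1 : dChart I c.1.1 c.1.1 v = v := dChart_self _ v
  rw [e1, densityRep_self] at e
  exact (dChart_self (I := I.prod 𝓘(ℝ, ℝ)) c (s.lift c v)).symm.trans e

/-- The covector on the cone with given ambient coordinates. -/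
def ambientInv (a : PosReal × WeightedCotangentSpace I X (-2) × ℝ) :
    CotangentSpace (I.prod 𝓘(ℝ, ℝ)) (thomasCone I X) :=
  ⟨s.coneSection a.1 a.2.1.1,
    (densityCoord (s.coneSection a.1 a.2.1.1).1.2 ^ 2 •
      ((densityCoord (w := -2) (x := a.2.1.1)).toContinuousLinearMap ∘L a.2.1.2 : E →L[ℝ] ℝ)) ∘L
        ContinuousLinearMap.fst ℝ E ℝ +
      ((a.1 : ℝ) ^ 2 * a.2.2) • ((densityCoord (s.coneSection a.1 a.2.1.1).1.2)⁻¹ •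
        ContinuousLinearMap.snd ℝ E ℝ -
        s.logDeriv a.2.1.1 (extChartAt I a.2.1.1 a.2.1.1) ∘L ContinuousLinearMap.fst ℝ E ℝ)⟩

lemma fibreCoord_coneSection (t : PosReal) (x : X) : s.fibreCoord (s.coneSection t x) = t := by
  refine Subtype.ext ?_
  change densityCoord ((t : ℝ) • s.val x) / densityCoord (s.val x) = t
  rw [map_smul, smul_eq_mul, mul_div_cancel_right₀ _ (s.pos x).ne']

/-- The two summands of `ambientInv` decouple: `y⁻¹ dy - β` vanishes on horizontal lifts and is one
on the Euler field, while covectors pulled back from the base vanish on the Euler field. -/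
lemma ambientCoord_ambientInv (a : PosReal × WeightedCotangentSpace I X (-2) × ℝ) :
    ambientCoord s (s.ambientInv a) = a := by
  have hy : densityCoord (s.coneSection a.1 a.2.1.1).1.2 ≠ 0 := ne_of_gt (s.coneSection a.1 a.2.1.1).2
  have h1 : s.fibreCoord (s.ambientInv a).1 = a.1 := s.fibreCoord_coneSection a.1 a.2.1.1
  have ht : (a.1 : ℝ) ≠ 0 := a.1.2.ne'
  have hform : ∀ V : E × ℝ, (s.ambientInv a).2 V =
      densityCoord (s.coneSection a.1 a.2.1.1).1.2 ^ 2 * densityCoord (a.2.1.2 V.1) +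
      ((a.1 : ℝ) ^ 2 * a.2.2) * ((densityCoord (s.coneSection a.1 a.2.1.1).1.2)⁻¹ * V.2 -
        s.logDeriv a.2.1.1 (extChartAt I a.2.1.1 a.2.1.1) V.1) := fun V => rfl
  refine Prod.ext h1 (Prod.ext ?_ ?_)
  · refine congrArg (TotalSpace.mk a.2.1.1) (ContinuousLinearMap.ext fun v => ?_)
    refine (densityCoord (I := I) (w := -2) (x := a.2.1.1)).injective ?_
    have e : (s.ambientInv a).2 (s.lift (s.ambientInv a).1 v) =
        densityCoord (s.coneSection a.1 a.2.1.1).1.2 ^ 2 * densityCoord (a.2.1.2 v) := by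
      refine (congrArg (s.ambientInv a).2 (s.lift_eq (s.coneSection a.1 a.2.1.1) v)).trans ?_
      rw [hform]
      simp only
      rw [inv_mul_cancel_left₀ hy]
      exact (add_eq_left.2 (mul_eq_zero_of_right _ (sub_self _)))
    change (densityCoord (s.coneSection a.1 a.2.1.1).1.2 ^ 2)⁻¹ *
      ((s.ambientInv a).2 (s.lift (s.ambientInv a).1 v)) = densityCoord (a.2.1.2 v)
    rw [e, inv_mul_cancel_left₀ (pow_ne_zero 2 hy)]
  · have e : (s.ambientInv a).2 (eulerField (s.ambientInv a).1) = (a.1 : ℝ) ^ 2 * a.2.2 := by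
      refine (hform (0, densityCoord (s.coneSection a.1 a.2.1.1).1.2)).trans ?_
      have e0 : densityCoord (a.2.1.2 (0 : E)) = 0 :=
        (congrArg densityCoord (map_zero a.2.1.2)).trans (map_zero _)
      simp only [map_zero, sub_zero]
      rw [e0, mul_zero, zero_add, inv_mul_cancel₀ hy, mul_one]
    change (s.ambientInv a).2 (eulerField (s.ambientInv a).1) /
      (s.fibreCoord (s.ambientInv a).1 : ℝ) ^ 2 = a.2.2
    rw [e, h1, mul_div_cancel_left₀ _ (pow_ne_zero 2 ht)]

lemma ambientInv_ambientCoord (ξ : CotangentSpace (I.prod 𝓘(ℝ, ℝ)) (thomasCone I X)) :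
    s.ambientInv (ambientCoord s ξ) = ξ :=
  s.ambientCoord_injective (s.ambientCoord_ambientInv _)

/-- The change of ambient coordinates between two scales. -/
def ambientChange (a : PosReal × WeightedCotangentSpace I X (-2) × ℝ) :
    PosReal × WeightedCotangentSpace I X (-2) × ℝ :=
  (⟨a.1 * (densityCoord (s.val a.2.1.1) / densityCoord (s'.val a.2.1.1)),
      Set.mem_Ioi.2 (mul_pos a.1.2 (div_pos (s.pos _) (s'.pos _)))⟩,
    ⟨a.2.1.1, a.2.1.2 + (a.2.2 * (densityCoord (s.val a.2.1.1) ^ 2)⁻¹) •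
      ((densityCoord (I := I) (w := -2) (x := a.2.1.1)).symm.toContinuousLinearMap ∘L
        (s'.logDeriv a.2.1.1 (extChartAt I a.2.1.1 a.2.1.1) -
          s.logDeriv a.2.1.1 (extChartAt I a.2.1.1 a.2.1.1)) ∘L dChart I a.2.1.1 a.2.1.1)⟩,
    a.2.2 * (densityCoord (s'.val a.2.1.1) / densityCoord (s.val a.2.1.1)) ^ 2)

/-- Since `t s = t' s'`, the factors of `t` and `ρ` are powers of `s/s'`. The lifts of the two
scales differ by `(β' - β)` times the Euler field, which adds a multiple of `ρ` to `q`. -/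
lemma ambientCoord_eq_ambientChange (ξ : CotangentSpace (I.prod 𝓘(ℝ, ℝ)) (thomasCone I X)) :
    ambientCoord s' ξ = s.ambientChange s' (ambientCoord s ξ) := by
  have hs := (s.pos ξ.1.1.1).ne'
  have hs' := (s'.pos ξ.1.1.1).ne'
  have hy : densityCoord ξ.1.1.2 ≠ 0 := ne_of_gt ξ.1.2
  refine Prod.ext (Subtype.ext ?_) (Prod.ext ?_ ?_)
  · change densityCoord ξ.1.1.2 / densityCoord (s'.val ξ.1.1.1) =
      densityCoord ξ.1.1.2 / densityCoord (s.val ξ.1.1.1) *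
        (densityCoord (s.val ξ.1.1.1) / densityCoord (s'.val ξ.1.1.1))
    field_simp
  · refine congrArg (TotalSpace.mk ξ.1.1.1) (ContinuousLinearMap.ext fun v : E => ?_)
    refine (densityCoord (I := I) (w := -2) (x := ξ.1.1.1)).injective ?_
    have e : ξ.2 (s'.lift ξ.1 v) = (ξ.2 (s.lift ξ.1 v) : ℝ) +
        (s'.logDeriv ξ.1.1.1 (extChartAt I ξ.1.1.1 ξ.1.1.1) v -
          s.logDeriv ξ.1.1.1 (extChartAt I ξ.1.1.1 ξ.1.1.1) v) * ξ.2 (eulerField ξ.1) := by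
      have e1 : s'.lift ξ.1 v = s.lift ξ.1 v +
          (s'.logDeriv ξ.1.1.1 (extChartAt I ξ.1.1.1 ξ.1.1.1) v -
          s.logDeriv ξ.1.1.1 (extChartAt I ξ.1.1.1 ξ.1.1.1) v) • eulerField ξ.1 := by
        have key : ((v, densityCoord ξ.1.1.2 *
            s'.logDeriv ξ.1.1.1 (extChartAt I ξ.1.1.1 ξ.1.1.1) v) : E × ℝ) =
            (v, densityCoord ξ.1.1.2 * s.logDeriv ξ.1.1.1 (extChartAt I ξ.1.1.1 ξ.1.1.1) v) +
            (s'.logDeriv ξ.1.1.1 (extChartAt I ξ.1.1.1 ξ.1.1.1) v -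
              s.logDeriv ξ.1.1.1 (extChartAt I ξ.1.1.1 ξ.1.1.1) v) • (0, densityCoord ξ.1.1.2) := by
          refine Prod.ext ?_ ?_
          · simp
          · simp only [Prod.snd_add, Prod.smul_snd, smul_eq_mul]
            ring
        exact (s'.lift_eq ξ.1 v).trans (key.trans (congrArg (fun a : E × ℝ => a +
          (s'.logDeriv ξ.1.1.1 (extChartAt I ξ.1.1.1 ξ.1.1.1) v -
            s.logDeriv ξ.1.1.1 (extChartAt I ξ.1.1.1 ξ.1.1.1) v) •
              ((0, densityCoord ξ.1.1.2) : E × ℝ)) (s.lift_eq ξ.1 v).symm))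
      rw [e1, map_add, map_smul]
      rfl
    change (densityCoord ξ.1.1.2 ^ 2)⁻¹ * ξ.2 (s'.lift ξ.1 v) =
      (densityCoord ξ.1.1.2 ^ 2)⁻¹ * ξ.2 (s.lift ξ.1 v) +
        (ξ.2 (eulerField ξ.1) / (densityCoord ξ.1.1.2 / densityCoord (s.val ξ.1.1.1)) ^ 2 *
          (densityCoord (s.val ξ.1.1.1) ^ 2)⁻¹) *
        (s'.logDeriv ξ.1.1.1 (extChartAt I ξ.1.1.1 ξ.1.1.1) (dChart I ξ.1.1.1 ξ.1.1.1 v) -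
          s.logDeriv ξ.1.1.1 (extChartAt I ξ.1.1.1 ξ.1.1.1) (dChart I ξ.1.1.1 ξ.1.1.1 v))
    have hv : dChart I ξ.1.1.1 ξ.1.1.1 v = v := dChart_self _ v
    rw [e, hv]
    field_simp
  · change ξ.2 (eulerField ξ.1) / (densityCoord ξ.1.1.2 / densityCoord (s'.val ξ.1.1.1)) ^ 2 =
      ξ.2 (eulerField ξ.1) / (densityCoord ξ.1.1.2 / densityCoord (s.val ξ.1.1.1)) ^ 2 *
        (densityCoord (s'.val ξ.1.1.1) / densityCoord (s.val ξ.1.1.1)) ^ 2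
    field_simp

/-- The change of scale multiplies `t` by a function on the base, and `t` enters neither of the
other components. -/
lemma ambientChange_dilate (l : PosReal) (a : PosReal × WeightedCotangentSpace I X (-2) × ℝ) :
    s.ambientChange s' (dilate l a) = dilate l (s.ambientChange s' a) :=
  Prod.ext (Subtype.ext (mul_assoc _ _ _)) rfl

/-- The correction of `q` is proportional to `ρ`. -/
lemma ambientCoord_snd_eq {ξ : CotangentSpace (I.prod 𝓘(ℝ, ℝ)) (thomasCone I X)}
    (h : (ambientCoord s ξ).2.2 = 0) : (ambientCoord s' ξ).2 = (ambientCoord s ξ).2 := by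
  rw [s.ambientCoord_eq_ambientChange s']
  generalize ambientCoord s ξ = a at h
  obtain ⟨t, q, ρ⟩ := a
  change ρ = 0 at h
  subst h
  refine Prod.ext (congrArg (TotalSpace.mk q.1) ?_) (zero_mul _)
  change q.2 + ((0 : ℝ) * (densityCoord (s.val q.1) ^ 2)⁻¹) • _ = q.2
  rw [zero_mul, zero_smul, add_zero]

end Scale

end AmbientCoordinates

end ProjectiveAmbient

namespace ProjectiveAmbient

open Filter Topology

/-! ### Smoothness of the ambient coordinates and of their inverse -/

section AmbientDiffeomorphism

variable {E : Type*} [NormedAddCommGroup E] [NormedSpace ℝ E] [FiniteDimensional ℝ E]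
  [CompleteSpace E]
  {H : Type*} [TopologicalSpace H] {I : ModelWithCorners ℝ E H} [I.Boundaryless]
  {X : Type*} [TopologicalSpace X] [ChartedSpace H X] [IsManifold I ∞ X]

namespace Scale

variable (s : Scale I X)

/-- The first ambient coordinate in a chart. -/
def ambientRadius (x₀ : X) (p : (E × ℝ) × (E × ℝ →L[ℝ] ℝ)) : ℝ := p.1.2 / s.rep x₀ p.1.1

/-- The component of the ambient coordinates along the fibres of the weighted cotangent bundle, in
a chart. -/
def ambientFibre (x₀ : X) (p : (E × ℝ) × (E × ℝ →L[ℝ] ℝ)) : E →L[ℝ] ℝ :=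
  (p.1.2 ^ 2)⁻¹ • (p.2 ∘L ContinuousLinearMap.inl ℝ E ℝ +
    (p.2 (0, 1) * p.1.2) • s.logDeriv x₀ p.1.1)

/-- The last ambient coordinate in a chart. -/
def ambientRho (x₀ : X) (p : (E × ℝ) × (E × ℝ →L[ℝ] ℝ)) : ℝ :=
  p.2 (0, 1) * s.rep x₀ p.1.1 ^ 2 / p.1.2

section Smoothness

variable {s} {x₀ : X} {p : (E × ℝ) × (E × ℝ →L[ℝ] ℝ)}

lemma contDiffAt_rep_base (hz : p.1.1 ∈ (extChartAt I x₀).target) :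
    ContDiffAt ℝ ∞ (fun p : (E × ℝ) × (E × ℝ →L[ℝ] ℝ) => s.rep x₀ p.1.1) p :=
  ContDiffAt.comp (g := s.rep x₀) p (s.contDiffAt_rep hz) (contDiffAt_fst.comp p contDiffAt_fst)

lemma contDiffAt_ambientRadius (hz : p.1.1 ∈ (extChartAt I x₀).target) :
    ContDiffAt ℝ ∞ (s.ambientRadius x₀) p :=
  ContDiffAt.div (contDiffAt_snd.comp p contDiffAt_fst) (contDiffAt_rep_base hz) (s.rep_pos hz).ne'

lemma contDiffAt_ambientFibre (hz : p.1.1 ∈ (extChartAt I x₀).target) (hy : p.1.2 ≠ 0) :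
    ContDiffAt ℝ ∞ (s.ambientFibre x₀) p := by
  have hyd : ContDiffAt ℝ ∞ (fun p : (E × ℝ) × (E × ℝ →L[ℝ] ℝ) => p.1.2) p :=
    contDiffAt_snd.comp p contDiffAt_fst
  have hβ : ContDiffAt ℝ ∞ (fun p : (E × ℝ) × (E × ℝ →L[ℝ] ℝ) => s.logDeriv x₀ p.1.1) p :=
    ContDiffAt.comp (g := s.logDeriv x₀) p (s.contDiffAt_logDeriv hz)
      (contDiffAt_fst.comp p contDiffAt_fst)
  exact ((hyd.pow 2).inv (pow_ne_zero 2 hy)).smul ((contDiffAt_snd.clm_comp contDiffAt_const).add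
    (((contDiffAt_snd.clm_apply contDiffAt_const).mul hyd).smul hβ))

lemma contDiffAt_ambientRho (hz : p.1.1 ∈ (extChartAt I x₀).target) (hy : p.1.2 ≠ 0) :
    ContDiffAt ℝ ∞ (s.ambientRho x₀) p :=
  ContDiffAt.div ((contDiffAt_snd.clm_apply contDiffAt_const).mul ((contDiffAt_rep_base hz).pow 2))
    (contDiffAt_snd.comp p contDiffAt_fst) hy

end Smoothness

variable {c₀ : thomasCone I X} {ξ : CotangentSpace (I.prod 𝓘(ℝ, ℝ)) (thomasCone I X)}

lemma cotangent_cone_extChartAt {ξ₀ : CotangentSpace (I.prod 𝓘(ℝ, ℝ)) (thomasCone I X)}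
    (h : ξ.1.1.1 ∈ (chartAt H ξ₀.1.1.1).source) :
    extChartAt ((I.prod 𝓘(ℝ, ℝ)).prod 𝓘(ℝ, E × ℝ →L[ℝ] ℝ)) ξ₀ ξ =
      ((extChartAt I ξ₀.1.1.1 ξ.1.1.1, densityRep ξ₀.1.1.1 ξ.1.1.2), covectorRep ξ₀.1 ξ) := by
  rw [cotangent_extChartAt (cone_mem_chart_source.2 h), cone_extChartAt h]

lemma fibreCoord_chart {x₀ : X} {c : thomasCone I X} (h : c.1.1 ∈ (chartAt H x₀).source) :
    (s.fibreCoord c : ℝ) = densityRep x₀ c.1.2 / s.rep x₀ (extChartAt I x₀ c.1.1) := by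
  rw [s.rep_apply h, ← s.fibreCoord_mul_densityRep,
    mul_div_cancel_right₀ _ (densityRep_pos h (s.pos _)).ne']

lemma covectorRep_euler (s : Scale I X) (h : ξ.1.1.1 ∈ (chartAt H c₀.1.1).source) :
    (ξ.2 (eulerField ξ.1) : ℝ) = covectorRep c₀ ξ (0, 1) * densityRep c₀.1.1 ξ.1.1.2 := by
  have hy := (coneRep_pos h).ne'
  have e := s.covectorRep_cone h ((0, 1) : E × ℝ)
  have e0 : (ξ.2 (s.lift ξ.1 (dChartInv I c₀.1.1 ξ.1.1.1 ((0, 1) : E × ℝ).1)) : ℝ) = 0 :=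
    (congrArg (fun v => ξ.2 (s.lift ξ.1 v)) (map_zero (dChartInv I c₀.1.1 ξ.1.1.1))).trans
      ((congrArg ξ.2 (map_zero (s.lift ξ.1))).trans (map_zero _))
  rw [e, e0]
  simp only [map_zero, zero_add, sub_zero]
  rw [one_div, mul_comm, mul_inv_cancel_left₀ hy]

lemma ambientRho_chart (h : ξ.1.1.1 ∈ (chartAt H c₀.1.1).source) :
    (ambientCoord s ξ).2.2 = s.ambientRho c₀.1.1
      ((extChartAt I c₀.1.1 ξ.1.1.1, densityRep c₀.1.1 ξ.1.1.2), covectorRep c₀ ξ) := by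
  have hy := (coneRep_pos h).ne'
  have hs := (densityRep_pos h (s.pos ξ.1.1.1)).ne'
  change (ξ.2 (eulerField ξ.1) : ℝ) / (s.fibreCoord ξ.1 : ℝ) ^ 2 = _
  rw [s.covectorRep_euler h, s.fibreCoord_chart h, ambientRho, s.rep_apply h]
  field_simp

/-- The covector is evaluated on `(v, y β(v))`, the components of the horizontal lift of `v`. -/
lemma ambientFibre_chart (h : ξ.1.1.1 ∈ (chartAt H c₀.1.1).source) :
    weightedRep c₀.1.1 (ambientCoord s ξ).2.1 = s.ambientFibre c₀.1.1
      ((extChartAt I c₀.1.1 ξ.1.1.1, densityRep c₀.1.1 ξ.1.1.2), covectorRep c₀ ξ) := by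
  have hy := (coneRep_pos h).ne'
  ext v
  have e1 := s.densityRep_sq_mul_ambientCoord h v
  have e2 := s.covectorRep_cone h ((v, densityRep c₀.1.1 ξ.1.1.2 *
    s.logDeriv c₀.1.1 (extChartAt I c₀.1.1 ξ.1.1.1) v) : E × ℝ)
  simp only [mul_div_cancel_left₀ _ hy, sub_self, zero_mul, add_zero] at e2
  have e3 : ((v, densityRep c₀.1.1 ξ.1.1.2 *
      s.logDeriv c₀.1.1 (extChartAt I c₀.1.1 ξ.1.1.1) v) : E × ℝ) = (v, 0) +
      (densityRep c₀.1.1 ξ.1.1.2 * s.logDeriv c₀.1.1 (extChartAt I c₀.1.1 ξ.1.1.1) v) • (0, 1) := by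
    refine Prod.ext ?_ ?_ <;> simp
  rw [e3, map_add, map_smul] at e2
  change _ = (densityRep c₀.1.1 ξ.1.1.2 ^ 2)⁻¹ * (covectorRep c₀ ξ (v, 0) +
    (covectorRep c₀ ξ (0, 1) * densityRep c₀.1.1 ξ.1.1.2) *
      s.logDeriv c₀.1.1 (extChartAt I c₀.1.1 ξ.1.1.1) v)
  rw [eq_inv_mul_iff_mul_eq₀ (pow_ne_zero 2 hy)]
  refine e1.trans (e2.symm.trans ?_)
  rw [smul_eq_mul]
  ring

lemma cotangent_cone_target {ξ₀ : CotangentSpace (I.prod 𝓘(ℝ, ℝ)) (thomasCone I X)}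
    {p : (E × ℝ) × (E × ℝ →L[ℝ] ℝ)}
    (hp : p ∈ (extChartAt ((I.prod 𝓘(ℝ, ℝ)).prod 𝓘(ℝ, E × ℝ →L[ℝ] ℝ)) ξ₀).target) :
    p.1.1 ∈ (extChartAt I ξ₀.1.1.1).target ∧ 0 < p.1.2 :=
  cone_target (cotangent_target hp)

/-- A function on the cotangent bundle of the cone that is given by a function in charts. -/
lemma eventuallyEq_cotangent_cone {Y : Type*} {f : CotangentSpace (I.prod 𝓘(ℝ, ℝ)) (thomasCone I X) → Y}
    {F : (E × ℝ) × (E × ℝ →L[ℝ] ℝ) → Y} {ξ₀ : CotangentSpace (I.prod 𝓘(ℝ, ℝ)) (thomasCone I X)}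
    (hf : ∀ ξ, ξ.1.1.1 ∈ (chartAt H ξ₀.1.1.1).source → f ξ = F ((extChartAt I ξ₀.1.1.1 ξ.1.1.1,
      densityRep ξ₀.1.1.1 ξ.1.1.2), covectorRep ξ₀.1 ξ)) :
    f ∘ (extChartAt ((I.prod 𝓘(ℝ, ℝ)).prod 𝓘(ℝ, E × ℝ →L[ℝ] ℝ)) ξ₀).symm
      =ᶠ[𝓝 (extChartAt ((I.prod 𝓘(ℝ, ℝ)).prod 𝓘(ℝ, E × ℝ →L[ℝ] ℝ)) ξ₀ ξ₀)] F := by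
  filter_upwards [eventually_target (chart_mem_target
    (I := (I.prod 𝓘(ℝ, ℝ)).prod 𝓘(ℝ, E × ℝ →L[ℝ] ℝ)) (mem_chart_source _ ξ₀))] with p hp
  have h := cone_mem_chart_source.1 (cotangent_mem_chart_source.1 (chart_symm_mem hp))
  have hr := (extChartAt ((I.prod 𝓘(ℝ, ℝ)).prod 𝓘(ℝ, E × ℝ →L[ℝ] ℝ)) ξ₀).right_inv hp
  rw [cotangent_cone_extChartAt h] at hr
  exact (hf _ h).trans (congrArg F hr)

lemma contMDiff_ambientRadius :
    ContMDiff ((I.prod 𝓘(ℝ, ℝ)).prod 𝓘(ℝ, E × ℝ →L[ℝ] ℝ)) 𝓘(ℝ, ℝ) ∞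
      fun ξ : CotangentSpace (I.prod 𝓘(ℝ, ℝ)) (thomasCone I X) => (ambientCoord s ξ).1 := by
  rw [← ContMDiff.subtypeVal_comp_iff]
  intro ξ
  have hξ := mem_chart_source (ModelProd (ModelProd H ℝ) (E × ℝ →L[ℝ] ℝ)) ξ
  have ht := chart_mem_target (I := (I.prod 𝓘(ℝ, ℝ)).prod 𝓘(ℝ, E × ℝ →L[ℝ] ℝ)) hξ
  rw [contMDiffAt_iff_chart hξ]
  exact (contDiffAt_ambientRadius (cotangent_cone_target ht).1).congr_of_eventuallyEq
    (eventuallyEq_cotangent_cone fun ξ h => s.fibreCoord_chart h)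

lemma contMDiff_ambientRho :
    ContMDiff ((I.prod 𝓘(ℝ, ℝ)).prod 𝓘(ℝ, E × ℝ →L[ℝ] ℝ)) 𝓘(ℝ, ℝ) ∞
      fun ξ : CotangentSpace (I.prod 𝓘(ℝ, ℝ)) (thomasCone I X) => (ambientCoord s ξ).2.2 := by
  intro ξ
  have hξ := mem_chart_source (ModelProd (ModelProd H ℝ) (E × ℝ →L[ℝ] ℝ)) ξ
  have ht := chart_mem_target (I := (I.prod 𝓘(ℝ, ℝ)).prod 𝓘(ℝ, E × ℝ →L[ℝ] ℝ)) hξ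
  rw [contMDiffAt_iff_chart hξ]
  exact (contDiffAt_ambientRho (cotangent_cone_target ht).1
    (cotangent_cone_target ht).2.ne').congr_of_eventuallyEq
    (eventuallyEq_cotangent_cone fun ξ h => s.ambientRho_chart h)

lemma contMDiff_ambientFibre :
    ContMDiff ((I.prod 𝓘(ℝ, ℝ)).prod 𝓘(ℝ, E × ℝ →L[ℝ] ℝ)) (I.prod 𝓘(ℝ, E →L[ℝ] ℝ)) ∞
      fun ξ : CotangentSpace (I.prod 𝓘(ℝ, ℝ)) (thomasCone I X) => (ambientCoord s ξ).2.1 := by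
  intro ξ
  rw [contMDiffAt_totalSpace]
  have hξ := mem_chart_source (ModelProd (ModelProd H ℝ) (E × ℝ →L[ℝ] ℝ)) ξ
  have ht := chart_mem_target (I := (I.prod 𝓘(ℝ, ℝ)).prod 𝓘(ℝ, E × ℝ →L[ℝ] ℝ)) hξ
  refine ⟨?_, ?_⟩
  · exact ((contMDiff_proj (Density I X 1)).comp (contMDiff_subtype_val.comp
      (contMDiff_proj (fun c : thomasCone I X =>
        TangentSpace (I.prod 𝓘(ℝ, ℝ)) c →L[ℝ] Trivial (thomasCone I X) ℝ c)))) ξ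
  · rw [contMDiffAt_iff_chart hξ]
    refine (contDiffAt_ambientFibre (s := s) (cotangent_cone_target ht).1
      (cotangent_cone_target ht).2.ne').congr_of_eventuallyEq
      (eventuallyEq_cotangent_cone fun η h => ?_)
    exact (weighted_trivializationAt (q := (ambientCoord s η).2.1) h).trans (s.ambientFibre_chart h)

lemma contMDiff_ambientCoord :
    ContMDiff ((I.prod 𝓘(ℝ, ℝ)).prod 𝓘(ℝ, E × ℝ →L[ℝ] ℝ))
      (𝓘(ℝ, ℝ).prod ((I.prod 𝓘(ℝ, E →L[ℝ] ℝ)).prod 𝓘(ℝ, ℝ))) ∞ (ambientCoord s) :=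
  s.contMDiff_ambientRadius.prodMk (s.contMDiff_ambientFibre.prodMk s.contMDiff_ambientRho)

lemma contMDiff_ambientInv :
    ContMDiff (𝓘(ℝ, ℝ).prod ((I.prod 𝓘(ℝ, E →L[ℝ] ℝ)).prod 𝓘(ℝ, ℝ)))
      ((I.prod 𝓘(ℝ, ℝ)).prod 𝓘(ℝ, E × ℝ →L[ℝ] ℝ)) ∞ s.ambientInv := by
  intro a₀
  let J := 𝓘(ℝ, ℝ).prod ((I.prod 𝓘(ℝ, E →L[ℝ] ℝ)).prod 𝓘(ℝ, ℝ))
  let x₀ := a₀.2.1.1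
  have hx := mem_chart_source H x₀
  have hz := chart_mem_target (I := I) hx
  have ht : ContMDiffAt J 𝓘(ℝ, ℝ) ∞
      (fun a : PosReal × WeightedCotangentSpace I X (-2) × ℝ => (a.1 : ℝ)) a₀ :=
    (contMDiff_subtype_val.comp contMDiff_fst) a₀
  have hq : ContMDiffAt J (I.prod 𝓘(ℝ, E →L[ℝ] ℝ)) ∞
      (fun a : PosReal × WeightedCotangentSpace I X (-2) × ℝ => a.2.1) a₀ :=
    (contMDiff_fst.comp contMDiff_snd) a₀
  have hρ : ContMDiffAt J 𝓘(ℝ, ℝ) ∞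
      (fun a : PosReal × WeightedCotangentSpace I X (-2) × ℝ => a.2.2) a₀ :=
    (contMDiff_snd.comp contMDiff_snd) a₀
  have hb : ContMDiffAt J I ∞
      (fun a : PosReal × WeightedCotangentSpace I X (-2) × ℝ => a.2.1.1) a₀ :=
    (contMDiffAt_totalSpace.1 hq).1
  have hμ : ContMDiffAt J 𝓘(ℝ, E →L[ℝ] ℝ) ∞ (fun a : PosReal × WeightedCotangentSpace I X (-2) × ℝ =>
      (trivializationAt (E →L[ℝ] ℝ) (fun x : X => TangentSpace I x →L[ℝ] Density I X (-2) x)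
        x₀ a.2.1).2) a₀ := (contMDiffAt_totalSpace.1 hq).2
  have hψ : ContMDiffAt J 𝓘(ℝ, E) ∞
      (fun a : PosReal × WeightedCotangentSpace I X (-2) × ℝ => extChartAt I x₀ a.2.1.1) a₀ :=
    (contMDiffAt_extChartAt (x := x₀)).comp a₀ hb
  have hsrc : ∀ᶠ a in 𝓝 a₀, a.2.1.1 ∈ (chartAt H x₀).source :=
    hb.continuousAt.eventually (eventually_mem_source hx)
  rw [contMDiffAt_totalSpace]
  refine ⟨?_, ?_⟩
  · change ContMDiffAt J (I.prod 𝓘(ℝ, ℝ)) ∞ (fun a : PosReal × WeightedCotangentSpace I X (-2) × ℝ =>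
      s.coneSection a.1 a.2.1.1) a₀
    rw [← ContMDiffAt.subtypeVal_comp_iff, contMDiffAt_totalSpace]
    refine ⟨hb, ?_⟩
    have hs : ContMDiffAt J 𝓘(ℝ, ℝ) ∞ (fun a : PosReal × WeightedCotangentSpace I X (-2) × ℝ =>
        densityRep x₀ (s.val a.2.1.1)) a₀ := 
      ContMDiffAt.comp (g := fun x => densityRep x₀ (s.val x)) a₀ (s.contMDiffAt_densityRep hx) hb
    refine (ht.mul hs).congr_of_eventuallyEq (Eventually.of_forall fun a => ?_)
    exact densityRep_smul x₀ (a.1 : ℝ) (s.val a.2.1.1)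
  -- `ambientInv` is written in the chart at the moving base point. `F` is the same covector in the
  -- fixed chart at `x₀`, as a function of `t`, the coordinates of the point, the components of `q`
  -- and `ρ`, with `y = t σ`.
  · let F : ℝ × E × (E →L[ℝ] ℝ) × ℝ → (E × ℝ →L[ℝ] ℝ) := fun b =>
      ((b.1 * s.rep x₀ b.2.1) ^ 2 • b.2.2.1) ∘L ContinuousLinearMap.fst ℝ E ℝ +
        (b.1 ^ 2 * b.2.2.2) • ((b.1 * s.rep x₀ b.2.1)⁻¹ • ContinuousLinearMap.snd ℝ E ℝ -
          s.logDeriv x₀ b.2.1 ∘L ContinuousLinearMap.fst ℝ E ℝ)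
    have htup := ht.prodMk_space (hψ.prodMk_space (hμ.prodMk_space hρ))
    have hF : ContDiffAt ℝ ∞ F ((a₀.1 : ℝ), extChartAt I x₀ a₀.2.1.1,
        (trivializationAt (E →L[ℝ] ℝ) (fun x : X => TangentSpace I x →L[ℝ] Density I X (-2) x)
        x₀ a₀.2.1).2, a₀.2.2) := by
      set b₀ : ℝ × E × (E →L[ℝ] ℝ) × ℝ := ((a₀.1 : ℝ), extChartAt I x₀ a₀.2.1.1,
        (trivializationAt (E →L[ℝ] ℝ) (fun x : X => TangentSpace I x →L[ℝ] Density I X (-2) x)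
        x₀ a₀.2.1).2, a₀.2.2) with hb₀
      have d2 : ContDiffAt ℝ ∞ (fun b : ℝ × E × (E →L[ℝ] ℝ) × ℝ => b.2.1) b₀ :=
        (contDiff_fst.comp contDiff_snd).contDiffAt
      have d3 : ContDiffAt ℝ ∞ (fun b : ℝ × E × (E →L[ℝ] ℝ) × ℝ => b.2.2.1) b₀ :=
        (contDiff_fst.comp (contDiff_snd.comp contDiff_snd)).contDiffAt
      have d4 : ContDiffAt ℝ ∞ (fun b : ℝ × E × (E →L[ℝ] ℝ) × ℝ => b.2.2.2) b₀ :=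
        (contDiff_snd.comp (contDiff_snd.comp contDiff_snd)).contDiffAt
      have dr : ContDiffAt ℝ ∞ (fun b : ℝ × E × (E →L[ℝ] ℝ) × ℝ => s.rep x₀ b.2.1) b₀ :=
        ContDiffAt.comp (g := s.rep x₀) b₀ (s.contDiffAt_rep hz) d2
      have dl : ContDiffAt ℝ ∞ (fun b : ℝ × E × (E →L[ℝ] ℝ) × ℝ => s.logDeriv x₀ b.2.1) b₀ :=
        ContDiffAt.comp (g := s.logDeriv x₀) b₀ (s.contDiffAt_logDeriv hz) d2
      have dy := contDiffAt_fst.mul dr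
      have hy : b₀.1 * s.rep x₀ b₀.2.1 ≠ 0 := mul_ne_zero a₀.1.2.ne' (s.rep_pos hz).ne'
      exact (((dy.pow 2).smul d3).clm_comp contDiffAt_const).add
        (((contDiffAt_fst.pow 2).mul d4).smul (((dy.inv hy).smul contDiffAt_const).sub
          (dl.clm_comp contDiffAt_const)))
    refine (hF.contMDiffAt.comp a₀ htup).congr_of_eventuallyEq ?_
    filter_upwards [hsrc] with a ha
    have hm : (s.ambientInv a).1.1.1 ∈ (chartAt H (s.ambientInv a₀).1.1.1).source := ha
    refine (cotangent_trivializationAt (s.ambientInv a₀).1 (s.ambientInv a)).trans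
      (ContinuousLinearMap.ext fun V => ?_)
    rw [s.covectorRep_eq_ambientCoord hm, s.ambientCoord_ambientInv]
    have hy : densityRep (s.ambientInv a₀).1.1.1 (s.ambientInv a).1.1.2 =
        (a.1 : ℝ) * s.rep x₀ (extChartAt I x₀ a.2.1.1) := by
      rw [s.rep_apply ha]
      exact densityRep_smul x₀ (a.1 : ℝ) (s.val a.2.1.1)
    rw [hy]
    have hw := weighted_trivializationAt ha
    simp only [F, Function.comp_apply, hw]
    simp only [add_apply, sub_apply, smul_apply, ContinuousLinearMap.comp_apply, smul_eq_mul,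
      ContinuousLinearMap.coe_fst', ContinuousLinearMap.coe_snd']
    rw [div_eq_inv_mul]
    exact congrArg₂ (· + ·) rfl (mul_comm _ _)

/-- The ambient coordinates of a scale as a diffeomorphism. -/
def ambientDiffeomorph :
    Diffeomorph ((I.prod 𝓘(ℝ, ℝ)).prod 𝓘(ℝ, E × ℝ →L[ℝ] ℝ))
      (𝓘(ℝ, ℝ).prod ((I.prod 𝓘(ℝ, E →L[ℝ] ℝ)).prod 𝓘(ℝ, ℝ)))
      (CotangentSpace (I.prod 𝓘(ℝ, ℝ)) (thomasCone I X))
      (PosReal × WeightedCotangentSpace I X (-2) × ℝ) ∞ where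
  toFun := ambientCoord s
  invFun := s.ambientInv
  left_inv := s.ambientInv_ambientCoord
  right_inv := s.ambientCoord_ambientInv
  contMDiff_toFun := s.contMDiff_ambientCoord
  contMDiff_invFun := s.contMDiff_ambientInv

end Scale

end AmbientDiffeomorphism

end ProjectiveAmbient

namespace ProjectiveAmbient

open Filter Topology

/-! ### The normal form of the ambient metric -/

section NormalForm

variable {E : Type*} [NormedAddCommGroup E] [NormedSpace ℝ E] [FiniteDimensional ℝ E]
  [CompleteSpace E]
  {H : Type*} [TopologicalSpace H] {I : ModelWithCorners ℝ E H} [I.Boundaryless]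
  {X : Type*} [TopologicalSpace X] [ChartedSpace H X] [IsManifold I ∞ X]

namespace Scale

variable (s : Scale I X)

section Derivatives

variable {s} {x₀ : X} {p : (E × ℝ) × (E × ℝ →L[ℝ] ℝ)}

lemma hasFDerivAt_rep_base (hz : p.1.1 ∈ (extChartAt I x₀).target) :
    HasFDerivAt (fun p : (E × ℝ) × (E × ℝ →L[ℝ] ℝ) => s.rep x₀ p.1.1)
      ((s.rep x₀ p.1.1 • s.logDeriv x₀ p.1.1) ∘L
        (ContinuousLinearMap.fst ℝ E ℝ ∘L ContinuousLinearMap.fst ℝ (E × ℝ) (E × ℝ →L[ℝ] ℝ))) p :=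
  HasFDerivAt.comp (g := s.rep x₀) p (s.hasFDerivAt_rep hz) (hasFDerivAt_fst.comp p hasFDerivAt_fst)

lemma fderiv_ambientRadius (hz : p.1.1 ∈ (extChartAt I x₀).target)
    (U : (E × ℝ) × (E × ℝ →L[ℝ] ℝ)) :
    fderiv ℝ (s.ambientRadius x₀) p U = U.1.2 / s.rep x₀ p.1.1 -
      p.1.2 / s.rep x₀ p.1.1 * s.logDeriv x₀ p.1.1 U.1.1 := by
  have hs := (s.rep_pos hz).ne'
  have hy : HasFDerivAt (fun p : (E × ℝ) × (E × ℝ →L[ℝ] ℝ) => p.1.2)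
      (ContinuousLinearMap.snd ℝ E ℝ ∘L ContinuousLinearMap.fst ℝ (E × ℝ) (E × ℝ →L[ℝ] ℝ)) p :=
    hasFDerivAt_snd.comp p hasFDerivAt_fst
  have h : HasFDerivAt (fun p : (E × ℝ) × (E × ℝ →L[ℝ] ℝ) => p.1.2 * (s.rep x₀ p.1.1)⁻¹) _ p :=
    hy.fun_mul ((hasDerivAt_inv hs).comp_hasFDerivAt p (hasFDerivAt_rep_base (s := s) hz))
  have e : s.ambientRadius x₀ = fun p => p.1.2 * (s.rep x₀ p.1.1)⁻¹ :=
    funext fun p => div_eq_mul_inv _ _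
  have h1 : fderiv ℝ (s.ambientRadius x₀) p U = p.1.2 * (-(s.rep x₀ p.1.1 ^ 2)⁻¹ *
      (s.rep x₀ p.1.1 * s.logDeriv x₀ p.1.1 U.1.1)) + (s.rep x₀ p.1.1)⁻¹ * U.1.2 := by
    rw [e, h.fderiv]
    rfl
  rw [h1]
  field_simp
  ring

lemma fderiv_ambientRho (hz : p.1.1 ∈ (extChartAt I x₀).target) (hy : p.1.2 ≠ 0)
    (U : (E × ℝ) × (E × ℝ →L[ℝ] ℝ)) :
    fderiv ℝ (s.ambientRho x₀) p U = s.rep x₀ p.1.1 ^ 2 / p.1.2 *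
      (U.2 (0, 1) + p.2 (0, 1) * (2 * s.logDeriv x₀ p.1.1 U.1.1 - U.1.2 / p.1.2)) := by
  have hs := (s.rep_pos hz).ne'
  have hyd : HasFDerivAt (fun p : (E × ℝ) × (E × ℝ →L[ℝ] ℝ) => p.1.2)
      (ContinuousLinearMap.snd ℝ E ℝ ∘L ContinuousLinearMap.fst ℝ (E × ℝ) (E × ℝ →L[ℝ] ℝ)) p :=
    hasFDerivAt_snd.comp p hasFDerivAt_fst
  have hw : HasFDerivAt (fun p : (E × ℝ) × (E × ℝ →L[ℝ] ℝ) => p.2 (0, 1)) _ p :=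
    hasFDerivAt_snd.clm_apply (hasFDerivAt_const ((0, 1) : E × ℝ) p)
  have h : HasFDerivAt (fun p : (E × ℝ) × (E × ℝ →L[ℝ] ℝ) =>
      p.2 (0, 1) * s.rep x₀ p.1.1 ^ 2 * (p.1.2)⁻¹) _ p :=
    (hw.fun_mul ((hasFDerivAt_rep_base (s := s) hz).pow 2)).fun_mul
      ((hasDerivAt_inv hy).comp_hasFDerivAt p hyd)
  have e : s.ambientRho x₀ = fun p => p.2 (0, 1) * s.rep x₀ p.1.1 ^ 2 * (p.1.2)⁻¹ :=
    funext fun p => div_eq_mul_inv _ _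
  have h1 : fderiv ℝ (s.ambientRho x₀) p U = p.2 (0, 1) * s.rep x₀ p.1.1 ^ 2 *
      (-(p.1.2 ^ 2)⁻¹ * U.1.2) + (p.1.2)⁻¹ * (p.2 (0, 1) * ((2 • s.rep x₀ p.1.1 ^ (2 - 1)) *
        (s.rep x₀ p.1.1 * s.logDeriv x₀ p.1.1 U.1.1)) +
          s.rep x₀ p.1.1 ^ 2 * (p.2 0 + U.2 (0, 1))) := by
    rw [e, h.fderiv]
    rfl
  rw [h1, map_zero, nsmul_eq_mul]
  field_simp
  push_cast
  ring

lemma fderiv_ambientFibre (hz : p.1.1 ∈ (extChartAt I x₀).target) (hy : p.1.2 ≠ 0)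
    (U : (E × ℝ) × (E × ℝ →L[ℝ] ℝ)) (x : E) :
    fderiv ℝ (s.ambientFibre x₀) p U x =
      (p.1.2 ^ 2)⁻¹ * (U.2 (x, 0) + (U.2 (0, 1) * p.1.2 + p.2 (0, 1) * U.1.2) * s.logDeriv x₀ p.1.1 x
        + p.2 (0, 1) * p.1.2 * fderiv ℝ (s.logDeriv x₀) p.1.1 U.1.1 x)
      - 2 * U.1.2 / p.1.2 ^ 3 * (p.2 (x, 0) + p.2 (0, 1) * p.1.2 * s.logDeriv x₀ p.1.1 x) := by
  have hyd : HasFDerivAt (fun p : (E × ℝ) × (E × ℝ →L[ℝ] ℝ) => p.1.2)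
      (ContinuousLinearMap.snd ℝ E ℝ ∘L ContinuousLinearMap.fst ℝ (E × ℝ) (E × ℝ →L[ℝ] ℝ)) p :=
    hasFDerivAt_snd.comp p hasFDerivAt_fst
  have hw : HasFDerivAt (fun p : (E × ℝ) × (E × ℝ →L[ℝ] ℝ) => p.2 (0, 1)) _ p :=
    hasFDerivAt_snd.clm_apply (hasFDerivAt_const ((0, 1) : E × ℝ) p)
  have hx : HasFDerivAt (fun p : (E × ℝ) × (E × ℝ →L[ℝ] ℝ) => p.2 (x, 0)) _ p :=
    hasFDerivAt_snd.clm_apply (hasFDerivAt_const ((x, 0) : E × ℝ) p)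
  have hβ : HasFDerivAt (fun p : (E × ℝ) × (E × ℝ →L[ℝ] ℝ) => s.logDeriv x₀ p.1.1)
      (fderiv ℝ (s.logDeriv x₀) p.1.1 ∘L
        (ContinuousLinearMap.fst ℝ E ℝ ∘L ContinuousLinearMap.fst ℝ (E × ℝ) (E × ℝ →L[ℝ] ℝ))) p :=
    HasFDerivAt.comp (g := s.logDeriv x₀) p
      ((s.contDiffAt_logDeriv hz).differentiableAt (by simp)).hasFDerivAt
      (hasFDerivAt_fst.comp p hasFDerivAt_fst)
  have hβx := hβ.clm_apply (hasFDerivAt_const x p)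
  have hi : HasFDerivAt (fun p : (E × ℝ) × (E × ℝ →L[ℝ] ℝ) => (p.1.2 ^ 2)⁻¹) _ p :=
    (hasDerivAt_inv (pow_ne_zero 2 hy)).comp_hasFDerivAt p (hyd.pow 2)
  have h : HasFDerivAt (fun p => s.ambientFibre x₀ p x) _ p :=
    hi.mul (hx.add ((hw.mul hyd).mul hβx))
  have h0 := (((contDiffAt_ambientFibre (s := s) hz hy).differentiableAt
    (by simp)).hasFDerivAt.clm_apply (hasFDerivAt_const x p)).fderiv
  -- The terms evaluated at `0` are the product-rule contributions of the constant vectors that the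
  -- covectors are applied to.
  have h1 : s.ambientFibre x₀ p 0 + fderiv ℝ (s.ambientFibre x₀) p U x =
      (p.1.2 ^ 2)⁻¹ * ((p.2 0 + U.2 (x, 0)) + (p.2 (0, 1) * p.1.2 * (s.logDeriv x₀ p.1.1 0 +
        fderiv ℝ (s.logDeriv x₀) p.1.1 U.1.1 x) + s.logDeriv x₀ p.1.1 x *
          (p.2 (0, 1) * U.1.2 + p.1.2 * (p.2 0 + U.2 (0, 1))))) +
      (p.2 (x, 0) + p.2 (0, 1) * p.1.2 * s.logDeriv x₀ p.1.1 x) *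
        (-((p.1.2 ^ 2) ^ 2)⁻¹ * ((2 • p.1.2 ^ (2 - 1)) * U.1.2)) :=
    congrArg (fun L => L U) (h0.symm.trans h.fderiv)
  simp only [map_zero, zero_add, nsmul_eq_mul] at h1
  rw [h1]
  field_simp
  push_cast
  ring

end Derivatives

variable {ξ : CotangentSpace (I.prod 𝓘(ℝ, ℝ)) (thomasCone I X)}

lemma fderiv_apply_congr {V W : Type*} [NormedAddCommGroup V] [NormedSpace ℝ V]
    [NormedAddCommGroup W] [NormedSpace ℝ W] {f g : V → W} {x : V} (h : f =ᶠ[𝓝 x] g) (u : V) :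
    fderiv ℝ f x u = fderiv ℝ g x u := by
  rw [h.fderiv_eq]

lemma mfderiv_ambientCoord (u : TangentSpace ((I.prod 𝓘(ℝ, ℝ)).prod 𝓘(ℝ, E × ℝ →L[ℝ] ℝ)) ξ) :
    mfderiv ((I.prod 𝓘(ℝ, ℝ)).prod 𝓘(ℝ, E × ℝ →L[ℝ] ℝ))
      (𝓘(ℝ, ℝ).prod ((I.prod 𝓘(ℝ, E →L[ℝ] ℝ)).prod 𝓘(ℝ, ℝ))) (ambientCoord s) ξ u =
    ((mfderiv ((I.prod 𝓘(ℝ, ℝ)).prod 𝓘(ℝ, E × ℝ →L[ℝ] ℝ)) 𝓘(ℝ, ℝ)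
        (fun ξ : CotangentSpace (I.prod 𝓘(ℝ, ℝ)) (thomasCone I X) => (ambientCoord s ξ).1) ξ u,
      mfderiv ((I.prod 𝓘(ℝ, ℝ)).prod 𝓘(ℝ, E × ℝ →L[ℝ] ℝ)) (I.prod 𝓘(ℝ, E →L[ℝ] ℝ))
        (fun ξ : CotangentSpace (I.prod 𝓘(ℝ, ℝ)) (thomasCone I X) => (ambientCoord s ξ).2.1) ξ u,
      mfderiv ((I.prod 𝓘(ℝ, ℝ)).prod 𝓘(ℝ, E × ℝ →L[ℝ] ℝ)) 𝓘(ℝ, ℝ)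
        (fun ξ : CotangentSpace (I.prod 𝓘(ℝ, ℝ)) (thomasCone I X) => (ambientCoord s ξ).2.2) ξ u) :
      ℝ × (E × (E →L[ℝ] ℝ)) × ℝ) := by
  have h1 := (s.contMDiff_ambientRadius ξ).mdifferentiableAt (by simp)
  have h2 := (s.contMDiff_ambientFibre ξ).mdifferentiableAt (by simp)
  have h3 := (s.contMDiff_ambientRho ξ).mdifferentiableAt (by simp)
  have e1 := mfderiv_prodMk h1 (h2.prodMk h3)
  have e2 := mfderiv_prodMk h2 h3
  have f1 := congrArg (fun L => L u) e1
  have f2 := congrArg (fun L => L u) e2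
  refine f1.trans ?_
  refine Prod.ext rfl ?_
  exact f2

lemma mfderiv_ambientRadius (u : TangentSpace ((I.prod 𝓘(ℝ, ℝ)).prod 𝓘(ℝ, E × ℝ →L[ℝ] ℝ)) ξ) :
    mfderiv ((I.prod 𝓘(ℝ, ℝ)).prod 𝓘(ℝ, E × ℝ →L[ℝ] ℝ)) 𝓘(ℝ, ℝ)
        (fun ξ : CotangentSpace (I.prod 𝓘(ℝ, ℝ)) (thomasCone I X) => (ambientCoord s ξ).1) ξ u =
    fderiv ℝ (s.ambientRadius ξ.1.1.1)
      (extChartAt ((I.prod 𝓘(ℝ, ℝ)).prod 𝓘(ℝ, E × ℝ →L[ℝ] ℝ)) ξ ξ) u := by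
  have hξ := mem_chart_source (ModelProd (ModelProd H ℝ) (E × ℝ →L[ℝ] ℝ)) ξ
  have h1 := (s.contMDiff_ambientRadius ξ).mdifferentiableAt (by simp)
  have h2 := dChart_mfderiv hξ (mem_chart_source ℝ (ambientCoord s ξ).1) h1 u
  rw [dChart_self, dChart_self] at h2
  refine h2.trans (fderiv_apply_congr ?_ _)
  exact eventuallyEq_cotangent_cone
    (f := fun ξ : CotangentSpace (I.prod 𝓘(ℝ, ℝ)) (thomasCone I X) => ((ambientCoord s ξ).1 : ℝ))
    fun η h => s.fibreCoord_chart h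

lemma mfderiv_ambientRho (u : TangentSpace ((I.prod 𝓘(ℝ, ℝ)).prod 𝓘(ℝ, E × ℝ →L[ℝ] ℝ)) ξ) :
    mfderiv ((I.prod 𝓘(ℝ, ℝ)).prod 𝓘(ℝ, E × ℝ →L[ℝ] ℝ)) 𝓘(ℝ, ℝ)
        (fun ξ : CotangentSpace (I.prod 𝓘(ℝ, ℝ)) (thomasCone I X) => (ambientCoord s ξ).2.2) ξ u =
    fderiv ℝ (s.ambientRho ξ.1.1.1)
      (extChartAt ((I.prod 𝓘(ℝ, ℝ)).prod 𝓘(ℝ, E × ℝ →L[ℝ] ℝ)) ξ ξ) u := by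
  have hξ := mem_chart_source (ModelProd (ModelProd H ℝ) (E × ℝ →L[ℝ] ℝ)) ξ
  have h1 := (s.contMDiff_ambientRho ξ).mdifferentiableAt (by simp)
  have h2 := mfderiv_eq_chart hξ h1 u
  rw [dChart_self] at h2
  refine h2.trans (fderiv_apply_congr ?_ _)
  exact eventuallyEq_cotangent_cone fun η h => s.ambientRho_chart h

lemma mfderiv_ambientFibre (u : TangentSpace ((I.prod 𝓘(ℝ, ℝ)).prod 𝓘(ℝ, E × ℝ →L[ℝ] ℝ)) ξ) :
    mfderiv ((I.prod 𝓘(ℝ, ℝ)).prod 𝓘(ℝ, E × ℝ →L[ℝ] ℝ)) (I.prod 𝓘(ℝ, E →L[ℝ] ℝ))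
        (fun ξ : CotangentSpace (I.prod 𝓘(ℝ, ℝ)) (thomasCone I X) => (ambientCoord s ξ).2.1) ξ u =
    (((u : (E × ℝ) × (E × ℝ →L[ℝ] ℝ)).1.1, fderiv ℝ (s.ambientFibre ξ.1.1.1)
      (extChartAt ((I.prod 𝓘(ℝ, ℝ)).prod 𝓘(ℝ, E × ℝ →L[ℝ] ℝ)) ξ ξ) u) : E × (E →L[ℝ] ℝ)) := by
  have hξ := mem_chart_source (ModelProd (ModelProd H ℝ) (E × ℝ →L[ℝ] ℝ)) ξ
  have ht := chart_mem_target (I := (I.prod 𝓘(ℝ, ℝ)).prod 𝓘(ℝ, E × ℝ →L[ℝ] ℝ)) hξ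
  have h1 := (s.contMDiff_ambientFibre ξ).mdifferentiableAt (by simp)
  have h2 := dChart_mfderiv hξ (mem_chart_source (ModelProd H (E →L[ℝ] ℝ)) (ambientCoord s ξ).2.1) h1 u
  rw [dChart_self, dChart_self] at h2
  refine h2.trans ((fderiv_apply_congr
    (eventuallyEq_cotangent_cone (f := fun η : CotangentSpace (I.prod 𝓘(ℝ, ℝ)) (thomasCone I X) =>
      extChartAt (I.prod 𝓘(ℝ, E →L[ℝ] ℝ)) (ambientCoord s ξ).2.1 (ambientCoord s η).2.1)
      (F := fun p => (p.1.1, s.ambientFibre ξ.1.1.1 p)) fun η h => ?_) _).trans ?_)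
  · rw [← s.ambientFibre_chart h]
    exact weighted_extChartAt h
  · have hd := ((contDiffAt_ambientFibre (s := s) (cotangent_cone_target ht).1
      (cotangent_cone_target ht).2.ne').differentiableAt (by simp)).hasFDerivAt
    have hb : HasFDerivAt (fun p : (E × ℝ) × (E × ℝ →L[ℝ] ℝ) => p.1.1)
        (ContinuousLinearMap.fst ℝ E ℝ ∘L ContinuousLinearMap.fst ℝ (E × ℝ) (E × ℝ →L[ℝ] ℝ))
        (extChartAt ((I.prod 𝓘(ℝ, ℝ)).prod 𝓘(ℝ, E × ℝ →L[ℝ] ℝ)) ξ ξ) :=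
      hasFDerivAt_fst.comp _ hasFDerivAt_fst
    rw [(hb.prodMk hd).fderiv]
    rfl

lemma mfderiv_proj (q : WeightedCotangentSpace I X (-2)) (u : TangentSpace (I.prod 𝓘(ℝ, E →L[ℝ] ℝ)) q) :
    mfderiv (I.prod 𝓘(ℝ, E →L[ℝ] ℝ)) I
      (TotalSpace.proj : WeightedCotangentSpace I X (-2) → X) q u = (u : E × (E →L[ℝ] ℝ)).1 := by
  have hq := mem_chart_source (ModelProd H (E →L[ℝ] ℝ)) q
  have h1 := (contMDiff_proj (fun x : X => TangentSpace I x →L[ℝ] Density I X (-2) x) (n := ∞)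
    (IB := I) q).mdifferentiableAt (by simp)
  have h2 := dChart_mfderiv hq (mem_chart_source H q.1) h1 u
  rw [dChart_self, dChart_self] at h2
  refine h2.trans ((fderiv_apply_congr (g := fun p : E × (E →L[ℝ] ℝ) => p.1) ?_ _).trans ?_)
  · filter_upwards [eventually_target (chart_mem_target (I := I.prod 𝓘(ℝ, E →L[ℝ] ℝ)) hq)] with p hp
    have h := weighted_mem_chart_source.1 (chart_symm_mem hp)
    have hr := (extChartAt (I.prod 𝓘(ℝ, E →L[ℝ] ℝ)) q).right_inv hp
    rw [weighted_extChartAt h] at hr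
    exact congrArg Prod.fst hr
  · rw [hasFDerivAt_fst.fderiv]
    rfl

lemma _root_.ProjectiveAmbient.Tensor2.pullback_apply {E' : Type*} [NormedAddCommGroup E']
    [NormedSpace ℝ E'] {H' : Type*} [TopologicalSpace H'] {J : ModelWithCorners ℝ E' H'}
    {Y : Type*} [TopologicalSpace Y] [ChartedSpace H' Y] {f : X → Y} (g : Tensor2 J Y) {x : X}
    {v w : TangentSpace I x} {v' w' : TangentSpace J (f x)} (hv : mfderiv I J f x v = v')
    (hw : mfderiv I J f x w = w') : Tensor2.pullback f g x v w = g (f x) v' w' := by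
  rw [← hv, ← hw]
  rfl

/-- The pullback of a metric in normal form under the ambient coordinates. -/
lemma pullback_normalForm
    (h : ℝ → Tensor2 (I.prod 𝓘(ℝ, E →L[ℝ] ℝ)) (WeightedCotangentSpace I X (-2)))
    (u u' : TangentSpace ((I.prod 𝓘(ℝ, ℝ)).prod 𝓘(ℝ, E × ℝ →L[ℝ] ℝ)) ξ) :
    let p := extChartAt ((I.prod 𝓘(ℝ, ℝ)).prod 𝓘(ℝ, E × ℝ →L[ℝ] ℝ)) ξ ξ
    let x := ξ.1.1.1
    Tensor2.pullback (ambientCoord s) (normalForm h) ξ u u' = s.ambientRadius x p ^ 2 *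
        h (s.ambientRho x p) (ambientCoord s ξ).2.1
          (((u : (E × ℝ) × (E × ℝ →L[ℝ] ℝ)).1.1, fderiv ℝ (s.ambientFibre x) p u) : E × (E →L[ℝ] ℝ))
          (((u' : (E × ℝ) × (E × ℝ →L[ℝ] ℝ)).1.1, fderiv ℝ (s.ambientFibre x) p u') : E × (E →L[ℝ] ℝ)) +
      2 * s.ambientRho x p * (fderiv ℝ (s.ambientRadius x) p u * fderiv ℝ (s.ambientRadius x) p u') +
      s.ambientRadius x p * (fderiv ℝ (s.ambientRadius x) p u * fderiv ℝ (s.ambientRho x) p u' +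
        fderiv ℝ (s.ambientRadius x) p u' * fderiv ℝ (s.ambientRho x) p u) := by
  intro p x
  have hx := mem_chart_source H ξ.1.1.1
  have hpe := cotangent_cone_extChartAt hx
  have hρ : (ambientCoord s ξ).2.2 = s.ambientRho x p :=
    (s.ambientRho_chart hx).trans (congrArg (s.ambientRho x) hpe.symm)
  have hτ : ((ambientCoord s ξ).1 : ℝ) = s.ambientRadius x p :=
    (s.fibreCoord_chart hx).trans (congrArg (s.ambientRadius x) hpe.symm)
  have hd : ∀ u : TangentSpace ((I.prod 𝓘(ℝ, ℝ)).prod 𝓘(ℝ, E × ℝ →L[ℝ] ℝ)) ξ,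
      mfderiv ((I.prod 𝓘(ℝ, ℝ)).prod 𝓘(ℝ, E × ℝ →L[ℝ] ℝ))
        (𝓘(ℝ, ℝ).prod ((I.prod 𝓘(ℝ, E →L[ℝ] ℝ)).prod 𝓘(ℝ, ℝ))) (ambientCoord s) ξ u =
      ((fderiv ℝ (s.ambientRadius x) p u, ((u : (E × ℝ) × (E × ℝ →L[ℝ] ℝ)).1.1,
        fderiv ℝ (s.ambientFibre x) p u), fderiv ℝ (s.ambientRho x) p u) :
          ℝ × (E × (E →L[ℝ] ℝ)) × ℝ) := fun u =>
    (s.mfderiv_ambientCoord u).trans (Prod.ext (s.mfderiv_ambientRadius u)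
      (Prod.ext (s.mfderiv_ambientFibre u) (s.mfderiv_ambientRho u)))
  rw [← hρ, ← hτ]
  exact Tensor2.pullback_apply (normalForm h) (hd u) (hd u')

variable [T2Space X]

/-- The Patterson-Walker metric of the Thomas cone connection in the ambient coordinates of a
scale. -/
lemma pattersonWalker_thomasConnection {D₀ D : TorsionFreeConnection I X} {s : Scale I X}
    (hE : (Module.finrank ℝ E - 1 : ℝ) ≠ 0) (hD : D₀.ProjectivelyRelated D) (hs : D.Preserves s) :
    pattersonWalker (thomasConnection D₀ hE) = Tensor2.pullback (ambientCoord s) (normalForm fun ρ =>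
      weightedPattersonWalker s D +
        (2 * ρ / (Module.finrank ℝ E - 1 : ℝ)) • Tensor2.pullback TotalSpace.proj D.ricci) := by
  funext ξ u u'
  have hξ := mem_chart_source (ModelProd (ModelProd H ℝ) (E × ℝ →L[ℝ] ℝ)) ξ
  have hx := mem_chart_source H ξ.1.1.1
  have hz := chart_mem_target (I := I) hx
  have ht := chart_mem_target (I := (I.prod 𝓘(ℝ, ℝ)).prod 𝓘(ℝ, E × ℝ →L[ℝ] ℝ)) hξ
  have hy := (cotangent_cone_target ht).2.ne'
  set q := (ambientCoord s ξ).2.1 with hq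
  set p := extChartAt ((I.prod 𝓘(ℝ, ℝ)).prod 𝓘(ℝ, E × ℝ →L[ℝ] ℝ)) ξ ξ with hp
  have hpe := cotangent_cone_extChartAt hx
  rw [← hp] at hpe
  have hp1 : p.1.1 = extChartAt I ξ.1.1.1 ξ.1.1.1 := congrArg (fun p => p.1.1) hpe
  have hL := pattersonWalker_eq_chart (thomasConnection D₀ hE) (ξ₀ := ξ) (ξ := ξ)
    (mem_chart_source _ _) u u'
  rw [dChart_self, dChart_self, ← hp] at hL
  have hf : weightedRep ξ.1.1.1 q = s.ambientFibre ξ.1.1.1 p := by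
    rw [hpe]
    exact s.ambientFibre_chart hx
  have hσ : densityRep ξ.1.1.1 (s.val ξ.1.1.1) = s.rep ξ.1.1.1 p.1.1 := by
    rw [hp1, s.rep_apply hx]
  change (E × ℝ) × (E × ℝ →L[ℝ] ℝ) at u u'
  replace hL := hL.trans (rfl : _ = u'.2 u.1 + u.2 u'.1 -
    2 * p.2 (chrisL (thomasConnection D₀ hE).cov ξ.1 p.1 u.1 u'.1))
  rw [chrisL_thomasConnection D₀ hE (cotangent_target ht), coneSymbol_apply] at hL
  have hW : ∀ V V' : E × (E →L[ℝ] ℝ), weightedPattersonWalker s D q V V' =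
      s.rep ξ.1.1.1 p.1.1 ^ 2 * (V'.2 V.1 + V.2 V'.1 - 2 * s.ambientFibre ξ.1.1.1 p
        (thomasSymbol D₀ ξ.1.1.1 p.1.1 V.1 V'.1)) := by
    intro V V'
    have h := weightedPattersonWalker_eq_chart hD hs (q₀ := q) (q := q) (mem_chart_source _ _) V V'
    have hself : ∀ u : TangentSpace (I.prod 𝓘(ℝ, E →L[ℝ] ℝ)) q,
      dChart (I.prod 𝓘(ℝ, E →L[ℝ] ℝ)) q q u = (u : E × (E →L[ℝ] ℝ)) := dChart_self q
    rw [hself V, hself V', weighted_extChartAt (mem_chart_source _ _)] at h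
    refine h.trans ?_
    change densityRep ξ.1.1.1 (s.val ξ.1.1.1) ^ 2 * (V'.2 V.1 + V.2 V'.1 - 2 *
      weightedRep ξ.1.1.1 q (thomasSymbol D₀ ξ.1.1.1 (extChartAt I ξ.1.1.1 ξ.1.1.1) V.1 V'.1)) = _
    rw [hf, hσ, hp1]
  have hR : ∀ V V' : E × (E →L[ℝ] ℝ), 
      Tensor2.pullback (I := I.prod 𝓘(ℝ, E →L[ℝ] ℝ)) TotalSpace.proj D.ricci q V V' =
      (Module.finrank ℝ E - 1 : ℝ) * (schoutenSymbol D₀ ξ.1.1.1 p.1.1 V.1 V'.1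
        - fderiv ℝ (s.logDeriv ξ.1.1.1) p.1.1 V.1 V'.1
        + s.logDeriv ξ.1.1.1 p.1.1 (thomasSymbol D₀ ξ.1.1.1 p.1.1 V.1 V'.1)
        + s.logDeriv ξ.1.1.1 p.1.1 V.1 * s.logDeriv ξ.1.1.1 p.1.1 V'.1) := by
    intro V V'
    have h := ricci_eq_schoutenSymbol hE hD hs hx V.1 V'.1
    have hself : ∀ v : TangentSpace I ξ.1.1.1, dChart I ξ.1.1.1 ξ.1.1.1 v = (v : E) := dChart_self _
    rw [hself V.1, hself V'.1, ← hp1] at h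
    refine Eq.trans ?_ h
    exact congrArg₂ (fun a b : E => D.ricci ξ.1.1.1 a b) (mfderiv_proj q V) (mfderiv_proj q V')
  have hN := s.pullback_normalForm (ξ := ξ) (fun ρ => weightedPattersonWalker s D +
    (2 * ρ / (Module.finrank ℝ E - 1 : ℝ)) • Tensor2.pullback TotalSpace.proj D.ricci) u u'
  rw [← hp, ← hq] at hN
  replace hN := hN.trans (rfl : _ =
      s.ambientRadius ξ.1.1.1 p ^ 2 * (weightedPattersonWalker s D q
          ((u.1.1, fderiv ℝ (s.ambientFibre ξ.1.1.1) p u) : E × (E →L[ℝ] ℝ))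
          ((u'.1.1, fderiv ℝ (s.ambientFibre ξ.1.1.1) p u') : E × (E →L[ℝ] ℝ)) +
        (2 * s.ambientRho ξ.1.1.1 p / (Module.finrank ℝ E - 1 : ℝ)) *
          Tensor2.pullback (I := I.prod 𝓘(ℝ, E →L[ℝ] ℝ)) TotalSpace.proj D.ricci q
          ((u.1.1, fderiv ℝ (s.ambientFibre ξ.1.1.1) p u) : E × (E →L[ℝ] ℝ))
          ((u'.1.1, fderiv ℝ (s.ambientFibre ξ.1.1.1) p u') : E × (E →L[ℝ] ℝ))) +
      2 * s.ambientRho ξ.1.1.1 p * (fderiv ℝ (s.ambientRadius ξ.1.1.1) p u *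
        fderiv ℝ (s.ambientRadius ξ.1.1.1) p u') +
      s.ambientRadius ξ.1.1.1 p * (fderiv ℝ (s.ambientRadius ξ.1.1.1) p u *
        fderiv ℝ (s.ambientRho ξ.1.1.1) p u' + fderiv ℝ (s.ambientRadius ξ.1.1.1) p u' *
        fderiv ℝ (s.ambientRho ξ.1.1.1) p u))
  have hz' : p.1.1 ∈ (extChartAt I ξ.1.1.1).target := (cotangent_cone_target ht).1
  have hσ0 := (s.rep_pos hz').ne'
  -- Covectors on the cone are reduced to their values on `(v, 0)` and `(0, 1)`, so that the
  -- identity becomes one between rational expressions in real numbers.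
  have hsplit : ∀ (L : E × ℝ →L[ℝ] ℝ) (V : E × ℝ), L V = L (V.1, 0) + V.2 * L (0, 1) := by
    intro L V
    rw [← smul_eq_mul, ← map_smul, ← map_add]
    exact congrArg L (Prod.ext (by simp) (by simp))
  have hadd : ∀ (L : E × ℝ →L[ℝ] ℝ) (v w : E), L (v + w, 0) = L (v, 0) + L (w, 0) := by
    intro L v w
    rw [← map_add]
    exact congrArg L (Prod.ext rfl (by simp))
  have hsmul : ∀ (L : E × ℝ →L[ℝ] ℝ) (a : ℝ) (v : E), L (a • v, 0) = a * L (v, 0) := by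
    intro L a v
    rw [← smul_eq_mul, ← map_smul]
    exact congrArg L (Prod.ext rfl (by simp))
  have hfib : ∀ x : E, s.ambientFibre ξ.1.1.1 p x = (p.1.2 ^ 2)⁻¹ *
      (p.2 (x, 0) + (p.2 (0, 1) * p.1.2) * s.logDeriv ξ.1.1.1 p.1.1 x) := fun x => rfl
  have hβ := s.fderiv_logDeriv_symm hz' u.1.1 u'.1.1
  rw [hW, hR, fderiv_ambientRadius hz', fderiv_ambientRadius hz', fderiv_ambientRho hz' hy,
    fderiv_ambientRho hz' hy] at hN
  simp only [fderiv_ambientFibre hz' hy, hfib] at hN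
  rw [hsplit u'.2, hsplit u.2, hsplit p.2 (_, _)] at hL
  simp only [hadd, hsmul] at hL
  refine hL.trans (Eq.trans ?_ hN.symm)
  -- Here `t² σ² = y²` and `t² ρ = y η₀`, with `η₀` the value of the covector on `(0, 1)`. The two
  -- terms with `dβ` from the differential of `p` are equal by symmetry and cancel the one in the
  -- Ricci tensor of `D`, while its term with `P` matches the fibre part of the cone symbols.
  rw [hβ]
  rw [ambientRho, ambientRadius]
  field_simp
  ring

end Scale

end NormalForm

end ProjectiveAmbient

namespace ProjectiveAmbient

/-! ### The ambient metric -/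

section AmbientMetric

variable {E : Type*} [NormedAddCommGroup E] [NormedSpace ℝ E] [FiniteDimensional ℝ E]
  [CompleteSpace E]
  {H : Type*} [TopologicalSpace H] {I : ModelWithCorners ℝ E H} [I.Boundaryless]
  {X : Type*} [TopologicalSpace X] [ChartedSpace H X] [IsManifold I ∞ X] [T2Space X]

/-- The metric `t² g_s` on the hypersurface `ρ = 0` does not depend on the scale. -/
lemma ambientCoord_sq_smul_weightedPattersonWalker {D₀ D D' : TorsionFreeConnection I X}
    {s s' : Scale I X} (hD : D₀.ProjectivelyRelated D) (hs : D.Preserves s)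
    (hD' : D₀.ProjectivelyRelated D') (hs' : D'.Preserves s')
    (ξ : CotangentSpace (I.prod 𝓘(ℝ, ℝ)) (thomasCone I X)) :
    ((ambientCoord s' ξ).1 : ℝ) ^ 2 • weightedPattersonWalker s' D' (ambientCoord s ξ).2.1 =
      ((ambientCoord s ξ).1 : ℝ) ^ 2 • weightedPattersonWalker s D (ambientCoord s ξ).2.1 := by
  funext u u'
  have hq := mem_chart_source H (ambientCoord s ξ).2.1.1
  change ((ambientCoord s' ξ).1 : ℝ) ^ 2 * weightedPattersonWalker s' D' (ambientCoord s ξ).2.1 u u' =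
    ((ambientCoord s ξ).1 : ℝ) ^ 2 * weightedPattersonWalker s D (ambientCoord s ξ).2.1 u u'
  rw [weightedPattersonWalker_eq_chart hD hs hq, weightedPattersonWalker_eq_chart hD' hs' hq,
    ← mul_assoc, ← mul_assoc, ← mul_pow, ← mul_pow]
  -- In both scales the product of `t` with the coefficient of the scale is the fibre coordinate
  -- `y`, so both metrics are `y²` times the metric built from `Π`.
  exact congrArg (fun r : ℝ => r ^ 2 * _) ((s'.fibreCoord_mul_densityRep (c := ξ.1)).trans
    (s.fibreCoord_mul_densityRep (c := ξ.1)).symm)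

lemma isRicciFlatAmbientMetric_thomasConnection [SigmaCompactSpace X] (D₀ : TorsionFreeConnection I X)
    (hE : (Module.finrank ℝ E - 1 : ℝ) ≠ 0) :
    IsRicciFlatAmbientMetric (conformalPattersonWalker D₀) (Module.finrank ℝ E) (Module.finrank ℝ E)
      (pattersonWalker (thomasConnection D₀ hE)) := by
  refine ⟨?_, ricciFlat_pattersonWalker (ricciFlat_thomasConnection D₀ hE), ?_⟩
  · have h := isPseudoRiemannian_pattersonWalker (thomasConnection D₀ hE)
    rwa [Module.finrank_prod, Module.finrank_self] at h
  · obtain ⟨s⟩ := nonempty_scale (I := I) (X := X)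
    have hD := D₀.projectivelyRelated_ofScale s
    have hs := D₀.ofScale_preserves s
    refine ⟨_, s.ambientDiffeomorph, ?_, Scale.pattersonWalker_thomasConnection hE hD hs⟩
    have h0 : weightedPattersonWalker s (D₀.ofScale s) +
        (2 * (0 : ℝ) / (Module.finrank ℝ E - 1 : ℝ)) • Tensor2.pullback TotalSpace.proj
          (D₀.ofScale s).ricci = weightedPattersonWalker s (D₀.ofScale s) := by
      rw [mul_zero, zero_div, zero_smul, add_zero]
    exact h0.symm ▸ weightedPattersonWalker_mem hD hs

end AmbientMetric

end ProjectiveAmbient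

end

/-! ### The theorem -/

open ProjectiveAmbient in
theorem theorem2 {n : ℕ} (hn : 2 ≤ n) {N : Type*} [TopologicalSpace N] [T2Space N]
    [SigmaCompactSpace N] [ChartedSpace (EuclideanSpace ℝ (Fin n)) N] [IsManifold (𝓡 n) ∞ N]
    (D₀ : TorsionFreeConnection (𝓡 n) N) :
    -- scales exist and correspond to connections in the projective class
    Nonempty (Scale (𝓡 n) N) ∧
    (∀ s : Scale (𝓡 n) N, ∃ D : TorsionFreeConnection (𝓡 n) N,
      (D₀.ProjectivelyRelated D ∧ D.Preserves s) ∧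
      ∀ D' : TorsionFreeConnection (𝓡 n) N,
        D₀.ProjectivelyRelated D' → D'.Preserves s → D.Same D') ∧
    -- the projective class induces a conformal structure on the weighted cotangent bundle
    IsConformalStructure (conformalPattersonWalker D₀) n n ∧
    -- the projective class determines the Thomas cone connection
    ∃ nabla : TorsionFreeConnection ((𝓡 n).prod 𝓘(ℝ, ℝ)) (thomasCone (𝓡 n) N),
      IsThomasConnection D₀ nabla ∧
      (∀ nabla', IsThomasConnection D₀ nabla' → nabla.Same nabla') ∧
      nabla.RicciFlat ∧ (∃ σ : Scale ((𝓡 n).prod 𝓘(ℝ, ℝ)) (thomasCone (𝓡 n) N),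
        nabla.Preserves σ) ∧
      -- its Patterson-Walker metric is an ambient metric of the conformal structure
      IsRicciFlatAmbientMetric (conformalPattersonWalker D₀) n n (pattersonWalker nabla) ∧
      -- for each scale, in normal form relative to the corresponding metric of the conformal class
      (∀ (s : Scale (𝓡 n) N) (D : TorsionFreeConnection (𝓡 n) N),
        D₀.ProjectivelyRelated D → D.Preserves s →
        ∃ Φ : Diffeomorph (((𝓡 n).prod 𝓘(ℝ, ℝ)).prod
              𝓘(ℝ, (EuclideanSpace ℝ (Fin n) × ℝ) →L[ℝ] ℝ))
            (𝓘(ℝ, ℝ).prod (((𝓡 n).prod 𝓘(ℝ, EuclideanSpace ℝ (Fin n) →L[ℝ] ℝ)).prod 𝓘(ℝ, ℝ)))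
            (CotangentSpace ((𝓡 n).prod 𝓘(ℝ, ℝ)) (thomasCone (𝓡 n) N))
            (PosReal × WeightedCotangentSpace (𝓡 n) N (-2) × ℝ) ∞,
          ⇑Φ = ambientCoord s ∧
          pattersonWalker nabla = Tensor2.pullback (ambientCoord s) (normalForm fun ρ =>
            weightedPattersonWalker s D +
              (2 * ρ / (n - 1 : ℝ)) • Tensor2.pullback TotalSpace.proj D.ricci)) ∧
      -- and the identification of the hypersurface `ρ = 0` with the ray bundle of metrics of the
      -- conformal class and the dilations do not depend on the scale
      (∀ (s s' : Scale (𝓡 n) N) (D D' : TorsionFreeConnection (𝓡 n) N),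
        D₀.ProjectivelyRelated D → D.Preserves s →
        D₀.ProjectivelyRelated D' → D'.Preserves s' →
        ∀ ξ : CotangentSpace ((𝓡 n).prod 𝓘(ℝ, ℝ)) (thomasCone (𝓡 n) N),
          ((ambientCoord s ξ).2.2 = 0 →
            (ambientCoord s' ξ).2 = (ambientCoord s ξ).2 ∧
            ((ambientCoord s' ξ).1 : ℝ) ^ 2 •
                weightedPattersonWalker s' D' (ambientCoord s ξ).2.1 =
              ((ambientCoord s ξ).1 : ℝ) ^ 2 •
                weightedPattersonWalker s D (ambientCoord s ξ).2.1) ∧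
          ∀ (l : PosReal) (η : CotangentSpace ((𝓡 n).prod 𝓘(ℝ, ℝ)) (thomasCone (𝓡 n) N)),
            ambientCoord s η = dilate l (ambientCoord s ξ) →
            ambientCoord s' η = dilate l (ambientCoord s' ξ)) := by
  have hfin : Module.finrank ℝ (EuclideanSpace ℝ (Fin n)) = n := finrank_euclideanSpace_fin
  -- The bound on the dimension enters through the invertibility of `n - 1`, by which the Ricci
  -- curvature is divided.
  have hE : (Module.finrank ℝ (EuclideanSpace ℝ (Fin n)) - 1 : ℝ) ≠ 0 := by
    rw [hfin, sub_ne_zero]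
    exact_mod_cast (by omega : n ≠ 1)
  have hconf := isConformalStructure_conformalPattersonWalker D₀
  have hamb := isRicciFlatAmbientMetric_thomasConnection D₀ hE
  rw [hfin] at hconf hamb
  refine ⟨nonempty_scale, fun s => ⟨D₀.ofScale s, ⟨D₀.projectivelyRelated_ofScale s,
    D₀.ofScale_preserves s⟩, fun D' hD' hs' => ?_⟩, hconf, thomasConnection D₀ hE,
    isThomasConnection_thomasConnection D₀ hE, fun nabla' h' =>
      (isThomasConnection_thomasConnection D₀ hE).same h', ricciFlat_thomasConnection D₀ hE,
    ⟨coneScale _ _, thomasConnection_preserves D₀ hE⟩, hamb, fun s D hD hs =>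
      ⟨s.ambientDiffeomorph, rfl, ?_⟩, fun s s' D D' hD hs hD' hs' ξ => ⟨fun h => ⟨?_, ?_⟩,
        fun l η h => ?_⟩⟩
  · exact (D₀.projectivelyRelated_ofScale s).same hD' (D₀.ofScale_preserves s) hs'
  · have h := Scale.pattersonWalker_thomasConnection hE hD hs
    rwa [hfin] at h
  · exact s.ambientCoord_snd_eq s' h
  · exact ambientCoord_sq_smul_weightedPattersonWalker hD hs hD' hs' ξ
  · rw [s.ambientCoord_eq_ambientChange s', s.ambientCoord_eq_ambientChange s' ξ, h,
      s.ambientChange_dilate]
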